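/- An $n$-player polymatrix game with $m$ actions per player consists of an undirected graph on the $n$ players and, for every edge $\{i,j\}$, rational $m\times m$ matrices $A_{ij}$ (payoffs to $i$) and $A_{ji}$ (payoffs to $j$). Under a profile $s=(s_1,\dots,s_n)$ of mixed strategies the payoff vector of player $i$ is $p_i(s)=\sum_{j\in N(i)}A_{ij}s_j$ and his expected payoff is $s_i\cdot p_i(s)$; payoffs are normalised so that $0\le s_i\cdot p_i(s)\le 1$ for every profile $s$ and every player $i$. A profile $s$ is a $\delta$-Nash equilibrium ($\delta$-NE) if $s_i\cdot p_i(s)\ge \max p_i(s)-\delta$ for every player $i$. The treewidth of a game is the treewidth of its graph. Running times count the steps of a random access machine that performs arithmetic operations ($+,-,\times,\div$ on rationals; $+$, truncated subtraction and $\times$ on natural numbers) and comparisons at unit cost, and has no rounding operation. (1) There are a single algorithm and an absolute constant $C$ such that for every normalised polymatrix game $G$ with $n$ players and $m$ actions per player, $1\le m\le \ln n$, and every rational $\varepsilon$ with $0<\varepsilon\le 1$, the algorithm, given $(G,\varepsilon)$, finds a $1.5\,\varepsilon$-NE of $G$ in time at most $$\Big(\frac{n}{\varepsilon}\Big)^{C\,\max\{w,1\}\ln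 n/\varepsilon^2},$$ where $w$ is the treewidth of $G$; that is, in time $(n/\varepsilon)^{O(w\ln n/\varepsilon^2)}$ when $w\ge 1$. (2) Consequently there is a quasi-polynomial time approximation scheme for bounded-treewidth polymatrix games with logarithmically many actions: there is an algorithm which, given a normalised polymatrix game $G$ with $1\le m\le\ln n$ and a rational $\varepsilon>0$, finds an $\varepsilon$-NE of $G$, such that for every bound $w$ on the treewidth and every fixed $\varepsilon$ there is a constant $c$ for which its running time on all such games of treewidth at most $w$ is at most $\exp(c(\ln n)^c+c)$. -/

import Mathlib

/-! ### Treewidth -/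

namespace Polymatrix

/-- A tree decomposition of `G` whose tree `T` has node set `ι`. -/
structure TreeDecomposition {V : Type*} (G : SimpleGraph V) (ι : Type*) where
  T : SimpleGraph ι
  isTree : T.IsTree
  bag : ι → Finset V
  covers : ∀ v, ∃ i, v ∈ bag i
  covers_edge : ∀ u v, G.Adj u v → ∃ i, u ∈ bag i ∧ v ∈ bag i
  path_inter : ∀ i j k, ∀ p : T.Walk i k, p.IsPath → j ∈ p.support →
    ∀ v, v ∈ bag i → v ∈ bag k → v ∈ bag j

/-- The width: maximal size of a bag, minus one. -/
def TreeDecomposition.width {V : Type*} {G : SimpleGraph V} {t : ℕ}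
    (D : TreeDecomposition G (Fin t)) : ℕ :=
  (Finset.univ.sup fun i => (D.bag i).card) - 1

/-- The treewidth: minimal width over all (finite) tree decompositions. -/
noncomputable def treewidth {V : Type*} (G : SimpleGraph V) : ℕ :=
  sInf {w : ℕ | ∃ (t : ℕ) (D : TreeDecomposition G (Fin t)), D.width = w}

end Polymatrix

/-! ### Polymatrix games -/

/-- A polymatrix game with players `Fin n` and actions `Fin m`. On an edge `(i, j)`,
`payoff i j a b` is what player `i` gets from this edge when `i` plays `a` and `j` plays `b`.
The matrices of non-adjacent pairs are never used. -/
structure PolymatrixGame (n m : ℕ) where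
  graph : SimpleGraph (Fin n)
  payoff : Fin n → Fin n → Matrix (Fin m) (Fin m) ℚ

namespace PolymatrixGame

variable {n m : ℕ}

/-- A strategy profile: one probability distribution over the actions for every player. -/
def IsProfile (s : Fin n → Fin m → ℝ) : Prop :=
  ∀ i, s i ∈ stdSimplex ℝ (Fin m)

open Classical in
/-- The payoff of the pure strategy `a` of player `i` against the profile `s`:
the entry `a` of `∑ j ∈ N(i), A i j * s j`. -/
noncomputable def purePayoff (G : PolymatrixGame n m) (s : Fin n → Fin m → ℝ)
    (i : Fin n) (a : Fin m) : ℝ :=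
  ∑ j with G.graph.Adj i j, ∑ b, (G.payoff i j a b : ℝ) * s j b

/-- The expected payoff of player `i` under the profile `s`. -/
noncomputable def expPayoff (G : PolymatrixGame n m) (s : Fin n → Fin m → ℝ)
    (i : Fin n) : ℝ :=
  ∑ a, s i a * G.purePayoff s i a

/-- Normalisation: under every strategy profile every player gets a payoff in `[0, 1]`. -/
def IsNormalised (G : PolymatrixGame n m) : Prop :=
  ∀ s, IsProfile s → ∀ i, 0 ≤ G.expPayoff s i ∧ G.expPayoff s i ≤ 1

/-- `s` is a `δ`-Nash equilibrium: it is a strategy profile, and for every player the payoff is at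
least the best response payoff minus `δ`. -/
def IsApproxNash (G : PolymatrixGame n m) (δ : ℝ) (s : Fin n → Fin m → ℝ) : Prop :=
  IsProfile s ∧ ∀ i a, G.purePayoff s i a - δ ≤ G.expPayoff s i

end PolymatrixGame

/-! ### The machine model

Structured programs for a random access machine with unit-cost arithmetic. The memory consists
of arrays of natural numbers and arrays of rational numbers, each with cells `0, 1, 2, …`; a
program names arrays by literals, so it uses finitely many of them. Indices may be computed,
so there is indirect addressing. There are no rounding, integer division or bit operations:
rational numbers influence natural numbers and control flow only through comparisons. -/

namespace RAM

/-- Memory: `nat a e` is cell `e` of natural-number array `a`, `rat a e` is cell `e` of rational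
array `a`. -/
structure State where
  nat : ℕ → ℕ → ℕ
  rat : ℕ → ℕ → ℚ

/-- Write the value `x` to cell `e` of natural-number array `a`. -/
def State.setNat (σ : State) (a e x : ℕ) : State where
  nat a' e' := if a' = a ∧ e' = e then x else σ.nat a' e'
  rat := σ.rat

/-- Write the value `x` to cell `e` of rational array `a`. -/
def State.setRat (σ : State) (a e : ℕ) (x : ℚ) : State where
  nat := σ.nat
  rat a' e' := if a' = a ∧ e' = e then x else σ.rat a' e'

/-- Natural-number expressions; `sub` is truncated subtraction. -/
inductive NatExpr where
  | lit (c : ℕ)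
  | get (a : ℕ) (i : NatExpr)
  | add (x y : NatExpr)
  | sub (x y : NatExpr)
  | mul (x y : NatExpr)

def NatExpr.eval (σ : State) : NatExpr → ℕ
  | lit c => c
  | get a i => σ.nat a (i.eval σ)
  | add x y => x.eval σ + y.eval σ
  | sub x y => x.eval σ - y.eval σ
  | mul x y => x.eval σ * y.eval σ

/-- Cost of evaluation: one per literal, memory access and arithmetic operation. -/
def NatExpr.cost : NatExpr → ℕ
  | lit _ => 1
  | get _ i => i.cost + 1
  | add x y => x.cost + y.cost + 1
  | sub x y => x.cost + y.cost + 1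
  | mul x y => x.cost + y.cost + 1

/-- Rational expressions; `div` returns `0` when the divisor is `0`. -/
inductive RatExpr where
  | ofNat (x : NatExpr)
  | get (a : ℕ) (i : NatExpr)
  | add (x y : RatExpr)
  | sub (x y : RatExpr)
  | mul (x y : RatExpr)
  | div (x y : RatExpr)

def RatExpr.eval (σ : State) : RatExpr → ℚ
  | ofNat x => (x.eval σ : ℚ)
  | get a i => σ.rat a (i.eval σ)
  | add x y => x.eval σ + y.eval σ
  | sub x y => x.eval σ - y.eval σ
  | mul x y => x.eval σ * y.eval σ
  | div x y => x.eval σ / y.eval σ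

def RatExpr.cost : RatExpr → ℕ
  | ofNat x => x.cost + 1
  | get _ i => i.cost + 1
  | add x y => x.cost + y.cost + 1
  | sub x y => x.cost + y.cost + 1
  | mul x y => x.cost + y.cost + 1
  | div x y => x.cost + y.cost + 1

/-- Tests. -/
inductive Test where
  | natLe (x y : NatExpr)
  | ratLe (x y : RatExpr)
  | not (b : Test)
  | and (b c : Test)

def Test.Holds (σ : State) : Test → Prop
  | natLe x y => x.eval σ ≤ y.eval σ
  | ratLe x y => x.eval σ ≤ y.eval σ
  | not b => ¬ b.Holds σ
  | and b c => b.Holds σ ∧ c.Holds σ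

def Test.cost : Test → ℕ
  | natLe x y => x.cost + y.cost + 1
  | ratLe x y => x.cost + y.cost + 1
  | not b => b.cost + 1
  | and b c => b.cost + c.cost + 1

/-- Programs. `setNat a i e` and `setRat a i e` store the value of `e` in cell `i` of array `a`. -/
inductive Program where
  | skip
  | setNat (a : ℕ) (i e : NatExpr)
  | setRat (a : ℕ) (i : NatExpr) (e : RatExpr)
  | seq (p q : Program)
  | cond (b : Test) (p q : Program)
  | loop (b : Test) (p : Program)

/-- `Exec p σ t τ`: started in memory `σ`, the program `p` halts after exactly `t` steps with
memory `τ`. (`loop b p` repeats `p` as long as `b` holds.) -/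
inductive Exec : Program → State → ℕ → State → Prop where
  | skip (σ : State) : Exec .skip σ 1 σ
  | setNat (σ : State) (a : ℕ) (i e : NatExpr) :
      Exec (.setNat a i e) σ (i.cost + e.cost + 1) (σ.setNat a (i.eval σ) (e.eval σ))
  | setRat (σ : State) (a : ℕ) (i : NatExpr) (e : RatExpr) :
      Exec (.setRat a i e) σ (i.cost + e.cost + 1) (σ.setRat a (i.eval σ) (e.eval σ))
  | seq {p q : Program} {σ τ ρ : State} {t u : ℕ} :
      Exec p σ t τ → Exec q τ u ρ → Exec (.seq p q) σ (t + u) ρ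
  | condTrue {b : Test} {p q : Program} {σ τ : State} {t : ℕ} :
      b.Holds σ → Exec p σ t τ → Exec (.cond b p q) σ (b.cost + t + 1) τ
  | condFalse {b : Test} {p q : Program} {σ τ : State} {t : ℕ} :
      ¬ b.Holds σ → Exec q σ t τ → Exec (.cond b p q) σ (b.cost + t + 1) τ
  | loopTrue {b : Test} {p : Program} {σ τ ρ : State} {t u : ℕ} :
      b.Holds σ → Exec p σ t τ → Exec (.loop b p) τ u ρ →
        Exec (.loop b p) σ (b.cost + t + u + 1) ρ
  | loopFalse {b : Test} {p : Program} {σ : State} :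
      ¬ b.Holds σ → Exec (.loop b p) σ (b.cost + 1) σ

end RAM

/-! ### Algorithms for approximate equilibria -/

namespace PolymatrixGame

variable {n m : ℕ}

open Classical in
/-- The memory that holds the input `(G, ε)`. Natural-number array `0` holds `n` and `m`,
natural-number array `1` the adjacency matrix, rational array `0` holds `ε`, and rational array `1`
the payoff matrices of the edges; matrices are stored row by row. All other cells are `0`. -/
noncomputable def input (G : PolymatrixGame n m) (ε : ℚ) : RAM.State where
  nat
    | 0, e => if e = 0 then n else if e = 1 then m else 0
    | 1, e => if ∃ i j : Fin n, G.graph.Adj i j ∧ e = i * n + j then 1 else 0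
    | _, _ => 0
  rat
    | 0, e => if e = 0 then ε else 0
    | 1, e => ∑ i : Fin n, ∑ j : Fin n, ∑ a : Fin m, ∑ b : Fin m,
        if G.graph.Adj i j ∧ e = ((i * n + j) * m + a) * m + b then G.payoff i j a b else 0
    | _, _ => 0

/-- The output: rational array `2`, where cell `i * m + a` holds the probability with which
player `i` plays action `a`. -/
def output (n m : ℕ) (τ : RAM.State) : Fin n → Fin m → ℝ :=
  fun i a => (τ.rat 2 (i * m + a) : ℝ)

/-- On input `(G, ε)`, the program `P` halts after at most `B` steps with a `δ`-Nash equilibrium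
of `G` as output. -/
def FindsNash (P : RAM.Program) (G : PolymatrixGame n m) (ε : ℚ) (δ B : ℝ) : Prop :=
  ∃ (t : ℕ) (τ : RAM.State), RAM.Exec P (G.input ε) t τ ∧ (t : ℝ) ≤ B ∧
    G.IsApproxNash δ (output n m τ)

/-- `P` is a quasi-polynomial time approximation scheme for Nash equilibria of the games in the
class `𝒢`: given a game and any `ε > 0` it finds an `ε`-Nash equilibrium, and for every
fixed `ε` its running time is quasi-polynomial, `exp (O((ln n) ^ O(1)))`, in the number `n` of
players. (In the classes considered here, the size of the input is polynomial in `n`.) -/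
def IsQPTAS (P : RAM.Program) (𝒢 : ∀ n m : ℕ, PolymatrixGame n m → Prop) : Prop :=
  ∀ ε : ℚ, 0 < ε → ∃ c : ℕ, ∀ (n m : ℕ) (G : PolymatrixGame n m), 𝒢 n m G →
    FindsNash P G ε ε (Real.exp (c * Real.log n ^ c + c))

end PolymatrixGame

/-! ### Static running-time bounds -/

/-! The algorithm searches a grid. With k about 11n²/ε, only mixed strategies whose probabilities
are multiples of 1/k are considered. A player has at most (k+1)^m of them, which is (n/ε)^O(m), and
m ≤ ln n. The payoffs are rounded to integers as well, and the rounded game is solved exactly: a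
`Solution` gives every player a grid strategy whose integer payoff, on the scale k³, misses that of
the best action by at most 10n²k². Every solution is an ε-NE (`isApproxNash_gridProfile`), which is
better than 1.5ε, and solutions exist (`exists_solution`).

Rounding. Normalisation bounds the payoff of a player against a whole profile, but not the single
matrix entries. It does bound by 1 the change of a payoff when one neighbour changes his action
(`IsNormalised.abs_sub_le`). Payoffs can therefore be redistributed among the matrices so that all
entries lie in [0,2] and every payoff of a player grows by his degree (`shiftedPay`), which leaves
all regrets unchanged.

Existence. An exact equilibrium is not needed. The logit response map with parameter l is smooth and
bounded on the whole Euclidean space, and its fixed points are (m/l)-NE. Fixed points come from an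
analytic form of Brouwer's theorem (`FixedPoint.exists_fixedPoint`): without one, the identity of a
ball could be deformed linearly, with the boundary fixed, into a map onto the sphere; the integral
of the Jacobian determinant is a polynomial in the deformation parameter, equal to the volume for
small parameters but zero at the end. Rounding a (1/k)-NE to the grid costs O(n²/k), which the
tolerance 10n²/k covers.

Elimination order. Let L = w+1. Players are placed in groups of at most L so that every component of
the unplaced players has at most 2L+1 placed neighbours. If a component has exactly 2L+1, some bag
of an optimal tree decomposition is a balanced separator of these neighbours, and the part of that
bag inside the component is a suitable next group (`exists_extension`). The program knows neither w
nor a decomposition: it tries all L-tuples of players, and increases L, starting at 1, when all have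
failed. In the resulting order, the component of a player after removal of his predecessors has at
most 3L+1 neighbours. The player together with these neighbours contains his bag in the elimination
tree, which is obtained by the usual fill-in rule.

Dynamic programming. The table of a tree node contains partial profiles on the players of its
subtree and bag, in which all players after that node are satisfied. Two of them are interchangeable
if they agree on the bag both in the strategies and in the payoffs accumulated so far, since the
rest of the graph meets the subtree only through the bag. One representative per class is kept, so a
table has at most ((K+1)(2nk²+1)^m)^(3L+2) rows, K being the number of strategies (`length_le`).
`merge_complete` shows that joining tables loses no solution up to equivalence. At the root, whose
bag is empty, every row is a solution.

Running time. Every loop of the program makes at most B = (n/ε)^(160·m·max(w,1)) iterations, so the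
time is at most a constant times B to the nesting depth of the loops. To make this checkable, the
algorithm is written in a small language with bounded sums and counting loops, which is compiled to
the machine; `Runs` and `R` are Hoare-style judgements that carry the time bound along with
correctness. Since m ≤ ln n and ε ≤ 1, the exponent is within O(max(w,1)·ln n/ε²). The approximation
scheme is the same program after ε has been replaced by min(ε,1). -/

namespace RAM

/-- The factor in the static running-time bound `p.weight * B ^ p.depth`. -/
def Program.weight : Program → ℕ
  | .skip => 1
  | .setNat _ i e => i.cost + e.cost + 1
  | .setRat _ i e => i.cost + e.cost + 1
  | .seq p q => p.weight + q.weight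
  | .cond b p q => b.cost + p.weight + q.weight + 1
  | .loop b p => 2 * b.cost + p.weight + 3

/-- The nesting depth of the loops of a program. -/
def Program.depth : Program → ℕ
  | .skip => 0
  | .setNat _ _ _ => 0
  | .setRat _ _ _ => 0
  | .seq p q => max p.depth q.depth
  | .cond _ p q => max p.depth q.depth
  | .loop _ p => p.depth + 1

/-- The program contains an assignment to natural-number array `a`. -/
def Program.WritesNat (a : ℕ) : Program → Prop
  | .skip => False
  | .setNat b _ _ => b = a
  | .setRat _ _ _ => False
  | .seq p q => p.WritesNat a ∨ q.WritesNat a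
  | .cond _ p q => p.WritesNat a ∨ q.WritesNat a
  | .loop _ p => p.WritesNat a

/-- The program contains an assignment to rational array `a`. -/
def Program.WritesRat (a : ℕ) : Program → Prop
  | .skip => False
  | .setNat _ _ _ => False
  | .setRat b _ _ => b = a
  | .seq p q => p.WritesRat a ∨ q.WritesRat a
  | .cond _ p q => p.WritesRat a ∨ q.WritesRat a
  | .loop _ p => p.WritesRat a

theorem Exec.nat_eq {p : Program} {σ τ : State} {t a : ℕ} (h : Exec p σ t τ)
    (ha : ¬ p.WritesNat a) : τ.nat a = σ.nat a := by
  induction h with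
  | setNat σ b i e =>
    funext c
    have : a ≠ b := fun h => ha h.symm
    simp [State.setNat, this]
  | seq _ _ ih1 ih2 =>
    simp only [Program.WritesNat, not_or] at ha
    rw [ih2 ha.2, ih1 ha.1]
  | condTrue _ _ ih => exact ih fun h => ha (Or.inl h)
  | condFalse _ _ ih => exact ih fun h => ha (Or.inr h)
  | loopTrue _ _ _ ih1 ih2 => rw [ih2 ha, ih1 ha]
  | _ => rfl

theorem Exec.rat_eq {p : Program} {σ τ : State} {t a : ℕ} (h : Exec p σ t τ)
    (ha : ¬ p.WritesRat a) : τ.rat a = σ.rat a := by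
  induction h with
  | setRat σ b i e =>
    funext c
    have : a ≠ b := fun h => ha h.symm
    simp [State.setRat, this]
  | seq _ _ ih1 ih2 =>
    simp only [Program.WritesRat, not_or] at ha
    rw [ih2 ha.2, ih1 ha.1]
  | condTrue _ _ ih => exact ih fun h => ha (Or.inl h)
  | condFalse _ _ ih => exact ih fun h => ha (Or.inr h)
  | loopTrue _ _ _ ih1 ih2 => rw [ih2 ha, ih1 ha]
  | _ => rfl

/-- Started in memory `σ`, the program `p` halts within the static time bound for loop bound `B`,
and the final memory satisfies `Q`. -/
def Runs (B : ℕ) (p : Program) (σ : State) (Q : State → Prop) : Prop :=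
  ∃ t τ, Exec p σ t τ ∧ t ≤ p.weight * B ^ p.depth ∧ Q τ

section Runs

variable {B : ℕ} {p q : Program} {σ : State} {Q Q' : State → Prop}

theorem Runs.mono (h : Runs B p σ Q) (hQ : ∀ τ, Q τ → Q' τ) : Runs B p σ Q' := by
  obtain ⟨t, τ, he, ht, hq⟩ := h
  exact ⟨t, τ, he, ht, hQ τ hq⟩

theorem Runs.frame (h : Runs B p σ Q) :
    Runs B p σ fun τ => Q τ ∧ (∀ a, ¬ p.WritesNat a → τ.nat a = σ.nat a) ∧
      ∀ a, ¬ p.WritesRat a → τ.rat a = σ.rat a := by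
  obtain ⟨t, τ, he, ht, hq⟩ := h
  exact ⟨t, τ, he, ht, hq, fun a ha => he.nat_eq ha, fun a ha => he.rat_eq ha⟩

theorem Runs.skip (h : Q σ) : Runs B .skip σ Q := ⟨1, σ, .skip σ, by simp [Program.weight, Program.depth], h⟩

theorem Runs.setNat {a : ℕ} {i e : NatExpr} (h : Q (σ.setNat a (i.eval σ) (e.eval σ))) :
    Runs B (.setNat a i e) σ Q :=
  ⟨_, _, .setNat σ a i e, by simp [Program.weight, Program.depth], h⟩

theorem Runs.setRat {a : ℕ} {i : NatExpr} {e : RatExpr}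
    (h : Q (σ.setRat a (i.eval σ) (e.eval σ))) : Runs B (.setRat a i e) σ Q :=
  ⟨_, _, .setRat σ a i e, by simp [Program.weight, Program.depth], h⟩

theorem Runs.seq (hB : 1 ≤ B) (h : Runs B p σ fun τ => Runs B q τ Q) : Runs B (.seq p q) σ Q := by
  obtain ⟨t, τ, he, ht, u, ρ, he', hu, hq⟩ := h
  refine ⟨t + u, ρ, .seq he he', ?_, hq⟩
  simp only [Program.weight, Program.depth, add_mul]
  have h1 : B ^ p.depth ≤ B ^ max p.depth q.depth := Nat.pow_le_pow_right hB (le_max_left _ _)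
  have h2 : B ^ q.depth ≤ B ^ max p.depth q.depth := Nat.pow_le_pow_right hB (le_max_right _ _)
  exact add_le_add (ht.trans (Nat.mul_le_mul_left _ h1)) (hu.trans (Nat.mul_le_mul_left _ h2))

theorem Runs.cond (hB : 1 ≤ B) {b : Test} (h1 : b.Holds σ → Runs B p σ Q)
    (h2 : ¬ b.Holds σ → Runs B q σ Q) : Runs B (.cond b p q) σ Q := by
  have h0 : 1 ≤ B ^ max p.depth q.depth := Nat.one_le_pow _ _ hB
  by_cases hb : b.Holds σ
  · obtain ⟨t, τ, he, ht, hq⟩ := h1 hb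
    refine ⟨_, τ, .condTrue hb he, ?_, hq⟩
    have h1 : B ^ p.depth ≤ B ^ max p.depth q.depth := Nat.pow_le_pow_right hB (le_max_left _ _)
    have := ht.trans (Nat.mul_le_mul_left _ h1)
    simp only [Program.weight, Program.depth]
    nlinarith
  · obtain ⟨t, τ, he, ht, hq⟩ := h2 hb
    refine ⟨_, τ, .condFalse hb he, ?_, hq⟩
    have h1 : B ^ q.depth ≤ B ^ max p.depth q.depth := Nat.pow_le_pow_right hB (le_max_right _ _)
    have := ht.trans (Nat.mul_le_mul_left _ h1)
    simp only [Program.weight, Program.depth]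
    nlinarith

/-- The invariant is indexed by the number j of completed iterations. As j < B has to follow from
the invariant and the test, termination and the time bound are obtained together with correctness.
-/
theorem Runs.loop (hB : 1 ≤ B) {b : Test} (I : ℕ → State → Prop) (h0 : I 0 σ)
    (h : ∀ j τ, I j τ → b.Holds τ → j < B ∧ Runs B p τ (I (j + 1))) :
    Runs B (.loop b p) σ fun τ => ¬ b.Holds τ ∧ ∃ j, I j τ := by
  -- Induction on the number r of iterations that are left; when none is left, the invariant
  -- excludes that the test holds.
  have key : ∀ r j τ, r = B - j → I j τ → ∃ t τ', Exec (.loop b p) τ t τ' ∧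
      t ≤ r * (b.cost + p.weight * B ^ p.depth + 1) + b.cost + 1 ∧
      ¬ b.Holds τ' ∧ ∃ j, I j τ' := by
    intro r
    induction r with
    | zero =>
      intro j τ hr hI
      have hb : ¬ b.Holds τ := fun hb => by have := (h j τ hI hb).1; omega
      exact ⟨_, τ, .loopFalse hb, by simp, hb, j, hI⟩
    | succ r ih =>
      intro j τ hr hI
      by_cases hb : b.Holds τ
      · obtain ⟨_, t, τ', he, ht, hI'⟩ := h j τ hI hb
        obtain ⟨u, τ'', he', hu, hq⟩ := ih (j + 1) τ' (by omega) hI'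
        refine ⟨_, τ'', .loopTrue hb he he', ?_, hq⟩
        rw [add_mul]
        omega
      · exact ⟨_, τ, .loopFalse hb, by omega, hb, j, hI⟩
  obtain ⟨t, τ, he, ht, hq⟩ := key B 0 σ rfl h0
  refine ⟨t, τ, he, ht.trans ?_, hq⟩
  simp only [Program.weight, Program.depth, pow_succ]
  have h1 : 1 ≤ B ^ p.depth := Nat.one_le_pow _ _ hB
  have h2 : B ≤ B ^ p.depth * B := Nat.le_mul_of_pos_left _ h1
  have h3 : 1 ≤ B ^ p.depth * B := hB.trans h2
  -- The test is evaluated once more than the body. This last evaluation is paid for by the second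
  -- `b.cost` in the weight, because the power of B is at least 1.
  calc B * (b.cost + p.weight * B ^ p.depth + 1) + b.cost + 1
      = b.cost * B + p.weight * (B ^ p.depth * B) + B + b.cost + 1 := by ring
    _ ≤ b.cost * (B ^ p.depth * B) + p.weight * (B ^ p.depth * B) + (B ^ p.depth * B)
          + b.cost * (B ^ p.depth * B) + B ^ p.depth * B := by
        gcongr
        exact Nat.le_mul_of_pos_right _ h3
    _ ≤ _ := by
        have : 0 ≤ B ^ p.depth * B := Nat.zero_le _
        nlinarith

end Runs

/-! ### A programming language with bounded sums

Variables are bound by sums and `for` loops; a variable is given by its de Bruijn level, and its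
value by the environment `ρ`. -/

/-- Expressions for natural numbers. -/
inductive X where
  | lit (c : ℕ)
  | var (x : ℕ)
  | get (a : ℕ) (i : X)
  | add (x y : X)
  | sub (x y : X)
  | mul (x y : X)
  | le (x y : X)
  | sum (N b : X)

namespace X

def eval (σ : State) : List ℕ → X → ℕ
  | _, lit c => c
  | ρ, var x => ρ.getD x 0
  | ρ, get a i => σ.nat a (i.eval σ ρ)
  | ρ, add x y => x.eval σ ρ + y.eval σ ρ
  | ρ, sub x y => x.eval σ ρ - y.eval σ ρ
  | ρ, mul x y => x.eval σ ρ * y.eval σ ρ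
  | ρ, le x y => if x.eval σ ρ ≤ y.eval σ ρ then 1 else 0
  | ρ, sum N b => ∑ i ∈ Finset.range (N.eval σ ρ), b.eval σ (ρ ++ [i])

/-- The variables are in scope and the sums have at most `B` terms. -/
def Bdd (B : ℕ) (σ : State) : List ℕ → X → Prop
  | _, lit _ => True
  | ρ, var x => x < ρ.length
  | ρ, get _ i => i.Bdd B σ ρ
  | ρ, add x y => x.Bdd B σ ρ ∧ y.Bdd B σ ρ
  | ρ, sub x y => x.Bdd B σ ρ ∧ y.Bdd B σ ρ
  | ρ, mul x y => x.Bdd B σ ρ ∧ y.Bdd B σ ρ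
  | ρ, le x y => x.Bdd B σ ρ ∧ y.Bdd B σ ρ
  | ρ, sum N b => N.Bdd B σ ρ ∧ N.eval σ ρ ≤ B ∧ ∀ i < N.eval σ ρ, b.Bdd B σ (ρ ++ [i])

end X

/-- The machine array for array `a`; the arrays `2` and `3` of the machine are reserved. -/
def natArr (a : ℕ) : ℕ := if a < 2 then a else a + 2

/-- The machine array for rational array `a`; the array `3` of the machine is reserved. -/
def ratArr (a : ℕ) : ℕ := if a < 3 then a else a + 1

theorem natArr_ne_two (a : ℕ) : natArr a ≠ 2 := by unfold natArr; split <;> omega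
theorem natArr_ne_three (a : ℕ) : natArr a ≠ 3 := by unfold natArr; split <;> omega
theorem ratArr_ne_three (a : ℕ) : ratArr a ≠ 3 := by unfold ratArr; split <;> omega
theorem natArr_inj {a b : ℕ} : natArr a = natArr b ↔ a = b := by
  unfold natArr; split <;> split <;> omega
theorem ratArr_inj {a b : ℕ} : ratArr a = ratArr b ↔ a = b := by
  unfold ratArr; split <;> split <;> omega

/-- Cell `c` of the array that holds the variables and loop bounds. -/
def vcell (c : ℕ) : NatExpr := .get 2 (.lit c)

/-- Cell `c` of the array that holds intermediate results. -/
def tcell (c : ℕ) : NatExpr := .get 3 (.lit c)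

/-- Cell `c` of the array that holds rational intermediate results. -/
def rcell (c : ℕ) : RatExpr := .get 3 (.lit c)

@[simp] theorem eval_vcell (σ : State) (c : ℕ) : (vcell c).eval σ = σ.nat 2 c := rfl
@[simp] theorem eval_tcell (σ : State) (c : ℕ) : (tcell c).eval σ = σ.nat 3 c := rfl
@[simp] theorem eval_rcell (σ : State) (c : ℕ) : (rcell c).eval σ = σ.rat 3 c := rfl

/-- Counting loop; the variable at level `d` runs from `0` to the value of `tcell 0` minus `1`. -/
def forProg (d t : ℕ) (init body : Program) : Program :=
  .seq (.setNat 2 (.lit (2 * d + 1)) (tcell t)) <| .seq (.setNat 2 (.lit (2 * d)) (.lit 0)) <|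
    .seq init <|
    .loop (.not (.natLe (vcell (2 * d + 1)) (vcell (2 * d))))
      (.seq body (.setNat 2 (.lit (2 * d)) (.add (vcell (2 * d)) (.lit 1))))

/-- The machine program that stores the value of an expression in `tcell t`, where `d` is the
number of variables in scope. -/
def X.comp : ℕ → ℕ → X → Program
  | _, t, lit c => .setNat 3 (.lit t) (.lit c)
  | _, t, var x => .setNat 3 (.lit t) (vcell (2 * x))
  | d, t, get a i => .seq (i.comp d t) (.setNat 3 (.lit t) (.get (natArr a) (tcell t)))
  | d, t, add x y => .seq (x.comp d t) <| .seq (y.comp d (t + 1)) <|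
      .setNat 3 (.lit t) (.add (tcell t) (tcell (t + 1)))
  | d, t, sub x y => .seq (x.comp d t) <| .seq (y.comp d (t + 1)) <|
      .setNat 3 (.lit t) (.sub (tcell t) (tcell (t + 1)))
  | d, t, mul x y => .seq (x.comp d t) <| .seq (y.comp d (t + 1)) <|
      .setNat 3 (.lit t) (.mul (tcell t) (tcell (t + 1)))
  | d, t, le x y => .seq (x.comp d t) <| .seq (y.comp d (t + 1)) <|
      .cond (.natLe (tcell t) (tcell (t + 1))) (.setNat 3 (.lit t) (.lit 1))
        (.setNat 3 (.lit t) (.lit 0))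
  | d, t, sum N b => .seq (N.comp d t) <| forProg d t (.setNat 3 (.lit t) (.lit 0))
      (.seq (b.comp (d + 1) (t + 1)) (.setNat 3 (.lit t) (.add (tcell t) (tcell (t + 1)))))

/-- The machine memory `σ'` represents the memory `σ`. -/
def Rep (σ σ' : State) : Prop :=
  (∀ a, σ'.nat (natArr a) = σ.nat a) ∧ ∀ a, σ'.rat (ratArr a) = σ.rat a

/-- The machine memory `σ'` represents the environment `ρ`. -/
def EnvRep (ρ : List ℕ) (σ' : State) : Prop := ∀ x < ρ.length, σ'.nat 2 (2 * x) = ρ.getD x 0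

/-- Only cells from `d` on of the variable array and from `t` on of the array of intermediate
results may have changed. -/
structure Keep (d t : ℕ) (σ τ : State) : Prop where
  var : ∀ c < d, τ.nat 2 c = σ.nat 2 c
  tmp : ∀ c < t, τ.nat 3 c = σ.nat 3 c
  nat : ∀ a, a ≠ 2 → a ≠ 3 → τ.nat a = σ.nat a
  rat : τ.rat = σ.rat

theorem Keep.trans {d t d' t' : ℕ} {σ τ υ : State} (h : Keep d t σ τ) (h' : Keep d' t' τ υ)
    (hd : d ≤ d') (ht : t ≤ t') : Keep d t σ υ where
  var c hc := (h'.var c (by omega)).trans (h.var c hc)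
  tmp c hc := (h'.tmp c (by omega)).trans (h.tmp c hc)
  nat a h2 h3 := (h'.nat a h2 h3).trans (h.nat a h2 h3)
  rat := h'.rat.trans h.rat

theorem Keep.setTmp (d t c x : ℕ) (σ : State) (h : t ≤ c) : Keep d t σ (σ.setNat 3 c x) where
  var c hc := by simp [State.setNat]
  tmp c' hc := by simp only [State.setNat]; rw [if_neg]; rintro ⟨_, h⟩; omega
  nat a h2 h3 := by funext e; simp [State.setNat, h3]
  rat := rfl

theorem Keep.setVar (d t c x : ℕ) (σ : State) (h : d ≤ c) : Keep d t σ (σ.setNat 2 c x) where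
  var c' hc := by simp only [State.setNat]; rw [if_neg]; rintro ⟨_, h⟩; omega
  tmp c hc := by simp [State.setNat]
  nat a h2 h3 := by funext e; simp [State.setNat, h2]
  rat := rfl

theorem Keep.rep {d t : ℕ} {σ τ υ : State} (h : Keep d t τ υ) (hr : Rep σ τ) : Rep σ υ := by
  refine ⟨fun a => ?_, fun a => ?_⟩
  · rw [h.nat _ (natArr_ne_two a) (natArr_ne_three a), hr.1]
  · rw [h.rat, hr.2]

theorem EnvRep.of_eq {ρ : List ℕ} {σ τ : State} (h : EnvRep ρ σ)
    (hk : ∀ c < 2 * ρ.length, τ.nat 2 c = σ.nat 2 c) : EnvRep ρ τ := fun x hx => by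
  rw [hk _ (by omega), h x hx]

theorem EnvRep.append {ρ : List ℕ} {σ : State} {i : ℕ} (h : EnvRep ρ σ)
    (hi : σ.nat 2 (2 * ρ.length) = i) : EnvRep (ρ ++ [i]) σ := fun x hx => by
  simp only [List.length_append, List.length_singleton] at hx
  rcases Nat.lt_succ_iff_lt_or_eq.1 hx with hx | rfl
  · rw [h x hx, List.getD_append _ _ _ _ hx]
  · simp [hi]

@[simp] theorem setNat_nat_same (σ : State) (a e x : ℕ) : (σ.setNat a e x).nat a e = x := by
  simp [State.setNat]

@[simp] theorem setNat_rat (σ : State) (a e x : ℕ) : (σ.setNat a e x).rat = σ.rat := rfl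

@[simp] theorem setRat_nat (σ : State) (a e : ℕ) (x : ℚ) : (σ.setRat a e x).nat = σ.nat := rfl

theorem setNat_nat_of_ne (σ : State) {a a' : ℕ} (e x : ℕ) (h : a' ≠ a) :
    (σ.setNat a e x).nat a' = σ.nat a' := by
  funext c; simp [State.setNat, h]

theorem setNat_nat_cell (σ : State) {a e e' : ℕ} (x : ℕ) (h : e' ≠ e) :
    (σ.setNat a e x).nat a e' = σ.nat a e' := by
  simp [State.setNat, h]

/-- Rule for counting loops of the machine. -/
theorem Runs.for {B d t N : ℕ} (hB : 1 ≤ B) {init body : Program} {σ : State}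
    (hN : σ.nat 3 t = N) (hNB : N ≤ B) (I : ℕ → State → Prop)
    (h0 : Runs B init ((σ.setNat 2 (2 * d + 1) N).setNat 2 (2 * d) 0) fun τ =>
      I 0 τ ∧ τ.nat 2 (2 * d) = 0 ∧ τ.nat 2 (2 * d + 1) = N)
    (h : ∀ j < N, ∀ τ, I j τ → τ.nat 2 (2 * d) = j → τ.nat 2 (2 * d + 1) = N →
      Runs B body τ fun τ' => I (j + 1) (τ'.setNat 2 (2 * d) (j + 1)) ∧
        τ'.nat 2 (2 * d) = j ∧ τ'.nat 2 (2 * d + 1) = N) :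
    Runs B (forProg d t init body) σ (I N) := by
  unfold forProg
  refine Runs.seq hB (Runs.setNat (Runs.seq hB (Runs.setNat (Runs.seq hB ?_))))
  simp only [NatExpr.eval, eval_tcell, hN]
  refine h0.mono fun τ h0 => ?_
  refine (Runs.loop hB (fun j τ => j ≤ N ∧ I j τ ∧ τ.nat 2 (2 * d) = j ∧
    τ.nat 2 (2 * d + 1) = N) ⟨Nat.zero_le _, h0⟩ ?_).mono ?_
  · rintro j τ ⟨hj, hI, h1, h2⟩ hb
    simp only [Test.Holds, eval_vcell, h1, h2, not_le] at hb
    refine ⟨hb.trans_le hNB, Runs.seq hB ((h j hb τ hI h1 h2).mono ?_)⟩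
    rintro τ' ⟨hI', h1', h2'⟩
    refine Runs.setNat ?_
    simp only [NatExpr.eval, eval_vcell, h1']
    refine ⟨hb, hI', by simp, ?_⟩
    rw [setNat_nat_cell _ _ (by omega), h2']
  · rintro τ ⟨hb, j, hj, hI, h1, h2⟩
    simp only [Test.Holds, eval_vcell, h1, h2, not_not] at hb
    rwa [le_antisymm hb hj]

/-- Array 3 is used as a stack: evaluation at height t leaves all cells below t and the variables in
scope alone, so the first operand can wait in cell t while the second is computed at t + 1. `Keep`
is the part of the induction hypothesis that records this. -/
theorem X.runs_comp {B : ℕ} (hB : 1 ≤ B) (e : X) : ∀ (ρ : List ℕ) (t : ℕ) (σ σ' : State),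
    Rep σ σ' → EnvRep ρ σ' → e.Bdd B σ ρ → Runs B (e.comp ρ.length t) σ' fun τ =>
      τ.nat 3 t = e.eval σ ρ ∧ Keep (2 * ρ.length) t σ' τ := by
  have bin : ∀ (x y : X) (z : NatExpr → NatExpr → NatExpr) (f : ℕ → ℕ → ℕ),
      (∀ υ a b, (z a b).eval υ = f (a.eval υ) (b.eval υ)) →
      (∀ (ρ : List ℕ) (t : ℕ) (σ σ' : State), Rep σ σ' → EnvRep ρ σ' → x.Bdd B σ ρ →
        Runs B (x.comp ρ.length t) σ' fun τ =>
          τ.nat 3 t = x.eval σ ρ ∧ Keep (2 * ρ.length) t σ' τ) →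
      (∀ (ρ : List ℕ) (t : ℕ) (σ σ' : State), Rep σ σ' → EnvRep ρ σ' → y.Bdd B σ ρ →
        Runs B (y.comp ρ.length t) σ' fun τ =>
          τ.nat 3 t = y.eval σ ρ ∧ Keep (2 * ρ.length) t σ' τ) →
      ∀ (ρ : List ℕ) (t : ℕ) (σ σ' : State), Rep σ σ' → EnvRep ρ σ' →
        x.Bdd B σ ρ ∧ y.Bdd B σ ρ →
        Runs B (.seq (x.comp ρ.length t) <| .seq (y.comp ρ.length (t + 1)) <|
          .setNat 3 (.lit t) (z (tcell t) (tcell (t + 1)))) σ' fun τ =>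
          τ.nat 3 t = f (x.eval σ ρ) (y.eval σ ρ) ∧ Keep (2 * ρ.length) t σ' τ := by
    intro x y z f hz ihx ihy ρ t σ σ' hr he ⟨hx, hy⟩
    refine Runs.seq hB ((ihx ρ t σ σ' hr he hx).mono ?_)
    rintro τ ⟨h1, k1⟩
    refine Runs.seq hB ((ihy ρ (t + 1) σ τ (k1.rep hr) (he.of_eq k1.var) hy).mono ?_)
    rintro υ ⟨h2, k2⟩
    refine Runs.setNat ⟨?_, ?_⟩
    · simp only [NatExpr.eval, setNat_nat_same, hz, eval_tcell, h2, k2.tmp t (by omega), h1]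
    · exact (k1.trans k2 le_rfl (by omega)).trans (Keep.setTmp _ _ _ _ _ le_rfl) le_rfl le_rfl
  induction e with
  | lit c =>
    intro ρ t σ σ' hr he hb
    exact Runs.setNat ⟨by simp [NatExpr.eval, X.eval], Keep.setTmp _ _ _ _ _ le_rfl⟩
  | var x =>
    intro ρ t σ σ' hr he hb
    exact Runs.setNat ⟨by simp [NatExpr.eval, X.eval, he x hb], Keep.setTmp _ _ _ _ _ le_rfl⟩
  | get a i ih =>
    intro ρ t σ σ' hr he hb
    refine Runs.seq hB ((ih ρ t σ σ' hr he hb).mono ?_)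
    rintro τ ⟨h1, k1⟩
    refine Runs.setNat ⟨?_, k1.trans (Keep.setTmp _ _ _ _ _ le_rfl) le_rfl le_rfl⟩
    simp [NatExpr.eval, X.eval, h1, (k1.rep hr).1 a]
  | add x y ihx ihy => exact bin x y .add (· + ·) (fun _ _ _ => rfl) ihx ihy
  | sub x y ihx ihy => exact bin x y .sub (· - ·) (fun _ _ _ => rfl) ihx ihy
  | mul x y ihx ihy => exact bin x y .mul (· * ·) (fun _ _ _ => rfl) ihx ihy
  | le x y ihx ihy =>
    intro ρ t σ σ' hr he ⟨hx, hy⟩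
    refine Runs.seq hB ((ihx ρ t σ σ' hr he hx).mono ?_)
    rintro τ ⟨h1, k1⟩
    refine Runs.seq hB ((ihy ρ (t + 1) σ τ (k1.rep hr) (he.of_eq k1.var) hy).mono ?_)
    rintro υ ⟨h2, k2⟩
    have k3 := k1.trans k2 le_rfl (by omega)
    have h1' : υ.nat 3 t = x.eval σ ρ := by rw [k2.tmp t (by omega), h1]
    refine Runs.cond hB (fun hb => ?_) (fun hb => ?_) <;>
      simp only [Test.Holds, eval_tcell, h1', h2] at hb <;>
      refine Runs.setNat ⟨?_, k3.trans (Keep.setTmp _ _ _ _ _ le_rfl) le_rfl le_rfl⟩ <;>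
      simp [X.eval, NatExpr.eval, hb]
  | sum N b ihN ihb =>
    intro ρ t σ σ' hr he ⟨hN, hNB, hb⟩
    refine Runs.seq hB ((ihN ρ t σ σ' hr he hN).mono ?_)
    rintro τ ⟨h1, k1⟩
    refine (Runs.for hB h1 hNB (fun j υ => υ.nat 3 t =
      (∑ i ∈ Finset.range j, b.eval σ (ρ ++ [i])) ∧ Keep (2 * ρ.length) t σ' υ) ?_ ?_)
    · refine Runs.setNat ⟨⟨by simp [NatExpr.eval], ?_⟩, ?_, ?_⟩
      · refine (((k1.trans (Keep.setVar _ _ _ _ _ ?_) le_rfl le_rfl).trans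
          (Keep.setVar _ _ _ _ _ ?_) le_rfl le_rfl).trans (Keep.setTmp _ _ _ _ _ ?_) le_rfl le_rfl)
        all_goals first | exact le_rfl | omega
      · simp [State.setNat]
      · simp [State.setNat]
    · intro j hj υ ⟨hs, hk⟩ hv hv'
      refine Runs.seq hB ?_
      have := ihb (ρ ++ [j]) (t + 1) σ υ (hk.rep hr) ((he.of_eq hk.var).append hv) (hb j hj)
      simp only [List.length_append, List.length_singleton] at this
      refine this.mono ?_
      rintro φ ⟨h2, k2⟩
      refine Runs.setNat ⟨⟨?_, ?_⟩, ?_, ?_⟩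
      · rw [setNat_nat_of_ne _ _ _ (by norm_num)]
        simp only [NatExpr.eval, setNat_nat_same, eval_tcell, h2, k2.tmp t (by omega), hs]
        rw [Finset.sum_range_succ]
      · refine (((hk.trans k2 (by omega) (by omega)).trans (Keep.setTmp _ _ _ _ _ le_rfl)
          le_rfl le_rfl).trans (Keep.setVar _ _ _ _ _ le_rfl) le_rfl le_rfl)
      · rw [setNat_nat_of_ne _ _ _ (by norm_num), k2.var _ (by omega), hv]
      · rw [setNat_nat_of_ne _ _ _ (by norm_num), k2.var _ (by omega), hv']

end RAM

/-! ### Rational expressions, statements, and rules for their execution -/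

namespace RAM

/-- Rational expressions. -/
inductive RX where
  | ofNat (x : X)
  | get (a : ℕ) (i : X)
  | add (x y : RX)
  | sub (x y : RX)
  | mul (x y : RX)
  | div (x y : RX)
  | sum (N : X) (b : RX)

namespace RX

def eval (σ : State) : List ℕ → RX → ℚ
  | ρ, ofNat x => (x.eval σ ρ : ℚ)
  | ρ, get a i => σ.rat a (i.eval σ ρ)
  | ρ, add x y => x.eval σ ρ + y.eval σ ρ
  | ρ, sub x y => x.eval σ ρ - y.eval σ ρ
  | ρ, mul x y => x.eval σ ρ * y.eval σ ρ
  | ρ, div x y => x.eval σ ρ / y.eval σ ρ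
  | ρ, sum N b => ∑ i ∈ Finset.range (N.eval σ ρ), b.eval σ (ρ ++ [i])

/-- The variables are in scope and the sums have at most `B` terms. -/
def Bdd (B : ℕ) (σ : State) : List ℕ → RX → Prop
  | ρ, ofNat x => x.Bdd B σ ρ
  | ρ, get _ i => i.Bdd B σ ρ
  | ρ, add x y => x.Bdd B σ ρ ∧ y.Bdd B σ ρ
  | ρ, sub x y => x.Bdd B σ ρ ∧ y.Bdd B σ ρ
  | ρ, mul x y => x.Bdd B σ ρ ∧ y.Bdd B σ ρ
  | ρ, div x y => x.Bdd B σ ρ ∧ y.Bdd B σ ρ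
  | ρ, sum N b => N.Bdd B σ ρ ∧ N.eval σ ρ ≤ B ∧ ∀ i < N.eval σ ρ, b.Bdd B σ (ρ ++ [i])

/-- The machine program that stores the value of an expression in `rcell r`. -/
def comp : ℕ → ℕ → RX → Program
  | d, r, ofNat x => .seq (x.comp d 0) (.setRat 3 (.lit r) (.ofNat (tcell 0)))
  | d, r, get a i => .seq (i.comp d 0) (.setRat 3 (.lit r) (.get (ratArr a) (tcell 0)))
  | d, r, add x y => .seq (x.comp d r) <| .seq (y.comp d (r + 1)) <|
      .setRat 3 (.lit r) (.add (rcell r) (rcell (r + 1)))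
  | d, r, sub x y => .seq (x.comp d r) <| .seq (y.comp d (r + 1)) <|
      .setRat 3 (.lit r) (.sub (rcell r) (rcell (r + 1)))
  | d, r, mul x y => .seq (x.comp d r) <| .seq (y.comp d (r + 1)) <|
      .setRat 3 (.lit r) (.mul (rcell r) (rcell (r + 1)))
  | d, r, div x y => .seq (x.comp d r) <| .seq (y.comp d (r + 1)) <|
      .setRat 3 (.lit r) (.div (rcell r) (rcell (r + 1)))
  | d, r, sum N b => .seq (N.comp d 0) <| forProg d 0 (.setRat 3 (.lit r) (.ofNat (.lit 0)))
      (.seq (b.comp (d + 1) (r + 1)) (.setRat 3 (.lit r) (.add (rcell r) (rcell (r + 1)))))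

end RX

/-- Only cells from `d` on of the variable array, intermediate results, and rational intermediate
results from `r` on may have changed. -/
structure KeepRat (d r : ℕ) (σ τ : State) : Prop where
  var : ∀ c < d, τ.nat 2 c = σ.nat 2 c
  tmp : ∀ c < r, τ.rat 3 c = σ.rat 3 c
  nat : ∀ a, a ≠ 2 → a ≠ 3 → τ.nat a = σ.nat a
  rat : ∀ a, a ≠ 3 → τ.rat a = σ.rat a

theorem KeepRat.trans {d r d' r' : ℕ} {σ τ υ : State} (h : KeepRat d r σ τ)
    (h' : KeepRat d' r' τ υ) (hd : d ≤ d') (hr : r ≤ r') : KeepRat d r σ υ where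
  var c hc := (h'.var c (by omega)).trans (h.var c hc)
  tmp c hc := (h'.tmp c (by omega)).trans (h.tmp c hc)
  nat a h2 h3 := (h'.nat a h2 h3).trans (h.nat a h2 h3)
  rat a h3 := (h'.rat a h3).trans (h.rat a h3)

theorem Keep.keepRat {d t : ℕ} {σ τ : State} (h : Keep d t σ τ) (r : ℕ) : KeepRat d r σ τ where
  var := h.var
  tmp c _ := by rw [h.rat]
  nat := h.nat
  rat a _ := by rw [h.rat]

theorem KeepRat.setTmp (d r c : ℕ) (x : ℚ) (σ : State) (h : r ≤ c) :
    KeepRat d r σ (σ.setRat 3 c x) where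
  var c hc := rfl
  tmp c' hc := by simp only [State.setRat]; rw [if_neg]; rintro ⟨_, h⟩; omega
  nat a h2 h3 := rfl
  rat a h3 := by funext e; simp [State.setRat, h3]

theorem KeepRat.rep {d t : ℕ} {σ τ υ : State} (h : KeepRat d t τ υ) (hr : Rep σ τ) :
    Rep σ υ := by
  refine ⟨fun a => ?_, fun a => ?_⟩
  · rw [h.nat _ (natArr_ne_two a) (natArr_ne_three a), hr.1]
  · rw [h.rat _ (ratArr_ne_three a), hr.2]

@[simp] theorem setRat_rat_same (σ : State) (a e : ℕ) (x : ℚ) : (σ.setRat a e x).rat a e = x := by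
  simp [State.setRat]

/-- As for natural-number expressions, with a stack of rational cells. No natural intermediate
result is alive while a rational expression is evaluated, so indices and sum bounds may always be
computed from cell 0 on; accordingly `KeepRat` does not protect natural temporaries. -/
theorem RX.runs_comp {B : ℕ} (hB : 1 ≤ B) (e : RX) : ∀ (ρ : List ℕ) (r : ℕ) (σ σ' : State),
    Rep σ σ' → EnvRep ρ σ' → e.Bdd B σ ρ → Runs B (e.comp ρ.length r) σ' fun τ =>
      τ.rat 3 r = e.eval σ ρ ∧ KeepRat (2 * ρ.length) r σ' τ := by
  have bin : ∀ (x y : RX) (z : RatExpr → RatExpr → RatExpr) (f : ℚ → ℚ → ℚ),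
      (∀ υ a b, (z a b).eval υ = f (a.eval υ) (b.eval υ)) →
      (∀ (ρ : List ℕ) (r : ℕ) (σ σ' : State), Rep σ σ' → EnvRep ρ σ' → x.Bdd B σ ρ →
        Runs B (x.comp ρ.length r) σ' fun τ =>
          τ.rat 3 r = x.eval σ ρ ∧ KeepRat (2 * ρ.length) r σ' τ) →
      (∀ (ρ : List ℕ) (r : ℕ) (σ σ' : State), Rep σ σ' → EnvRep ρ σ' → y.Bdd B σ ρ →
        Runs B (y.comp ρ.length r) σ' fun τ =>
          τ.rat 3 r = y.eval σ ρ ∧ KeepRat (2 * ρ.length) r σ' τ) →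
      ∀ (ρ : List ℕ) (r : ℕ) (σ σ' : State), Rep σ σ' → EnvRep ρ σ' →
        x.Bdd B σ ρ ∧ y.Bdd B σ ρ →
        Runs B (.seq (x.comp ρ.length r) <| .seq (y.comp ρ.length (r + 1)) <|
          .setRat 3 (.lit r) (z (rcell r) (rcell (r + 1)))) σ' fun τ =>
          τ.rat 3 r = f (x.eval σ ρ) (y.eval σ ρ) ∧ KeepRat (2 * ρ.length) r σ' τ := by
    intro x y z f hz ihx ihy ρ t σ σ' hr he ⟨hx, hy⟩
    refine Runs.seq hB ((ihx ρ t σ σ' hr he hx).mono ?_)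
    rintro τ ⟨h1, k1⟩
    refine Runs.seq hB ((ihy ρ (t + 1) σ τ (k1.rep hr) (he.of_eq k1.var) hy).mono ?_)
    rintro υ ⟨h2, k2⟩
    refine Runs.setRat ⟨?_, ?_⟩
    · simp only [NatExpr.eval, setRat_rat_same, hz, eval_rcell, h2, k2.tmp t (by omega), h1]
    · exact (k1.trans k2 le_rfl (by omega)).trans (KeepRat.setTmp _ _ _ _ _ le_rfl) le_rfl le_rfl
  induction e with
  | ofNat x =>
    intro ρ r σ σ' hr he hb
    refine Runs.seq hB ((x.runs_comp hB ρ 0 σ σ' hr he hb).mono ?_)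
    rintro τ ⟨h1, k1⟩
    refine Runs.setRat ⟨?_, (k1.keepRat r).trans (KeepRat.setTmp _ _ _ _ _ le_rfl) le_rfl le_rfl⟩
    simp [NatExpr.eval, RatExpr.eval, RX.eval, h1]
  | get a x =>
    intro ρ r σ σ' hr he hb
    refine Runs.seq hB ((x.runs_comp hB ρ 0 σ σ' hr he hb).mono ?_)
    rintro τ ⟨h1, k1⟩
    refine Runs.setRat ⟨?_, (k1.keepRat r).trans (KeepRat.setTmp _ _ _ _ _ le_rfl) le_rfl le_rfl⟩
    simp [NatExpr.eval, RatExpr.eval, RX.eval, h1, (k1.rep hr).2 a]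
  | add x y ihx ihy => exact bin x y .add (· + ·) (fun _ _ _ => rfl) ihx ihy
  | sub x y ihx ihy => exact bin x y .sub (· - ·) (fun _ _ _ => rfl) ihx ihy
  | mul x y ihx ihy => exact bin x y .mul (· * ·) (fun _ _ _ => rfl) ihx ihy
  | div x y ihx ihy => exact bin x y .div (· / ·) (fun _ _ _ => rfl) ihx ihy
  | sum N b ihb =>
    intro ρ r σ σ' hr he ⟨hN, hNB, hb⟩
    refine Runs.seq hB ((N.runs_comp hB ρ 0 σ σ' hr he hN).mono ?_)
    rintro τ ⟨h1, k1⟩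
    have k1' := k1.keepRat r
    refine (Runs.for hB h1 hNB (fun j υ => υ.rat 3 r =
      (∑ i ∈ Finset.range j, b.eval σ (ρ ++ [i])) ∧ KeepRat (2 * ρ.length) r σ' υ) ?_ ?_)
    · refine Runs.setRat ⟨⟨by simp [NatExpr.eval, RatExpr.eval], ?_⟩, ?_, ?_⟩
      · refine (((k1'.trans ((Keep.setVar _ 0 _ _ _ ?_).keepRat _) le_rfl le_rfl).trans
          ((Keep.setVar _ 0 _ _ _ ?_).keepRat _) le_rfl le_rfl).trans
          (KeepRat.setTmp _ _ _ _ _ ?_) le_rfl le_rfl)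
        all_goals first | exact le_rfl | omega
      · simp [State.setNat]
      · simp [State.setNat]
    · intro j hj υ ⟨hs, hk⟩ hv hv'
      refine Runs.seq hB ?_
      have := ihb (ρ ++ [j]) (r + 1) σ υ (hk.rep hr) ((he.of_eq hk.var).append hv) (hb j hj)
      simp only [List.length_append, List.length_singleton] at this
      refine this.mono ?_
      rintro φ ⟨h2, k2⟩
      refine Runs.setRat ⟨⟨?_, ?_⟩, ?_, ?_⟩
      · rw [setNat_rat]
        simp only [NatExpr.eval, RatExpr.eval, setRat_rat_same, eval_rcell, h2,
          k2.tmp r (by omega), hs]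
        rw [Finset.sum_range_succ]
      · exact (((hk.trans k2 (by omega) (by omega)).trans (KeepRat.setTmp _ _ _ _ _ le_rfl)
          le_rfl le_rfl).trans ((Keep.setVar _ 0 _ _ _ le_rfl).keepRat _) le_rfl le_rfl)
      · rw [setRat_nat, k2.var _ (by omega), hv]
      · rw [setRat_nat, k2.var _ (by omega), hv']

/-- Conditions: `nz x` holds if `x ≠ 0`. -/
inductive Tst where
  | nz (x : X)
  | le (x y : RX)

namespace Tst

def Holds (σ : State) (ρ : List ℕ) : Tst → Prop
  | nz x => x.eval σ ρ ≠ 0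
  | le x y => x.eval σ ρ ≤ y.eval σ ρ

def Bdd (B : ℕ) (σ : State) (ρ : List ℕ) : Tst → Prop
  | nz x => x.Bdd B σ ρ
  | le x y => x.Bdd B σ ρ ∧ y.Bdd B σ ρ

/-- The machine program that stores the truth value of a condition in `tcell 0`. -/
def comp (d : ℕ) : Tst → Program
  | nz x => x.comp d 0
  | le x y => .seq (x.comp d 0) <| .seq (y.comp d 1) <|
      .cond (.ratLe (rcell 0) (rcell 1)) (.setNat 3 (.lit 0) (.lit 1)) (.setNat 3 (.lit 0) (.lit 0))

theorem runs_comp {B : ℕ} (hB : 1 ≤ B) (b : Tst) (ρ : List ℕ) (σ σ' : State)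
    (hr : Rep σ σ') (he : EnvRep ρ σ') (hb : b.Bdd B σ ρ) :
    Runs B (b.comp ρ.length) σ' fun τ =>
      (1 ≤ τ.nat 3 0 ↔ b.Holds σ ρ) ∧ KeepRat (2 * ρ.length) 0 σ' τ := by
  cases b with
  | nz x =>
    refine (x.runs_comp hB ρ 0 σ σ' hr he hb).mono ?_
    rintro τ ⟨h1, k1⟩
    exact ⟨by rw [h1, Holds, Nat.one_le_iff_ne_zero], k1.keepRat 0⟩
  | le x y =>
    refine Runs.seq hB ((x.runs_comp hB ρ 0 σ σ' hr he hb.1).mono ?_)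
    rintro τ ⟨h1, k1⟩
    refine Runs.seq hB ((y.runs_comp hB ρ 1 σ τ (k1.rep hr) (he.of_eq k1.var) hb.2).mono ?_)
    rintro υ ⟨h2, k2⟩
    have k3 := k1.trans k2 le_rfl (by omega)
    have h1' : υ.rat 3 0 = x.eval σ ρ := by rw [k2.tmp 0 (by omega), h1]
    refine Runs.cond hB (fun hb => ?_) (fun hb => ?_) <;>
      simp only [Test.Holds, eval_rcell, h1', h2] at hb <;>
      refine Runs.setNat ⟨?_, k3.trans ((Keep.setTmp _ _ _ _ _ le_rfl).keepRat 0) le_rfl le_rfl⟩ <;>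
      simp [Holds, NatExpr.eval, hb]

end Tst

/-- Statements. -/
inductive S where
  | setN (a : ℕ) (i e : X)
  | setR (a : ℕ) (i : X) (e : RX)
  | seq (s s' : S)
  | ite (b : Tst) (s s' : S)
  | for (N : X) (s : S)
  | while (b : Tst) (s : S)
  | skip

namespace S

/-- The machine program for a statement. -/
def comp : ℕ → S → Program
  | d, setN a i e => .seq (i.comp d 0) <| .seq (e.comp d 1) <| .setNat (natArr a) (tcell 0) (tcell 1)
  | d, setR a i e => .seq (e.comp d 0) <| .seq (i.comp d 0) <| .setRat (ratArr a) (tcell 0) (rcell 0)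
  | d, seq s s' => .seq (s.comp d) (s'.comp d)
  | d, ite b s s' => .seq (b.comp d) <| .cond (.natLe (.lit 1) (tcell 0)) (s.comp d) (s'.comp d)
  | d, .for N s => .seq (N.comp d 0) <| forProg d 0 .skip (s.comp (d + 1))
  | d, .while b s => .seq (b.comp d) <| .loop (.natLe (.lit 1) (tcell 0))
      (.seq (s.comp d) (b.comp d))
  | _, skip => .skip

/-- The natural-number arrays that are assigned to. -/
def nats : S → List ℕ
  | setN a _ _ => [a]
  | setR _ _ _ => []
  | seq s s' => s.nats ++ s'.nats
  | ite _ s s' => s.nats ++ s'.nats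
  | .for _ s => s.nats
  | .while _ s => s.nats
  | skip => []

/-- The rational arrays that are assigned to. -/
def rats : S → List ℕ
  | setN _ _ _ => []
  | setR a _ _ => [a]
  | seq s s' => s.rats ++ s'.rats
  | ite _ s s' => s.rats ++ s'.rats
  | .for _ s => s.rats
  | .while _ s => s.rats
  | skip => []

end S

theorem X.not_writesNat {a : ℕ} (h2 : a ≠ 2) (h3 : a ≠ 3) (e : X) : ∀ d t,
    ¬ (e.comp d t).WritesNat a := by
  induction e <;> intro d t <;>
    simp_all [X.comp, Program.WritesNat, forProg, h2.symm, h3.symm]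

theorem X.not_writesRat {a : ℕ} (e : X) : ∀ d t, ¬ (e.comp d t).WritesRat a := by
  induction e <;> intro d t <;> simp_all [X.comp, Program.WritesRat, forProg]

theorem RX.not_writesNat {a : ℕ} (h2 : a ≠ 2) (h3 : a ≠ 3) (e : RX) : ∀ d r,
    ¬ (e.comp d r).WritesNat a := by
  induction e <;> intro d r <;>
    simp_all [RX.comp, Program.WritesNat, X.not_writesNat, forProg, h2.symm]

theorem RX.not_writesRat {a : ℕ} (h3 : a ≠ 3) (e : RX) : ∀ d r,
    ¬ (e.comp d r).WritesRat a := by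
  induction e <;> intro d r <;>
    simp_all [RX.comp, Program.WritesRat, X.not_writesRat, forProg, h3.symm]

theorem Tst.not_writesNat {a : ℕ} (h2 : a ≠ 2) (h3 : a ≠ 3) (b : Tst) (d : ℕ) :
    ¬ (b.comp d).WritesNat a := by
  cases b <;>
    simp [Tst.comp, Program.WritesNat, X.not_writesNat, RX.not_writesNat, h2, h3, h3.symm]

theorem Tst.not_writesRat {a : ℕ} (h3 : a ≠ 3) (b : Tst) (d : ℕ) :
    ¬ (b.comp d).WritesRat a := by
  cases b <;>
    simp [Tst.comp, Program.WritesRat, X.not_writesRat, RX.not_writesRat, h3]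

theorem S.not_writesNat (s : S) {a : ℕ} : ∀ d, a ∉ s.nats → ¬ (s.comp d).WritesNat (natArr a) := by
  have h2 := natArr_ne_two a
  have h3 := natArr_ne_three a
  induction s <;> intro d ha <;>
    simp_all [S.comp, S.nats, Program.WritesNat, X.not_writesNat, RX.not_writesNat,
      Tst.not_writesNat, forProg, natArr_inj, eq_comm, h2.symm]

theorem S.not_writesRat (s : S) {a : ℕ} : ∀ d, a ∉ s.rats → ¬ (s.comp d).WritesRat (ratArr a) := by
  have h3 := ratArr_ne_three a
  induction s <;> intro d ha <;>
    simp_all [S.comp, S.rats, Program.WritesRat, X.not_writesRat, RX.not_writesRat,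
      Tst.not_writesRat, forProg, ratArr_inj, eq_comm]

/-- Started in memory `σ` with environment `ρ`, the statement `s` terminates within the static
time bound for loop bound `B`, and the final memory satisfies `Q`. -/
def R (B : ℕ) (s : S) (ρ : List ℕ) (σ : State) (Q : State → Prop) : Prop :=
  ∀ σ', Rep σ σ' → EnvRep ρ σ' → Runs B (s.comp ρ.length) σ' fun τ' =>
    (∀ c < 2 * ρ.length, τ'.nat 2 c = σ'.nat 2 c) ∧ ∃ τ, Rep τ τ' ∧ Q τ

section R

variable {B : ℕ} {s s' : S} {ρ : List ℕ} {σ : State} {Q Q' : State → Prop}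

theorem R.mono (h : R B s ρ σ Q) (hQ : ∀ τ, Q τ → Q' τ) : R B s ρ σ Q' := fun σ' hr he =>
  (h σ' hr he).mono fun _ ⟨h1, τ, h2, h3⟩ => ⟨h1, τ, h2, hQ τ h3⟩

/-- Arrays that are not assigned to do not change. -/
theorem R.frame (h : R B s ρ σ Q) :
    R B s ρ σ fun τ => Q τ ∧ (∀ a ∉ s.nats, τ.nat a = σ.nat a) ∧
      ∀ a ∉ s.rats, τ.rat a = σ.rat a := fun σ' hr he => by
  refine ((h σ' hr he).frame).mono ?_
  rintro τ' ⟨⟨h1, τ, h2, h3⟩, hn, hq⟩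
  refine ⟨h1, τ, h2, h3, fun a ha => ?_, fun a ha => ?_⟩
  · rw [← h2.1, ← hr.1, hn _ (s.not_writesNat _ ha)]
  · rw [← h2.2, ← hr.2, hq _ (s.not_writesRat _ ha)]

theorem R.skip (h : Q σ) : R B .skip ρ σ Q := fun _ hr _ =>
  Runs.skip ⟨fun _ _ => rfl, σ, hr, h⟩

theorem R.seq (hB : 1 ≤ B) (h : R B s ρ σ fun τ => R B s' ρ τ Q) : R B (.seq s s') ρ σ Q :=
  fun σ' hr he => Runs.seq hB <| (h σ' hr he).mono fun τ' ⟨h1, _, h2, h3⟩ =>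
    (h3 τ' h2 (he.of_eq h1)).mono fun _ ⟨h4, υ, h5, h6⟩ =>
      ⟨fun c hc => (h4 c hc).trans (h1 c hc), υ, h5, h6⟩

theorem Rep.setNat {σ σ' : State} (h : Rep σ σ') (a e x : ℕ) :
    Rep (σ.setNat a e x) (σ'.setNat (natArr a) e x) := by
  refine ⟨fun b => ?_, fun b => h.2 b⟩
  funext c
  have := h.1 b
  simp [State.setNat, natArr_inj, this]

theorem Rep.setRat {σ σ' : State} (h : Rep σ σ') (a e : ℕ) (x : ℚ) :
    Rep (σ.setRat a e x) (σ'.setRat (ratArr a) e x) := by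
  refine ⟨fun b => h.1 b, fun b => ?_⟩
  funext c
  have := h.2 b
  simp [State.setRat, ratArr_inj, this]

theorem R.setN (hB : 1 ≤ B) {a : ℕ} {i e : X} (hi : i.Bdd B σ ρ) (he : e.Bdd B σ ρ)
    (h : Q (σ.setNat a (i.eval σ ρ) (e.eval σ ρ))) : R B (.setN a i e) ρ σ Q := by
  intro σ' hr hρ
  refine Runs.seq hB ((i.runs_comp hB ρ 0 σ σ' hr hρ hi).mono ?_)
  rintro τ ⟨h1, k1⟩
  refine Runs.seq hB ((e.runs_comp hB ρ 1 σ τ (k1.rep hr) (hρ.of_eq k1.var) he).mono ?_)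
  rintro υ ⟨h2, k2⟩
  have k3 := k1.trans k2 le_rfl (by omega)
  refine Runs.setNat ⟨fun c hc => ?_, _, ?_, h⟩
  · rw [setNat_nat_of_ne _ _ _ (natArr_ne_two a).symm, k3.var c hc]
  · simp only [eval_tcell, k2.tmp 0 (by omega), h1, h2]
    exact (k3.rep hr).setNat _ _ _

/-- The value is computed before the index, because the evaluation of a rational expression may
overwrite natural temporaries, whereas that of an index leaves the rational ones alone. -/
theorem R.setR (hB : 1 ≤ B) {a : ℕ} {i : X} {e : RX} (hi : i.Bdd B σ ρ) (he : e.Bdd B σ ρ)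
    (h : Q (σ.setRat a (i.eval σ ρ) (e.eval σ ρ))) : R B (.setR a i e) ρ σ Q := by
  intro σ' hr hρ
  refine Runs.seq hB ((e.runs_comp hB ρ 0 σ σ' hr hρ he).mono ?_)
  rintro τ ⟨h1, k1⟩
  refine Runs.seq hB ((i.runs_comp hB ρ 0 σ τ (k1.rep hr) (hρ.of_eq k1.var) hi).mono ?_)
  rintro υ ⟨h2, k2⟩
  have k3 := k1.trans (k2.keepRat 0) le_rfl le_rfl
  refine Runs.setRat ⟨fun c hc => ?_, _, ?_, h⟩
  · rw [setRat_nat, k3.var c hc]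
  · simp only [eval_tcell, eval_rcell, k2.rat, h1, h2]
    exact (k3.rep hr).setRat _ _ _

theorem R.ite (hB : 1 ≤ B) {b : Tst} (hb : b.Bdd B σ ρ) (h1 : b.Holds σ ρ → R B s ρ σ Q)
    (h2 : ¬ b.Holds σ ρ → R B s' ρ σ Q) : R B (.ite b s s') ρ σ Q := by
  intro σ' hr hρ
  refine Runs.seq hB ((b.runs_comp hB ρ σ σ' hr hρ hb).mono ?_)
  rintro τ ⟨h, k⟩
  refine Runs.cond hB (fun hb => ?_) (fun hb => ?_) <;>
    simp only [Test.Holds, NatExpr.eval, eval_tcell, h] at hb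
  · refine (h1 hb τ (k.rep hr) (hρ.of_eq k.var)).mono ?_
    rintro υ ⟨h3, h4⟩
    exact ⟨fun c hc => (h3 c hc).trans (k.var c hc), h4⟩
  · refine (h2 hb τ (k.rep hr) (hρ.of_eq k.var)).mono ?_
    rintro υ ⟨h3, h4⟩
    exact ⟨fun c hc => (h3 c hc).trans (k.var c hc), h4⟩

theorem R.for (hB : 1 ≤ B) {N : X} (n : ℕ) (hN : N.Bdd B σ ρ) (hn : N.eval σ ρ = n) (hnB : n ≤ B)
    (I : ℕ → State → Prop) (h0 : I 0 σ)
    (h : ∀ j < n, ∀ τ, I j τ → R B s (ρ ++ [j]) τ (I (j + 1))) (hQ : ∀ τ, I n τ → Q τ) :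
    R B (.for N s) ρ σ Q := by
  intro σ' hr hρ
  refine Runs.seq hB ((N.runs_comp hB ρ 0 σ σ' hr hρ hN).mono ?_)
  rintro τ ⟨h1, k1⟩
  refine (Runs.for hB (h1.trans hn) hnB
    (fun j υ => (∀ c < 2 * ρ.length, υ.nat 2 c = σ'.nat 2 c) ∧ ∃ τ, Rep τ υ ∧ I j τ)
    ?_ ?_).mono ?_
  · have k2 := (k1.trans (Keep.setVar (2 * ρ.length) 0 (2 * ρ.length + 1) n τ (by omega))
      le_rfl le_rfl).trans (Keep.setVar _ _ (2 * ρ.length) 0 _ le_rfl) le_rfl le_rfl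
    refine Runs.skip ⟨⟨k2.var, σ, k2.rep hr, h0⟩, ?_, ?_⟩ <;> simp [State.setNat]
  · rintro j hj υ ⟨hv, υ₀, hυ, hI⟩ h2 h3
    have := h j hj υ₀ hI υ hυ ((hρ.of_eq hv).append h2)
    simp only [List.length_append, List.length_singleton] at this
    refine this.mono ?_
    rintro φ ⟨h4, φ₀, h5, h6⟩
    have k3 := Keep.setVar (2 * ρ.length) 0 (2 * ρ.length) (j + 1) φ le_rfl
    refine ⟨⟨fun c hc => ?_, φ₀, k3.rep h5, h6⟩, ?_, ?_⟩
    · rw [k3.var c hc, h4 c (by omega), hv c hc]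
    · rw [h4 _ (by omega), h2]
    · rw [h4 _ (by omega), h3]
  · rintro υ ⟨hv, υ₀, hυ, hI⟩
    exact ⟨hv, υ₀, hυ, hQ _ hI⟩

/-- The compiled test is run once before the loop and again at the end of every round, so the
invariant on the machine also says that temporary cell 0 holds the current truth value of the test.
-/
theorem R.while (hB : 1 ≤ B) {b : Tst} (I : ℕ → State → Prop) (h0 : I 0 σ)
    (hb : ∀ j τ, I j τ → b.Bdd B τ ρ)
    (h : ∀ j τ, I j τ → b.Holds τ ρ → j < B ∧ R B s ρ τ (I (j + 1)))
    (hQ : ∀ j τ, I j τ → ¬ b.Holds τ ρ → Q τ) : R B (.while b s) ρ σ Q := by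
  intro σ' hr hρ
  refine Runs.seq hB ((b.runs_comp hB ρ σ σ' hr hρ (hb 0 σ h0)).mono ?_)
  rintro τ ⟨h1, k1⟩
  refine (Runs.loop hB (fun j υ => (∀ c < 2 * ρ.length, υ.nat 2 c = σ'.nat 2 c) ∧
    ∃ φ, Rep φ υ ∧ I j φ ∧ (1 ≤ υ.nat 3 0 ↔ b.Holds φ ρ))
    ⟨k1.var, σ, k1.rep hr, h0, h1⟩ ?_).mono ?_
  · rintro j υ ⟨hv, υ₀, hυ, hI, h2⟩ h3
    simp only [Test.Holds, NatExpr.eval, eval_tcell, h2] at h3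
    obtain ⟨hj, hR⟩ := h j υ₀ hI h3
    refine ⟨hj, Runs.seq hB ((hR υ hυ (hρ.of_eq hv)).mono ?_)⟩
    rintro φ ⟨h4, φ₀, h5, h6⟩
    have hv' : ∀ c < 2 * ρ.length, φ.nat 2 c = σ'.nat 2 c := fun c hc =>
      (h4 c hc).trans (hv c hc)
    refine (b.runs_comp hB ρ φ₀ φ h5 (hρ.of_eq hv') (hb _ _ h6)).mono ?_
    rintro ψ ⟨h7, k7⟩
    exact ⟨fun c hc => (k7.var c hc).trans (hv' c hc), φ₀, k7.rep h5, h6, h7⟩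
  · rintro υ ⟨h2, j, hv, υ₀, hυ, hI, h3⟩
    simp only [Test.Holds, NatExpr.eval, eval_tcell, h3] at h2
    exact ⟨hv, υ₀, hυ, hQ j υ₀ hI h2⟩

end R

end RAM

namespace RAM

/-! ### Notation and truth values for expressions -/

instance (c : ℕ) : OfNat X c := ⟨.lit c⟩
instance : Add X := ⟨.add⟩
instance : Sub X := ⟨.sub⟩
instance : Mul X := ⟨.mul⟩
instance : Add RX := ⟨.add⟩
instance : Sub RX := ⟨.sub⟩
instance : Mul RX := ⟨.mul⟩
instance : Div RX := ⟨.div⟩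

open Classical in
/-- The truth value of `p` as a number. -/
noncomputable def ind (p : Prop) : ℕ := if p then 1 else 0

@[simp] theorem ind_eq_zero (p : Prop) : ind p = 0 ↔ ¬ p := by
  unfold ind; split_ifs <;> simp_all

theorem ind_of {p : Prop} (h : p) : ind p = 1 := if_pos h

theorem ind_of_not {p : Prop} (h : ¬ p) : ind p = 0 := if_neg h

namespace X

def lt (x y : X) : X := le (x + 1) y
def eq (x y : X) : X := le x y * le y x
def not (x : X) : X := 1 - x
/-- Some `i < N` satisfies `b`. -/
def ex (N b : X) : X := lt 0 (sum N b)
/-- Every `i < N` satisfies `b`. -/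
def all (N b : X) : X := not (sum N (not b))

variable {σ : State} {ρ : List ℕ} {B : ℕ}

@[simp] theorem eval_ofNat (c : ℕ) :
    (no_index (OfNat.ofNat c) : X).eval σ ρ = (OfNat.ofNat c : ℕ) := rfl
@[simp] theorem eval_lit (c : ℕ) : (lit c).eval σ ρ = c := rfl
@[simp] theorem eval_var (x : ℕ) : (var x).eval σ ρ = ρ.getD x 0 := rfl
@[simp] theorem eval_get (a : ℕ) (i : X) : (get a i).eval σ ρ = σ.nat a (i.eval σ ρ) := rfl
@[simp] theorem eval_add (x y : X) : (x + y).eval σ ρ = x.eval σ ρ + y.eval σ ρ := rfl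
@[simp] theorem eval_sub (x y : X) : (x - y).eval σ ρ = x.eval σ ρ - y.eval σ ρ := rfl
@[simp] theorem eval_mul (x y : X) : (x * y).eval σ ρ = x.eval σ ρ * y.eval σ ρ := rfl
@[simp] theorem eval_le (x y : X) :
    (le x y).eval σ ρ = ind (x.eval σ ρ ≤ y.eval σ ρ) := by
  simp only [ind]; split_ifs <;> simp_all [eval]
@[simp] theorem eval_sum (N b : X) :
    (sum N b).eval σ ρ = ∑ i ∈ Finset.range (N.eval σ ρ), b.eval σ (ρ ++ [i]) := rfl
@[simp] theorem eval_lt (x y : X) :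
    (lt x y).eval σ ρ = ind (x.eval σ ρ < y.eval σ ρ) := eval_le _ _
@[simp] theorem eval_eq (x y : X) :
    (eq x y).eval σ ρ = ind (x.eval σ ρ = y.eval σ ρ) := by
  simp only [eq, eval_mul, eval_le, ind]
  split_ifs <;> omega
@[simp] theorem eval_not (x : X) : (not x).eval σ ρ = ind (x.eval σ ρ = 0) := by
  simp only [not, eval_sub, eval_ofNat, ind]
  split_ifs <;> omega
@[simp] theorem eval_ex (N b : X) : (ex N b).eval σ ρ =
    ind (∃ i < N.eval σ ρ, b.eval σ (ρ ++ [i]) ≠ 0) := by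
  simp only [ex, eval_lt, eval_ofNat, eval_sum, pos_iff_ne_zero, ne_eq, Finset.sum_eq_zero_iff,
    Finset.mem_range, not_forall, exists_prop]
@[simp] theorem eval_all (N b : X) : (all N b).eval σ ρ =
    ind (∀ i < N.eval σ ρ, b.eval σ (ρ ++ [i]) ≠ 0) := by
  simp only [all, eval_not, eval_sum, Finset.sum_eq_zero_iff, Finset.mem_range]
  simp

@[simp] theorem bdd_ofNat (c : ℕ) : (no_index (OfNat.ofNat c) : X).Bdd B σ ρ := trivial
@[simp] theorem bdd_lit (c : ℕ) : (lit c).Bdd B σ ρ := trivial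
@[simp] theorem bdd_var (x : ℕ) : (var x).Bdd B σ ρ ↔ x < ρ.length := Iff.rfl
@[simp] theorem bdd_get (a : ℕ) (i : X) : (get a i).Bdd B σ ρ ↔ i.Bdd B σ ρ := Iff.rfl
@[simp] theorem bdd_add (x y : X) : (x + y).Bdd B σ ρ ↔ x.Bdd B σ ρ ∧ y.Bdd B σ ρ := Iff.rfl
@[simp] theorem bdd_sub (x y : X) : (x - y).Bdd B σ ρ ↔ x.Bdd B σ ρ ∧ y.Bdd B σ ρ := Iff.rfl
@[simp] theorem bdd_mul (x y : X) : (x * y).Bdd B σ ρ ↔ x.Bdd B σ ρ ∧ y.Bdd B σ ρ := Iff.rfl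
@[simp] theorem bdd_le (x y : X) : (le x y).Bdd B σ ρ ↔ x.Bdd B σ ρ ∧ y.Bdd B σ ρ := Iff.rfl
@[simp] theorem bdd_sum (N b : X) : (sum N b).Bdd B σ ρ ↔ N.Bdd B σ ρ ∧ N.eval σ ρ ≤ B ∧
    ∀ i < N.eval σ ρ, b.Bdd B σ (ρ ++ [i]) := Iff.rfl
@[simp] theorem bdd_lt (x y : X) : (lt x y).Bdd B σ ρ ↔ x.Bdd B σ ρ ∧ y.Bdd B σ ρ := by
  simp [lt]
@[simp] theorem bdd_eq (x y : X) : (eq x y).Bdd B σ ρ ↔ x.Bdd B σ ρ ∧ y.Bdd B σ ρ := by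
  simp only [eq, bdd_mul, bdd_le]; tauto
@[simp] theorem bdd_not (x : X) : (not x).Bdd B σ ρ ↔ x.Bdd B σ ρ := by simp [not]
@[simp] theorem bdd_ex (N b : X) : (ex N b).Bdd B σ ρ ↔ N.Bdd B σ ρ ∧ N.eval σ ρ ≤ B ∧
    ∀ i < N.eval σ ρ, b.Bdd B σ (ρ ++ [i]) := by simp [ex]
@[simp] theorem bdd_all (N b : X) : (all N b).Bdd B σ ρ ↔ N.Bdd B σ ρ ∧ N.eval σ ρ ≤ B ∧
    ∀ i < N.eval σ ρ, b.Bdd B σ (ρ ++ [i]) := by simp [all]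

end X

namespace RX

variable {σ : State} {ρ : List ℕ} {B : ℕ}

@[simp] theorem eval_ofNat (x : X) : (ofNat x).eval σ ρ = (x.eval σ ρ : ℚ) := rfl
@[simp] theorem eval_get (a : ℕ) (i : X) : (get a i).eval σ ρ = σ.rat a (i.eval σ ρ) := rfl
@[simp] theorem eval_add (x y : RX) : (x + y).eval σ ρ = x.eval σ ρ + y.eval σ ρ := rfl
@[simp] theorem eval_sub (x y : RX) : (x - y).eval σ ρ = x.eval σ ρ - y.eval σ ρ := rfl
@[simp] theorem eval_mul (x y : RX) : (x * y).eval σ ρ = x.eval σ ρ * y.eval σ ρ := rfl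
@[simp] theorem eval_div (x y : RX) : (x / y).eval σ ρ = x.eval σ ρ / y.eval σ ρ := rfl
@[simp] theorem eval_sum (N : X) (b : RX) :
    (sum N b).eval σ ρ = ∑ i ∈ Finset.range (N.eval σ ρ), b.eval σ (ρ ++ [i]) := rfl
@[simp] theorem bdd_ofNat (x : X) : (ofNat x).Bdd B σ ρ ↔ x.Bdd B σ ρ := Iff.rfl
@[simp] theorem bdd_get (a : ℕ) (i : X) : (get a i).Bdd B σ ρ ↔ i.Bdd B σ ρ := Iff.rfl
@[simp] theorem bdd_add (x y : RX) : (x + y).Bdd B σ ρ ↔ x.Bdd B σ ρ ∧ y.Bdd B σ ρ := Iff.rfl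
@[simp] theorem bdd_sub (x y : RX) : (x - y).Bdd B σ ρ ↔ x.Bdd B σ ρ ∧ y.Bdd B σ ρ := Iff.rfl
@[simp] theorem bdd_mul (x y : RX) : (x * y).Bdd B σ ρ ↔ x.Bdd B σ ρ ∧ y.Bdd B σ ρ := Iff.rfl
@[simp] theorem bdd_div (x y : RX) : (x / y).Bdd B σ ρ ↔ x.Bdd B σ ρ ∧ y.Bdd B σ ρ := Iff.rfl
@[simp] theorem bdd_sum (N : X) (b : RX) : (sum N b).Bdd B σ ρ ↔ N.Bdd B σ ρ ∧ N.eval σ ρ ≤ B ∧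
    ∀ i < N.eval σ ρ, b.Bdd B σ (ρ ++ [i]) := Iff.rfl

end RX

@[simp] theorem Tst.holds_nz (σ : State) (ρ : List ℕ) (x : X) :
    (Tst.nz x).Holds σ ρ ↔ x.eval σ ρ ≠ 0 := Iff.rfl
@[simp] theorem Tst.holds_le (σ : State) (ρ : List ℕ) (x y : RX) :
    (Tst.le x y).Holds σ ρ ↔ x.eval σ ρ ≤ y.eval σ ρ := Iff.rfl
@[simp] theorem Tst.bdd_nz (B : ℕ) (σ : State) (ρ : List ℕ) (x : X) :
    (Tst.nz x).Bdd B σ ρ ↔ x.Bdd B σ ρ := Iff.rfl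
@[simp] theorem Tst.bdd_le (B : ℕ) (σ : State) (ρ : List ℕ) (x y : RX) :
    (Tst.le x y).Bdd B σ ρ ↔ x.Bdd B σ ρ ∧ y.Bdd B σ ρ := Iff.rfl

/-! ### Replacing whole arrays -/

/-- Replace natural-number array `a` by `h`. -/
def State.put (σ : State) (a : ℕ) (h : ℕ → ℕ) : State where
  nat := Function.update σ.nat a h
  rat := σ.rat

/-- Replace rational array `a` by `h`. -/
def State.putR (σ : State) (a : ℕ) (h : ℕ → ℚ) : State where
  nat := σ.nat
  rat := Function.update σ.rat a h

theorem State.setNat_eq_put (σ : State) (a e x : ℕ) :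
    σ.setNat a e x = σ.put a (Function.update (σ.nat a) e x) := by
  unfold setNat put
  congr 1
  funext b c
  by_cases hb : b = a
  · subst hb; simp [Function.update_apply]
  · simp [hb]

theorem State.setRat_eq_putR (σ : State) (a e : ℕ) (x : ℚ) :
    σ.setRat a e x = σ.putR a (Function.update (σ.rat a) e x) := by
  unfold setRat putR
  congr 1
  funext b c
  by_cases hb : b = a
  · subst hb; simp [Function.update_apply]
  · simp [hb]

theorem State.put_nat (σ : State) (a b : ℕ) (h : ℕ → ℕ) :
    (σ.put a h).nat b = if b = a then h else σ.nat b := by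
  simp [State.put, Function.update_apply]

@[simp] theorem State.put_nat_same (σ : State) (a : ℕ) (h : ℕ → ℕ) : (σ.put a h).nat a = h := by
  simp [State.put]

@[simp] theorem State.put_rat (σ : State) (a : ℕ) (h : ℕ → ℕ) : (σ.put a h).rat = σ.rat := rfl

@[simp] theorem State.putR_nat (σ : State) (a : ℕ) (h : ℕ → ℚ) : (σ.putR a h).nat = σ.nat := rfl

@[simp] theorem State.put_put (σ : State) (a : ℕ) (h h' : ℕ → ℕ) :
    (σ.put a h).put a h' = σ.put a h' := by
  simp [State.put]

@[simp] theorem State.putR_putR (σ : State) (a : ℕ) (h h' : ℕ → ℚ) :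
    (σ.putR a h).putR a h' = σ.putR a h' := by
  simp [State.putR]

@[simp] theorem State.put_self (σ : State) (a : ℕ) : σ.put a (σ.nat a) = σ := by
  simp [State.put]

@[simp] theorem State.putR_self (σ : State) (a : ℕ) : σ.putR a (σ.rat a) = σ := by
  simp [State.putR]

open Classical in
/-- The function that is `g` on `Y` and `f` elsewhere. -/
noncomputable def patch {β : Type*} (Y : Set ℕ) (g f : ℕ → β) (c : ℕ) : β :=
  if c ∈ Y then g c else f c

theorem patch_of_mem {β : Type*} {Y : Set ℕ} {g f : ℕ → β} {c : ℕ} (h : c ∈ Y) :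
    patch Y g f c = g c := if_pos h

theorem patch_of_notMem {β : Type*} {Y : Set ℕ} {g f : ℕ → β} {c : ℕ} (h : c ∉ Y) :
    patch Y g f c = f c := if_neg h

theorem patch_patch {β : Type*} (Y Z : Set ℕ) (g f : ℕ → β) :
    patch Z g (patch Y g f) = patch (Y ∪ Z) g f := by
  funext c
  by_cases h1 : c ∈ Z <;> by_cases h2 : c ∈ Y <;> simp [patch, h1, h2]

@[simp] theorem patch_empty {β : Type*} (g f : ℕ → β) : patch ∅ g f = f := by
  funext c; simp [patch]

theorem patch_singleton {β : Type*} (c : ℕ) (g f : ℕ → β) :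
    patch {c} g f = Function.update f c (g c) := by
  funext d
  by_cases h : d = c
  · subst h; simp [patch]
  · simp [patch, h]

/-- The statement replaces the cells in `Y` of array `a` by the values of `g`, and does nothing
else. -/
def Fills (B : ℕ) (s : S) (ρ : List ℕ) (σ : State) (a : ℕ) (Y : Set ℕ) (g : ℕ → ℕ) : Prop :=
  R B s ρ σ (· = σ.put a (patch Y g (σ.nat a)))

/-- The statement replaces the cells in `Y` of rational array `a` by the values of `g`, and does
nothing else. -/
def FillsR (B : ℕ) (s : S) (ρ : List ℕ) (σ : State) (a : ℕ) (Y : Set ℕ) (g : ℕ → ℚ) : Prop :=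
  R B s ρ σ (· = σ.putR a (patch Y g (σ.rat a)))

section Fills

variable {B : ℕ} {s : S} {ρ : List ℕ} {σ : State} {a : ℕ}

theorem Fills.setN (hB : 1 ≤ B) {i e : X} {c : ℕ} {g : ℕ → ℕ} (hi : i.Bdd B σ ρ)
    (he : e.Bdd B σ ρ) (hic : i.eval σ ρ = c) (hec : e.eval σ ρ = g c) :
    Fills B (.setN a i e) ρ σ a {c} g :=
  R.setN hB hi he <| by rw [State.setNat_eq_put, hic, hec, patch_singleton]

theorem FillsR.setR (hB : 1 ≤ B) {i : X} {e : RX} {c : ℕ} {g : ℕ → ℚ} (hi : i.Bdd B σ ρ)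
    (he : e.Bdd B σ ρ) (hic : i.eval σ ρ = c) (hec : e.eval σ ρ = g c) :
    FillsR B (.setR a i e) ρ σ a {c} g :=
  R.setR hB hi he <| by rw [State.setRat_eq_putR, hic, hec, patch_singleton]

/-- All written values come from one function g of the cell, which recovers the loop variables from
the cell number by division with remainder. The memory before each round is then explicit, and
nested loops simply fill nested unions, without a separate invariant for every loop. -/
theorem Fills.for (hB : 1 ≤ B) {N : X} (n : ℕ) (hN : N.Bdd B σ ρ) (hn : N.eval σ ρ = n)
    (hnB : n ≤ B) (Y : ℕ → Set ℕ) (g : ℕ → ℕ)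
    (h : ∀ j < n, Fills B s (ρ ++ [j]) (σ.put a (patch (⋃ i < j, Y i) g (σ.nat a))) a (Y j) g) :
    Fills B (.for N s) ρ σ a (⋃ i < n, Y i) g := by
  refine R.for hB n hN hn hnB (fun j τ => τ = σ.put a (patch (⋃ i < j, Y i) g (σ.nat a)))
    (by simp) ?_ (fun τ h => h)
  rintro j hj τ rfl
  refine (h j hj).mono ?_
  rintro τ rfl
  simp only [State.put_nat_same, State.put_put, patch_patch]
  congr 2
  ext c
  simp only [Set.mem_union, Set.mem_iUnion, Nat.lt_succ_iff_lt_or_eq]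
  grind

theorem FillsR.for (hB : 1 ≤ B) {N : X} (n : ℕ) (hN : N.Bdd B σ ρ) (hn : N.eval σ ρ = n)
    (hnB : n ≤ B) (Y : ℕ → Set ℕ) (g : ℕ → ℚ)
    (h : ∀ j < n, FillsR B s (ρ ++ [j]) (σ.putR a (patch (⋃ i < j, Y i) g (σ.rat a))) a (Y j) g) :
    FillsR B (.for N s) ρ σ a (⋃ i < n, Y i) g := by
  refine R.for hB n hN hn hnB (fun j τ => τ = σ.putR a (patch (⋃ i < j, Y i) g (σ.rat a)))
    (by simp) ?_ (fun τ h => h)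
  rintro j hj τ rfl
  refine (h j hj).mono ?_
  rintro τ rfl
  have h1 : ∀ f, (σ.putR a f).rat a = f := fun f => by simp [State.putR]
  simp only [h1, State.putR_putR, patch_patch]
  congr 2
  ext c
  simp only [Set.mem_union, Set.mem_iUnion, Nat.lt_succ_iff_lt_or_eq]
  grind

end Fills

theorem add_mul_div_of_lt {x y n : ℕ} (h : y < n) : (x * n + y) / n = x := by
  rw [Nat.add_comm, Nat.add_mul_div_right _ _ (by omega), Nat.div_eq_of_lt h, Nat.zero_add]

theorem add_mul_mod_of_lt {x y n : ℕ} (h : y < n) : (x * n + y) % n = y := by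
  rw [Nat.add_comm, Nat.add_mul_mod_self_right, Nat.mod_eq_of_lt h]

end RAM

/-! ### The algorithm

Arrays of natural numbers: `0` holds `n` and `m`, `1` the adjacency matrix, `2` the resolution `k`,
`3` the rounded payoffs, `4` the strategies and `5` their number, `6` and `7` a counter with carry,
`8` the position of each player in the elimination order, `9` the number of players that have one,
`10` the order, `11` the size of the separators, `12` reachability, `14` the removed players,
`15` a pool of partial profiles and `16` its size, `17` and `18` the tables, `19` the bags,
`20` the tree, `21` to `23` the bounds of the current tables, `24` a flag. -/

namespace RAM.Algo

open X

def n : X := get 0 0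
def m : X := get 0 1
def k : X := get 2 0
def adj (i j : X) : X := get 1 (i * n + j)
def pay (i j a b : X) : X := get 3 (((i * n + j) * m + a) * m + b)
def cnt (x a : X) : X := get 4 (x * m + a)
def numStrat : X := get 5 0
def dig (i : X) : X := get 6 i
def carry : X := get 7 0
def pos (v : X) : X := get 8 v
def placed : X := get 9 0
def ord (t : X) : X := get 10 t
def sepSize : X := get 11 0
def mark (r u y : X) : X := get 12 ((r * n + u) * n + y)
def rem (v : X) : X := get 14 v
def wit (r j : X) : X := get 15 (r * n + j)
def top : X := get 16 0
def lo (t : X) : X := get 17 t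
def hi (t : X) : X := get 18 t
def bag (t j : X) : X := get 19 (t * n + j)
def par (t : X) : X := get 20 t
def curLo : X := get 21 0
def curHi : X := get 22 0
def newLo : X := get 23 0
def flag : X := get 24 0

def eps : RX := .get 0 0
def A (i j a b : X) : RX := .get 1 (((i * n + j) * m + a) * m + b)

/-- Compute the resolution: the least `k` with `11 * n ^ 2 ≤ k * ε`. -/
def findRes : S :=
  .seq (.setN 24 0 1) <|
  .while (.nz flag) <|
    .seq (.setN 2 0 (k + 1)) <|
    .ite (.le (.ofNat (11 * (n * n))) (.ofNat k * eps)) (.setN 24 0 0) .skip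

/-- The shifted and scaled payoff. -/
def shifted (i j a b : X) (d : ℕ) : RX :=
  .ofNat (k * adj i j) * (.ofNat 1 + A i j a b - A i j a 0) +
    .ofNat (k * eq i j) * .sum n (.ofNat (adj i (.var d)) * A i (.var d) a 0)

/-- Round the payoffs. -/
def roundPay : S :=
  .for n <| .for n <| .for m <| .for m <|
    let i := var 0; let j := var 1; let a := var 2; let b := var 3
    let c := ((i * n + j) * m + a) * m + b
    .seq (.setN 3 c 0) <|
    .for (2 * k) <| .ite (.le (.ofNat (var 4 + 1)) (shifted i j a b 5)) (.setN 3 c (get 3 c + 1)) .skip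

/-- Increment the counter with `len` digits to base `base`. -/
def inc (len base : X) : S :=
  .seq (.setN 7 0 1) <|
  .for len <|
    .seq (.setN 6 (var 0) (dig (var 0) + carry)) <|
    .ite (.nz (le base (dig (var 0)))) (.seq (.setN 6 (var 0) 0) (.setN 7 0 1)) (.setN 7 0 0)

/-- List all strategies. -/
def strategies : S :=
  .while (.nz (not carry)) <|
    .seq (.ite (.nz (eq (sum m (dig (var 0))) k))
      (.seq (.setN 5 0 (numStrat + 1)) (.for m (.setN 4 (numStrat * m + var 0) (dig (var 0))))) .skip) <|
    inc m (k + 1)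

/-- Mark the players that have a position or occur in the counter. -/
def markRemoved : S :=
  .for n <| .setN 14 (var 0) (lt 0 (pos (var 0) + sum sepSize (eq (dig (var 1)) (var 0))))

/-- Compute which players reach each other avoiding removed players. -/
def reach : S :=
  .seq (.for n <| .for n <| .setN 12 ((0 * n + var 0) * n + var 1) (eq (var 0) (var 1))) <|
  .for n <| .for n <| .for n <|
    let r := var 0; let u := var 1; let y := var 2
    .setN 12 (((r + 1) * n + u) * n + y)
      (lt 0 (mark r u y + not (rem y) * ex n (mark r u (var 3) * adj (var 3) y)))

/-- Some player is new, and all components have a small neighbourhood. -/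
def good : X :=
  ex n (not (pos (var 0)) * rem (var 0)) *
  all n (lt 0 (rem (var 0) +
    lt (sum n (rem (var 1) * ex n (mark n (var 0) (var 2) * adj (var 2) (var 1))))
      (2 * sepSize + 2)))

/-- Give positions to the players in the counter, and reset the counter. -/
def place : S :=
  .for sepSize <|
    .seq (.ite (.nz (not (pos (dig (var 0)))))
      (.seq (.setN 9 0 (placed + 1)) <| .seq (.setN 8 (dig (var 0)) placed) <|
        .setN 10 placed (dig (var 0))) .skip) <|
    .setN 6 (var 0) 0

/-- Compute an elimination order. -/
def elimOrder : S :=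
  .seq (.setN 11 0 1) <|
  .while (.nz (lt placed n)) <|
    .seq markRemoved <| .seq reach <|
    .ite (.nz good) place <|
      .seq (inc sepSize n) (.ite (.nz carry) (.setN 11 0 (sepSize + 1)) .skip)

/-- The partial profiles in which a single player has a strategy. -/
def singles : S :=
  .seq (.for n <| .for numStrat <| .setN 15 ((var 0 * numStrat + var 1) * n + var 0) (var 1 + 1)) <|
  .setN 16 0 (n * numStrat)

/-- The payoff of action `a` of player `s` under the partial profile `r`; `d` variables are in
scope. -/
def value (r s a : X) (d : ℕ) : X :=
  sum n (sum m (pay s (var d) a (var (d + 1)) * cnt (wit r (var d)) (var (d + 1))))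

/-- Player `c` is satisfied under the partial profile `r`. -/
def sat (r c : X) (d : ℕ) : X :=
  all m (le (k * value r c (var d) (d + 1))
    (sum m (cnt (wit r c) (var (d + 1)) * value r c (var (d + 1)) (d + 2)) +
      10 * (n * n) * (k * k)))

/-- Every player after position `t` that has a strategy is satisfied. -/
def satAll (r t : X) (d : ℕ) : X :=
  all n (lt 0 (le (pos (var d)) t + not (wit r (var d)) + sat r (var d) (d + 1)))

/-- The partial profiles agree on the bag of `t`, and so do the payoffs. -/
def equiv (r r' t : X) (d : ℕ) : X :=
  all n (lt 0 (not (bag t (var d)) + eq (wit r (var d)) (wit r' (var d)) *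
    all m (eq (value r (var d) (var (d + 1)) (d + 2)) (value r' (var d) (var (d + 1)) (d + 2)))))

/-- The partial profiles agree where both are defined. -/
def compat (r r' : X) (d : ℕ) : X :=
  all n (lt 0 (not (wit r (var d)) + not (wit r' (var d)) + eq (wit r (var d)) (wit r' (var d))))

/-- Replace the current table by its join with the partial profiles from `l` to `h`. -/
def join (l h t : X) : S :=
  .seq (.setN 23 0 top) <|
  .seq (.for (curHi - curLo) <| .for (h - l) <|
    let r := curLo + var 2; let r' := l + var 3
    .ite (.nz (compat r r' 4))
      (.seq (.for n <| .setN 15 (top * n + var 4)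
          (wit r (var 4) + not (wit r (var 4)) * wit r' (var 4))) <|
        .ite (.nz (satAll top t 4 * not (ex (top - newLo) (equiv (newLo + var 4) top t 5))))
          (.setN 16 0 (top + 1)) .skip)
      .skip) <|
  .seq (.setN 21 0 newLo) (.setN 22 0 top)

/-- Compute the bag at position `t`. -/
def bagPart (t : X) : S :=
  .for n <| .setN 19 (t * n + var 1)
    (lt 0 (eq (pos (var 1)) t + lt (pos (var 1)) t * (adj (ord t) (var 1) +
      ex (n + 1) (lt t (var 2) * eq (par (var 2)) t * bag (var 2) (var 1)))))

/-- Compute the parent of position `t`. -/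
def parPart (t : X) : S :=
  .setN 20 t (sum n (ex n (bag t (var 2) * lt (pos (var 2)) t * lt (var 1) (pos (var 2)))))

/-- Start with the table of the empty profile. -/
def initPart : S :=
  .seq (.setN 21 0 top) <|
  .seq (.for n <| .setN 15 (top * n + var 1) 0) <|
  .seq (.setN 16 0 (top + 1)) <| .setN 22 0 top

/-- Add the players in the bag. -/
def singlePart (t : X) : S :=
  .for n <| .ite (.nz (bag t (var 1)))
    (join (var 1 * numStrat) (var 1 * numStrat + numStrat) t) .skip

/-- Add the tables of the children. -/
def childPart (t : X) : S :=
  .for (n + 1) <| .ite (.nz (lt t (var 1) * eq (par (var 1)) t))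
    (join (lo (var 1)) (hi (var 1)) t) .skip

/-- Compute the bag and the table at position `t`. -/
def table (t : X) : S :=
  .seq (bagPart t) <| .seq (parPart t) <| .seq initPart <| .seq (singlePart t) <|
  .seq (childPart t) <| .seq (.setN 17 t curLo) (.setN 18 t curHi)

/-- Write the output. -/
def output : S :=
  .for n <| .for m <| .setR 2 (var 0 * m + var 1)
    (.ofNat (cnt (wit (lo 0) (var 0)) (var 1)) / .ofNat k)

def main : S :=
  .seq findRes <| .seq roundPay <| .seq strategies <| .seq elimOrder <| .seq singles <|
  .seq (.for (n + 1) (table (n - var 0))) output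

end RAM.Algo

namespace RAM

theorem setNat_nat (σ : State) (a e x b c : ℕ) :
    (σ.setNat a e x).nat b c = if b = a ∧ c = e then x else σ.nat b c := rfl

/-! ### Counting -/

/-- The number with digits `d 0, …, d (L - 1)` to base `q`. -/
def digitVal (q L : ℕ) (d : ℕ → ℕ) : ℕ := ∑ i ∈ Finset.range L, d i * q ^ i

theorem digitVal_succ (q L : ℕ) (d : ℕ → ℕ) :
    digitVal q (L + 1) d = digitVal q L d + d L * q ^ L := Finset.sum_range_succ _ _

theorem digitVal_lt {q L : ℕ} {d : ℕ → ℕ} (h : ∀ i < L, d i < q) : digitVal q L d < q ^ L := by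
  induction L with
  | zero => simp [digitVal]
  | succ L ih =>
    rw [digitVal_succ, pow_succ]
    have h1 := ih fun i hi => h i (by omega)
    have h2 : d L + 1 ≤ q := h L (by omega)
    nlinarith [Nat.mul_le_mul_right (q ^ L) h2]

theorem digitVal_inj {q L : ℕ} {d d' : ℕ → ℕ} (h : ∀ i < L, d i < q) (h' : ∀ i < L, d' i < q)
    (he : digitVal q L d = digitVal q L d') : ∀ i < L, d i = d' i := by
  induction L with
  | zero => intro i hi; omega
  | succ L ih =>
    have h1 := digitVal_lt fun i hi => h i (Nat.lt_succ_of_lt hi)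
    have h2 := digitVal_lt fun i hi => h' i (Nat.lt_succ_of_lt hi)
    rw [digitVal_succ, digitVal_succ] at he
    have hq : 0 < q ^ L := by omega
    have h3 : d L = d' L := by
      have e1 : (digitVal q L d + d L * q ^ L) / q ^ L = d L := by
        rw [Nat.add_mul_div_right _ _ hq, Nat.div_eq_of_lt h1, zero_add]
      have e2 : (digitVal q L d' + d' L * q ^ L) / q ^ L = d' L := by
        rw [Nat.add_mul_div_right _ _ hq, Nat.div_eq_of_lt h2, zero_add]
      rw [← e1, ← e2, he]
    intro i hi
    rcases Nat.lt_succ_iff_lt_or_eq.1 hi with hi | rfl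
    · exact ih (fun i hi => h i (by omega)) (fun i hi => h' i (by omega)) (by rw [h3] at he; omega) i hi
    · exact h3

theorem eq_zero_of_digitVal {q L : ℕ} {d : ℕ → ℕ} (hq : 1 ≤ q) (h : digitVal q L d = 0) :
    ∀ i < L, d i = 0 := by
  intro i hi
  have := (Finset.sum_eq_zero_iff.1 h) i (Finset.mem_range.2 hi)
  simpa [Nat.pos_iff_ne_zero.1 hq] using this

namespace Algo

open X

variable {B : ℕ} {σ : State}

/-- After j digits, the value of the lowest j digits plus the carry times q^j is the old value plus
one. A carry that is left over after all L digits therefore signals an overflow. -/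
theorem R_inc (hB : 1 ≤ B) {len base : X} {L q : ℕ}
    (hlen : ∀ τ : State, (∀ b, b ≠ 6 → b ≠ 7 → τ.nat b = σ.nat b) → ∀ ρ,
      (len.Bdd B τ ρ ∧ len.eval τ ρ = L) ∧ base.Bdd B τ ρ ∧ base.eval τ ρ = q)
    (hLB : L ≤ B) (hq : 1 ≤ q) (hd : ∀ i < L, σ.nat 6 i < q) :
    R B (inc len base) [] σ fun τ =>
      (∀ b, b ≠ 6 → b ≠ 7 → τ.nat b = σ.nat b) ∧ τ.rat = σ.rat ∧
      (∀ i < L, τ.nat 6 i < q) ∧ (∀ i, L ≤ i → τ.nat 6 i = σ.nat 6 i) ∧ τ.nat 7 0 ≤ 1 ∧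
      digitVal q L (τ.nat 6) + τ.nat 7 0 * q ^ L = digitVal q L (σ.nat 6) + 1 := by
  refine R.seq hB (R.setN hB (by simp) (by simp) ?_)
  have h1 : ∀ b, b ≠ 6 → b ≠ 7 → (σ.setNat 7 0 1).nat b = σ.nat b := fun b _ h7 =>
    setNat_nat_of_ne _ _ _ h7
  refine R.for hB L (hlen _ h1 _).1.1 (hlen _ h1 _).1.2 hLB (fun j τ =>
    (∀ b, b ≠ 6 → b ≠ 7 → τ.nat b = σ.nat b) ∧ τ.rat = σ.rat ∧
      (∀ i < j, τ.nat 6 i < q) ∧ (∀ i, j ≤ i → τ.nat 6 i = σ.nat 6 i) ∧ τ.nat 7 0 ≤ 1 ∧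
      digitVal q j (τ.nat 6) + τ.nat 7 0 * q ^ j = digitVal q j (σ.nat 6) + 1) ?_ ?_ ?_
  · refine ⟨h1, rfl, by simp, fun i _ => ?_, ?_, ?_⟩
    · exact congrFun (setNat_nat_of_ne _ _ _ (by norm_num)) i
    · simp
    · simp [digitVal]
  · rintro j hj τ ⟨hf, hr, hlt, hge, hc, hv⟩
    refine R.seq hB (R.setN hB (by simp) (by simp [dig, carry]) ?_)
    simp only [dig, carry, List.nil_append, eval_var, List.getD_cons_zero, eval_get, eval_add,
      eval_ofNat]
    set x := τ.nat 6 j + τ.nat 7 0 with hx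
    have hx' : x = σ.nat 6 j + τ.nat 7 0 := by rw [hx, hge j le_rfl]
    have hxq : x ≤ q := by have := hd j hj; omega
    have hf' : ∀ b, b ≠ 6 → b ≠ 7 → (τ.setNat 6 j x).nat b = σ.nat b := fun b h6 h7 => by
      rw [setNat_nat_of_ne _ _ _ h6, hf b h6 h7]
    -- Both branches replace digit plus carry, x, by a digit y < q and a new carry z with y + z·q =
    -- x; this is all that the invariant needs.
    have key : ∀ (υ : State) (y z : ℕ), (∀ b, b ≠ 6 → b ≠ 7 → υ.nat b = σ.nat b) →
        υ.rat = σ.rat → (∀ i, υ.nat 6 i = if i = j then y else τ.nat 6 i) → υ.nat 7 0 = z →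
        y < q → z ≤ 1 → y + z * q = x →
        (∀ b, b ≠ 6 → b ≠ 7 → υ.nat b = σ.nat b) ∧ υ.rat = σ.rat ∧
        (∀ i < j + 1, υ.nat 6 i < q) ∧ (∀ i, j + 1 ≤ i → υ.nat 6 i = σ.nat 6 i) ∧ υ.nat 7 0 ≤ 1 ∧
        digitVal q (j + 1) (υ.nat 6) + υ.nat 7 0 * q ^ (j + 1) =
          digitVal q (j + 1) (σ.nat 6) + 1 := by
      intro υ y z h1 h2 h3 h4 hy hz hyz
      refine ⟨h1, h2, fun i hi => ?_, fun i hi => ?_, h4 ▸ hz, ?_⟩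
      · rw [h3]
        split_ifs
        · exact hy
        · exact hlt i (by omega)
      · rw [h3, if_neg (by omega), hge i (by omega)]
      · have e1 : digitVal q j (υ.nat 6) = digitVal q j (τ.nat 6) :=
          Finset.sum_congr rfl fun i hi => by
            rw [h3, if_neg (by have := Finset.mem_range.1 hi; omega)]
        rw [digitVal_succ, digitVal_succ, h4, h3, if_pos rfl, e1, pow_succ]
        have : y * q ^ j + z * (q ^ j * q) = σ.nat 6 j * q ^ j + τ.nat 7 0 * q ^ j := by
          rw [← add_mul, ← hx', ← hyz]; ring
        omega
    refine R.ite hB ⟨(hlen _ hf' _).2.1, by simp⟩ (fun hb => ?_) (fun hb => ?_) <;>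
      simp only [Tst.holds_nz, eval_le, (hlen _ hf' _).2.2, eval_get, eval_var,
        List.getD_cons_zero, setNat_nat_same, ne_eq, ind_eq_zero, not_not, not_le] at hb
    · refine R.seq hB (R.setN hB (by simp) (by simp) (R.setN hB (by simp) (by simp) ?_))
      refine key _ 0 1 (fun b h6 h7 => ?_) hr (fun i => ?_) ?_ hq le_rfl (by omega)
      · rw [setNat_nat_of_ne _ _ _ h7, setNat_nat_of_ne _ _ _ h6, hf' b h6 h7]
      · simp only [setNat_nat]; simp; grind
      · simp
    · refine R.setN hB (by simp) (by simp) ?_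
      refine key _ x 0 (fun b h6 h7 => ?_) hr (fun i => ?_) ?_ hb (by omega) (by omega)
      · rw [setNat_nat_of_ne _ _ _ h7, hf' b h6 h7]
      · simp only [setNat_nat]; simp
      · simp
  · exact fun τ h => h

/-- `C` lists (from number `1` to number `K`) exactly the strategies with resolution `k`. -/
structure IsStratTable (m k K : ℕ) (C : ℕ → ℕ) : Prop where
  -- Number 0 stands for a player without a strategy. Because its row is zero, such a player
  -- contributes nothing to any payoff.
  zero : ∀ a < m, C a = 0
  sum_eq : ∀ x, 1 ≤ x → x ≤ K → ∑ a ∈ Finset.range m, C (x * m + a) = k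
  exists_eq : ∀ f : ℕ → ℕ, ∑ a ∈ Finset.range m, f a = k →
    ∃ x, 1 ≤ x ∧ x ≤ K ∧ ∀ a < m, C (x * m + a) = f a

/-- In round j the counter has the value j, an overflow counting as (k+1)^m, and the table contains
all vectors of smaller value with digit sum k. A vector of natural numbers with sum k has entries at
most k, so it is found before the overflow. -/
theorem R_strategies (hB : 1 ≤ B) {m k : ℕ} (hm : σ.nat 0 1 = m) (hk : σ.nat 2 0 = k)
    (hmB : m ≤ B) (hkB : (k + 1) ^ m ≤ B) (h4 : σ.nat 4 = 0) (h5 : σ.nat 5 0 = 0)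
    (h6 : σ.nat 6 = 0) (h7 : σ.nat 7 0 = 0) :
    R B strategies [] σ fun τ => (∀ b, b ≠ 4 → b ≠ 5 → b ≠ 6 → b ≠ 7 → τ.nat b = σ.nat b) ∧
      τ.rat = σ.rat ∧ τ.nat 6 = 0 ∧ τ.nat 5 0 ≤ (k + 1) ^ m ∧
      IsStratTable m k (τ.nat 5 0) (τ.nat 4) := by
  let I : ℕ → State → Prop := fun j τ =>
    ((∀ b, b ≠ 4 → b ≠ 5 → b ≠ 6 → b ≠ 7 → τ.nat b = σ.nat b) ∧ τ.rat = σ.rat) ∧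
    (∀ i < m, τ.nat 6 i < k + 1) ∧ (∀ i, m ≤ i → τ.nat 6 i = 0) ∧ τ.nat 7 0 ≤ 1 ∧
    digitVal (k + 1) m (τ.nat 6) + τ.nat 7 0 * (k + 1) ^ m = j ∧ j ≤ (k + 1) ^ m ∧
    τ.nat 5 0 ≤ j ∧ (∀ a < m, τ.nat 4 a = 0) ∧
    (∀ x, 1 ≤ x → x ≤ τ.nat 5 0 → ∑ a ∈ Finset.range m, τ.nat 4 (x * m + a) = k) ∧
    (∀ f : ℕ → ℕ, (∀ a < m, f a < k + 1) → digitVal (k + 1) m f < j →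
      ∑ a ∈ Finset.range m, f a = k → ∃ x, 1 ≤ x ∧ x ≤ τ.nat 5 0 ∧ ∀ a < m, τ.nat 4 (x * m + a) = f a)
  refine R.while hB I ?_ (fun j τ _ => by simp [carry]) ?_ ?_
  · refine ⟨⟨fun _ _ _ _ _ => rfl, rfl⟩, by simp [h6], by simp [h6], by simp [h7], ?_, Nat.zero_le _,
      by simp [h5], by simp [h4], fun x h1 h2 => by omega, fun f _ h => by omega⟩
    simp [h6, h7, digitVal]
  · rintro j τ ⟨⟨hf, hr⟩, hd, hd0, hc, hv, hj, hK, hz, hs, he⟩ hb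
    simp [carry] at hb
    rw [hb, Nat.zero_mul, add_zero] at hv
    have hvlt := digitVal_lt hd
    have hjlt : j < (k + 1) ^ m := by omega
    refine ⟨hjlt.trans_le hkB, R.seq hB ?_⟩
    have hm' : τ.nat 0 1 = m := by rw [hf 0 (by simp) (by simp) (by simp) (by simp), hm]
    have hk' : τ.nat 2 0 = k := by rw [hf 2 (by simp) (by simp) (by simp) (by simp), hk]
    have next : ∀ υ : State, (∀ b, b ≠ 4 → b ≠ 5 → υ.nat b = τ.nat b) → υ.rat = τ.rat →
        υ.nat 5 0 ≤ j + 1 → (∀ a < m, υ.nat 4 a = 0) →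
        (∀ x, 1 ≤ x → x ≤ υ.nat 5 0 → ∑ a ∈ Finset.range m, υ.nat 4 (x * m + a) = k) →
        (∀ f : ℕ → ℕ, (∀ a < m, f a < k + 1) → digitVal (k + 1) m f < j + 1 →
          ∑ a ∈ Finset.range m, f a = k →
            ∃ x, 1 ≤ x ∧ x ≤ υ.nat 5 0 ∧ ∀ a < m, υ.nat 4 (x * m + a) = f a) →
        R B (inc Algo.m (Algo.k + 1)) [] υ (I (j + 1)) := by
      intro υ g1 g2 g3 g4 g5 g6
      have hm'' : υ.nat 0 1 = m := by rw [g1 0 (by simp) (by simp), hm']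
      have hk'' : υ.nat 2 0 = k := by rw [g1 2 (by simp) (by simp), hk']
      have hd6 : υ.nat 6 = τ.nat 6 := g1 6 (by simp) (by simp)
      refine (R_inc (L := m) (q := k + 1) hB (fun φ hφ ρ => ?_) hmB (by omega) ?_).mono ?_
      · simp [Algo.m, Algo.k, hφ 0 (by simp) (by simp), hφ 2 (by simp) (by simp), hm'', hk'']
      · rw [hd6]; exact hd
      · rintro φ ⟨e1, e2, e3, e4, e5, e6⟩
        have e7 := e1 4 (by simp) (by simp)
        have e8 := e1 5 (by simp) (by simp)
        refine ⟨⟨fun b b4 b5 b6 b7 => ?_, by rw [e2, g2, hr]⟩, e3, fun i hi => ?_, e5, ?_, hjlt, ?_⟩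
        · rw [e1 b b6 b7, g1 b b4 b5, hf b b4 b5 b6 b7]
        · rw [e4 i hi, hd6, hd0 i hi]
        · rw [e6, hd6, hv]
        · rw [e7, e8]; exact ⟨g3, g4, g5, g6⟩
    refine R.ite hB (by simp [dig, Algo.m, Algo.k, hm', hmB]) (fun hb => ?_) (fun hb => ?_) <;>
      simp [dig, Algo.m, Algo.k, hm', hk'] at hb
    · refine R.seq hB (R.setN hB (by simp) (by simp [numStrat]) ?_)
      refine (Fills.for (a := 4) hB m (by simp [Algo.m]) (by simp [Algo.m, setNat_nat, hm']) hmB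
        (fun i => {(τ.nat 5 0 + 1) * m + i})
        (fun c => τ.nat 6 (c % m)) fun i hi => Fills.setN hB ?_ ?_ ?_ ?_).mono ?_
      · simp [numStrat, Algo.m]
      · simp [dig]
      · simp [numStrat, Algo.m, State.put_nat, setNat_nat, hm']
      · simp [dig, State.put_nat, setNat_nat, add_mul_mod_of_lt hi]
      · rintro υ rfl
        set Y : Set ℕ := ⋃ i < m, {(τ.nat 5 0 + 1) * m + i} with hY
        have hnew : ∀ a < m, patch Y (fun c => τ.nat 6 (c % m)) (τ.nat 4)
            ((τ.nat 5 0 + 1) * m + a) = τ.nat 6 a := fun a ha => by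
          rw [patch_of_mem (by simp only [hY, Set.mem_iUnion]; exact ⟨a, ha, rfl⟩)]
          simp [add_mul_mod_of_lt ha]
        have hold : ∀ c, c < (τ.nat 5 0 + 1) * m →
            patch Y (fun c => τ.nat 6 (c % m)) (τ.nat 4) c = τ.nat 4 c := fun c hc => by
          rw [patch_of_notMem]
          simp only [hY, Set.mem_iUnion, Set.mem_singleton_iff, not_exists]
          intro i hi; omega
        have hlt : ∀ x a, x ≤ τ.nat 5 0 → a < m → x * m + a < (τ.nat 5 0 + 1) * m :=
          fun x a hx ha => by
            have := Nat.mul_le_mul_right m (show x + 1 ≤ τ.nat 5 0 + 1 by omega)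
            rw [Nat.add_mul x 1] at this
            omega
        refine next _ (fun b b4 b5 => ?_) rfl ?_ ?_ ?_ ?_
        · simp [State.put_nat, b4, setNat_nat_of_ne _ _ _ b5]
        · simp [State.put_nat, numStrat, hK]
        · intro a ha
          have := hlt 0 a (by omega) ha
          simp only [Nat.zero_mul, zero_add] at this
          simp only [State.put_nat_same]
          rw [setNat_nat_of_ne _ _ _ (by norm_num), hold a this, hz a ha]
        · intro x h1 h2
          simp only [State.put_nat_same]
          simp [State.put_nat, numStrat] at h2
          rw [setNat_nat_of_ne _ _ _ (by norm_num)]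
          rcases Nat.lt_or_ge (τ.nat 5 0) x with h3 | h3
          · obtain rfl : x = τ.nat 5 0 + 1 := by omega
            rw [Finset.sum_congr rfl fun a ha => hnew a (Finset.mem_range.1 ha), hb]
          · rw [Finset.sum_congr rfl fun a ha => hold _ (hlt x a h3 (Finset.mem_range.1 ha)),
              hs x h1 h3]
        · intro f h1 h2 h3
          simp only [State.put_nat_same]
          rw [setNat_nat_of_ne (a := 5) (a' := 4) _ _ _ (by norm_num)]
          by_cases h4 : digitVal (k + 1) m f < j
          · obtain ⟨x, hx1, hx2, hx3⟩ := he f h1 h4 h3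
            refine ⟨x, hx1, ?_, fun a ha => ?_⟩
            · simp [State.put_nat, numStrat]; omega
            · rw [hold _ (hlt x a hx2 ha), hx3 a ha]
          · refine ⟨τ.nat 5 0 + 1, by omega, ?_, fun a ha => ?_⟩
            · simp [State.put_nat, numStrat]
            · rw [hnew a ha]
              exact digitVal_inj hd h1 (by omega) a ha
    · refine R.skip (next τ (fun _ _ _ => rfl) rfl (by omega) hz hs fun f h1 h2 h3 => ?_)
      by_cases h4 : digitVal (k + 1) m f < j
      · exact he f h1 h4 h3
      · exfalso
        have := digitVal_inj hd h1 (by omega)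
        apply hb
        rw [← h3]
        exact Finset.sum_congr rfl fun a ha => this a (Finset.mem_range.1 ha)
  · rintro j τ ⟨⟨hf, hr⟩, hd, hd0, hc, hv, hj, hK, hz, hs, he⟩ hb
    simp [carry] at hb
    have hb : τ.nat 7 0 = 1 := by omega
    rw [hb, one_mul] at hv
    have h0 := eq_zero_of_digitVal (q := k + 1) (L := m) (d := τ.nat 6) (by omega) (by omega)
    refine ⟨hf, hr, ?_, by omega, hz, hs, fun f hfk => ?_⟩
    · funext i
      rcases Nat.lt_or_ge i m with hi | hi
      · exact h0 i hi
      · exact hd0 i hi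
    · have h1 : ∀ a < m, f a < k + 1 := fun a ha => by
        have := Finset.single_le_sum (f := f) (fun _ _ => Nat.zero_le _) (Finset.mem_range.2 ha)
        omega
      have := digitVal_lt h1
      exact he f h1 (by omega) hfk

end Algo

end RAM

/-! ### The resolution of the grid and the rounding of payoffs -/

namespace RAM.Algo

open X

variable {B : ℕ} {σ : State}

/-- The number k₀ only limits the search: as long as the flag is set, j·e < 11n² ≤ k₀·e, hence j <
k₀. The last inequality of the conclusion says that the result is minimal; it is used to compare it
with k₀. -/
theorem R_findRes (hB : 1 ≤ B) {n k₀ : ℕ} {e : ℚ} (hn : σ.nat 0 0 = n) (h2 : σ.nat 2 0 = 0)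
    (he : σ.rat 0 0 = e) (h1n : 1 ≤ n) (he0 : 0 < e) (hk₀ : 11 * (n * n : ℚ) ≤ k₀ * e)
    (hk₀B : k₀ ≤ B) :
    R B findRes [] σ fun τ => (∀ b, b ≠ 2 → b ≠ 24 → τ.nat b = σ.nat b) ∧ τ.rat = σ.rat ∧
      11 * (n * n : ℚ) ≤ τ.nat 2 0 * e ∧ ((τ.nat 2 0 : ℚ) - 1) * e < 11 * (n * n : ℚ) := by
  have h1n' : (1 : ℚ) ≤ n := by exact_mod_cast h1n
  refine R.seq hB (R.setN hB (by simp) (by simp) ?_)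
  refine R.while hB (fun j τ => (∀ b, b ≠ 2 → b ≠ 24 → τ.nat b = σ.nat b) ∧ τ.rat = σ.rat ∧
    τ.nat 2 0 = j ∧ (τ.nat 24 0 ≠ 0 → (j : ℚ) * e < 11 * (n * n : ℚ)) ∧
    (τ.nat 24 0 = 0 → 11 * (n * n : ℚ) ≤ j * e ∧ ((j : ℚ) - 1) * e < 11 * (n * n : ℚ)))
    ?_ (fun j τ _ => by simp [flag]) ?_ ?_
  · refine ⟨fun b _ h24 => setNat_nat_of_ne _ _ _ h24, rfl, ?_, fun _ => ?_, fun h => ?_⟩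
    · simp [setNat_nat, h2]
    · simp; positivity
    · simp at h
  · rintro j τ ⟨hf, hr, hj, h1, h0⟩ hb
    simp [flag] at hb
    have h3 := h1 hb
    have h4 : (j : ℚ) < k₀ := lt_of_mul_lt_mul_right (h3.trans_le hk₀) he0.le
    have h5 : j < k₀ := by exact_mod_cast h4
    refine ⟨h5.trans_le hk₀B, R.seq hB (R.setN hB (by simp) (by simp [k]) ?_)⟩
    have hn' : τ.nat 0 0 = n := by rw [hf 0 (by simp) (by simp), hn]
    have he' : τ.rat 0 0 = e := by rw [hr, he]
    refine R.ite hB (by simp [Algo.n, Algo.k, eps]) (fun hb' => ?_) (fun hb' => ?_) <;>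
      simp [Algo.n, Algo.k, eps, setNat_nat, hn', hj, he'] at hb'
    · refine R.setN hB (by simp) (by simp) ⟨fun b b2 b24 => ?_, hr, ?_, fun h => ?_, fun _ => ?_⟩
      · rw [setNat_nat_of_ne _ _ _ b24, setNat_nat_of_ne _ _ _ b2, hf b b2 b24]
      · simp [setNat_nat, Algo.k, hj]
      · simp at h
      · push_cast
        exact ⟨hb', by simpa using h3⟩
    · refine R.skip ⟨fun b b2 b24 => ?_, hr, ?_, fun h => ?_, fun h => ?_⟩
      · rw [setNat_nat_of_ne _ _ _ b2, hf b b2 b24]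
      · simp [Algo.k, hj]
      · push_cast
        exact hb'
      · simp [setNat_nat] at h
        exact absurd h hb
  · rintro j τ ⟨hf, hr, hj, h1, h0⟩ hb
    simp [flag] at hb
    rw [hj]
    exact ⟨hf, hr, h0 hb⟩

/-- The value of the expression `shifted`. -/
noncomputable def shiftedVal (σ : State) (n m k i j a b : ℕ) : ℚ :=
  (k * σ.nat 1 (i * n + j) : ℕ) * (1 + σ.rat 1 (((i * n + j) * m + a) * m + b) -
    σ.rat 1 (((i * n + j) * m + a) * m + 0)) +
    (k * ind (i = j) : ℕ) * ∑ l ∈ Finset.range n,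
      σ.nat 1 (i * n + l) * σ.rat 1 (((i * n + l) * m + a) * m + 0)

/-- The machine has no rounding operation, so the floor is obtained by counting the j < 2k with j +
1 ≤ v, which is exact because v ≤ 2k. After j rounds the cell contains min j ⌊v⌋₊. -/
theorem fills_floor (hB : 1 ≤ B) {k x c : ℕ} {v : ℚ} {ρ : List ℕ} {cx : X} {r : RX} {g : ℕ → ℕ}
    (hk : σ.nat 2 0 = k) (hkB : 2 * k ≤ B) (hv : v ≤ 2 * k) (hx : ρ.length = x)
    (hc : ∀ h : ℕ → ℕ, ∀ l : List ℕ, cx.Bdd B (σ.put 3 h) (ρ ++ l) ∧ cx.eval (σ.put 3 h) (ρ ++ l) = c)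
    (hr : ∀ h : ℕ → ℕ, ∀ j, r.Bdd B (σ.put 3 h) (ρ ++ [j]) ∧ r.eval (σ.put 3 h) (ρ ++ [j]) = v)
    (hg : g c = ⌊v⌋₊) :
    Fills B (.seq (.setN 3 cx 0) (.for (2 * Algo.k) (.ite (.le (.ofNat (var x + 1)) r)
      (.setN 3 cx (get 3 cx + 1)) .skip))) ρ σ 3 {c} g := by
  have hc0 := hc (σ.nat 3) []
  simp only [State.put_self, List.append_nil] at hc0
  refine R.seq hB (R.setN hB hc0.1 (by simp) ?_)
  rw [hc0.2, State.setNat_eq_put]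
  refine R.for hB (2 * k) (by simp [Algo.k]) (by simp [Algo.k, State.put_nat, hk]) hkB
    (fun j τ => τ = σ.put 3 (Function.update (σ.nat 3) c (min j ⌊v⌋₊))) (by simp) ?_ ?_
  · rintro j hj τ rfl
    have e1 : ((ρ ++ [j])[x]?).getD 0 = j := by simp [← hx]
    have hc1 := hc (Function.update (σ.nat 3) c (min j ⌊v⌋₊)) [j]
    have hr1 := hr (Function.update (σ.nat 3) c (min j ⌊v⌋₊)) j
    have hfl : ((j : ℚ) + 1 ≤ v) ↔ j + 1 ≤ ⌊v⌋₊ := by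
      rw [Nat.le_floor_iff' (by omega)]; push_cast; rfl
    refine R.ite hB ?_ (fun hb => ?_) (fun hb => ?_)
    · simp [hr1.1, hx]
    · simp [hr1.2, e1, hfl] at hb
      refine R.setN hB hc1.1 (by simpa using hc1.1) ?_
      rw [State.setNat_eq_put]
      simp only [hc1.2, eval_add, eval_get, eval_ofNat, State.put_put, State.put_nat_same,
        Function.update_self, Function.update_idem]
      congr 2
      omega
    · simp [hr1.2, e1, hfl] at hb
      refine R.skip ?_
      congr 2
      omega
  · rintro τ rfl
    rw [patch_singleton, hg]
    congr 2
    have : ⌊v⌋₊ ≤ 2 * k := by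
      have := Nat.floor_le_floor hv
      rwa [show (2 * (k : ℚ)) = ((2 * k : ℕ) : ℚ) by push_cast; rfl, Nat.floor_natCast] at this
    omega

theorem R_roundPay (hB : 1 ≤ B) {n m k : ℕ} (hn : σ.nat 0 0 = n) (hm : σ.nat 0 1 = m)
    (hk : σ.nat 2 0 = k) (hnB : n ≤ B) (hmB : m ≤ B) (hkB : 2 * k ≤ B)
    (hv : ∀ i < n, ∀ j < n, ∀ a < m, ∀ b < m, shiftedVal σ n m k i j a b ≤ 2 * k) :
    R B roundPay [] σ fun τ => (∀ b, b ≠ 3 → τ.nat b = σ.nat b) ∧ τ.rat = σ.rat ∧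
      ∀ i < n, ∀ j < n, ∀ a < m, ∀ b < m,
        τ.nat 3 (((i * n + j) * m + a) * m + b) = ⌊shiftedVal σ n m k i j a b⌋₊ := by
  let g : ℕ → ℕ := fun c =>
    ⌊shiftedVal σ n m k (c / m / m / n) (c / m / m % n) (c / m % m) (c % m)⌋₊
  have hg : ∀ i < n, ∀ j < n, ∀ a < m, ∀ b < m, g (((i * n + j) * m + a) * m + b) =
      ⌊shiftedVal σ n m k i j a b⌋₊ := by
    intro i _ j hj a ha b hb
    simp only [g, add_mul_div_of_lt hb, add_mul_div_of_lt ha, add_mul_div_of_lt hj,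
      add_mul_mod_of_lt hb, add_mul_mod_of_lt ha, add_mul_mod_of_lt hj]
  have main : Fills B roundPay [] σ 3 (⋃ i < n, ⋃ j < n, ⋃ a < m, ⋃ b < m,
      {((i * n + j) * m + a) * m + b}) g := by
    refine Fills.for hB n (by simp [Algo.n]) (by simp [Algo.n, hn]) hnB _ _ fun i hi => ?_
    refine Fills.for hB n (by simp [Algo.n]) (by simp [Algo.n, State.put_nat, hn]) hnB _ _
      fun j hj => ?_
    refine Fills.for hB m (by simp [Algo.m]) (by simp [Algo.m, State.put_nat, hm]) hmB _ _
      fun a ha => ?_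
    refine Fills.for hB m (by simp [Algo.m]) (by simp [Algo.m, State.put_nat, hm]) hmB _ _
      fun b hb => ?_
    refine fills_floor hB (k := k) (v := shiftedVal σ n m k i j a b) ?_ hkB
      (hv i hi j hj a ha b hb) (by simp) (fun h l => ?_) (fun h l => ?_) (hg i hi j hj a ha b hb)
    · simp [State.put_nat, hk]
    · simp [Algo.n, Algo.m, State.put_nat, hn, hm]
    · simp [Algo.n, Algo.m, Algo.k, shifted, Algo.adj, Algo.A, State.put_nat, hn, hm, hk, shiftedVal, hnB]
  refine main.mono ?_
  rintro τ rfl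
  refine ⟨fun b hb => by simp [State.put_nat, hb], rfl, fun i hi j hj a ha b hb => ?_⟩
  rw [State.put_nat_same, patch_of_mem, hg i hi j hj a ha b hb]
  simp only [Set.mem_iUnion]
  exact ⟨i, hi, j, hj, a, ha, b, hb, rfl⟩

end RAM.Algo

/-! ### Separators of graphs of bounded treewidth -/

namespace Polymatrix

section Reach

variable {V : Type*} {adj : V → V → Prop} {R R' : Set V} {u v x y : V}

/-- `x` can be reached from `u` without entering `R`. -/
def Reach (adj : V → V → Prop) (R : Set V) : V → V → Prop :=
  Relation.ReflTransGen fun a b => adj a b ∧ b ∉ R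

/-- The neighbours in `R` of the component of `u` in the complement of `R`. -/
def nbrs (adj : V → V → Prop) (R : Set V) (u : V) : Set V :=
  {y | y ∈ R ∧ ∃ x, Reach adj R u x ∧ adj x y}

theorem Reach.mono (hR : R ⊆ R') (h : Reach adj R' u x) : Reach adj R u x := by
  induction h with
  | refl => exact .refl
  | tail _ h ih => exact ih.tail ⟨h.1, fun hb => h.2 (hR hb)⟩

theorem Reach.notMem (h : Reach adj R u x) (hu : u ∉ R) : x ∉ R := by
  induction h with
  | refl => exact hu
  | tail _ h _ => exact h.2

theorem Reach.symm (hs : ∀ x y, adj x y → adj y x) (h : Reach adj R u x) (hu : u ∉ R) : Reach adj R x u := by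
  induction h with
  | refl => exact .refl
  | tail h1 h2 ih => exact .head ⟨hs _ _ h2.1, Reach.notMem h1 hu⟩ ih

theorem nbrs_subset_union (h1 : R ⊆ R') {X : Set V} (h2 : R' ⊆ R ∪ X) :
    nbrs adj R' u ⊆ nbrs adj R u ∪ X := by
  rintro y ⟨hy, x, hx, hxy⟩
  rcases h2 hy with h | h
  · exact Or.inl ⟨h, x, hx.mono h1, hxy⟩
  · exact Or.inr h

/-- A set that is removed from one component does not change the neighbours of the others. -/
theorem nbrs_subset_of_not_reach (hs : ∀ x y, adj x y → adj y x) {X : Set V}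
    (hX : ∀ x ∈ X, Reach adj R u x) (hvR : v ∉ R) (hv : ¬ Reach adj R u v) :
    nbrs adj (R ∪ X) v ⊆ nbrs adj R v := by
  rintro y ⟨hy, x, hx, hxy⟩
  have hx' : Reach adj R v x := hx.mono Set.subset_union_left
  by_cases hyR : y ∈ R
  · exact ⟨hyR, x, hx', hxy⟩
  · exfalso
    have hyX : y ∈ X := hy.resolve_left hyR
    exact hv ((hX y hyX).trans (Reach.symm hs (hx'.tail ⟨hxy, hyR⟩) hvR))

end Reach

section Tree

variable {V ι : Type*} {G : SimpleGraph V} (D : TreeDecomposition G ι) {R : Set V} {u : V}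

/-- If some bag contains the neighbours of a component then so does a bag that meets it. -/
theorem TreeDecomposition.exists_bag_meets {i i₀ : ι} (p : D.T.Walk i i₀) (hp : p.IsPath)
    (hu : u ∈ D.bag i₀) (hi : nbrs G.Adj R u ⊆ D.bag i) :
    ∃ j, nbrs G.Adj R u ⊆ D.bag j ∧ ∃ x, Reach G.Adj R u x ∧ x ∈ D.bag j := by
  induction p with
  | nil => exact ⟨_, hi, u, .refl, hu⟩
  | @cons i i₁ i₀ h p ih =>
    rw [SimpleGraph.Walk.cons_isPath_iff] at hp
    by_cases hx : ∃ x, Reach G.Adj R u x ∧ x ∈ D.bag i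
    · exact ⟨i, hi, hx⟩
    push Not at hx
    refine ih hp.1 hu ?_
    -- Bag i misses the component of u. After the tree edge from i to i₁ is cut, i₀ is on the side
    -- of i₁. The bags containing a given vertex of the component form a subtree avoiding i, and
    -- adjacent vertices share a bag, so all bags that meet the component are on the side of i₁. A
    -- neighbour of the component lies in one of these and in bag i, hence also in bag i₁.
    let T' := D.T.deleteEdges {s(i, i₁)}
    have cross : ∀ l l', T'.Reachable i₁ l → ¬ T'.Reachable i₁ l' → ∀ q : D.T.Walk l l',
        s(i, i₁) ∈ q.edges := by
      intro l l' h1 h2 q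
      by_contra hq
      exact h2 (h1.trans (q.toDeleteEdge _ hq).reachable)
    have hi₁ : ¬ T'.Reachable i₁ i := by
      have := SimpleGraph.isAcyclic_iff_forall_adj_isBridge.1 D.isTree.isAcyclic h
      rw [SimpleGraph.isBridge_iff] at this
      exact fun h => this h.symm
    have hi₀ : T'.Reachable i₁ i₀ :=
      (p.toDeleteEdge s(i, i₁) fun hq => hp.2 (p.fst_mem_support_of_mem_edges hq)).reachable
    have key : ∀ x, Reach G.Adj R u x → ∀ l l', T'.Reachable i₁ l → x ∈ D.bag l → x ∈ D.bag l' →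
        T'.Reachable i₁ l' := by
      intro x hr l l' h1 hl hl'
      by_contra h2
      obtain ⟨q, hq⟩ := (D.isTree.connected.preconnected l l').exists_isPath
      have := cross l l' h1 h2 q
      exact hx x hr (D.path_inter l i l' q hq (q.fst_mem_support_of_mem_edges this) x hl hl')
    have all : ∀ x, Reach G.Adj R u x → ∀ l, x ∈ D.bag l → T'.Reachable i₁ l := by
      intro x hr
      induction hr with
      | refl => exact fun l hl => key u .refl i₀ l hi₀ hu hl
      | @tail x y h1 h2 ih =>
        intro l hl
        obtain ⟨l₀, hl₀, hl₀'⟩ := D.covers_edge x y h2.1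
        exact key y (.tail h1 h2) l₀ l (ih l₀ hl₀) hl₀' hl
    rintro y ⟨hyR, x, hr, hxy⟩
    obtain ⟨l, hl, hl'⟩ := D.covers_edge x y hxy
    obtain ⟨q, hq⟩ := (D.isTree.connected.preconnected l i).exists_isPath
    have := cross l i (all x hr l hl) hi₁ q
    exact D.path_inter l i₁ i q hq (q.snd_mem_support_of_mem_edges this) y hl'
      (hi ⟨hyR, x, hr, hxy⟩)

/-- Some bag is a balanced separator for `W`. -/
theorem TreeDecomposition.exists_balanced [Finite V] (W : Set V) :
    ∃ i, ∀ u, u ∉ D.bag i →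
      2 * (W ∩ {x | Reach G.Adj (D.bag i : Set V) u x}).ncard ≤ W.ncard := by
  classical
  by_contra! hcon
  have hs : ∀ x y, G.Adj x y → G.Adj y x := fun _ _ h => h.symm
  let C : ι × V → Set V := fun p => {x | Reach G.Adj (D.bag p.1 : Set V) p.2 x}
  let P : Set (ι × V) := {p | p.2 ∉ D.bag p.1 ∧ W.ncard < 2 * (W ∩ C p).ncard}
  obtain ⟨i⟩ := D.isTree.connected.nonempty
  obtain ⟨u, hu⟩ := hcon i
  have hne : P.Nonempty := ⟨(i, u), hu⟩
  -- Take a smallest component containing more than half of W, over all bags. Some bag j contains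
  -- its boundary and meets it at x. A heavy component for j shares a vertex of W with it, cannot
  -- leave it through the boundary, and omits x, so it is strictly smaller.
  obtain ⟨⟨i, u⟩, ⟨hu, hW⟩, hmin⟩ :=
    (wellFounded_lt (α := ℕ)).onFun (f := fun p => (C p).ncard) |>.has_min P hne
  obtain ⟨i₀, hi₀⟩ := D.covers u
  obtain ⟨q, hq⟩ := (D.isTree.connected.preconnected i i₀).exists_isPath
  obtain ⟨j, hj, x, hx, hxj⟩ := D.exists_bag_meets (R := D.bag i) q hq hi₀
    fun y hy => by simpa using hy.1
  obtain ⟨u', hu', hW'⟩ := hcon j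
  refine hmin (j, u') ⟨hu', hW'⟩ (Set.ncard_lt_ncard ?_ (Set.toFinite _))
  have hmeet : (W ∩ C (i, u) ∩ (W ∩ C (j, u'))).Nonempty := by
    rw [Set.nonempty_iff_ne_empty]
    intro h0
    have h1 := Set.ncard_union_add_ncard_inter (W ∩ C (i, u)) (W ∩ C (j, u'))
    have h2 : (W ∩ C (i, u) ∪ W ∩ C (j, u')).ncard ≤ W.ncard :=
      Set.ncard_le_ncard (by simp) (Set.toFinite _)
    rw [h0, Set.ncard_empty] at h1
    have hW'' : W.ncard < 2 * (W ∩ C (j, u')).ncard := hW'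
    have hW3 : W.ncard < 2 * (W ∩ C (i, u)).ncard := hW
    omega
  obtain ⟨z, ⟨-, hz⟩, -, hz'⟩ := hmeet
  have hz : Reach G.Adj (D.bag i : Set V) u z := hz
  have hz' : Reach G.Adj (D.bag j : Set V) u' z := hz'
  have hsub : C (j, u') ⊆ C (i, u) := by
    intro y (hy : Reach G.Adj (D.bag j : Set V) u' y)
    have hzy : Reach G.Adj (D.bag j : Set V) z y := (hz'.symm hs (by simpa using hu')).trans hy
    have : ∀ y, Reach G.Adj (D.bag j : Set V) z y → Reach G.Adj (D.bag i : Set V) u y := by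
      intro y h
      induction h with
      | refl => exact hz
      | @tail a b h1 h2 ih =>
        refine ih.tail ⟨h2.1, fun hb => h2.2 ?_⟩
        exact hj ⟨hb, a, ih, h2.1⟩
    exact this y hzy
  refine (Set.ssubset_iff_of_subset hsub).2 ⟨x, hx, fun h => ?_⟩
  exact Reach.notMem (R := (D.bag j : Set V)) h (by simpa using hu') (by simpa using hxj)

/-- If all components of the complement of `R` have few neighbours, then some more vertices can
be removed such that this remains true. -/
theorem TreeDecomposition.exists_extension [Finite V] {L : ℕ} (hL : 1 ≤ L)
    (hbag : ∀ i, (D.bag i).card ≤ L) (hu : u ∉ R)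
    (hR : ∀ v, v ∉ R → (nbrs G.Adj R v).ncard ≤ 2 * L + 1) :
    ∃ X : Set V, X.ncard ≤ L ∧ (∃ x ∈ X, x ∉ R) ∧
      ∀ v, v ∉ R ∪ X → (nbrs G.Adj (R ∪ X) v).ncard ≤ 2 * L + 1 := by
  classical
  have hs : ∀ x y, G.Adj x y → G.Adj y x := fun _ _ h => h.symm
  -- If the component of u has at most 2L neighbours, one more is harmless and u alone is removed.
  -- If it has 2L + 1, a balanced separator of them is removed, but only its part inside the
  -- component, so that the other components gain no neighbours.
  rcases Nat.lt_or_ge (2 * L) (nbrs G.Adj R u).ncard with hlt | hle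
  · obtain ⟨i, hi⟩ := D.exists_balanced (nbrs G.Adj R u)
    set W := nbrs G.Adj R u with hWdef
    set X : Set V := {x | x ∈ D.bag i ∧ Reach G.Adj R u x} with hXdef
    have hXbag : X ⊆ (D.bag i : Set V) := fun x hx => hx.1
    have hbagL : (D.bag i : Set V).ncard ≤ L := by rw [Set.ncard_coe_finset]; exact hbag i
    have hW : W.ncard ≤ 2 * L + 1 := hR u hu
    -- N has at most L elements in the bag. The others belong to W and to a single component outside
    -- the bag, so there are at most half of 2L + 1 of them.
    have bal : ∀ v, v ∉ D.bag i → ∀ N : Set V, N ⊆ W ∪ X →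
        (∀ y ∈ N, y ∉ D.bag i → Reach G.Adj (D.bag i : Set V) v y) → N.ncard ≤ 2 * L := by
      intro v hv N hN hNr
      have h1 : N ⊆ (D.bag i : Set V) ∪ (W ∩ {x | Reach G.Adj (D.bag i : Set V) v x}) := by
        intro y hy
        by_cases hyb : y ∈ D.bag i
        · exact Or.inl hyb
        · exact Or.inr ⟨(hN hy).resolve_right fun h => hyb h.1, hNr y hy hyb⟩
      have h2 := (Set.ncard_le_ncard h1 (Set.toFinite _)).trans (Set.ncard_union_le _ _)
      have h3 := hi v hv
      omega
    refine ⟨X, (Set.ncard_le_ncard hXbag (Set.toFinite _)).trans hbagL, ?_, fun v hv => ?_⟩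
    -- If nothing new is removed, the component of u avoids the bag and is contained in one
    -- component of its complement. Then `bal` applies to W itself and leaves at most 2L neighbours,
    -- contrary to the case at hand.
    · by_contra! hX
      have hdis : ∀ x, Reach G.Adj R u x → x ∉ D.bag i := fun x hx hxb =>
        Reach.notMem hx hu (hX x ⟨hxb, hx⟩)
      have hr : ∀ x, Reach G.Adj R u x → Reach G.Adj (D.bag i : Set V) u x := by
        intro x h
        induction h with
        | refl => exact .refl
        | tail h1 h2 ih => exact ih.tail ⟨h2.1, by simpa using hdis _ (h1.tail h2)⟩
      have := bal u (hdis u .refl) W Set.subset_union_left fun y hy hyb => by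
        obtain ⟨-, x, hx, hxy⟩ := hy
        exact (hr x hx).tail ⟨hxy, by simpa using hyb⟩
      omega
    · have hvR : v ∉ R := fun h => hv (Or.inl h)
      have hvX : v ∉ X := fun h => hv (Or.inr h)
      by_cases huv : Reach G.Adj R u v
      · have hvb : v ∉ D.bag i := fun h => hvX ⟨h, huv⟩
        have hr : ∀ x, Reach G.Adj (R ∪ X) v x → Reach G.Adj (D.bag i : Set V) v x := by
          intro x h
          induction h with
          | refl => exact .refl
          | @tail a b h1 h2 ih =>
            refine ih.tail ⟨h2.1, fun hb => h2.2 (Or.inr ⟨by simpa using hb, ?_⟩)⟩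
            refine huv.trans ((Reach.mono Set.subset_union_left h1).tail ⟨h2.1, fun h => ?_⟩)
            exact h2.2 (Or.inl h)
        refine (bal v hvb _ ?_ ?_).trans (Nat.le_succ _)
        · rintro y ⟨hy, x, hx, hxy⟩
          rcases hy with hy | hy
          · exact Or.inl ⟨hy, x, huv.trans (hx.mono Set.subset_union_left), hxy⟩
          · exact Or.inr hy
        · rintro y ⟨-, x, hx, hxy⟩ hyb
          exact (hr x hx).tail ⟨hxy, by simpa using hyb⟩
      · exact (Set.ncard_le_ncard (nbrs_subset_of_not_reach hs (fun x hx => hx.2) hvR huv)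
          (Set.toFinite _)).trans (hR v hvR)
  · refine ⟨{u}, by simpa using hL, ⟨u, rfl, hu⟩, fun v hv => ?_⟩
    have hvR : v ∉ R := fun h => hv (Or.inl h)
    by_cases huv : Reach G.Adj R u v
    · have h1 : nbrs G.Adj (R ∪ {u}) v ⊆ nbrs G.Adj R u ∪ {u} := by
        refine (nbrs_subset_union Set.subset_union_left subset_rfl).trans ?_
        refine Set.union_subset_union_left _ ?_
        rintro y ⟨hy, x, hx, hxy⟩
        exact ⟨hy, x, huv.trans hx, hxy⟩
      have h2 := (Set.ncard_le_ncard h1 (Set.toFinite _)).trans (Set.ncard_union_le _ _)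
      rw [Set.ncard_singleton] at h2
      omega
    · exact (Set.ncard_le_ncard (nbrs_subset_of_not_reach hs
        (by rintro x rfl; exact .refl) hvR huv) (Set.toFinite _)).trans (hR v hvR)

end Tree

/-! ### Graphs on the natural numbers below `n` -/

/-- The adjacency relation of a graph on `Fin n` as a relation between natural numbers. -/
def adjNat {n : ℕ} (G : SimpleGraph (Fin n)) (i j : ℕ) : Prop :=
  ∃ (hi : i < n) (hj : j < n), G.Adj ⟨i, hi⟩ ⟨j, hj⟩

theorem adjNat_symm {n : ℕ} (G : SimpleGraph (Fin n)) {i j : ℕ} :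
    adjNat G i j → adjNat G j i :=
  fun ⟨hi, hj, h⟩ => ⟨hj, hi, h.symm⟩

theorem reach_adjNat_iff {n : ℕ} (G : SimpleGraph (Fin n)) (R : Set ℕ) (u : Fin n) (x : ℕ) :
    Reach (adjNat G) R u x ↔ ∃ y : Fin n, y = x ∧ Reach G.Adj (Fin.val ⁻¹' R) u y := by
  constructor
  · intro h
    induction h with
    | refl => exact ⟨u, rfl, .refl⟩
    | tail h1 h2 ih =>
      obtain ⟨y, rfl, hy⟩ := ih
      obtain ⟨⟨hi, hj, h3⟩, h4⟩ := h2
      exact ⟨⟨_, hj⟩, rfl, hy.tail ⟨h3, h4⟩⟩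
  · rintro ⟨y, rfl, h⟩
    induction h with
    | refl => exact .refl
    | @tail a b h1 h2 ih => exact ih.tail ⟨⟨a.2, b.2, h2.1⟩, h2.2⟩

theorem ncard_nbrs_adjNat {n : ℕ} (G : SimpleGraph (Fin n)) (R : Set ℕ) (u : Fin n) :
    (nbrs (adjNat G) R u).ncard = (nbrs G.Adj (Fin.val ⁻¹' R) u).ncard := by
  rw [← Set.ncard_image_of_injective _ Fin.val_injective]
  congr 1
  ext y
  constructor
  · rintro ⟨hy, x, hx, hxn, hyn, hxy⟩
    obtain ⟨z, rfl, hz⟩ := (reach_adjNat_iff G R u x).1 hx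
    exact ⟨⟨y, hyn⟩, ⟨hy, z, hz, hxy⟩, rfl⟩
  · rintro ⟨y, ⟨hy, x, hx, hxy⟩, rfl⟩
    exact ⟨hy, x, (reach_adjNat_iff G R u x).2 ⟨x, rfl, hx⟩, x.2, y.2, hxy⟩

theorem treewidth_spec {n : ℕ} (G : SimpleGraph (Fin n)) :
    ∃ (t : ℕ) (D : TreeDecomposition G (Fin t)), ∀ i, (D.bag i).card ≤ treewidth G + 1 := by
  have hne : {w : ℕ | ∃ (t : ℕ) (D : TreeDecomposition G (Fin t)), D.width = w}.Nonempty := by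
    -- A single bag with all vertices is a tree decomposition, so the infimum is attained.
    refine ⟨_, 1, ⟨⊥, ?_, fun _ => Finset.univ, ?_, ?_, ?_⟩, rfl⟩
    · exact ⟨SimpleGraph.Connected.mk fun a b => by rw [Subsingleton.elim a b],
        SimpleGraph.isAcyclic_bot⟩
    all_goals simp
  obtain ⟨t, D, hD⟩ := Nat.sInf_mem hne
  refine ⟨t, D, fun i => ?_⟩
  have h1 : (D.bag i).card ≤ Finset.univ.sup fun i => (D.bag i).card :=
    Finset.le_sup (f := fun i => (D.bag i).card) (Finset.mem_univ i)
  have h2 : (Finset.univ.sup fun i => (D.bag i).card) - 1 = treewidth G := hD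
  omega

/-- The step of the computation of an elimination order succeeds if the separators may be as large
as the bags of a tree decomposition of minimal width. -/
theorem exists_extension_nat {n : ℕ} (G : SimpleGraph (Fin n)) {R : Set ℕ} {u L : ℕ}
    (hL : L = treewidth G + 1) (hun : u < n) (hu : u ∉ R)
    (hR : ∀ v < n, v ∉ R → (nbrs (adjNat G) R v).ncard ≤ 2 * L + 1) :
    ∃ f : ℕ → ℕ, (∀ i < L, f i < n) ∧ (∃ i < L, f i ∉ R) ∧
      ∀ v < n, v ∉ R ∪ {x | ∃ i < L, f i = x} →
        (nbrs (adjNat G) (R ∪ {x | ∃ i < L, f i = x}) v).ncard ≤ 2 * L + 1 := by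
  obtain ⟨t, D, hD⟩ := treewidth_spec G
  obtain ⟨X, hX, ⟨x₀, hx₀, hx₀R⟩, hX'⟩ := D.exists_extension (R := Fin.val ⁻¹' R) (u := ⟨u, hun⟩)
    (L := L) (by omega) (by rw [hL]; exact hD) hu fun v hv => by
      rw [← ncard_nbrs_adjNat]; exact hR v v.2 hv
  -- The program tries tuples of length exactly L; a smaller X is listed with repetitions of x₀.
  obtain ⟨f, hf⟩ : ∃ f : ℕ → Fin n, {x | ∃ i < L, f i = x} = X := by
    have hXf : X.Finite := Set.toFinite X
    let e := hXf.toFinset.equivFin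
    have hc : hXf.toFinset.card ≤ L := by rw [← Set.ncard_eq_toFinset_card X hXf]; exact hX
    refine ⟨fun i => if h : i < hXf.toFinset.card then (e.symm ⟨i, h⟩ : Fin n) else x₀, ?_⟩
    ext x
    constructor
    · rintro ⟨i, hi, rfl⟩
      dsimp only
      split_ifs with h
      · exact hXf.mem_toFinset.1 (e.symm ⟨i, h⟩).2
      · exact hx₀
    · intro hx
      have hx' : x ∈ hXf.toFinset := by simpa using hx
      refine ⟨e ⟨x, hx'⟩, (e ⟨x, hx'⟩).2.trans_le hc, ?_⟩
      simp
  have hset : Fin.val ⁻¹' (R ∪ {x | ∃ i < L, (f i : ℕ) = x}) = Fin.val ⁻¹' R ∪ X := by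
    rw [← hf]
    ext x
    simp [Fin.ext_iff]
  refine ⟨fun i => f i, fun i _ => (f i).2, ?_, fun v hv hvR => ?_⟩
  · rw [← hf] at hx₀
    obtain ⟨i, hi, rfl⟩ := hx₀
    exact ⟨i, hi, hx₀R⟩
  · have := ncard_nbrs_adjNat G (R ∪ {x | ∃ i < L, (f i : ℕ) = x}) ⟨v, hv⟩
    rw [this, hset]
    refine hX' _ ?_
    rw [← hset]
    exact hvR

end Polymatrix

/-! ### Reachability and its computation -/

namespace RAM

theorem ind_mul_ind (p q : Prop) : ind p * ind q = ind (p ∧ q) := by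
  by_cases hp : p <;> by_cases hq : q <;> simp [ind, hp, hq]

theorem ind_congr {p q : Prop} (h : p ↔ q) : ind p = ind q := by rw [propext h]

theorem sum_ind (n : ℕ) (p : ℕ → Prop) :
    ∑ y ∈ Finset.range n, ind (p y) = {y | y < n ∧ p y}.ncard := by
  classical
  have : {y | y < n ∧ p y} = (((Finset.range n).filter p : Finset ℕ) : Set ℕ) := by
    ext y; simp
  rw [this, Set.ncard_coe_finset, Finset.card_filter]
  exact Finset.sum_congr rfl fun y _ => by unfold ind; split_ifs <;> rfl

end RAM

namespace Polymatrix

/-- `x` can be reached from `u` in at most `r` steps without entering `R`. -/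
def ReachIn (adj : ℕ → ℕ → Prop) (R : Set ℕ) (u : ℕ) : ℕ → ℕ → Prop
  | 0, y => u = y
  | r + 1, y => ReachIn adj R u r y ∨ y ∉ R ∧ ∃ x, ReachIn adj R u r x ∧ adj x y

/-- The sets reached in r steps increase with r, stay inside n elements, and remain constant once
two consecutive ones are equal. Hence nothing is gained after step n. -/
theorem reachIn_iff {adj : ℕ → ℕ → Prop} {n : ℕ} (hadj : ∀ i j, adj i j → i < n ∧ j < n)
    (R : Set ℕ) {u : ℕ} (hu : u < n) (y : ℕ) : ReachIn adj R u n y ↔ Reach adj R u y := by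
  constructor
  · generalize n = r
    intro h
    induction r generalizing y with
    | zero => rw [show u = y from h]; exact .refl
    | succ r ih =>
      rcases h with h | ⟨h1, x, h2, h3⟩
      · exact ih y h
      · exact (ih x h2).tail ⟨h3, h1⟩
  · intro h
    have hlt : ∀ r y, ReachIn adj R u r y → y < n := by
      intro r
      induction r with
      | zero => rintro y rfl; exact hu
      | succ r ih =>
        rintro y (h | ⟨h1, x, h2, h3⟩)
        · exact ih y h
        · exact (hadj _ _ h3).2
    have hfin : ∀ r, {y | ReachIn adj R u r y}.Finite := fun r =>
      (Set.finite_lt_nat n).subset fun y hy => hlt r y hy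
    have hsub : ∀ r, {y | ReachIn adj R u r y} ⊆ {y | ReachIn adj R u (r + 1) y} :=
      fun r y hy => Or.inl hy
    have hcard : ({y | y < n} : Set ℕ).ncard ≤ n := by
      rw [show {i | i < n} = ((Finset.range n : Finset ℕ) : Set ℕ) by ext; simp,
        Set.ncard_coe_finset]
      simp
    have hstab := Nat.stabilises_of_monotone (f := fun r => {y | ReachIn adj R u r y}.ncard)
      (b := n) (monotone_nat_of_le_succ fun r => Set.ncard_le_ncard (hsub r) (hfin _))
      (fun r => (Set.ncard_le_ncard (t := {y | y < n}) (fun y hy => hlt r y hy)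
        (Set.finite_lt_nat n)).trans hcard)
      (fun r hr => by
        have h1 := Set.eq_of_subset_of_ncard_le (hsub r) hr.ge (hfin _)
        have h2 : {y | ReachIn adj R u (r + 1) y} = {y | ReachIn adj R u (r + 1 + 1) y} := by
          have h1' : ∀ y, ReachIn adj R u r y ↔ ReachIn adj R u (r + 1) y := fun y =>
            Set.ext_iff.1 h1 y
          ext y
          simp only [Set.mem_ofPred_eq]
          rw [show ReachIn adj R u (r + 1) y ↔ (ReachIn adj R u r y ∨ y ∉ R ∧
            ∃ x, ReachIn adj R u r x ∧ adj x y) from Iff.rfl,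
            show ReachIn adj R u (r + 1 + 1) y ↔ (ReachIn adj R u (r + 1) y ∨ y ∉ R ∧
            ∃ x, ReachIn adj R u (r + 1) x ∧ adj x y) from Iff.rfl]
          simp only [← h1']
        exact congrArg Set.ncard h2)
      (show n ≤ n + 1 by omega)
    have heq := Set.eq_of_subset_of_ncard_le (hsub n) hstab.le (hfin _)
    induction h with
    | refl =>
      clear hstab heq hfin hsub hlt
      induction n with
      | zero => rfl
      | succ n _ =>
        clear * -
        induction n + 1 with
        | zero => rfl
        | succ n ih => exact Or.inl ih
    | tail h1 h2 ih =>
      have : ∀ y, ReachIn adj R u (n + 1) y → ReachIn adj R u n y := fun y hy => by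
        rw [Set.ext_iff] at heq
        exact (heq y).2 hy
      exact this _ (Or.inr ⟨h2.2, _, ih, h2.1⟩)

end Polymatrix

namespace RAM.Algo

open X Polymatrix

variable {B : ℕ} {σ : State}

theorem R_markRemoved (hB : 1 ≤ B) {n L : ℕ} (hn : σ.nat 0 0 = n) (hL : σ.nat 11 0 = L)
    (hnB : n ≤ B) (hLB : L ≤ B) :
    R B markRemoved [] σ fun τ => (∀ b, b ≠ 14 → τ.nat b = σ.nat b) ∧ τ.rat = σ.rat ∧
      ∀ v < n, τ.nat 14 v = ind (σ.nat 8 v ≠ 0 ∨ ∃ i < L, σ.nat 6 i = v) := by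
  refine (Fills.for (a := 14) hB n (by simp [Algo.n]) (by simp [Algo.n, hn]) hnB (fun v => {v})
    (fun v => ind (σ.nat 8 v ≠ 0 ∨ ∃ i < L, σ.nat 6 i = v)) fun v hv => ?_).mono ?_
  · refine Fills.setN hB (by simp) ?_ (by simp) ?_
    · simp [pos, sepSize, dig, State.put_nat, hL, hLB]
    · simp only [pos, sepSize, dig, State.put_nat, eval_lt, eval_ofNat, eval_add, eval_get,
        eval_sum, eval_eq, eval_var, List.nil_append, List.cons_append, List.getD_cons_zero,
        List.getD_cons_succ]
      apply ind_congr
      simp [Nat.pos_iff_ne_zero, ← hL]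
  · rintro τ rfl
    refine ⟨fun b hb => by simp [State.put_nat, hb], rfl, fun v hv => ?_⟩
    rw [State.put_nat_same, patch_of_mem]
    simpa using hv

/-- Every round of the search is stored in its own layer of the array, so writing layer r + 1 does
not disturb layer r. Layer n is the reachability relation by `reachIn_iff`. -/
theorem R_reach (hB : 1 ≤ B) {n : ℕ} {R' : Set ℕ} {adj : ℕ → ℕ → Prop} (hn : σ.nat 0 0 = n)
    (hnB : n ≤ B) (hadj : ∀ i < n, ∀ j < n, σ.nat 1 (i * n + j) ≠ 0 ↔ adj i j)
    (hlt : ∀ i j, adj i j → i < n ∧ j < n) (hrem : ∀ v < n, σ.nat 14 v = ind (v ∈ R')) :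
    R B reach [] σ fun τ => (∀ b, b ≠ 12 → τ.nat b = σ.nat b) ∧ τ.rat = σ.rat ∧
      ∀ u < n, ∀ y < n, τ.nat 12 ((n * n + u) * n + y) = ind (Reach adj R' u y) := by
  have hcell : ∀ r u y, u < n → y < n → ((r * n + u) * n + y) % n = y ∧
      ((r * n + u) * n + y) / n % n = u ∧ ((r * n + u) * n + y) / n / n = r := by
    intro r u y hu hy
    rw [add_mul_mod_of_lt hy, add_mul_div_of_lt hy, add_mul_mod_of_lt hu, add_mul_div_of_lt hu]
    exact ⟨rfl, rfl, rfl⟩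
  have hmem : ∀ r u y, u < n → y < n → (r * n + u) * n + y ∈
      ⋃ u < n, ⋃ y < n, ({(r * n + u) * n + y} : Set ℕ) := by
    intro r u y hu hy
    simp only [Set.mem_iUnion]
    exact ⟨u, hu, y, hy, rfl⟩
  let I : ℕ → State → Prop := fun r τ =>
    ((∀ b, b ≠ 12 → τ.nat b = σ.nat b) ∧ τ.rat = σ.rat) ∧
      ∀ u < n, ∀ y < n, τ.nat 12 ((r * n + u) * n + y) = ind (ReachIn adj R' u r y)
  refine R.seq hB ((Fills.for (a := 12) hB n (by simp [Algo.n]) (by simp [Algo.n, hn]) hnB _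
    (fun c => ind (c / n % n = c % n)) fun u hu => Fills.for hB n (by simp [Algo.n])
      (by simp [Algo.n, State.put_nat, hn]) hnB (fun y => {(0 * n + u) * n + y}) _
      fun y hy => Fills.setN hB ?_ ?_ ?_ ?_).mono ?_)
  · simp [Algo.n]
  · simp
  · simp [Algo.n, State.put_nat, hn]
  · obtain ⟨h1, h2, -⟩ := hcell 0 u y hu hy
    simp only [h1, h2]; simp
  rintro τ rfl
  refine R.for hB n (by simp [Algo.n]) (by simp [Algo.n, State.put_nat, hn]) hnB I ?_ ?_ ?_
  · refine ⟨⟨fun b hb => by simp [State.put_nat, hb], rfl⟩, fun u hu y hy => ?_⟩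
    obtain ⟨h1, h2, -⟩ := hcell 0 u y hu hy
    rw [State.put_nat_same, patch_of_mem (hmem 0 u y hu hy), h1, h2]
    rfl
  · rintro r hr τ ⟨⟨hf, hrat⟩, hI⟩
    have hn' : τ.nat 0 0 = n := by rw [hf 0 (by simp), hn]
    refine (Fills.for hB n (by simp [Algo.n]) (by simp [Algo.n, hn']) hnB _
      (fun c => ind (ReachIn adj R' (c / n % n) (r + 1) (c % n))) fun u hu =>
        Fills.for hB n (by simp [Algo.n])
        (by simp [Algo.n, State.put_nat, hn']) hnB (fun y => {((r + 1) * n + u) * n + y}) _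
        fun y hy => Fills.setN hB ?_ ?_ ?_ ?_).mono ?_
    · simp [Algo.n]
    · simp [Algo.n, mark, rem, Algo.adj, State.put_nat, hn', hnB]
    · simp [Algo.n, State.put_nat, hn']
    · obtain ⟨h1, h2, -⟩ := hcell (r + 1) u y hu hy
      have hold : ∀ (P Q : ℕ → ℕ → Prop) (x : ℕ), x < n →
          patch (⋃ i, ⋃ (_ : i < y), {((r + 1) * n + u) * n + i})
            (fun c => ind (ReachIn adj R' (c / n % n) (r + 1) (c % n)))
            (patch (⋃ i, ⋃ (_ : i < u), ⋃ i_1, ⋃ (_ : i_1 < n), {((r + 1) * n + i) * n + i_1})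
              (fun c => ind (ReachIn adj R' (c / n % n) (r + 1) (c % n))) (τ.nat 12))
            ((r * n + u) * n + x) = ind (ReachIn adj R' u r x) := by
        intro P Q x hx
        have hne : ∀ u' y', u' < n → y' < n → (r * n + u) * n + x ≠ ((r + 1) * n + u') * n + y' := by
          intro u' y' hu' hy' h
          have h3 := (hcell r u x hu hx).2.2
          rw [h, (hcell (r + 1) u' y' hu' hy').2.2] at h3
          omega
        rw [patch_of_notMem, patch_of_notMem, hI u hu x hx]
        · simp only [Set.mem_iUnion, Set.mem_singleton_iff, not_exists]
          exact fun i hi j hj => hne i j (by omega) hj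
        · simp only [Set.mem_iUnion, Set.mem_singleton_iff, not_exists]
          exact fun i hi => hne u i hu (by omega)
      have hrem' : τ.nat 14 y = ind (y ∈ R') := by rw [hf 14 (by simp), hrem y hy]
      simp only [h1, h2]
      simp only [Algo.n, mark, rem, Algo.adj, State.put_nat, eval_lt, eval_ofNat, eval_add,
        eval_mul, eval_not, eval_ex, eval_get, eval_var, List.nil_append, List.cons_append,
        List.getD_cons_zero, List.getD_cons_succ, if_true]
      apply ind_congr
      have hold' := hold (fun _ _ => True) (fun _ _ => True)
      simp only [Nat.reduceEqDiff, ↓reduceIte, hn'] at *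
      rw [hold' y hy, hrem', Nat.pos_iff_ne_zero, ne_eq, Nat.add_eq_zero_iff, not_and_or]
      refine or_congr (by simp) ?_
      simp only [Nat.mul_eq_zero, not_or, ind_eq_zero, not_not, Nat.mul_ne_zero_iff]
      refine and_congr Iff.rfl ⟨?_, ?_⟩
      · rintro ⟨x, hx, h3⟩
        rw [hold' x hx] at h3
        refine ⟨x, by simpa using h3.1, ?_⟩
        rw [← hadj x hx y hy, ← hf 1 (by simp)]
        exact h3.2
      · rintro ⟨x, hx, h3⟩
        have hxn := (hlt x y h3).1
        refine ⟨x, hxn, ?_⟩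
        rw [hold' x hxn]
        refine ⟨by simpa using hx, ?_⟩
        have := (hadj x hxn y hy).2 h3
        rw [← hf 1 (by simp)] at this
        exact this
    · rintro υ rfl
      refine ⟨⟨fun b hb => ?_, ?_⟩, fun u hu y hy => ?_⟩
      · simp [State.put_nat, hb, hf b hb]
      · simp [hrat]
      · obtain ⟨h1, h2, -⟩ := hcell (r + 1) u y hu hy
        rw [State.put_nat_same, patch_of_mem (hmem (r + 1) u y hu hy), h1, h2]
  · rintro τ ⟨⟨hf, hr⟩, hI⟩
    refine ⟨hf, hr, fun u hu y hy => ?_⟩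
    rw [hI u hu y hy]
    exact ind_congr (reachIn_iff hlt R' hu y)

end RAM.Algo

/-! ### Elimination orders and their computation -/

namespace Polymatrix

/-- `pos` numbers some of the players below `n` by `1, …, c`, with inverse `ord`, and every
component that is left when the players before `v` are removed, and that contains `v`, has at
most `D` neighbours. -/
structure Placed (adj : ℕ → ℕ → Prop) (n D : ℕ) (pos ord : ℕ → ℕ) (c : ℕ) : Prop where
  le : ∀ v, pos v ≤ c
  lt_of_ne : ∀ v, pos v ≠ 0 → v < n
  ord_pos : ∀ v, pos v ≠ 0 → ord (pos v) = v
  pos_ord : ∀ t, 1 ≤ t → t ≤ c → pos (ord t) = t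
  ncard_le : ∀ v, pos v ≠ 0 → (nbrs adj {x | pos x ≠ 0 ∧ pos x < pos v} v).ncard ≤ D

namespace Placed

variable {adj : ℕ → ℕ → Prop} {n D c : ℕ} {pos ord : ℕ → ℕ}

theorem ord_lt (h : Placed adj n D pos ord c) {t : ℕ} (h1 : 1 ≤ t) (h2 : t ≤ c) : ord t < n :=
  h.lt_of_ne _ (by rw [h.pos_ord t h1 h2]; omega)

/-- A player that is placed last precedes nobody, so the sets of predecessors of the others do not
change, and only his own component needs a bound. -/
theorem insert (h : Placed adj n D pos ord c) {v : ℕ} (hv : v < n) (h0 : pos v = 0)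
    (hD : (nbrs adj {x | pos x ≠ 0} v).ncard ≤ D) :
    Placed adj n D (Function.update pos v (c + 1)) (Function.update ord (c + 1) v) (c + 1) where
  le x := by
    by_cases hx : x = v
    · simp [hx]
    · simpa [hx] using (h.le x).trans (by omega)
  lt_of_ne x hx := by
    by_cases hxv : x = v
    · rwa [hxv]
    · exact h.lt_of_ne x (by simpa [hxv] using hx)
  ord_pos x hx := by
    by_cases hxv : x = v
    · simp [hxv]
    · rw [Function.update_of_ne hxv] at hx ⊢
      have := h.le x
      rw [Function.update_of_ne (by omega), h.ord_pos x hx]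
  pos_ord t h1 h2 := by
    rcases Nat.lt_or_ge c t with ht | ht
    · obtain rfl : t = c + 1 := by omega
      simp
    · have h3 := h.pos_ord t h1 ht
      rw [Function.update_of_ne (show t ≠ c + 1 by omega), Function.update_of_ne, h3]
      rintro h4
      rw [h4, h0] at h3
      omega
  ncard_le x hx := by
    by_cases hxv : x = v
    · subst hxv
      refine le_of_eq_of_le ?_ hD
      congr 2
      ext y
      by_cases hy : y = x
      · simp [hy, h0]
      · have := h.le y
        simp [hy]
        omega
    · rw [Function.update_of_ne hxv] at hx
      refine le_of_eq_of_le ?_ (h.ncard_le x hx)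
      congr 2
      ext y
      by_cases hy : y = v
      · have := h.le x
        simp [hxv, hy, h0]
        omega
      · simp [hxv, hy]

theorem image_ord (h : Placed adj n D pos ord c) :
    (Finset.Icc 1 c).image ord ⊆ Finset.range n ∧ ((Finset.Icc 1 c).image ord).card = c := by
  constructor
  · intro x hx
    obtain ⟨t, ht, rfl⟩ := Finset.mem_image.1 hx
    rw [Finset.mem_Icc] at ht
    exact Finset.mem_range.2 (h.ord_lt ht.1 ht.2)
  · rw [Finset.card_image_of_injOn, Nat.card_Icc, Nat.add_sub_cancel]
    intro t ht t' ht' he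
    simp only [Finset.coe_Icc, Set.mem_Icc] at ht ht'
    rw [← h.pos_ord t ht.1 ht.2, ← h.pos_ord t' ht'.1 ht'.2, he]

theorem le_card (h : Placed adj n D pos ord c) : c ≤ n := by
  have := Finset.card_le_card h.image_ord.1
  rwa [h.image_ord.2, Finset.card_range] at this

/-- The n positions are occupied by n distinct players below n, which leaves nobody without a
position. -/
theorem pos_ne_zero (h : Placed adj n D pos ord n) {v : ℕ} (hv : v < n) : pos v ≠ 0 := by
  have h1 := Finset.eq_of_subset_of_card_le h.image_ord.1 (by rw [h.image_ord.2]; simp)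
  have h2 := Finset.mem_range.2 hv
  rw [← h1] at h2
  obtain ⟨t, ht, rfl⟩ := Finset.mem_image.1 h2
  rw [Finset.mem_Icc] at ht
  rw [h.pos_ord t ht.1 ht.2]
  omega

end Placed

theorem ncard_image_le (f : ℕ → ℕ) (j : ℕ) :
    {x | ∃ i < j, f i = x}.Finite ∧ {x | ∃ i < j, f i = x}.ncard ≤ j := by
  have h : {x | ∃ i < j, f i = x} = (((Finset.range j).image f : Finset ℕ) : Set ℕ) := by
    ext x; simp
  rw [h, Set.ncard_coe_finset]
  exact ⟨Finset.finite_toSet _, Finset.card_image_le.trans (by simp)⟩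

end Polymatrix

namespace RAM.Algo

open X Polymatrix

variable {B : ℕ} {σ : State}

theorem bdd_good {n : ℕ} (hn : σ.nat 0 0 = n) (hnB : n ≤ B) : good.Bdd B σ [] := by
  simp [good, Algo.n, pos, rem, mark, Algo.adj, sepSize, hn, hnB]

theorem eval_good {n L : ℕ} {R' : Set ℕ} {adj : ℕ → ℕ → Prop} (hn : σ.nat 0 0 = n)
    (hL : σ.nat 11 0 = L) (hadj : ∀ i < n, ∀ j < n, σ.nat 1 (i * n + j) ≠ 0 ↔ adj i j)
    (hlt : ∀ i j, adj i j → i < n ∧ j < n) (hrem : ∀ v < n, σ.nat 14 v = ind (v ∈ R'))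
    (hmark : ∀ u < n, ∀ y < n, σ.nat 12 ((n * n + u) * n + y) = ind (Reach adj R' u y)) :
    good.eval σ [] ≠ 0 ↔ (∃ v < n, σ.nat 8 v = 0 ∧ v ∈ R') ∧
      ∀ u < n, u ∉ R' → (nbrs adj R' u).ncard ≤ 2 * L + 1 := by
  have h1 : ∀ u < n, ∑ y ∈ Finset.range n, σ.nat 14 y *
      ind (∃ x < n, σ.nat 12 ((n * n + u) * n + x) ≠ 0 ∧ σ.nat 1 (x * n + y) ≠ 0) =
      (nbrs adj R' u).ncard := by
    intro u hu
    have h2 : nbrs adj R' u = {y | y < n ∧ y ∈ R' ∧ ∃ x, Reach adj R' u x ∧ adj x y} := by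
      ext y
      exact ⟨fun ⟨h1, x, h2, h3⟩ => ⟨(hlt x y h3).2, h1, x, h2, h3⟩, fun h => h.2⟩
    rw [h2, ← sum_ind]
    refine Finset.sum_congr rfl fun y hy => ?_
    have hy := Finset.mem_range.1 hy
    rw [hrem y hy, ind_mul_ind]
    refine ind_congr (and_congr Iff.rfl ⟨?_, ?_⟩)
    · rintro ⟨x, hx, h⟩
      rw [hmark u hu x hx, hadj x hx y hy] at h
      exact ⟨x, by simpa using h.1, h.2⟩
    · rintro ⟨x, h, h'⟩
      have hx := (hlt x y h').1
      refine ⟨x, hx, ?_⟩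
      rw [hmark u hu x hx, hadj x hx y hy]
      exact ⟨by simpa using h, h'⟩
  simp only [good, Algo.n, pos, rem, mark, Algo.adj, sepSize, eval_mul, eval_ex, eval_all, eval_lt,
    eval_get, eval_var, eval_not, eval_ofNat, eval_add, eval_sum, List.nil_append, List.cons_append,
    List.getD_cons_zero, List.getD_cons_succ, hn, hL, Nat.mul_ne_zero_iff]
  refine and_congr ?_ ?_
  · rw [ne_eq, ind_eq_zero, not_not]
    refine exists_congr fun v => and_congr_right fun hv => and_congr ?_ ?_
    · simp
    · rw [hrem v hv]; simp
  · rw [ne_eq, ind_eq_zero, not_not]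
    refine forall_congr' fun u => forall_congr' fun hu => ?_
    rw [h1 u hu, hrem u hu, ne_eq, ind_eq_zero, not_not, Nat.pos_iff_ne_zero, ne_eq,
      Nat.add_eq_zero_iff, not_and_or]
    simp only [ind_eq_zero, not_not]
    constructor
    · rintro (h | h) h'
      · exact absurd h h'
      · omega
    · intro h
      by_cases h' : u ∈ R'
      · exact Or.inl h'
      · have := h h'
        exact Or.inr (by omega)

theorem R_place (hB : 1 ≤ B) {n L D : ℕ} {adj : ℕ → ℕ → Prop}
    (hL : σ.nat 11 0 = L) (hLB : L ≤ B) (hd : ∀ i < L, σ.nat 6 i < n)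
    (hP : Placed adj n D (σ.nat 8) (σ.nat 10) (σ.nat 9 0)) (hD : 3 * L + 1 ≤ D)
    (hfin : ∀ R v, (nbrs adj R v).Finite)
    (hcomp : ∀ v < n, σ.nat 8 v = 0 → (nbrs adj {x | σ.nat 8 x ≠ 0} v).ncard ≤ 2 * L + 1) :
    R B place [] σ fun τ => τ.nat 0 = σ.nat 0 ∧ τ.nat 1 = σ.nat 1 ∧ τ.nat 11 = σ.nat 11 ∧
      (∀ i, τ.nat 6 i = if i < L then 0 else σ.nat 6 i) ∧
      Placed adj n D (τ.nat 8) (τ.nat 10) (τ.nat 9 0) ∧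
      (∀ x, τ.nat 8 x ≠ 0 ↔ σ.nat 8 x ≠ 0 ∨ ∃ i < L, σ.nat 6 i = x) ∧
      σ.nat 9 0 + ind (∃ i < L, σ.nat 8 (σ.nat 6 i) = 0) ≤ τ.nat 9 0 := by
  refine R.for hB L (by simp [sepSize]) (by simp [sepSize, hL]) hLB (fun j τ =>
    τ.nat 0 = σ.nat 0 ∧ τ.nat 1 = σ.nat 1 ∧ τ.nat 11 = σ.nat 11 ∧
      (∀ i, τ.nat 6 i = if i < j then 0 else σ.nat 6 i) ∧
      Placed adj n D (τ.nat 8) (τ.nat 10) (τ.nat 9 0) ∧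
      (∀ x, τ.nat 8 x ≠ 0 ↔ σ.nat 8 x ≠ 0 ∨ ∃ i < j, σ.nat 6 i = x) ∧
      σ.nat 9 0 + ind (∃ i < j, σ.nat 8 (σ.nat 6 i) = 0) ≤ τ.nat 9 0) ?_ ?_ (fun τ h => h)
  · simp [hP, ind_of_not]
  rintro j hj τ ⟨t0, t1, t11, t6, tP, t8, t9⟩
  have hdj : τ.nat 6 j = σ.nat 6 j := by simp [t6]
  have hex : ∀ p : ℕ → Prop, (∃ i < j + 1, p i) ↔ (∃ i < j, p i) ∨ p j := by
    intro p
    simp only [Nat.lt_succ_iff_lt_or_eq]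
    grind
  refine R.seq hB ?_
  have next : ∀ υ : State, υ.nat 0 = σ.nat 0 → υ.nat 1 = σ.nat 1 → υ.nat 11 = σ.nat 11 →
      υ.nat 6 = τ.nat 6 → Placed adj n D (υ.nat 8) (υ.nat 10) (υ.nat 9 0) →
      (∀ x, υ.nat 8 x ≠ 0 ↔ σ.nat 8 x ≠ 0 ∨ ∃ i < j + 1, σ.nat 6 i = x) →
      σ.nat 9 0 + ind (∃ i < j + 1, σ.nat 8 (σ.nat 6 i) = 0) ≤ υ.nat 9 0 →
      R B (.setN 6 (var 0) 0) ([] ++ [j]) υ fun τ =>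
        τ.nat 0 = σ.nat 0 ∧ τ.nat 1 = σ.nat 1 ∧ τ.nat 11 = σ.nat 11 ∧
        (∀ i, τ.nat 6 i = if i < j + 1 then 0 else σ.nat 6 i) ∧
        Placed adj n D (τ.nat 8) (τ.nat 10) (τ.nat 9 0) ∧
        (∀ x, τ.nat 8 x ≠ 0 ↔ σ.nat 8 x ≠ 0 ∨ ∃ i < j + 1, σ.nat 6 i = x) ∧
        σ.nat 9 0 + ind (∃ i < j + 1, σ.nat 8 (σ.nat 6 i) = 0) ≤ τ.nat 9 0 := by
    intro υ u0 u1 u11 u6 uP u8 u9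
    refine R.setN hB (by simp) (by simp) ?_
    have hf : ∀ b, b ≠ 6 → (υ.setNat 6 ((var 0).eval υ ([] ++ [j]))
        ((0 : X).eval υ ([] ++ [j]))).nat b = υ.nat b := fun b hb => setNat_nat_of_ne _ _ _ hb
    rw [hf 0 (by simp), hf 1 (by simp), hf 11 (by simp), hf 8 (by simp), hf 10 (by simp),
      hf 9 (by simp)]
    refine ⟨u0, u1, u11, fun i => ?_, uP, u8, u9⟩
    simp only [setNat_nat, u6, t6]
    simp
    grind
  refine R.ite hB (by simp [pos, dig]) (fun hb => ?_) (fun hb => ?_) <;>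
    simp [pos, dig, hdj] at hb
  · obtain ⟨v, hv⟩ : ∃ v, σ.nat 6 j = v := ⟨_, rfl⟩
    rw [hv] at hdj hb
    have hvn : v < n := hv ▸ hd j hj
    have hσv : σ.nat 8 v = 0 := by
      by_contra h
      exact (t8 v).2 (Or.inl h) hb
    -- Since the call started, only the first j < L players of the separator can have been placed.
    -- The component of v had at most 2L + 1 neighbours, so it now has at most 3L + 1 ≤ D.
    have hins := tP.insert hvn hb (by
      have h1 : {x | τ.nat 8 x ≠ 0} ⊆ {x | σ.nat 8 x ≠ 0} ∪ {x | ∃ i < j, σ.nat 6 i = x} :=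
        fun x hx => (t8 x).1 hx
      have h2 : {x | σ.nat 8 x ≠ 0} ⊆ {x | τ.nat 8 x ≠ 0} := fun x hx => (t8 x).2 (Or.inl hx)
      have h3 := Set.ncard_le_ncard (nbrs_subset_union (adj := adj) (u := v) h2 h1)
        ((hfin _ _).union (ncard_image_le _ _).1)
      have h4 := Set.ncard_union_le (nbrs adj {x | σ.nat 8 x ≠ 0} v) {x | ∃ i < j, σ.nat 6 i = x}
      have h5 := (ncard_image_le (σ.nat 6) j).2
      have h6 := hcomp v hvn hσv
      omega)
    refine R.seq hB (R.setN hB (by simp) (by simp [placed]) ?_)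
    refine R.seq hB (R.setN hB (by simp [dig]) (by simp [placed]) ?_)
    refine R.setN hB (by simp [placed]) (by simp [dig]) ?_
    have hd2 : ∀ a : ℕ, a ≠ 6 → ∀ e x, (τ.setNat a e x).nat 6 j = v := fun a ha e x => by
      rw [setNat_nat_of_ne _ _ _ ha.symm, hdj]
    simp only [State.setNat_eq_put, dig, placed, eval_get, eval_add, eval_ofNat, eval_var,
      State.put_nat, List.nil_append, List.getD_cons_zero, Nat.reduceEqDiff, if_true, if_false,
      hdj, Function.update_self]
    refine next _ ?_ ?_ ?_ ?_ ?_ ?_ ?_ <;>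
      simp [State.put_nat, -Order.lt_add_one_iff]
    · exact t0
    · exact t1
    · exact t11
    · exact hins
    · intro x
      rw [hex, ← or_assoc]
      by_cases hx : x = v
      · simp [hx, hv]
      · rw [Function.update_of_ne hx]
        have := t8 x
        have hx' : ¬ v = x := fun h => hx h.symm
        simp only [ne_eq] at this
        simp only [hv, hx', or_false]
        exact this
    · have : ind (∃ i < j + 1, σ.nat 8 (σ.nat 6 i) = 0) ≤ 1 := by unfold ind; split_ifs <;> simp
      omega
  · refine R.skip (next τ t0 t1 t11 rfl tP (fun x => ?_) ?_)
    · rw [hex, ← or_assoc, t8]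
      constructor
      · exact Or.inl
      · rintro (h | h)
        · exact h
        · rw [← t8, ← h]; exact hb
    · by_cases h : ∃ i < j, σ.nat 8 (σ.nat 6 i) = 0
      · rw [ind_of ((hex _).2 (Or.inl h))]
        rwa [ind_of h] at t9
      · rw [ind_of_not h] at t9
        by_cases h' : σ.nat 8 (σ.nat 6 j) = 0
        · exfalso
          rcases (t8 _).1 hb with h1 | ⟨i, hi, h1⟩
          · exact h1 h'
          · exact h ⟨i, hi, by rw [h1, h']⟩
        · rw [ind_of_not]
          · exact t9
          · rw [hex]; rintro (h1 | h1)
            · exact h h1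
            · exact h' h1

end RAM.Algo

namespace RAM.Algo

open X Polymatrix

variable {B : ℕ} {σ : State}

/-- Removing the first `L` values of `d` extends `pos` by a new player and leaves only components
with at most `2 * L + 1` neighbours. -/
def GoodSep (adj : ℕ → ℕ → Prop) (n L : ℕ) (pos d : ℕ → ℕ) : Prop :=
  (∃ i < L, pos (d i) = 0) ∧ ∀ v < n, v ∉ {x | pos x ≠ 0} ∪ {x | ∃ i < L, d i = x} →
    (nbrs adj ({x | pos x ≠ 0} ∪ {x | ∃ i < L, d i = x}) v).ncard ≤ 2 * L + 1

theorem GoodSep.congr {adj : ℕ → ℕ → Prop} {n L : ℕ} {pos d d' : ℕ → ℕ}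
    (h : GoodSep adj n L pos d) (hd : ∀ i < L, d i = d' i) : GoodSep adj n L pos d' := by
  have h1 : {x | ∃ i < L, d i = x} = {x | ∃ i < L, d' i = x} := by
    ext x
    exact exists_congr fun i => and_congr_right fun hi => by rw [hd i hi]
  unfold GoodSep at *
  rw [h1] at h
  obtain ⟨⟨i, hi, h2⟩, h3⟩ := h
  exact ⟨⟨i, hi, hd i hi ▸ h2⟩, h3⟩

/-- The invariant of the computation of an elimination order. -/
structure ElimInv (adj : ℕ → ℕ → Prop) (n w : ℕ) (σ : State) : Prop where
  placed : Placed adj n (3 * (w + 1) + 1) (σ.nat 8) (σ.nat 10) (σ.nat 9 0)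
  one_le : 1 ≤ σ.nat 11 0
  le : σ.nat 11 0 ≤ w + 1
  dig_lt : ∀ i < σ.nat 11 0, σ.nat 6 i < n
  dig_zero : ∀ i, σ.nat 11 0 ≤ i → σ.nat 6 i = 0
  comp : ∀ v < n, σ.nat 8 v = 0 →
    (nbrs adj {x | σ.nat 8 x ≠ 0} v).ncard ≤ 2 * σ.nat 11 0 + 1
  not_good : ∀ d : ℕ → ℕ, (∀ i < σ.nat 11 0, d i < n) →
    digitVal n (σ.nat 11 0) d < digitVal n (σ.nat 11 0) (σ.nat 6) →
      ¬ GoodSep adj n (σ.nat 11 0) (σ.nat 8) d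

/-- The progress measure of the computation of an elimination order. -/
def elimRank (n w : ℕ) (σ : State) : ℕ :=
  -- Lexicographic in the number of placed players, the size L of the separators, and the counter.
  -- The counter is below n^L ≤ n^(w+1) and L - 1 ≤ w, so the last two terms together stay below the
  -- weight of one placed player.
  σ.nat 9 0 * ((w + 2) * n ^ (w + 1)) + (σ.nat 11 0 - 1) * n ^ (w + 1) +
    digitVal n (σ.nat 11 0) (σ.nat 6)

/-- One round has three outcomes: a good tuple is placed, the counter advances, or it overflows and
L grows. Each raises the rank. The condition 2L + 1 on the components survives an increase of L, and
`not_good` remembers that all smaller tuples have failed. -/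
theorem R_elimStep (hB : 1 ≤ B) {n w : ℕ} {adj : ℕ → ℕ → Prop} (hn : σ.nat 0 0 = n) (hnB : n ≤ B)
    (hwB : w + 1 ≤ B) (hadj : ∀ i < n, ∀ j < n, σ.nat 1 (i * n + j) ≠ 0 ↔ adj i j)
    (hlt : ∀ i j, adj i j → i < n ∧ j < n)
    (hext : ∀ (R : Set ℕ) (u : ℕ), u < n → u ∉ R →
      (∀ v < n, v ∉ R → (nbrs adj R v).ncard ≤ 2 * (w + 1) + 1) →
      ∃ f : ℕ → ℕ, (∀ i < w + 1, f i < n) ∧ (∃ i < w + 1, f i ∉ R) ∧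
        ∀ v < n, v ∉ R ∪ {x | ∃ i < w + 1, f i = x} →
          (nbrs adj (R ∪ {x | ∃ i < w + 1, f i = x}) v).ncard ≤ 2 * (w + 1) + 1)
    (hI : ElimInv adj n w σ) (hc : σ.nat 9 0 < n) :
    elimRank n w σ < n * ((w + 2) * n ^ (w + 1)) ∧
    R B (.seq markRemoved <| .seq reach <|
      .ite (.nz good) place <|
      .seq (inc sepSize Algo.n) (.ite (.nz carry) (.setN 11 0 (sepSize + 1)) .skip)) [] σ fun τ =>
      τ.nat 0 = σ.nat 0 ∧ τ.nat 1 = σ.nat 1 ∧ ElimInv adj n w τ ∧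
        elimRank n w σ + 1 ≤ elimRank n w τ := by
  obtain ⟨L, hL⟩ : ∃ L, σ.nat 11 0 = L := ⟨_, rfl⟩
  obtain ⟨iP, i1, iL, id, iz, ic, ig⟩ := hI
  rw [hL] at i1 iL id iz ic ig
  have hn1 : 1 ≤ n := by omega
  have hq : n ^ L ≤ n ^ (w + 1) := Nat.pow_le_pow_right hn1 iL
  have hdv := digitVal_lt id
  have hLB : L ≤ B := by omega
  obtain ⟨q, hqd⟩ : ∃ q, n ^ (w + 1) = q := ⟨_, rfl⟩
  have hLq : (L - 1) * q ≤ w * q := Nat.mul_le_mul_right _ (by omega)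
  have hfin : ∀ R v, (nbrs adj R v).Finite := fun R v =>
    (Set.finite_lt_nat n).subset fun y ⟨_, x, _, h⟩ => (hlt x y h).2
  rw [hqd] at hq
  constructor
  · unfold elimRank
    rw [hL, hqd]
    have h1 : (σ.nat 9 0 + 1) * ((w + 2) * q) ≤ n * ((w + 2) * q) := Nat.mul_le_mul_right _ hc
    have h2 : (w + 2) * q = w * q + 2 * q := add_mul _ _ _
    rw [add_mul, one_mul] at h1
    omega
  set R' : Set ℕ := {x | σ.nat 8 x ≠ 0} ∪ {x | ∃ i < L, σ.nat 6 i = x} with hR'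
  refine R.seq hB ((R_markRemoved hB hn hL hnB hLB).mono ?_)
  rintro τ ⟨t, tr, trem⟩
  refine R.seq hB ((R_reach (R' := R') (adj := adj) hB (by rw [t 0 (by simp), hn]) hnB
    (by rw [t 1 (by simp)]; exact hadj) hlt trem).mono ?_)
  rintro υ ⟨u, ur, umark⟩
  have hu : ∀ b, b ≠ 12 → b ≠ 14 → υ.nat b = σ.nat b := fun b h1 h2 => by rw [u b h1, t b h2]
  have u0 := hu 0 (by simp) (by simp)
  have u1 := hu 1 (by simp) (by simp)
  have u6 := hu 6 (by simp) (by simp)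
  have u8 := hu 8 (by simp) (by simp)
  have u9 := hu 9 (by simp) (by simp)
  have u10 := hu 10 (by simp) (by simp)
  have u11 := hu 11 (by simp) (by simp)
  have hgood := eval_good (σ := υ) (n := n) (L := L) (R' := R') (adj := adj) (by rw [u0, hn])
    (by rw [u11, hL]) (by rw [u1]; exact hadj) hlt (by rw [u 14 (by simp)]; exact trem) umark
  rw [u8] at hgood
  have hgood' : good.eval υ [] ≠ 0 ↔ GoodSep adj n L (σ.nat 8) (σ.nat 6) := by
    rw [hgood, GoodSep]
    refine and_congr ⟨?_, ?_⟩ Iff.rfl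
    · rintro ⟨v, hv, h1, h2 | ⟨i, hi, rfl⟩⟩
      · exact absurd h1 h2
      · exact ⟨i, hi, h1⟩
    · rintro ⟨i, hi, h1⟩
      exact ⟨_, id i hi, h1, Or.inr ⟨i, hi, rfl⟩⟩
  refine R.ite hB (bdd_good (by rw [u0, hn]) hnB) (fun hb => ?_) (fun hb => ?_) <;>
    rw [Tst.holds_nz, hgood'] at hb
  · refine (R_place (n := n) (L := L) (D := 3 * (w + 1) + 1) (adj := adj) hB (by rw [u11, hL]) hLB
      (by rw [u6]; exact id) (by rw [u8, u9, u10]; exact iP) (by omega) hfin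
      (by rw [u8]; exact ic)).mono ?_
    rintro φ ⟨f0, f1, f11, f6, fP, f8, f9⟩
    have e11 : φ.nat 11 0 = L := by rw [f11, u11, hL]
    have e6 : ∀ i, φ.nat 6 i = 0 := fun i => by
      rw [f6, u6]
      split_ifs with h
      · rfl
      · exact iz i (by omega)
    have e0 : digitVal n L (φ.nat 6) = 0 := Finset.sum_eq_zero fun i _ => by rw [e6, zero_mul]
    refine ⟨f0.trans u0, f1.trans u1, ⟨fP, by omega, by omega, fun i _ => ?_, fun i _ => e6 i,
      fun v hv hv0 => ?_, fun d _ hd => ?_⟩, ?_⟩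
    · rw [e6]; omega
    · have h1 : {x | φ.nat 8 x ≠ 0} = R' := by
        ext x
        have := f8 x
        rw [u8, u6] at this
        exact this
      rw [e11, h1]
      refine hb.2 v hv ?_
      rw [← hR', ← h1]
      exact fun h => h hv0
    · rw [e11, e0] at hd; omega
    · rw [u6, u8, ind_of hb.1, u9] at f9
      unfold elimRank
      rw [e11, e0, hL, hqd]
      have h1 : (σ.nat 9 0 + 1) * ((w + 2) * q) ≤ φ.nat 9 0 * ((w + 2) * q) :=
        Nat.mul_le_mul_right _ f9
      have h2 : (w + 2) * q = w * q + 2 * q := add_mul _ _ _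
      rw [add_mul, one_mul] at h1
      omega
  · refine R.seq hB ((R_inc (L := L) (q := n) hB (fun φ hφ ρ => ?_) hLB hn1
      (by rw [u6]; exact id)).mono ?_)
    · simp [sepSize, Algo.n, hφ 11 (by simp) (by simp), hφ 0 (by simp) (by simp), u11, u0, hL, hn]
    · rintro φ ⟨f, fr, fd, fz, fc, fv⟩
      have hf : ∀ b, b ≠ 6 → b ≠ 7 → b ≠ 12 → b ≠ 14 → φ.nat b = σ.nat b :=
        fun b h1 h2 h3 h4 => by rw [f b h1 h2, hu b h3 h4]
      have f0 := hf 0 (by simp) (by simp) (by simp) (by simp)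
      have f1 := hf 1 (by simp) (by simp) (by simp) (by simp)
      have f8 := hf 8 (by simp) (by simp) (by simp) (by simp)
      have f9 := hf 9 (by simp) (by simp) (by simp) (by simp)
      have f10 := hf 10 (by simp) (by simp) (by simp) (by simp)
      have f11 := hf 11 (by simp) (by simp) (by simp) (by simp)
      rw [u6] at fv fz
      have hnot : ∀ d : ℕ → ℕ, (∀ i < L, d i < n) →
          digitVal n L d < digitVal n L (σ.nat 6) + 1 → ¬ GoodSep adj n L (σ.nat 8) d := by
        intro d hd hdl hgd
        by_cases h : digitVal n L d < digitVal n L (σ.nat 6)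
        · exact ig d hd h hgd
        · exact hb (hgd.congr (digitVal_inj hd id (by omega)))
      refine R.ite hB (by simp [carry]) (fun hb' => ?_) (fun hb' => ?_) <;>
        simp [carry] at hb'
      · have hcar : φ.nat 7 0 = 1 := by omega
        rw [hcar, one_mul] at fv
        have hdv' := digitVal_lt fd
        have hd0 := eq_zero_of_digitVal (q := n) (L := L) (d := φ.nat 6) hn1 (by omega)
        have hd0' : ∀ i, φ.nat 6 i = 0 := fun i => by
          rcases Nat.lt_or_ge i L with hi | hi
          · exact hd0 i hi
          · rw [fz i hi, iz i hi]
        -- An overflow means that all tuples of length L have failed. For L = w + 1 this contradicts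
        -- `hext`, applied to a player who is not yet placed.
        have hLw : L ≤ w := by
          by_contra hLw
          obtain rfl : L = w + 1 := by omega
          obtain ⟨v, hv, hv0⟩ : ∃ v < n, σ.nat 8 v = 0 := by
            by_contra! h
            have h1 : ((Finset.range n).image (σ.nat 8)) ⊆ Finset.Icc 1 (σ.nat 9 0) := by
              intro x hx
              obtain ⟨v, hv, rfl⟩ := Finset.mem_image.1 hx
              have := h v (Finset.mem_range.1 hv)
              exact Finset.mem_Icc.2 ⟨by omega, iP.le v⟩
            have h2 := Finset.card_le_card h1
            rw [Finset.card_image_of_injOn, Nat.card_Icc, Finset.card_range] at h2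
            · omega
            · intro x hx y hy hxy
              simp only [Finset.coe_range, Set.mem_Iio] at hx hy
              rw [← iP.ord_pos x (h x hx), ← iP.ord_pos y (h y hy), hxy]
          obtain ⟨g, g1, ⟨i, hi, g2⟩, g3⟩ := hext {x | σ.nat 8 x ≠ 0} v hv
            (fun h => h hv0) fun x hx hx0 => ic x hx (not_not.1 hx0)
          refine hnot g g1 ?_ ⟨⟨i, hi, not_not.1 g2⟩, g3⟩
          have := digitVal_lt g1
          omega
        refine R.setN hB (by simp) (by simp [sepSize]) ?_
        have e : (sepSize + 1).eval φ [] = L + 1 := by simp [sepSize, f11, hL]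
        rw [e]
        generalize hψ : φ.setNat 11 _ (L + 1) = ψ
        have p : ∀ b, b ≠ 11 → ψ.nat b = φ.nat b := fun b hb => by
          rw [← hψ, setNat_nat_of_ne _ _ _ hb]
        have p11 : ψ.nat 11 0 = L + 1 := by rw [← hψ]; simp
        have p6 := p 6 (by simp)
        have e0 : digitVal n (L + 1) (ψ.nat 6) = 0 :=
          Finset.sum_eq_zero fun i _ => by rw [p6, hd0', zero_mul]
        refine ⟨by rw [p 0 (by simp), f0], by rw [p 1 (by simp), f1], ⟨?_, by omega, by omega,
          fun i _ => ?_, fun i _ => ?_, ?_, fun d _ hd => ?_⟩, ?_⟩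
        · rw [p 8 (by simp), p 9 (by simp), p 10 (by simp), f8, f9, f10]; exact iP
        · rw [p6, hd0']; omega
        · rw [p6, hd0']
        · rw [p 8 (by simp), f8, p11]
          intro v hv hv0
          have := ic v hv hv0
          omega
        · rw [p11, e0] at hd; omega
        · unfold elimRank
          rw [p11, e0, hL, hqd, p 9 (by simp), f9]
          have h3 : (L + 1 - 1) * q = (L - 1) * q + q := by
            rw [show L + 1 - 1 = L - 1 + 1 by omega, add_mul, one_mul]
          omega
      · rw [hb', Nat.zero_mul, add_zero] at fv
        have e11 : φ.nat 11 0 = L := by rw [f11, hL]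
        refine R.skip ⟨f0, f1, ⟨?_, by omega, by omega, ?_, fun i hi => ?_, ?_, ?_⟩, ?_⟩
        · rw [f8, f9, f10]; exact iP
        · rw [e11]; exact fd
        · rw [e11] at hi; rw [fz i hi, iz i hi]
        · rw [f8, e11]; exact ic
        · rw [f8, e11, fv]; exact hnot
        · unfold elimRank
          rw [e11, fv, f9, hL]
          omega

theorem R_elimOrder (hB : 1 ≤ B) {n w : ℕ} {adj : ℕ → ℕ → Prop} (hn : σ.nat 0 0 = n)
    (hn1 : 1 ≤ n) (hBn : n * ((w + 2) * n ^ (w + 1)) ≤ B)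
    (hadj : ∀ i < n, ∀ j < n, σ.nat 1 (i * n + j) ≠ 0 ↔ adj i j)
    (hlt : ∀ i j, adj i j → i < n ∧ j < n)
    (hext : ∀ (R : Set ℕ) (u : ℕ), u < n → u ∉ R →
      (∀ v < n, v ∉ R → (nbrs adj R v).ncard ≤ 2 * (w + 1) + 1) →
      ∃ f : ℕ → ℕ, (∀ i < w + 1, f i < n) ∧ (∃ i < w + 1, f i ∉ R) ∧
        ∀ v < n, v ∉ R ∪ {x | ∃ i < w + 1, f i = x} →
          (nbrs adj (R ∪ {x | ∃ i < w + 1, f i = x}) v).ncard ≤ 2 * (w + 1) + 1)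
    (h6 : σ.nat 6 = 0) (h8 : σ.nat 8 = 0) (h9 : σ.nat 9 0 = 0) :
    R B elimOrder [] σ fun τ => Placed adj n (3 * (w + 1) + 1) (τ.nat 8) (τ.nat 10) n := by
  have hq : 1 ≤ n ^ (w + 1) := Nat.one_le_pow _ _ hn1
  have hnB : n ≤ B := le_trans (Nat.le_mul_of_pos_right _ (by positivity)) hBn
  have hwB : w + 1 ≤ B := by
    have h1 : (w + 2) * 1 ≤ (w + 2) * n ^ (w + 1) := Nat.mul_le_mul_left _ hq
    have h2 : 1 * ((w + 2) * n ^ (w + 1)) ≤ n * ((w + 2) * n ^ (w + 1)) :=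
      Nat.mul_le_mul_right _ hn1
    omega
  refine R.seq hB (R.setN hB (by simp) (by simp) ?_)
  -- The rank grows in every round, so it bounds the number j of rounds, and it stays below
  -- n(w+2)n^(w+1) ≤ B while some player has no position.
  refine R.while hB (fun j τ => τ.nat 0 = σ.nat 0 ∧ τ.nat 1 = σ.nat 1 ∧ ElimInv adj n w τ ∧
    j ≤ elimRank n w τ) ?_ (fun j τ _ => by simp [placed, Algo.n]) ?_ ?_
  · have s : ∀ b, b ≠ 11 → (σ.setNat 11 ((0 : X).eval σ []) ((1 : X).eval σ [])).nat b = σ.nat b :=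
      fun b hb => setNat_nat_of_ne _ _ _ hb
    have s11 : (σ.setNat 11 ((0 : X).eval σ []) ((1 : X).eval σ [])).nat 11 0 = 1 := by simp
    refine ⟨s 0 (by simp), s 1 (by simp), ⟨?_, ?_, ?_, fun i _ => ?_, fun i _ => ?_,
      fun v _ _ => ?_, fun d _ hd => ?_⟩, Nat.zero_le _⟩
    · rw [s 8 (by simp), s 9 (by simp), s 10 (by simp), h8, h9]
      exact ⟨by simp, by simp, by simp, by omega, by simp⟩
    · rw [s11]
    · rw [s11]; omega
    · rw [s 6 (by simp), h6]; exact hn1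
    · rw [s 6 (by simp), h6]; rfl
    · rw [s 8 (by simp), h8]
      have : nbrs adj {x | (0 : ℕ → ℕ) x ≠ 0} v = ∅ := by
        ext y; simp [nbrs]
      rw [this]
      simp
    · rw [s 6 (by simp), h6] at hd
      simp [digitVal] at hd
  · rintro j τ ⟨t0, t1, tI, tj⟩ hb
    have t0' : τ.nat 0 0 = n := by rw [t0, hn]
    simp [placed, Algo.n, t0'] at hb
    obtain ⟨h1, h2⟩ := R_elimStep hB t0' hnB hwB (by rw [t1]; exact hadj) hlt hext tI hb
    refine ⟨by omega, h2.mono ?_⟩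
    rintro υ ⟨u0, u1, uI, uj⟩
    exact ⟨by rw [u0, t0], by rw [u1, t1], uI, by omega⟩
  · rintro j τ ⟨t0, t1, tI, tj⟩ hb
    have t0' : τ.nat 0 0 = n := by rw [t0, hn]
    simp [placed, Algo.n, t0'] at hb
    have h1 := tI.placed
    have h2 := h1.le_card
    rwa [show τ.nat 9 0 = n by omega] at h1

end RAM.Algo

/-! ### Bags and tree of an elimination order -/

namespace RAM.Algo

open Polymatrix

/-- The data of the dynamic program: `pos` and `ord` describe an elimination order, `J` the
payoffs, and `C` the strategies. -/
structure Data where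
  n : ℕ
  m : ℕ
  k : ℕ
  K : ℕ
  J : ℕ → ℕ
  C : ℕ → ℕ
  pos : ℕ → ℕ
  ord : ℕ → ℕ
  adj : ℕ → ℕ → Prop

namespace Data

/-- The data are consistent, and the neighbourhoods have at most `D` elements. -/
structure Wf (d : Data) (D : ℕ) : Prop where
  placed : Placed d.adj d.n D d.pos d.ord d.n
  symm : ∀ i j, d.adj i j → d.adj j i
  lt : ∀ i j, d.adj i j → i < d.n ∧ j < d.n
  J_eq_zero : ∀ i < d.n, ∀ j < d.n, ∀ a < d.m, ∀ b < d.m, i ≠ j → ¬ d.adj i j →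
    d.J (((i * d.n + j) * d.m + a) * d.m + b) = 0
  J_le : ∀ i < d.n, ∀ j < d.n, ∀ a < d.m, ∀ b < d.m,
    d.J (((i * d.n + j) * d.m + a) * d.m + b) ≤ 2 * d.k
  strat : IsStratTable d.m d.k d.K d.C

variable {d : Data} {D : ℕ}

theorem Wf.pos_pos (h : d.Wf D) {j : ℕ} (hj : j < d.n) : 1 ≤ d.pos j :=
  Nat.one_le_iff_ne_zero.2 (h.placed.pos_ne_zero hj)

theorem Wf.pos_inj (h : d.Wf D) {i j : ℕ} (hi : i < d.n) (hj : j < d.n) (he : d.pos i = d.pos j) :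
    i = j := by
  rw [← h.placed.ord_pos i (h.placed.pos_ne_zero hi), he,
    h.placed.ord_pos j (h.placed.pos_ne_zero hj)]

/-- The bags and the tree of the dynamic program, from position `t₀` on. -/
structure BagTree (d : Data) (t₀ : ℕ) (bag : ℕ → ℕ → Prop) (par : ℕ → ℕ) : Prop where
  bag_iff : ∀ t, t₀ ≤ t → t ≤ d.n → ∀ j < d.n, bag t j ↔ d.pos j = t ∨ d.pos j < t ∧
    (d.adj (d.ord t) j ∨ ∃ t', t' ≤ d.n ∧ t < t' ∧ par t' = t ∧ bag t' j)
  le_par : ∀ t, t₀ ≤ t → t ≤ d.n → ∀ j < d.n, bag t j → d.pos j < t → d.pos j ≤ par t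
  par_eq : ∀ t, t₀ ≤ t → t ≤ d.n → par t = 0 ∨ ∃ j < d.n, bag t j ∧ d.pos j < t ∧ d.pos j = par t

/-- `t` is an ancestor of `u` in the tree. -/
def Desc (d : Data) (par : ℕ → ℕ) : ℕ → ℕ → Prop :=
  Relation.ReflTransGen fun a b => a < b ∧ b ≤ d.n ∧ par b = a

/-- The players that occur in the bags of the subtree at `t`. -/
def span (d : Data) (bag : ℕ → ℕ → Prop) (par : ℕ → ℕ) (t : ℕ) : Set ℕ :=
  {j | j < d.n ∧ (bag t j ∨ d.Desc par t (d.pos j))}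

theorem Desc.le {par : ℕ → ℕ} {t u : ℕ} (h : d.Desc par t u) : t ≤ u := by
  induction h with
  | refl => exact le_rfl
  | tail _ h ih => exact ih.trans h.1.le

/-- Every node has one parent, so the ancestors of u form a chain. Two children of t above u are
comparable, and the parent t of the lower one lies strictly above the upper one unless they are
equal. -/
theorem Desc.not_siblings {par : ℕ → ℕ} {t t₁ t₂ u : ℕ} (h1 : d.Desc par t₁ u)
    (h2 : d.Desc par t₂ u) (ht₁ : t < t₁) (hp₁ : par t₁ = t) (ht₂ : t < t₂) (hp₂ : par t₂ = t) :
    t₁ = t₂ := by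
  have key : ∀ a b, d.Desc par a b → t < a → par b = t → a = b := by
    intro a b h ha hb
    rcases Relation.ReflTransGen.cases_tail h with h | ⟨c, h3, h4⟩
    · exact h.symm
    · have := Desc.le h3
      omega
  have htot : d.Desc par t₁ t₂ ∨ d.Desc par t₂ t₁ := by
    have h1' := Relation.reflTransGen_swap.2 h1
    have h2' := Relation.reflTransGen_swap.2 h2
    rcases Relation.ReflTransGen.total_of_right_unique
      (fun a b c hab hac => hab.2.2.symm.trans hac.2.2) h1' h2' with h | h
    · exact Or.inr (Relation.reflTransGen_swap.1 h)
    · exact Or.inl (Relation.reflTransGen_swap.1 h)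
  rcases htot with h | h
  · exact key _ _ h ht₁ hp₂
  · exact (key _ _ h ht₂ hp₁).symm

namespace BagTree

variable {t₀ t t' j : ℕ} {bag : ℕ → ℕ → Prop} {par : ℕ → ℕ}

theorem pos_le (h : d.BagTree t₀ bag par) (h1 : t₀ ≤ t) (h2 : t ≤ d.n) (hj : j < d.n)
    (hb : bag t j) : d.pos j ≤ t := by
  rcases (h.bag_iff t h1 h2 j hj).1 hb with h | h
  · exact h.le
  · exact h.1.le

/-- The parent t is the largest position before t' in the bag of t'. A player of this bag other than
that of t' itself is therefore either the player of t or an earlier one, and earlier ones are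
inherited by the fill-in rule. -/
theorem bag_parent (h : d.BagTree t₀ bag par) (h1 : t₀ ≤ t) (ht : t < t') (h2 : t' ≤ d.n)
    (hp : par t' = t) (hj : j < d.n) (hb : bag t' j) (hne : d.pos j ≠ t') : bag t j := by
  have h3 := h.pos_le (by omega) h2 hj hb
  have h4 := h.le_par t' (by omega) h2 j hj hb (by omega)
  rw [h.bag_iff t h1 (by omega) j hj]
  rcases Nat.lt_or_ge (d.pos j) t with h5 | h5
  · exact Or.inr ⟨h5, Or.inr ⟨t', h2, ht, hp, hb⟩⟩
  · exact Or.inl (by omega)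

theorem bag_of_span (h : d.BagTree t₀ bag par) (h1 : t₀ ≤ t) (h2 : t ≤ d.n)
    (hj : j ∈ d.span bag par t) (hle : d.pos j ≤ t) : bag t j := by
  rcases hj.2 with h3 | h3
  · exact h3
  · exact (h.bag_iff t h1 h2 j hj.1).2 (Or.inl (le_antisymm hle (Desc.le h3)))

theorem desc_of_span (h : d.BagTree t₀ bag par) (h1 : t₀ ≤ t) (ht : t < t') (h2 : t' ≤ d.n)
    (hp : par t' = t) (hj : j ∈ d.span bag par t') (hlt : t < d.pos j) :
    d.Desc par t' (d.pos j) := by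
  rcases hj.2 with h3 | h3
  · have h4 := h.pos_le (by omega) h2 hj.1 h3
    by_cases h5 : d.pos j < t'
    · have := h.le_par t' (by omega) h2 j hj.1 h3 h5
      omega
    · rw [show d.pos j = t' by omega]
      exact .refl
  · exact h3

theorem desc_trans {a b : ℕ} (h1 : d.Desc par t a) (h2 : d.Desc par a b) : d.Desc par t b :=
  Relation.ReflTransGen.trans h1 h2

theorem span_of_desc_bag (h : d.BagTree t₀ bag par) (h1 : t₀ ≤ t) {s u : ℕ}
    (hd : d.Desc par t s) (hu : u < d.n) (hb : bag s u) : u ∈ d.span bag par t := by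
  unfold Desc at hd
  induction hd with
  | refl => exact ⟨hu, Or.inl hb⟩
  | @tail s' s hd hs ih =>
    by_cases hp : d.pos u = s
    · refine ⟨hu, Or.inr ?_⟩
      rw [hp]
      exact hd.tail hs
    · exact ih (h.bag_parent (h1.trans (Desc.le hd)) hs.1 hs.2.1 hs.2.2 hu hb hp)

/-- Going from s to its parent keeps j in the bag by `bag_parent`, and positions decrease, so the
walk must arrive at the position of j. -/
theorem desc_of_bag (h : d.BagTree t₀ bag par) (hj : j < d.n) (h1 : t₀ ≤ d.pos j) :
    ∀ s, d.pos j ≤ s → s ≤ d.n → bag s j → d.Desc par (d.pos j) s := by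
  intro s
  induction s using Nat.strong_induction_on with
  | _ s ih =>
    intro h2 h3 hb
    by_cases hp : d.pos j = s
    · rw [hp]; exact .refl
    · have h4 := h.le_par s (by omega) h3 j hj hb (by omega)
      have h5 : par s < s := by
        rcases h.par_eq s (by omega) h3 with h6 | ⟨i, _, _, h6, h7⟩ <;> omega
      exact (ih (par s) h5 h4 (by omega)
        (h.bag_parent (by omega) h5 h3 rfl hj hb hp)).tail ⟨h5, h3, rfl⟩

/-- Of two adjacent players the earlier one is in the bag of the later one. Thus a neighbour of a
player in the subtree is either in a bag of the subtree or sits in the subtree himself. This is why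
the payoffs of such a player are determined by the span. -/
theorem span_of_adj (h : d.BagTree t₀ bag par) (hw : d.Wf D) (h1 : t₀ ≤ t) {u : ℕ} (hj : j < d.n)
    (hd : d.Desc par t (d.pos j)) (ha : d.adj j u) : u ∈ d.span bag par t := by
  have hu := (hw.lt _ _ ha).2
  have hge := Desc.le hd
  have hjn := hw.placed.le j
  have hun := hw.placed.le u
  rcases lt_trichotomy (d.pos u) (d.pos j) with h2 | h2 | h2
  · refine h.span_of_desc_bag h1 hd hu ?_
    rw [h.bag_iff _ (by omega) hjn u hu, hw.placed.ord_pos j (hw.placed.pos_ne_zero hj)]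
    exact Or.inr ⟨h2, Or.inl ha⟩
  · rw [hw.pos_inj hu hj h2]
    exact ⟨hj, Or.inr hd⟩
  · refine ⟨hu, Or.inr (desc_trans hd (h.desc_of_bag hj (by omega) _ h2.le hun ?_))⟩
    rw [h.bag_iff _ (by omega) hun j hj, hw.placed.ord_pos u (hw.placed.pos_ne_zero hu)]
    exact Or.inr ⟨h2, Or.inl (hw.symm _ _ ha)⟩

/-- The subtrees of distinct children are disjoint, so a player common to both spans has a position
at most t. He is then in both children's bags and passes to that of t. This makes the overlaps in a
join part of the bag. -/
theorem bag_of_span_span (h : d.BagTree t₀ bag par) (h1 : t₀ ≤ t) {t₁ t₂ : ℕ} (ht₁ : t < t₁)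
    (hn₁ : t₁ ≤ d.n) (hp₁ : par t₁ = t) (ht₂ : t < t₂) (hn₂ : t₂ ≤ d.n) (hp₂ : par t₂ = t)
    (hne : t₁ ≠ t₂) (hj₁ : j ∈ d.span bag par t₁) (hj₂ : j ∈ d.span bag par t₂) : bag t j := by
  have key : ∀ s, t < s → s ≤ d.n → par s = t → j ∈ d.span bag par s → d.pos j ≤ t → bag t j :=
    fun s hs hsn hp hj hle => h.bag_parent h1 hs hsn hp hj.1
      (h.bag_of_span (by omega) hsn hj (by omega)) (by omega)
  by_cases hle : d.pos j ≤ t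
  · exact key t₁ ht₁ hn₁ hp₁ hj₁ hle
  · exact absurd ((h.desc_of_span h1 ht₁ hn₁ hp₁ hj₁ (by omega)).not_siblings
      (h.desc_of_span h1 ht₂ hn₂ hp₂ hj₂ (by omega)) ht₁ hp₁ ht₂ hp₂) hne

theorem span_eq (h : d.BagTree t₀ bag par) (h1 : t₀ ≤ t) (h2 : t ≤ d.n) :
    d.span bag par t = {j | j < d.n ∧ bag t j} ∪
      ⋃ t' ∈ {t' | t' ≤ d.n ∧ t < t' ∧ par t' = t}, d.span bag par t' := by
  ext j
  simp only [Set.mem_union, Set.mem_iUnion, exists_prop]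
  constructor
  · rintro ⟨hj, hb | hb⟩
    · exact Or.inl ⟨hj, hb⟩
    · rcases Relation.ReflTransGen.cases_head hb with h3 | ⟨t', h3, h4⟩
      · exact Or.inl ⟨hj, (h.bag_iff t h1 h2 j hj).2 (Or.inl h3.symm)⟩
      · exact Or.inr ⟨t', ⟨h3.2.1, h3.1, h3.2.2⟩, hj, Or.inr h4⟩
  · rintro (⟨hj, hb⟩ | ⟨t', ⟨h3, h4, h5⟩, hj⟩)
    · exact ⟨hj, Or.inl hb⟩
    · by_cases hle : d.pos j ≤ t
      · exact ⟨hj.1, Or.inl (h.bag_parent h1 h4 h3 h5 hj.1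
          (h.bag_of_span (by omega) h3 hj (by omega)) (by omega))⟩
      · exact ⟨hj.1, Or.inr (.head ⟨h4, h3, h5⟩ (h.desc_of_span h1 h4 h3 h5 hj (by omega)))⟩

/-- The fill-in rule adds only neighbours of the component of the player of t after the removal of
his predecessors. If j comes from a child t', then the player of t is also in the bag of t', being
its parent. By induction both j and he are adjacent to the component of the player of t', so a path
through that component leads from him to a neighbour of j. -/
theorem exists_reach (h : d.BagTree t₀ bag par) (hw : d.Wf D) : ∀ r t, t + r = d.n → t₀ ≤ t → 1 ≤ t →
    ∀ j < d.n, bag t j → d.pos j < t →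
      ∃ x, Reach d.adj {x | d.pos x ≠ 0 ∧ d.pos x < t} (d.ord t) x ∧ d.adj x j := by
  intro r
  induction r using Nat.strong_induction_on with
  | _ r ih =>
    intro t htr h1 ht1 j hj hb hlt
    rcases (h.bag_iff t h1 (by omega) j hj).1 hb with h3 | ⟨-, h3 | ⟨t', h4, h5, h6, h7⟩⟩
    · omega
    · exact ⟨_, .refl, h3⟩
    · obtain ⟨x, hx, hxj⟩ := ih (d.n - t') (by omega) t' (by omega) (by omega) (by omega) j hj h7
        (by omega)
      rcases h.par_eq t' (by omega) h4 with h8 | ⟨j₀, hj₀, h8, h9, h10⟩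
      · omega
      obtain ⟨y, hy, hyj⟩ := ih (d.n - t') (by omega) t' (by omega) (by omega) (by omega) j₀ hj₀ h8
        h9
      have hord : d.ord t = j₀ := by
        rw [← h6, ← h10, hw.placed.ord_pos j₀ (hw.placed.pos_ne_zero hj₀)]
      have hsub : {x | d.pos x ≠ 0 ∧ d.pos x < t} ⊆ {x | d.pos x ≠ 0 ∧ d.pos x < t'} :=
        fun x hx => ⟨hx.1, hx.2.trans h5⟩
      have hpo := hw.placed.pos_ord t' (by omega) h4
      have hnot : d.ord t' ∉ {x | d.pos x ≠ 0 ∧ d.pos x < t'} := fun h => by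
        have := h.2
        omega
      have hy' := hy.symm hw.symm hnot
      have hyt : y ∉ {x | d.pos x ≠ 0 ∧ d.pos x < t} := fun hc => hy.notMem hnot (hsub hc)
      refine ⟨x, ?_, hxj⟩
      rw [hord]
      exact Relation.ReflTransGen.trans (.head ⟨hw.symm _ _ hyj, hyt⟩ (hy'.mono hsub))
        (hx.mono hsub)

/-- By `exists_reach` a bag consists of its own player and of neighbours of that player's component,
which `Placed` bounds by D. Position 0 belongs to no player and is a root with empty bag. -/
theorem ncard_bag_le (h : d.BagTree t₀ bag par) (hw : d.Wf D) (h1 : t₀ ≤ t) (h2 : t ≤ d.n) :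
    {j | j < d.n ∧ bag t j}.ncard ≤ D + 1 := by
  rcases Nat.eq_zero_or_pos t with h0 | h0
  · have : {j | j < d.n ∧ bag t j} = ∅ := by
      ext j
      simp only [Set.mem_ofPred_eq, Set.mem_empty_iff_false, iff_false, not_and]
      intro hj hb
      have := h.pos_le h1 h2 hj hb
      have := hw.pos_pos hj
      omega
    rw [this]
    simp
  · have hpo := hw.placed.pos_ord t h0 h2
    have hsub : {j | j < d.n ∧ bag t j} ⊆
        nbrs d.adj {x | d.pos x ≠ 0 ∧ d.pos x < t} (d.ord t) ∪ {d.ord t} := by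
      rintro j ⟨hj, hb⟩
      have hle := h.pos_le h1 h2 hj hb
      rcases Nat.lt_or_ge (d.pos j) t with h3 | h3
      · refine Or.inl ⟨⟨hw.placed.pos_ne_zero hj, h3⟩, ?_⟩
        exact h.exists_reach hw (d.n - t) t (by omega) h1 h0 j hj hb h3
      · refine Or.inr ?_
        rw [Set.mem_singleton_iff, ← hw.placed.ord_pos j (hw.placed.pos_ne_zero hj)]
        congr 1
        omega
    have hfin : (nbrs d.adj {x | d.pos x ≠ 0 ∧ d.pos x < t} (d.ord t)).Finite :=
      (Set.finite_lt_nat d.n).subset fun y ⟨_, x, _, h⟩ => (hw.lt x y h).2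
    refine (Set.ncard_le_ncard hsub (hfin.union (Set.finite_singleton _))).trans
      ((Set.ncard_union_le _ _).trans ?_)
    rw [Set.ncard_singleton]
    have := hw.placed.ncard_le (d.ord t) (by omega)
    rw [hpo] at this
    omega

end BagTree

end Data

end RAM.Algo

/-! ### Partial profiles, tables and joins -/

namespace RAM.Algo.Data

open Polymatrix

variable {d : Data} {D : ℕ}

/-- The part of the payoff of action `a` of player `s` that is due to player `j` playing the
strategy with number `x`. -/
def edgePay (d : Data) (s j x a : ℕ) : ℕ :=
  ∑ b ∈ Finset.range d.m, d.J (((s * d.n + j) * d.m + a) * d.m + b) * d.C (x * d.m + b)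

/-- The payoff of action `a` of player `s` under the partial profile `f`. -/
def Pay (d : Data) (f : ℕ → ℕ) (s a : ℕ) : ℕ := ∑ j ∈ Finset.range d.n, d.edgePay s j (f j) a

/-- A player with strategy `x` and payoffs `p` has no much better action. -/
def Sat (d : Data) (x : ℕ) (p : ℕ → ℕ) : Prop :=
  ∀ a < d.m, d.k * p a ≤ (∑ a' ∈ Finset.range d.m, d.C (x * d.m + a') * p a') +
    10 * (d.n * d.n) * (d.k * d.k)

theorem Sat.congr {x : ℕ} {p p' : ℕ → ℕ} (h : d.Sat x p) (hp : ∀ a < d.m, p a = p' a) :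
    d.Sat x p' := by
  intro a ha
  have e : ∑ a' ∈ Finset.range d.m, d.C (x * d.m + a') * p' a' =
      ∑ a' ∈ Finset.range d.m, d.C (x * d.m + a') * p a' :=
    Finset.sum_congr rfl fun a' ha' => by rw [hp a' (Finset.mem_range.1 ha')]
  rw [← hp a ha, e]
  exact h a ha

/-- Two partial profiles, and the payoffs under them, agree for the player `s`. -/
def AgreeAt (d : Data) (f g : ℕ → ℕ) (s : ℕ) : Prop :=
  f s = g s ∧ ∀ a < d.m, d.Pay f s a = d.Pay g s a

theorem AgreeAt.trans {f g h : ℕ → ℕ} {s : ℕ} (h1 : d.AgreeAt f g s) (h2 : d.AgreeAt g h s) :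
    d.AgreeAt f h s :=
  ⟨h1.1.trans h2.1, fun a ha => (h1.2 a ha).trans (h2.2 a ha)⟩

/-- All players have strategies and are satisfied. -/
def Solution (d : Data) (z : ℕ → ℕ) : Prop :=
  ∀ j < d.n, 1 ≤ z j ∧ z j ≤ d.K ∧ d.Sat (z j) (d.Pay z j)

open Classical in
/-- The restriction of a profile to `X`. -/
noncomputable def restr (z : ℕ → ℕ) (X : Set ℕ) (j : ℕ) : ℕ := if j ∈ X then z j else 0

/-- The profile that is `f` where `f` is defined, and `g` elsewhere. -/
def merge (f g : ℕ → ℕ) (j : ℕ) : ℕ := if f j = 0 then g j else f j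

theorem restr_of_mem {z : ℕ → ℕ} {X : Set ℕ} {j : ℕ} (h : j ∈ X) : restr z X j = z j := if_pos h

theorem restr_of_notMem {z : ℕ → ℕ} {X : Set ℕ} {j : ℕ} (h : j ∉ X) : restr z X j = 0 := if_neg h

/-- The partial profile `f` gives strategies to the players in `X`. -/
def IsOn (d : Data) (f : ℕ → ℕ) (X : Set ℕ) : Prop :=
  ∀ j < d.n, f j ≤ d.K ∧ (f j ≠ 0 ↔ j ∈ X)

theorem IsOn.eq_zero {f : ℕ → ℕ} {X : Set ℕ} (h : d.IsOn f X) {j : ℕ} (hj : j < d.n)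
    (hX : j ∉ X) : f j = 0 := by
  by_contra hc
  exact hX ((h j hj).2.1 hc)

theorem IsOn.ne_zero {f : ℕ → ℕ} {X : Set ℕ} (h : d.IsOn f X) {j : ℕ} (hj : j < d.n)
    (hX : j ∈ X) : f j ≠ 0 := (h j hj).2.2 hX

theorem IsOn.merge {f g : ℕ → ℕ} {X Y : Set ℕ} (hf : d.IsOn f X) (hg : d.IsOn g Y) :
    d.IsOn (merge f g) (X ∪ Y) := by
  intro j hj
  unfold Data.merge
  rw [Set.mem_union, ← (hf j hj).2, ← (hg j hj).2]
  split_ifs with h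
  · exact ⟨(hg j hj).1, by simp [h]⟩
  · exact ⟨(hf j hj).1, by simp [h]⟩

theorem edgePay_zero (hw : d.Wf D) (s j : ℕ) (a : ℕ) : d.edgePay s j 0 a = 0 :=
  Finset.sum_eq_zero fun b hb => by
    rw [Nat.zero_mul, Nat.zero_add, hw.strat.zero b (Finset.mem_range.1 hb), Nat.mul_zero]

theorem edgePay_eq_zero (hw : d.Wf D) {s j a : ℕ} (x : ℕ) (hs : s < d.n) (hj : j < d.n)
    (ha : a < d.m) (hne : s ≠ j) (hadj : ¬ d.adj s j) : d.edgePay s j x a = 0 :=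
  Finset.sum_eq_zero fun b hb => by
    rw [hw.J_eq_zero s hs j hj a ha b (Finset.mem_range.1 hb) hne hadj, Nat.zero_mul]

theorem edgePay_le (hw : d.Wf D) {s j x a : ℕ} (hs : s < d.n) (hj : j < d.n) (ha : a < d.m)
    (hx : x ≤ d.K) : d.edgePay s j x a ≤ 2 * d.k * d.k := by
  rcases Nat.eq_zero_or_pos x with h0 | h0
  · rw [h0, edgePay_zero hw]; exact Nat.zero_le _
  · calc d.edgePay s j x a ≤ ∑ b ∈ Finset.range d.m, 2 * d.k * d.C (x * d.m + b) :=
          Finset.sum_le_sum fun b hb =>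
            Nat.mul_le_mul_right _ (hw.J_le s hs j hj a ha b (Finset.mem_range.1 hb))
      _ = 2 * d.k * d.k := by rw [← Finset.mul_sum, hw.strat.sum_eq x h0 hx]

theorem Pay_le (hw : d.Wf D) {f : ℕ → ℕ} {s a : ℕ} (hs : s < d.n) (ha : a < d.m)
    (hf : ∀ j < d.n, f j ≤ d.K) : d.Pay f s a ≤ d.n * (2 * d.k * d.k) := by
  refine (Finset.sum_le_card_nsmul _ _ _ fun j hj =>
    edgePay_le hw hs (Finset.mem_range.1 hj) ha (hf j (Finset.mem_range.1 hj))).trans ?_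
  simp

theorem Pay_congr {f g : ℕ → ℕ} {s a : ℕ}
    (h : ∀ j < d.n, d.edgePay s j (f j) a = d.edgePay s j (g j) a) : d.Pay f s a = d.Pay g s a :=
  Finset.sum_congr rfl fun j hj => h j (Finset.mem_range.1 hj)

/-- If all neighbours of `c` are in `Y`, then the payoffs of `c` depend only on the strategies
in `Y`. -/
theorem Pay_eq_of_closed (hw : d.Wf D) {f g : ℕ → ℕ} {c a : ℕ} {Y : Set ℕ} (hc : c < d.n)
    (ha : a < d.m) (hcY : c ∈ Y) (hY : ∀ j, d.adj c j → j ∈ Y) (h : ∀ j < d.n, j ∈ Y → f j = g j) :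
    d.Pay f c a = d.Pay g c a := by
  refine Pay_congr fun j hj => ?_
  by_cases hjY : j ∈ Y
  · rw [h j hj hjY]
  · rw [edgePay_eq_zero hw _ hc hj ha (fun h => hjY (h ▸ hcY)) (fun h => hjY (hY j h)),
      edgePay_eq_zero hw _ hc hj ha (fun h => hjY (h ▸ hcY)) (fun h => hjY (hY j h))]

/-- Inclusion and exclusion: payoffs are sums over players, and players without a strategy
contribute nothing. The overlap is added on the left to avoid subtraction of natural numbers. -/
theorem Pay_union (hw : d.Wf D) {h f g : ℕ → ℕ} {X Y : Set ℕ} (s a : ℕ)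
    (hX : ∀ j < d.n, j ∈ X → h j = f j) (hY : ∀ j < d.n, j ∈ Y → h j = g j)
    (hh : ∀ j < d.n, j ∉ X → j ∉ Y → h j = 0) (hf : ∀ j < d.n, j ∉ X → f j = 0)
    (hg : ∀ j < d.n, j ∉ Y → g j = 0) :
    d.Pay h s a + d.Pay (restr h (X ∩ Y)) s a = d.Pay f s a + d.Pay g s a := by
  unfold Pay
  rw [← Finset.sum_add_distrib, ← Finset.sum_add_distrib]
  refine Finset.sum_congr rfl fun j hj => ?_
  have hj := Finset.mem_range.1 hj
  by_cases h1 : j ∈ X <;> by_cases h2 : j ∈ Y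
  · rw [restr_of_mem (show j ∈ X ∩ Y from ⟨h1, h2⟩), ← hX j hj h1, ← hY j hj h2]
  · rw [restr_of_notMem fun h => h2 h.2, hg j hj h2, hX j hj h1]
  · rw [restr_of_notMem fun h => h1 h.1, hf j hj h1, hY j hj h2, edgePay_zero hw, Nat.zero_add,
      Nat.add_zero]
  · rw [restr_of_notMem fun h => h1 h.1, hf j hj h1, hg j hj h2, hh j hj h1 h2]

/-- The step of the dynamic program: partial profiles that represent the restrictions of `z` to
`X` and `Y` can be merged. -/
theorem merge_complete (hw : d.Wf D) {f g z : ℕ → ℕ} {X Y β P : Set ℕ}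
    (hf : d.IsOn f X) (hg : d.IsOn g Y) (hXY : X ∩ Y ⊆ β)
    (hfz : ∀ s < d.n, s ∈ β → d.AgreeAt f (restr z X) s)
    (hgz : ∀ s < d.n, s ∈ β → d.AgreeAt g (restr z Y) s)
    (hfc : ∀ c < d.n, c ∈ X → c ∈ P → d.Sat (f c) (d.Pay f c) ∧ ∀ j, d.adj c j → j ∈ X)
    (hgc : ∀ c < d.n, c ∈ Y → c ∈ P → d.Sat (g c) (d.Pay g c) ∧ ∀ j, d.adj c j → j ∈ Y) :
    (∀ j < d.n, f j = 0 ∨ g j = 0 ∨ f j = g j) ∧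
    (∀ c < d.n, c ∈ P → merge f g c = 0 ∨ d.Sat (merge f g c) (d.Pay (merge f g) c)) ∧
    ∀ s < d.n, s ∈ β → d.AgreeAt (merge f g) (restr z (X ∪ Y)) s := by
  -- The overlap lies in β, where both partial profiles use the strategies of z. So they are
  -- compatible, and the merged profile extends both.
  have hcap : ∀ j < d.n, j ∈ X → j ∈ Y → f j = z j ∧ g j = z j := fun j hj h1 h2 => by
    have h3 := (hfz j hj (hXY ⟨h1, h2⟩)).1
    have h4 := (hgz j hj (hXY ⟨h1, h2⟩)).1
    rw [restr_of_mem h1] at h3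
    rw [restr_of_mem h2] at h4
    exact ⟨h3, h4⟩
  have hmX : ∀ j < d.n, j ∈ X → merge f g j = f j := fun j hj h1 => if_neg (hf.ne_zero hj h1)
  have hmY : ∀ j < d.n, j ∈ Y → merge f g j = g j := fun j hj h1 => by
    by_cases h2 : j ∈ X
    · rw [hmX j hj h2, (hcap j hj h2 h1).1, (hcap j hj h2 h1).2]
    · exact if_pos (hf.eq_zero hj h2)
  have hm0 : ∀ j < d.n, j ∉ X → j ∉ Y → merge f g j = 0 := fun j hj h1 h2 => by
    unfold merge
    rw [if_pos (hf.eq_zero hj h1), hg.eq_zero hj h2]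
  have hsat : ∀ (h : ℕ → ℕ) (Z : Set ℕ), (∀ j < d.n, j ∈ Z → merge f g j = h j) →
      (∀ c < d.n, c ∈ Z → c ∈ P → d.Sat (h c) (d.Pay h c) ∧ ∀ j, d.adj c j → j ∈ Z) →
      ∀ c < d.n, c ∈ P → c ∈ Z → d.Sat (merge f g c) (d.Pay (merge f g) c) := by
    intro h Z h1 h2 c hc hP hZ
    obtain ⟨h3, h4⟩ := h2 c hc hZ hP
    rw [h1 c hc hZ]
    exact h3.congr fun a ha => (Pay_eq_of_closed hw hc ha hZ h4 h1).symm
  refine ⟨fun j hj => ?_, fun c hc hP => ?_, fun s hs hβ => ⟨?_, fun a ha => ?_⟩⟩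
  · by_cases h1 : j ∈ X
    · by_cases h2 : j ∈ Y
      · exact Or.inr (Or.inr ((hcap j hj h1 h2).1.trans (hcap j hj h1 h2).2.symm))
      · exact Or.inr (Or.inl (hg.eq_zero hj h2))
    · exact Or.inl (hf.eq_zero hj h1)
  · by_cases h1 : c ∈ X
    · exact Or.inr (hsat f X hmX hfc c hc hP h1)
    · by_cases h2 : c ∈ Y
      · exact Or.inr (hsat g Y hmY hgc c hc hP h2)
      · exact Or.inl (hm0 c hc h1 h2)
  · by_cases h1 : s ∈ X
    · rw [hmX s hs h1, restr_of_mem (Or.inl h1), (hfz s hs hβ).1, restr_of_mem h1]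
    · by_cases h2 : s ∈ Y
      · rw [hmY s hs h2, restr_of_mem (Or.inr h2), (hgz s hs hβ).1, restr_of_mem h2]
      · rw [hm0 s hs h1 h2, restr_of_notMem]
        rintro (h | h)
        · exact h1 h
        · exact h2 h
  -- Inclusion and exclusion is applied to the merged profile and to the restrictions of z. On the
  -- overlap the profiles coincide, so the corrections cancel.
  · have e1 := Pay_union hw s a hmX hmY hm0 (fun j hj => hf.eq_zero hj)
      (fun j hj => hg.eq_zero hj)
    have e2 := Pay_union hw (h := restr z (X ∪ Y)) (f := restr z X) (g := restr z Y) (X := X)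
      (Y := Y) s a (fun j _ h1 => by rw [restr_of_mem (Or.inl h1), restr_of_mem h1])
      (fun j _ h1 => by rw [restr_of_mem (Or.inr h1), restr_of_mem h1])
      (fun j _ h1 h2 => restr_of_notMem fun h => h.elim h1 h2)
      (fun j _ h1 => restr_of_notMem h1) (fun j _ h1 => restr_of_notMem h1)
    have e3 : d.Pay (restr (merge f g) (X ∩ Y)) s a = d.Pay (restr (restr z (X ∪ Y)) (X ∩ Y)) s a :=
      Pay_congr fun j hj => by
        by_cases h1 : j ∈ X ∩ Y
        · rw [restr_of_mem h1, restr_of_mem h1, restr_of_mem (Or.inl h1.1), hmX j hj h1.1,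
            (hcap j hj h1.1 h1.2).1]
        · rw [restr_of_notMem h1, restr_of_notMem h1]
    rw [(hfz s hs hβ).2 a ha, (hgz s hs hβ).2 a ha] at e1
    omega

/-- A table for the position `t`: the partial profiles are defined on `X`, the players in `X` after
`t` are satisfied, and every solution is represented. -/
structure IsTable (d : Data) (bag : ℕ → Prop) (t : ℕ) (𝓐 : Set (ℕ → ℕ)) (X : Set ℕ) : Prop where
  isOn : ∀ f ∈ 𝓐, d.IsOn f X
  sat : ∀ f ∈ 𝓐, ∀ c < d.n, c ∈ X → t < d.pos c → d.Sat (f c) (d.Pay f c)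
  complete : ∀ z, d.Solution z → ∃ f ∈ 𝓐, ∀ s < d.n, bag s → d.AgreeAt f (restr z X) s

/-- The table `𝓒` consists of merged partial profiles, one for every equivalence class. -/
structure IsJoin (d : Data) (bag : ℕ → Prop) (t : ℕ) (𝓐 𝓑 𝓒 : Set (ℕ → ℕ)) : Prop where
  sound : ∀ h ∈ 𝓒, (∃ f ∈ 𝓐, ∃ g ∈ 𝓑, ∀ j < d.n, h j = merge f g j) ∧
    ∀ c < d.n, t < d.pos c → h c = 0 ∨ d.Sat (h c) (d.Pay h c)
  complete : ∀ f ∈ 𝓐, ∀ g ∈ 𝓑, (∀ j < d.n, f j = 0 ∨ g j = 0 ∨ f j = g j) →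
    (∀ c < d.n, t < d.pos c → merge f g c = 0 ∨ d.Sat (merge f g c) (d.Pay (merge f g) c)) →
    ∃ h ∈ 𝓒, ∀ s < d.n, bag s → d.AgreeAt h (merge f g) s

/-- Players after t have all their neighbours on their own side, so merging does not alter their
payoffs and the merged representatives of a solution pass the satisfaction test. Their class is kept
by the join, and equivalence is transitive. -/
theorem IsTable.join (hw : d.Wf D) {bag : ℕ → Prop} {t : ℕ} {𝓐 𝓑 𝓒 : Set (ℕ → ℕ)} {X Y : Set ℕ}
    (hA : d.IsTable bag t 𝓐 X) (hJ : d.IsJoin bag t 𝓐 𝓑 𝓒) (hB : ∀ g ∈ 𝓑, d.IsOn g Y)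
    (hXY : ∀ j ∈ X, j ∈ Y → bag j)
    (hX : ∀ c ∈ X, t < d.pos c → ∀ j, d.adj c j → j ∈ X)
    (hY : ∀ c ∈ Y, t < d.pos c → ∀ j, d.adj c j → j ∈ Y)
    (hBc : ∀ z, d.Solution z → ∃ g ∈ 𝓑, (∀ s < d.n, bag s → d.AgreeAt g (restr z Y) s) ∧
      ∀ c < d.n, c ∈ Y → t < d.pos c → d.Sat (g c) (d.Pay g c)) :
    d.IsTable bag t 𝓒 (X ∪ Y) where
  isOn h hh := by
    obtain ⟨⟨f, hf, g, hg, he⟩, -⟩ := hJ.sound h hh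
    have := (hA.isOn f hf).merge (hB g hg)
    intro j hj
    rw [he j hj]
    exact this j hj
  sat h hh c hc hcX hct := by
    obtain ⟨⟨f, hf, g, hg, he⟩, h2⟩ := hJ.sound h hh
    rcases h2 c hc hct with h3 | h3
    · have := ((hA.isOn f hf).merge (hB g hg)).ne_zero hc hcX
      rw [← he c hc] at this
      exact absurd h3 this
    · exact h3
  complete z hz := by
    obtain ⟨f, hf, hfz⟩ := hA.complete z hz
    obtain ⟨g, hg, hgz, hgs⟩ := hBc z hz
    obtain ⟨h1, h2, h3⟩ := merge_complete hw (β := {s | bag s}) (P := {c | t < d.pos c})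
      (hA.isOn f hf) (hB g hg) (fun j hj => hXY j hj.1 hj.2) hfz hgz
      (fun c hc hcX hct => ⟨hA.sat f hf c hc hcX hct, hX c hcX hct⟩)
      (fun c hc hcX hct => ⟨hgs c hc hcX hct, hY c hcX hct⟩)
    obtain ⟨h, hh, h4⟩ := hJ.complete f hf g hg h1 h2
    exact ⟨h, hh, fun s hs hb => (h4 s hs hb).trans (h3 s hs hb)⟩

open Classical in
/-- Partial profiles that are pairwise inequivalent are few. -/
theorem length_le (hw : d.Wf D) {bag : ℕ → Prop} {N : ℕ} (hN : {j | j < d.n ∧ bag j}.ncard ≤ N)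
    (F : ℕ → ℕ → ℕ) (l : ℕ) (hF : ∀ r < l, ∀ j < d.n, F r j ≤ d.K)
    (hne : ∀ r < l, ∀ r' < l, r < r' → ¬ ∀ s < d.n, bag s → d.AgreeAt (F r) (F r') s) :
    l ≤ ((d.K + 1) * (d.n * (2 * d.k * d.k) + 1) ^ d.m) ^ N := by
  let S : Finset ℕ := (Finset.range d.n).filter bag
  have hS : ∀ s ∈ S, s < d.n ∧ bag s := fun s hs => by simpa [S] using hs
  have hSN : S.card ≤ N := by
    refine le_of_eq_of_le ?_ hN
    rw [← Set.ncard_coe_finset]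
    congr 1
    ext j
    simp [S]
  -- A class is determined by one of K + 1 strategy numbers and m payoffs between 0 and n·2k² for
  -- every player of the bag.
  let Φ : Fin l → (S → Fin (d.K + 1) × (Fin d.m → Fin (d.n * (2 * d.k * d.k) + 1))) := fun r s =>
    (⟨F r s, Nat.lt_succ_of_le (hF r r.2 s (hS s s.2).1)⟩, fun a =>
      ⟨d.Pay (F r) s a, Nat.lt_succ_of_le (Pay_le hw (hS s s.2).1 a.2 (hF r r.2))⟩)
  have key : ∀ r r' : Fin l, Φ r = Φ r' → ¬ r.val < r'.val := by
    intro r r' he hlt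
    refine hne r r.2 r' r'.2 hlt fun s hs hb => ?_
    have h1 := congrFun he ⟨s, by simp [S, hs, hb]⟩
    simp only [Φ, Prod.mk.injEq, Fin.mk.injEq] at h1
    refine ⟨h1.1, fun a ha => ?_⟩
    have := congrFun h1.2 ⟨a, ha⟩
    simpa using this
  have hinj : Function.Injective Φ := fun r r' he => by
    have h1 := key r r' he
    have h2 := key r' r he.symm
    exact Fin.ext (by omega)
  have := Fintype.card_le_of_injective Φ hinj
  simp only [Fintype.card_fin, Fintype.card_pi, Fintype.card_prod, Finset.prod_const,
    Finset.card_univ, Fintype.card_coe] at this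
  exact this.trans (Nat.pow_le_pow_right (by positivity) hSN)

/-- The table of a child, seen from the parent. -/
theorem IsTable.child (hw : d.Wf D) {t₀ t t' : ℕ} {bag : ℕ → ℕ → Prop} {par : ℕ → ℕ}
    (ht : d.BagTree t₀ bag par) (h1 : t₀ ≤ t) (htt : t < t') (hn : t' ≤ d.n) (hp : par t' = t)
    {𝓑 : Set (ℕ → ℕ)} (hB : d.IsTable (bag t') t' 𝓑 (d.span bag par t')) (z : ℕ → ℕ)
    (hz : d.Solution z) :
    ∃ g ∈ 𝓑, (∀ s < d.n, bag t s → d.AgreeAt g (restr z (d.span bag par t')) s) ∧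
      ∀ c < d.n, c ∈ d.span bag par t' → t < d.pos c → d.Sat (g c) (d.Pay g c) := by
  obtain ⟨g, hg, h⟩ := hB.complete z hz
  have hon := hB.isOn g hg
  have hadj : ∀ c < d.n, c ∈ d.span bag par t' → t < d.pos c → ∀ j, d.adj c j →
      j ∈ d.span bag par t' := fun c hc hcs hlt j ha =>
    ht.span_of_adj hw (by omega) hc (ht.desc_of_span h1 htt hn hp hcs hlt) ha
  refine ⟨g, hg, fun s hs hb => ?_, fun c hc hcs hlt => ?_⟩
  · have hst : d.pos s ≤ t := ht.pos_le h1 (by omega) hs hb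
    by_cases hsp : s ∈ d.span bag par t'
    · exact h s hs (ht.bag_of_span (by omega) hn hsp (by omega))
    -- Here s lies outside the span of the child, so only contributions from the span to his payoffs
    -- matter. A neighbour of s inside the span cannot be later than t', since then s would be in
    -- the span as well. He is thus in the bag of t', where g and z agree.
    · refine ⟨by rw [hon.eq_zero hs hsp, restr_of_notMem hsp], fun a ha => Pay_congr fun j hj => ?_⟩
      by_cases hj' : j ∈ d.span bag par t'
      · by_cases hle : d.pos j ≤ t'
        · rw [(h j hj (ht.bag_of_span (by omega) hn hj' hle)).1]
        · have hna : ¬ d.adj s j := fun ha' =>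
            hsp (hadj j hj hj' (by omega) s (hw.symm _ _ ha'))
          have hne : s ≠ j := fun he => hsp (he ▸ hj')
          rw [edgePay_eq_zero hw _ hs hj ha hne hna, edgePay_eq_zero hw _ hs hj ha hne hna]
      · rw [hon.eq_zero hj hj', restr_of_notMem hj']
  · by_cases hle : t' < d.pos c
    · exact hB.sat g hg c hc hcs hle
    · have h2 := h c hc (ht.bag_of_span (by omega) hn hcs (by omega))
      rw [h2.1, restr_of_mem hcs]
      refine (hz c hc).2.2.congr fun a ha => ?_
      rw [h2.2 a ha]
      exact Pay_eq_of_closed hw hc ha hcs (hadj c hc hcs hlt) fun j _ hj => (restr_of_mem hj).symm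

end RAM.Algo.Data

/-! ### Data in memory and the values of the tests -/

namespace RAM.Algo

open X Polymatrix Data

/-- The expression has the value `v`, also if more variables are in scope. -/
def Stable (B : ℕ) (σ : State) (ρ : List ℕ) (e : X) (v : ℕ) : Prop :=
  ∀ l, e.Bdd B σ (ρ ++ l) ∧ e.eval σ (ρ ++ l) = v

theorem Stable.append {B : ℕ} {σ : State} {ρ : List ℕ} {e : X} {v : ℕ} (h : Stable B σ ρ e v)
    (l : List ℕ) : Stable B σ (ρ ++ l) e v := fun l' => by
  rw [List.append_assoc]; exact h _

theorem Stable.here {B : ℕ} {σ : State} {ρ : List ℕ} {e : X} {v : ℕ} (h : Stable B σ ρ e v) :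
    e.Bdd B σ ρ ∧ e.eval σ ρ = v := by
  have := h []
  rwa [List.append_nil] at this

theorem Stable.var_length (B : ℕ) (σ : State) (ρ : List ℕ) (j : ℕ) (l : List ℕ) {x : ℕ}
    (hx : x = ρ.length) : Stable B σ (ρ ++ j :: l) (.var x) j := fun l' => by
  subst hx
  simp

/-- The memory holds the data. -/
structure Data.Holds (d : Data) (σ : State) : Prop where
  n : σ.nat 0 0 = d.n
  m : σ.nat 0 1 = d.m
  k : σ.nat 2 0 = d.k
  K : σ.nat 5 0 = d.K
  J : σ.nat 3 = d.J
  C : σ.nat 4 = d.C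
  pos : σ.nat 8 = d.pos
  ord : σ.nat 10 = d.ord
  adj : ∀ i < d.n, ∀ j < d.n, σ.nat 1 (i * d.n + j) ≠ 0 ↔ d.adj i j

theorem Data.Holds.congr {d : Data} {σ τ : State} (h : d.Holds σ)
    (hf : ∀ b < 15, τ.nat b = σ.nat b) : d.Holds τ where
  n := by rw [hf 0 (by simp), h.n]
  m := by rw [hf 0 (by simp), h.m]
  k := by rw [hf 2 (by simp), h.k]
  K := by rw [hf 5 (by simp), h.K]
  J := by rw [hf 3 (by simp), h.J]
  C := by rw [hf 4 (by simp), h.C]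
  pos := by rw [hf 8 (by simp), h.pos]
  ord := by rw [hf 10 (by simp), h.ord]
  adj := by rw [hf 1 (by simp)]; exact h.adj

/-- The partial profile in row `r` of the pool. -/
def row (n : ℕ) (σ : State) (r : ℕ) : ℕ → ℕ := fun j => if j < n then σ.nat 15 (r * n + j) else 0

theorem row_of_lt {n r j : ℕ} {σ : State} (h : j < n) : row n σ r j = σ.nat 15 (r * n + j) :=
  if_pos h

theorem cell_lt {n r j T : ℕ} (hj : j < n) (hr : r < T) : r * n + j < T * n := by
  have := Nat.mul_le_mul_right n (show r + 1 ≤ T from hr)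
  rw [add_mul] at this
  omega

theorem row_congr {n r T : ℕ} {σ τ : State} (h : ∀ c < T * n, τ.nat 15 c = σ.nat 15 c) (hr : r < T) :
    row n τ r = row n σ r := by
  funext j
  unfold row
  split_ifs with hj
  · exact h _ (cell_lt hj hr)
  · rfl

section Eval

variable {d : Data} {B : ℕ} {σ : State} {ρ : List ℕ} {r r' s a c t : X} {rv rv' sv av cv tv x : ℕ}

theorem eval_value (hd : d.Holds σ) (hnB : d.n ≤ B) (hmB : d.m ≤ B) (hx : x = ρ.length)
    (hr : Stable B σ ρ r rv) (hs : Stable B σ ρ s sv) (ha : Stable B σ ρ a av) :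
    (value r s a x).Bdd B σ ρ ∧ (value r s a x).eval σ ρ = d.Pay (row d.n σ rv) sv av := by
  subst hx
  constructor
  · simp [value, Algo.n, Algo.m, pay, cnt, wit, hd.n, hd.m, hnB, hmB, (hr _).1, (hs _).1, (ha _).1]
  · simp [value, Algo.n, Algo.m, pay, cnt, wit, hd.n, hd.m, (hr _).2, (hs _).2, (ha _).2, Data.Pay,
      Data.edgePay, hd.J, hd.C]
    exact Finset.sum_congr rfl fun j hj => by rw [row_of_lt (Finset.mem_range.1 hj)]

theorem eval_sat (hd : d.Holds σ) (hnB : d.n ≤ B) (hmB : d.m ≤ B) (hx : x = ρ.length)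
    (hr : Stable B σ ρ r rv) (hc : Stable B σ ρ c cv) (hcv : cv < d.n) :
    (sat r c x).Bdd B σ ρ ∧ (sat r c x).eval σ ρ =
      ind (d.Sat (row d.n σ rv cv) (d.Pay (row d.n σ rv) cv)) := by
  have h1 : ∀ b, _ := fun b => eval_value (x := x + 1) (ρ := ρ ++ [b]) hd hnB hmB (by simp [hx])
    (hr.append [b]) (hc.append [b]) (.var_length B σ ρ b [] hx)
  have h2 : ∀ b b', _ := fun b b' => eval_value (x := x + 2) (ρ := ρ ++ [b, b']) (a := .var (x + 1))
    (av := b') hd hnB hmB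
    (by simp [hx]) (hr.append [b, b']) (hc.append [b, b']) (fun l => by simp [hx])
  subst hx
  constructor
  · simp [sat, Algo.n, Algo.m, Algo.k, cnt, wit, hd.m, hmB, (hr _).1, (hc _).1, (h1 _).1,
      (h2 _ _).1]
  · simp [sat, Algo.n, Algo.m, Algo.k, cnt, wit, hd.n, hd.m, hd.k, hd.C, (hr _).2, (hc _).2,
      (h1 _).2, (h2 _ _).2, Data.Sat, row_of_lt hcv]

theorem eval_satAll (hd : d.Holds σ) (hnB : d.n ≤ B) (hmB : d.m ≤ B) (hx : x = ρ.length)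
    (hr : Stable B σ ρ r rv) (ht : Stable B σ ρ t tv) :
    (satAll r t x).Bdd B σ ρ ∧ (satAll r t x).eval σ ρ = ind (∀ c < d.n, tv < d.pos c →
      row d.n σ rv c = 0 ∨ d.Sat (row d.n σ rv c) (d.Pay (row d.n σ rv) c)) := by
  have h1 : ∀ b, b < d.n → _ := fun b hb => eval_sat (x := x + 1) (ρ := ρ ++ [b]) hd hnB hmB
    (by simp [hx]) (hr.append [b]) (.var_length B σ ρ b [] hx) hb
  subst hx
  constructor
  · simp +contextual [satAll, Algo.n, wit, Algo.pos, hd.n, hnB, (hr _).1, (ht _).1, h1]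
  · simp only [satAll, Algo.n, wit, Algo.pos, hd.n, hd.pos, eval_all, eval_lt, eval_get, eval_ofNat,
      eval_add, eval_le, eval_not, eval_mul, (hr _).2, (ht _).2]
    refine ind_congr (forall_congr' fun c => forall_congr' fun hc => ?_)
    have h3 : (var ρ.length).eval σ (ρ ++ [c]) = c := by simp
    rw [(h1 c hc).2, h3, row_of_lt hc]
    simp only [ne_eq, ind_eq_zero, not_not, Nat.pos_iff_ne_zero, Nat.add_eq_zero_iff]
    rw [← not_le]
    tauto

theorem eval_equiv (hd : d.Holds σ) (hnB : d.n ≤ B) (hmB : d.m ≤ B) (hx : x = ρ.length)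
    (hr : Stable B σ ρ r rv) (hr' : Stable B σ ρ r' rv') (ht : Stable B σ ρ t tv) :
    (equiv r r' t x).Bdd B σ ρ ∧ (equiv r r' t x).eval σ ρ = ind (∀ s < d.n,
      σ.nat 19 (tv * d.n + s) ≠ 0 → d.AgreeAt (row d.n σ rv) (row d.n σ rv') s) := by
  have h1 : ∀ b b', _ := fun b b' => eval_value (x := x + 2) (ρ := ρ ++ [b, b']) (a := .var (x + 1))
    (av := b') hd hnB hmB
    (by simp [hx]) (hr.append [b, b']) (.var_length B σ ρ b [b'] hx) (fun l => by simp [hx])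
  have h2 : ∀ b b', _ := fun b b' => eval_value (x := x + 2) (ρ := ρ ++ [b, b']) (a := .var (x + 1))
    (av := b') hd hnB hmB
    (by simp [hx]) (hr'.append [b, b']) (.var_length B σ ρ b [b'] hx) (fun l => by simp [hx])
  subst hx
  constructor
  · simp [equiv, Algo.n, Algo.m, wit, Algo.bag, hd.n, hd.m, hnB, hmB, (hr _).1, (hr' _).1, (ht _).1,
      (h1 _ _).1, (h2 _ _).1]
  · simp only [equiv, Algo.n, Algo.m, wit, Algo.bag, hd.n, hd.m, eval_all, eval_lt, eval_get,
      eval_ofNat, eval_eq, eval_add, eval_not, eval_mul, (hr _).2, (hr' _).2, (ht _).2,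
      List.append_assoc, List.cons_append, List.nil_append, (h1 _ _).2, (h2 _ _).2]
    refine ind_congr (forall_congr' fun c => forall_congr' fun hc => ?_)
    have h3 : (var ρ.length).eval σ (ρ ++ [c]) = c := by simp
    rw [h3, ← row_of_lt hc, ← row_of_lt hc, ind_mul_ind]
    simp only [ne_eq, ind_eq_zero, not_not, Nat.pos_iff_ne_zero, Nat.add_eq_zero_iff,
      Data.AgreeAt]
    tauto

theorem eval_compat (hd : d.Holds σ) (hnB : d.n ≤ B) (hx : x = ρ.length)
    (hr : Stable B σ ρ r rv) (hr' : Stable B σ ρ r' rv') :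
    (compat r r' x).Bdd B σ ρ ∧ (compat r r' x).eval σ ρ = ind (∀ j < d.n,
      row d.n σ rv j = 0 ∨ row d.n σ rv' j = 0 ∨ row d.n σ rv j = row d.n σ rv' j) := by
  subst hx
  constructor
  · simp [compat, Algo.n, wit, hd.n, hnB, (hr _).1, (hr' _).1]
  · simp only [compat, Algo.n, wit, hd.n, eval_all, eval_lt, eval_get,
      eval_ofNat, eval_eq, eval_add, eval_not, eval_mul, (hr _).2, (hr' _).2]
    refine ind_congr (forall_congr' fun c => forall_congr' fun hc => ?_)
    have h3 : (var ρ.length).eval σ (ρ ++ [c]) = c := by simp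
    rw [h3, ← row_of_lt hc, ← row_of_lt hc]
    simp only [ne_eq, ind_eq_zero, not_not, Nat.pos_iff_ne_zero, Nat.add_eq_zero_iff]
    tauto

end Eval

end RAM.Algo

/-! ### Computing the join of two tables -/

namespace RAM.Algo

open X Polymatrix Data

variable {d : Data} {D B : ℕ} {σ τ : State}

theorem Data.merge_le {K : ℕ} {f g : ℕ → ℕ} {j : ℕ} (hf : f j ≤ K) (hg : g j ≤ K) :
    merge f g j ≤ K := by
  unfold merge; split_ifs <;> assumption

/-- The invariant of the computation of a join; the tables are at rows `lA, …, lA + nA - 1` and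
`lB, …, lB + nB - 1`. -/
structure JoinInv (d : Data) (bag : ℕ → Prop) (t lA nA lB nB : ℕ) (σ : State)
    (done : ℕ → ℕ → Prop) (τ : State) : Prop where
  frame : ∀ b, b ≠ 15 → b ≠ 16 → τ.nat b = σ.nat b
  old : ∀ c < σ.nat 16 0 * d.n, τ.nat 15 c = σ.nat 15 c
  top : σ.nat 16 0 ≤ τ.nat 16 0
  sound : ∀ r, σ.nat 16 0 ≤ r → r < τ.nat 16 0 →
    (∃ p < nA, ∃ q < nB, row d.n τ r = merge (row d.n σ (lA + p)) (row d.n σ (lB + q))) ∧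
    ∀ c < d.n, t < d.pos c → row d.n τ r c = 0 ∨ d.Sat (row d.n τ r c) (d.Pay (row d.n τ r) c)
  ineq : ∀ r r', σ.nat 16 0 ≤ r → r < r' → r' < τ.nat 16 0 →
    ¬ ∀ s < d.n, bag s → d.AgreeAt (row d.n τ r) (row d.n τ r') s
  complete : ∀ p < nA, ∀ q < nB, done p q →
    (∀ j < d.n, row d.n σ (lA + p) j = 0 ∨ row d.n σ (lB + q) j = 0 ∨
      row d.n σ (lA + p) j = row d.n σ (lB + q) j) →
    (∀ c < d.n, t < d.pos c → merge (row d.n σ (lA + p)) (row d.n σ (lB + q)) c = 0 ∨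
      d.Sat (merge (row d.n σ (lA + p)) (row d.n σ (lB + q)) c)
        (d.Pay (merge (row d.n σ (lA + p)) (row d.n σ (lB + q))) c)) →
    ∃ r, σ.nat 16 0 ≤ r ∧ r < τ.nat 16 0 ∧ ∀ s < d.n, bag s →
      d.AgreeAt (row d.n τ r) (merge (row d.n σ (lA + p)) (row d.n σ (lB + q))) s

section Step

variable {bag : ℕ → Prop} {t lA nA lB nB : ℕ} {done done' : ℕ → ℕ → Prop}

/-- The rows produced so far are pairwise inequivalent at every moment, so the bound on the number
of classes also applies to an unfinished join. It limits the search for equivalent rows. -/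
theorem JoinInv.card_le {N : ℕ} (hw : d.Wf D) (hN : {j | j < d.n ∧ bag j}.ncard ≤ N)
    (hA : ∀ p < nA, ∀ j < d.n, row d.n σ (lA + p) j ≤ d.K)
    (hB : ∀ q < nB, ∀ j < d.n, row d.n σ (lB + q) j ≤ d.K)
    (h : JoinInv d bag t lA nA lB nB σ done τ) : τ.nat 16 0 - σ.nat 16 0 ≤
      ((d.K + 1) * (d.n * (2 * d.k * d.k) + 1) ^ d.m) ^ N := by
  refine length_le hw hN (fun r => row d.n τ (σ.nat 16 0 + r)) _ (fun r hr j hj => ?_)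
    fun r hr r' hr' hlt => h.ineq _ _ (by omega) (by omega) (by omega)
  obtain ⟨⟨p, hp, q, hq, he⟩, -⟩ := h.sound (σ.nat 16 0 + r) (by omega) (by omega)
  rw [he]
  exact Data.merge_le (hA p hp j hj) (hB q hq j hj)

theorem JoinInv.mono (h : JoinInv d bag t lA nA lB nB σ done τ)
    (hd : ∀ p < nA, ∀ q < nB, done' p q → done p q) : JoinInv d bag t lA nA lB nB σ done' τ :=
  { h with complete := fun p hp q hq hdo => h.complete p hp q hq (hd p hp q hq hdo) }

/-- The merged profile is written to the first free row of the pool, where it can be tested like any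
other row. It becomes part of the table only when `top` is increased; otherwise the row may be
overwritten later. -/
theorem R_joinStep (hB1 : 1 ≤ B) (hnB : d.n ≤ B) (hmB : d.m ≤ B) (hd : d.Holds σ)
    {i s p q : ℕ} {l t' : X} (hp : p < nA) (hq : q < nB)
    (hlA : lA + nA ≤ σ.nat 16 0) (hlB : lB + nB ≤ σ.nat 16 0)
    (h21 : σ.nat 21 0 = lA) (h23 : σ.nat 23 0 = σ.nat 16 0)
    (hl : ∀ τ : State, (∀ b, b ≠ 15 → b ≠ 16 → τ.nat b = σ.nat b) → Stable B τ [i, s] l lB)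
    (ht : ∀ τ : State, (∀ b, b ≠ 15 → b ≠ 16 → τ.nat b = σ.nat b) → Stable B τ [i, s] t' t)
    (hcard : τ.nat 16 0 - σ.nat 16 0 ≤ B)
    (h : JoinInv d (fun s => σ.nat 19 (t * d.n + s) ≠ 0) t lA nA lB nB σ done τ) :
    R B (
      let r := curLo + var 2; let r' := l + var 3
      .ite (.nz (compat r r' 4))
        (.seq (.for Algo.n <| .setN 15 (Algo.top * Algo.n + var 4)
            (wit r (var 4) + not (wit r (var 4)) * wit r' (var 4))) <|
          .ite (.nz (satAll Algo.top t' 4 *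
              not (ex (Algo.top - newLo) (equiv (newLo + var 4) Algo.top t' 5))))
            (.setN 16 0 (Algo.top + 1)) .skip)
        .skip) [i, s, p, q] τ
      (JoinInv d (fun s => σ.nat 19 (t * d.n + s) ≠ 0) t lA nA lB nB σ
        (fun p' q' => done p' q' ∨ p' = p ∧ q' = q)) := by
  have hR : ∀ υ : State, (∀ b, b ≠ 15 → b ≠ 16 → υ.nat b = σ.nat b) →
      Stable B υ [i, s, p, q] (curLo + var 2) (lA + p) := fun υ hυ l' => by
    simp [curLo, hυ 21 (by simp) (by simp), h21]
  have hR' : ∀ υ : State, (∀ b, b ≠ 15 → b ≠ 16 → υ.nat b = σ.nat b) →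
      Stable B υ [i, s, p, q] (l + var 3) (lB + q) := fun υ hυ l' => by
    have := hl υ hυ ([p, q] ++ l')
    simp only [List.cons_append, List.nil_append] at this
    simp [this.1, this.2]
  have hT : ∀ υ : State, (∀ b, b ≠ 15 → b ≠ 16 → υ.nat b = σ.nat b) →
      Stable B υ [i, s, p, q] t' t := fun υ hυ => (ht υ hυ).append [p, q]
  have hH : ∀ υ : State, (∀ b, b ≠ 15 → b ≠ 16 → υ.nat b = σ.nat b) → d.Holds υ :=
    fun υ hυ => hd.congr fun b hb => hυ b (by omega) (by omega)
  have hf := h.frame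
  have htop := h.top
  obtain ⟨T, hTop⟩ : ∃ T, τ.nat 16 0 = T := ⟨_, rfl⟩
  have hrA : row d.n τ (lA + p) = row d.n σ (lA + p) := row_congr h.old (by omega)
  have hrB : row d.n τ (lB + q) = row d.n σ (lB + q) := row_congr h.old (by omega)
  set f := row d.n σ (lA + p) with hfdef
  set g := row d.n σ (lB + q) with hgdef
  have hcomp := eval_compat (x := 4) (hH τ hf) hnB rfl (hR τ hf) (hR' τ hf)
  rw [hrA, hrB] at hcomp
  refine R.ite hB1 (by simpa using hcomp.1) (fun hb => ?_) (fun hb => ?_) <;>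
    rw [Tst.holds_nz, hcomp.2, ne_eq, ind_eq_zero, not_not] at hb
  · refine R.seq hB1 ((Fills.for (a := 15) hB1 d.n (by simp [Algo.n])
      (by simp [Algo.n, (hH τ hf).n]) hnB (fun j => {T * d.n + j}) (fun c => merge f g (c % d.n))
      fun j hj => Fills.setN hB1 ?_ ?_ ?_ ?_).mono ?_)
    · simp [Algo.top, Algo.n]
    · have h1 : ∀ h : ℕ → ℕ, (∀ b, b ≠ 15 → b ≠ 16 → (τ.put 15 h).nat b = σ.nat b) :=
        fun h b hb hb' => by simp [State.put_nat, hb, hf b hb hb']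
      have h2 := hR _ (h1 (patch (⋃ i < j, {T * d.n + i}) (fun c => merge f g (c % d.n))
        (τ.nat 15))) [j]
      have h3 := hR' _ (h1 (patch (⋃ i < j, {T * d.n + i}) (fun c => merge f g (c % d.n))
        (τ.nat 15))) [j]
      simp only [List.cons_append, List.nil_append] at h2 h3
      simp only [List.cons_append, List.nil_append, wit, bdd_add, bdd_get, bdd_mul, bdd_not, h2.1,
        h3.1, Algo.n, bdd_var, bdd_ofNat]
      simp
    · simp [Algo.top, Algo.n, State.put_nat, hTop, (hH τ hf).n]
    · have h1 : ∀ h : ℕ → ℕ, (∀ b, b ≠ 15 → b ≠ 16 → (τ.put 15 h).nat b = σ.nat b) :=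
        fun h b hb hb' => by simp [State.put_nat, hb, hf b hb hb']
      set P := patch (⋃ i < j, {T * d.n + i}) (fun c => merge f g (c % d.n)) (τ.nat 15) with hP
      have h2 := (hR _ (h1 P) [j]).2
      have h3 := (hR' _ (h1 P) [j]).2
      have h4 : ∀ r, r < σ.nat 16 0 → P (r * d.n + j) = row d.n σ r j := fun r hr => by
        rw [hP, patch_of_notMem, h.old _ (cell_lt hj hr), row_of_lt hj]
        simp only [Set.mem_iUnion, Set.mem_singleton_iff, not_exists]
        intro i' _ he
        have := cell_lt (n := d.n) (j := j) hj (show r < T by omega)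
        omega
      simp only [List.cons_append, List.nil_append] at h2 h3
      have h5 : (var 4).eval (τ.put 15 P) [i, s, p, q, j] = j := rfl
      have h6 : Algo.n.eval (τ.put 15 P) [i, s, p, q, j] = d.n := by
        simp [Algo.n, State.put_nat, (hH τ hf).n]
      simp only [List.cons_append, List.nil_append, wit, eval_add, eval_get, eval_mul, eval_not] at h2 h3 ⊢
      rw [h2, h3, h5, h6, State.put_nat_same, h4 _ (by omega), h4 _ (by omega),
        add_mul_mod_of_lt hj, ← hfdef, ← hgdef]
      unfold merge ind
      split_ifs with h7 <;> simp [h7]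
    rintro υ rfl
    set P := patch (⋃ i < d.n, {T * d.n + i}) (fun c => merge f g (c % d.n)) (τ.nat 15) with hP
    have hυ : ∀ b, b ≠ 15 → b ≠ 16 → (τ.put 15 P).nat b = σ.nat b :=
      fun b hb hb' => by simp [State.put_nat, hb, hf b hb hb']
    have hυ16 : (τ.put 15 P).nat 16 0 = T := by simp [State.put_nat, hTop]
    have hPold : ∀ c < T * d.n, P c = τ.nat 15 c := fun c hc => by
      rw [hP, patch_of_notMem]
      simp only [Set.mem_iUnion, Set.mem_singleton_iff, not_exists]
      intro i' _ he
      omega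
    have hrow : ∀ υ : State, υ.nat 15 = P → (∀ r < T, row d.n υ r = row d.n τ r) ∧
        row d.n υ T = merge f g := by
      intro υ hυ
      refine ⟨fun r hr => row_congr (fun c hc => by rw [hυ]; exact hPold c hc) hr, ?_⟩
      funext j
      unfold row
      split_ifs with hj
      · rw [hυ, hP, patch_of_mem, add_mul_mod_of_lt hj]
        simp only [Set.mem_iUnion]
        exact ⟨j, hj, rfl⟩
      · rw [merge, hfdef, hgdef, row, row, if_neg hj, if_neg hj]
        simp
    obtain ⟨hrow1, hrow2⟩ := hrow (τ.put 15 P) (by simp)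
    have hTT : Stable B (τ.put 15 P) [i, s, p, q] Algo.top T := fun l' => by
      simp [Algo.top, hυ16]
    have hsat := eval_satAll (x := 4) (hH _ hυ) hnB hmB rfl hTT (hT _ hυ)
    rw [hrow2] at hsat
    have heq : ∀ e, e < T - σ.nat 16 0 → _ := fun e he =>
      eval_equiv (x := 5) (ρ := [i, s, p, q, e]) (r := newLo + var 4) (rv := σ.nat 16 0 + e)
        (hH _ hυ) hnB hmB rfl (fun l' => by
          simp [newLo, hυ 23 (by simp) (by simp), h23]) (hTT.append [e]) ((hT _ hυ).append [e])
    have hex : (not (ex (Algo.top - newLo) (equiv (newLo + var 4) Algo.top t' 5))).eval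
        (τ.put 15 P) [i, s, p, q] = ind (¬ ∃ r, σ.nat 16 0 ≤ r ∧ r < T ∧ ∀ s < d.n,
          σ.nat 19 (t * d.n + s) ≠ 0 → d.AgreeAt (row d.n τ r) (merge f g) s) := by
      have e1 : Algo.top.eval (τ.put 15 P) [i, s, p, q] = T := hTT.here.2
      have e2 : newLo.eval (τ.put 15 P) [i, s, p, q] = σ.nat 16 0 := by
        simp [newLo, hυ 23 (by simp) (by simp), h23]
      rw [eval_not, eval_ex, eval_sub, e1, e2]
      refine ind_congr ?_
      rw [ind_eq_zero, not_iff_not]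
      constructor
      · rintro ⟨e, he, h1⟩
        simp only [List.cons_append, List.nil_append] at h1
        rw [(heq e he).2, hrow2, hrow1 _ (by omega), hυ 19 (by simp) (by simp), ne_eq, ind_eq_zero,
          not_not] at h1
        exact ⟨_, by omega, by omega, h1⟩
      · rintro ⟨r, hr1, hr2, h1⟩
        refine ⟨r - σ.nat 16 0, by omega, ?_⟩
        simp only [List.cons_append, List.nil_append]
        rw [(heq _ (by omega)).2, hrow2, hrow1 _ (by omega), hυ 19 (by simp) (by simp), ne_eq,
          ind_eq_zero, not_not]
        rwa [show σ.nat 16 0 + (r - σ.nat 16 0) = r by omega]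
    refine R.ite hB1 ?_ (fun hb' => ?_) (fun hb' => ?_)
    · refine ⟨hsat.1, ?_⟩
      rw [bdd_not, bdd_ex]
      refine ⟨by simp [Algo.top, newLo], ?_, fun e he => ?_⟩ <;>
        simp only [Algo.top, newLo, eval_sub, eval_get, eval_ofNat, hυ16, hυ 23 (by simp) (by simp),
          h23] at *
      · omega
      · exact (heq e he).1
    · rw [Tst.holds_nz, eval_mul, hsat.2, hex, ind_mul_ind, ne_eq, ind_eq_zero, not_not] at hb'
      refine R.setN hB1 (by simp) (by simp [Algo.top]) ?_
      have e1 : (Algo.top + 1).eval (τ.put 15 P) [i, s, p, q] = T + 1 := by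
        rw [eval_add, hTT.here.2]; rfl
      have e2 : (0 : X).eval (τ.put 15 P) [i, s, p, q] = 0 := rfl
      rw [e1, e2]
      generalize hφ : (τ.put 15 P).setNat 16 0 (T + 1) = φ
      have f16 : φ.nat 16 0 = T + 1 := by rw [← hφ]; simp
      have fb : ∀ b, b ≠ 16 → φ.nat b = (τ.put 15 P).nat b := fun b hb => by
        rw [← hφ, setNat_nat_of_ne _ _ _ hb]
      obtain ⟨fr1, fr2⟩ := hrow φ (by rw [fb 15 (by simp)]; simp)
      refine ⟨fun b h1 h2 => by rw [fb b h2, hυ b h1 h2], fun c hc => ?_, by omega,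
        fun r h1 h2 => ?_, fun r r' h1 h2 h3 => ?_, fun p' hp' q' hq' hdo h1 h2 => ?_⟩
      · rw [fb 15 (by simp), State.put_nat_same, hPold _ (hc.trans_le (Nat.mul_le_mul_right _
          (by omega))), h.old c hc]
      · rw [f16] at h2
        rcases Nat.lt_succ_iff_lt_or_eq.1 h2 with h3 | rfl
        · rw [fr1 r h3]; exact h.sound r h1 (by omega)
        · rw [fr2]
          exact ⟨⟨p, hp, q, hq, rfl⟩, hb'.1⟩
      · rw [f16] at h3
        rcases Nat.lt_succ_iff_lt_or_eq.1 h3 with h4 | rfl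
        · rw [fr1 r (by omega), fr1 r' h4]; exact h.ineq r r' h1 h2 (by omega)
        · rw [fr1 r h2, fr2]
          exact fun h4 => hb'.2 ⟨r, h1, h2, h4⟩
      · rcases hdo with hdo | ⟨rfl, rfl⟩
        · obtain ⟨r, h3, h4, h5⟩ := h.complete p' hp' q' hq' hdo h1 h2
          refine ⟨r, h3, by omega, ?_⟩
          rw [fr1 r (by omega)]
          exact h5
        · refine ⟨T, by omega, by omega, fun s _ _ => ?_⟩
          rw [fr2]
          exact ⟨rfl, fun _ _ => rfl⟩
    · rw [Tst.holds_nz, eval_mul, hsat.2, hex, ind_mul_ind, ne_eq, ind_eq_zero, not_not] at hb'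
      refine R.skip ⟨hυ, fun c hc => ?_, by omega, fun r h1 h2 => ?_, fun r r' h1 h2 h3 => ?_,
        fun p' hp' q' hq' hdo h1 h2 => ?_⟩
      · rw [State.put_nat_same, hPold _ (hc.trans_le (Nat.mul_le_mul_right _ (by omega))),
          h.old c hc]
      · rw [hυ16] at h2
        rw [hrow1 r h2]; exact h.sound r h1 (by omega)
      · rw [hυ16] at h3
        rw [hrow1 r (by omega), hrow1 r' h3]; exact h.ineq r r' h1 h2 (by omega)
      · rw [hυ16]
        rcases hdo with hdo | ⟨rfl, rfl⟩
        · obtain ⟨r, h3, h4, h5⟩ := h.complete p' hp' q' hq' hdo h1 h2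
          refine ⟨r, h3, by omega, ?_⟩
          rw [hrow1 r (by omega)]
          exact h5
        · by_contra hno
          refine hb' ⟨h2, ?_⟩
          rintro ⟨r, h3, h4, h5⟩
          refine hno ⟨r, h3, h4, ?_⟩
          rw [hrow1 r h4]
          exact h5
  · refine R.skip { h with complete := fun p' hp' q' hq' hdo h1 h2 => ?_ }
    rcases hdo with hdo | ⟨rfl, rfl⟩
    · exact h.complete p' hp' q' hq' hdo h1 h2
    · exact absurd h1 hb

end Step

end RAM.Algo

namespace RAM.Algo

open X Polymatrix Data

variable {d : Data} {D B : ℕ} {σ τ : State}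

/-- The partial profiles in the `len` rows of the pool from `lo` on. -/
def rows (n : ℕ) (σ : State) (lo len : ℕ) : Set (ℕ → ℕ) := {f | ∃ r < len, f = row n σ (lo + r)}

theorem rows_congr {n lo len T : ℕ} (h : ∀ c < T * n, τ.nat 15 c = σ.nat 15 c)
    (hT : lo + len ≤ T) : rows n τ lo len = rows n σ lo len := by
  ext f
  refine exists_congr fun r => and_congr_right fun hr => ?_
  rw [row_congr h (show lo + r < T by omega)]

/-- The bag of `t` in memory. -/
def bagOf (n : ℕ) (σ : State) (t j : ℕ) : Prop := σ.nat 19 (t * n + j) ≠ 0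

/-- Loops of length `B` are long enough for the data. -/
structure Data.Fits (d : Data) (D B : ℕ) : Prop where
  one_le : 1 ≤ B
  n_lt : d.n + 1 ≤ B
  m_le : d.m ≤ B
  K_le : d.K ≤ B
  table_le : ((d.K + 1) * (d.n * (2 * d.k * d.k) + 1) ^ d.m) ^ (D + 1) ≤ B

theorem R_join (hfit : d.Fits D B) (hw : d.Wf D) (hd : d.Holds σ) {i s t lA nA lB nB : ℕ}
    {l h t' : X} (h21 : σ.nat 21 0 = lA) (h22 : σ.nat 22 0 = lA + nA)
    (hlA : lA + nA ≤ σ.nat 16 0) (hlB : lB + nB ≤ σ.nat 16 0) (hnA : nA ≤ B) (hnB : nB ≤ B)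
    (hst : ∀ τ : State, (∀ b, b ≠ 15 → b ≠ 16 → b ≠ 21 → b ≠ 22 → b ≠ 23 → τ.nat b = σ.nat b) →
      Stable B τ [i, s] l lB ∧ Stable B τ [i, s] h (lB + nB) ∧ Stable B τ [i, s] t' t)
    (hN : {j | j < d.n ∧ bagOf d.n σ t j}.ncard ≤ D + 1)
    (hA : ∀ f ∈ rows d.n σ lA nA, ∀ j < d.n, f j ≤ d.K)
    (hB : ∀ f ∈ rows d.n σ lB nB, ∀ j < d.n, f j ≤ d.K) :
    R B (join l h t') [i, s] σ fun τ =>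
      (∀ b, b ≠ 15 → b ≠ 16 → b ≠ 21 → b ≠ 22 → b ≠ 23 → τ.nat b = σ.nat b) ∧
      (∀ c < σ.nat 16 0 * d.n, τ.nat 15 c = σ.nat 15 c) ∧ σ.nat 16 0 ≤ τ.nat 16 0 ∧
      τ.nat 16 0 - σ.nat 16 0 ≤ B ∧ τ.nat 21 0 = σ.nat 16 0 ∧ τ.nat 22 0 = τ.nat 16 0 ∧
      d.IsJoin (bagOf d.n σ t) t (rows d.n σ lA nA) (rows d.n σ lB nB)
        (rows d.n τ (σ.nat 16 0) (τ.nat 16 0 - σ.nat 16 0)) := by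
  have hB1 := hfit.one_le
  refine R.seq hB1 (R.setN hB1 (by simp) (by simp [Algo.top]) ?_)
  have e1 : (Algo.top).eval σ [i, s] = σ.nat 16 0 := rfl
  rw [e1]
  generalize hσ' : σ.setNat 23 ((0 : X).eval σ [i, s]) (σ.nat 16 0) = σ'
  have hs : ∀ b, b ≠ 23 → σ'.nat b = σ.nat b := fun b hb => by
    rw [← hσ', setNat_nat_of_ne _ _ _ hb]
  have s23 : σ'.nat 23 0 = σ.nat 16 0 := by rw [← hσ']; simp
  have s16 := hs 16 (by simp)
  have hd' : d.Holds σ' := hd.congr fun b hb => hs b (by omega)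
  have hrow : ∀ r, row d.n σ' r = row d.n σ r := fun r => by
    funext j; unfold row; rw [hs 15 (by simp)]
  have hrows : ∀ lo len, rows d.n σ' lo len = rows d.n σ lo len := fun lo len => by
    unfold rows; simp only [hrow]
  have hbag : ∀ s, σ'.nat 19 (t * d.n + s) ≠ 0 ↔ bagOf d.n σ t s := fun s => by
    rw [hs 19 (by simp)]; rfl
  have hst' : ∀ υ : State, (∀ b, b ≠ 15 → b ≠ 16 → υ.nat b = σ'.nat b) →
      Stable B υ [i, s] l lB ∧ Stable B υ [i, s] h (lB + nB) ∧ Stable B υ [i, s] t' t :=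
    fun υ hυ => hst υ fun b h1 h2 _ _ h5 => by rw [hυ b h1 h2, hs b h5]
  have hcard : ∀ done υ, JoinInv d (fun s => σ'.nat 19 (t * d.n + s) ≠ 0) t lA nA lB nB σ' done υ →
      υ.nat 16 0 - σ'.nat 16 0 ≤ B := fun done υ hJ =>
    (hJ.card_le hw (N := D + 1) (by simpa only [hbag] using hN)
      (fun p hp j hj => by rw [hrow]; exact hA _ ⟨p, hp, rfl⟩ j hj)
      (fun q hq j hj => by rw [hrow]; exact hB _ ⟨q, hq, rfl⟩ j hj)).trans hfit.table_le
  refine R.seq hB1 (R.for hB1 nA (by simp [curHi, curLo])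
    (by simp [curHi, curLo, hs 21, hs 22, h21, h22]) hnA
    (fun p υ => JoinInv d (fun s => σ'.nat 19 (t * d.n + s) ≠ 0) t lA nA lB nB σ'
      (fun p' _ => p' < p) υ) ?_ (fun p hp υ hJ => ?_) ?_)
  · exact ⟨fun _ _ _ => rfl, fun _ _ => rfl, le_rfl, fun r h1 h2 => by omega,
      fun r r' h1 h2 h3 => by omega, fun p _ q _ h => by omega⟩
  · have hυ := hst' υ hJ.frame
    refine R.for hB1 nB ?_ ?_ hnB (fun q υ => JoinInv d (fun s => σ'.nat 19 (t * d.n + s) ≠ 0) t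
      lA nA lB nB σ' (fun p' q' => p' < p ∨ p' = p ∧ q' < q) υ) (hJ.mono fun p' _ q' _ h => by omega)
      (fun q hq φ hJ' => ?_) (fun φ hJ' => hJ'.mono fun p' _ q' _ h => by omega)
    · simp only [bdd_sub]
      exact ⟨(hυ.2.1 [p]).1, (hυ.1 [p]).1⟩
    · rw [eval_sub, (hυ.2.1 [p]).2, (hυ.1 [p]).2, Nat.add_sub_cancel_left]
    · refine (R_joinStep hB1 (by have := hfit.n_lt; omega) hfit.m_le hd' hp hq (by rw [s16]; exact hlA)
        (by rw [s16]; exact hlB) (by rw [hs 21 (by simp), h21]) (by rw [s23, s16])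
        (fun ψ hψ => (hst' ψ hψ).1) (fun ψ hψ => (hst' ψ hψ).2.2) (hcard _ _ hJ') hJ').mono ?_
      exact fun ψ hψ => hψ.mono fun p' _ q' _ h => by omega
  · intro υ hJ
    have u16 := hJ.top
    have hc := hcard _ _ hJ
    rw [s16] at u16 hc
    refine R.seq hB1 (R.setN hB1 (by simp) (by simp [newLo]) ?_)
    refine R.setN hB1 (by simp) (by simp [Algo.top]) ?_
    generalize hφ : (State.setNat _ _ _ _ : State) = φ
    have hf : ∀ b, b ≠ 21 → b ≠ 22 → φ.nat b = υ.nat b := fun b h1 h2 => by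
      rw [← hφ, setNat_nat_of_ne _ _ _ h2, setNat_nat_of_ne _ _ _ h1]
    have f16 : φ.nat 16 0 = υ.nat 16 0 := by rw [hf 16 (by simp) (by simp)]
    have f21 : φ.nat 21 0 = σ.nat 16 0 := by
      rw [← hφ]
      simp [setNat_nat, newLo, hJ.frame 23, s23]
    have f22 : φ.nat 22 0 = φ.nat 16 0 := by
      rw [← hφ]
      simp [setNat_nat, Algo.top]
    have frow : ∀ r, row d.n φ r = row d.n υ r := fun r => by
      funext j; unfold row; rw [hf 15 (by simp) (by simp)]
    refine ⟨fun b h1 h2 h3 h4 h5 => by rw [hf b h3 h4, hJ.frame b h1 h2, hs b h5],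
      fun c hc => ?_, by omega, by omega, f21, f22, ⟨?_, ?_⟩⟩
    · rw [hf 15 (by simp) (by simp), hJ.old c (by rw [s16]; exact hc), hs 15 (by simp)]
    · rintro _ ⟨r, hr, rfl⟩
      obtain ⟨⟨p, hp, q, hq, he⟩, h2⟩ := hJ.sound (σ.nat 16 0 + r) (by rw [s16]; omega) (by omega)
      rw [frow]
      refine ⟨⟨_, ⟨p, hp, rfl⟩, _, ⟨q, hq, rfl⟩, fun j _ => ?_⟩, h2⟩
      rw [he, hrow, hrow]
    · rintro _ ⟨p, hp, rfl⟩ _ ⟨q, hq, rfl⟩ h1 h2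
      obtain ⟨r, h3, h4, h5⟩ := hJ.complete p hp q hq hp (by rw [hrow, hrow]; exact h1)
        (by rw [hrow, hrow]; exact h2)
      rw [s16] at h3
      refine ⟨_, ⟨r - σ.nat 16 0, by omega, rfl⟩, fun s hs hb => ?_⟩
      rw [frow, show σ.nat 16 0 + (r - σ.nat 16 0) = r by omega]
      have := h5 s hs ((hbag s).2 hb)
      rwa [hrow, hrow] at this

/-- The memory holds the data, the bags and the tree from `t` on, the single strategies, and the
tables after `t`. -/
structure Base (d : Data) (B t : ℕ) (σ : State) : Prop where
  holds : d.Holds σ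
  tree : d.BagTree t (bagOf d.n σ) (σ.nat 20)
  top : d.n * d.K ≤ σ.nat 16 0
  single : ∀ s < d.n, ∀ x < d.K, ∀ j < d.n,
    row d.n σ (s * d.K + x) j = if j = s then x + 1 else 0
  table : ∀ t', t < t' → t' ≤ d.n → σ.nat 17 t' ≤ σ.nat 18 t' ∧ σ.nat 18 t' ≤ σ.nat 16 0 ∧
    σ.nat 18 t' - σ.nat 17 t' ≤ B ∧
    d.IsTable (bagOf d.n σ t') t' (rows d.n σ (σ.nat 17 t') (σ.nat 18 t' - σ.nat 17 t'))
      (d.span (bagOf d.n σ) (σ.nat 20) t')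

/-- The pool only grows: rows below the old value of `top` are never changed, so the single
strategies and the finished tables survive a join. -/
theorem Base.congr {t : ℕ} (h : Base d B t σ)
    (hf : ∀ b, b ≠ 15 → b ≠ 16 → b ≠ 21 → b ≠ 22 → b ≠ 23 → τ.nat b = σ.nat b)
    (hold : ∀ c < σ.nat 16 0 * d.n, τ.nat 15 c = σ.nat 15 c) (htop : σ.nat 16 0 ≤ τ.nat 16 0) :
    Base d B t τ := by
  have h17 := hf 17 (by simp) (by simp) (by simp) (by simp) (by simp)
  have h18 := hf 18 (by simp) (by simp) (by simp) (by simp) (by simp)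
  have h19 := hf 19 (by simp) (by simp) (by simp) (by simp) (by simp)
  have h20 := hf 20 (by simp) (by simp) (by simp) (by simp) (by simp)
  have hb : bagOf d.n τ = bagOf d.n σ := by unfold bagOf; rw [h19]
  refine ⟨h.holds.congr fun b hb => hf b (by omega) (by omega) (by omega) (by omega) (by omega),
    by rw [hb, h20]; exact h.tree, h.top.trans htop, fun s hs x hx j hj => ?_, fun t' h1 h2 => ?_⟩
  · have h3 := cell_lt hx hs
    rw [row_congr hold (h3.trans_le h.top)]
    exact h.single s hs x hx j hj
  · obtain ⟨h3, h4, h5, h6⟩ := h.table t' h1 h2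
    rw [h17, h18, hb, h20, rows_congr hold (by omega)]
    exact ⟨h3, h4.trans htop, h5, h6⟩

/-- The memory holds a current table. -/
structure Cur (d : Data) (B t : ℕ) (X : Set ℕ) (σ : State) : Prop where
  le : σ.nat 21 0 ≤ σ.nat 22 0
  le_top : σ.nat 22 0 ≤ σ.nat 16 0
  card : σ.nat 22 0 - σ.nat 21 0 ≤ B
  table : d.IsTable (bagOf d.n σ t) t (rows d.n σ (σ.nat 21 0) (σ.nat 22 0 - σ.nat 21 0)) X

theorem R_join_table (hfit : d.Fits D B) (hw : d.Wf D) {i s t lB nB : ℕ} {X Y : Set ℕ}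
    (hbase : Base d B t σ) (hcur : Cur d B t X σ) (htn : t ≤ d.n)
    {l h t' : RAM.X} (hlB : lB + nB ≤ σ.nat 16 0) (hnB : nB ≤ B)
    (hst : ∀ τ : State, (∀ b, b ≠ 15 → b ≠ 16 → b ≠ 21 → b ≠ 22 → b ≠ 23 → τ.nat b = σ.nat b) →
      Stable B τ [i, s] l lB ∧ Stable B τ [i, s] h (lB + nB) ∧ Stable B τ [i, s] t' t)
    (hYo : ∀ g ∈ rows d.n σ lB nB, d.IsOn g Y) (hXY : ∀ j ∈ X, j ∈ Y → bagOf d.n σ t j)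
    (hX : ∀ c ∈ X, t < d.pos c → ∀ j, d.adj c j → j ∈ X)
    (hY : ∀ c ∈ Y, t < d.pos c → ∀ j, d.adj c j → j ∈ Y)
    (hBc : ∀ z, d.Solution z → ∃ g ∈ rows d.n σ lB nB,
      (∀ s < d.n, bagOf d.n σ t s → d.AgreeAt g (restr z Y) s) ∧
      ∀ c < d.n, c ∈ Y → t < d.pos c → d.Sat (g c) (d.Pay g c)) :
    R B (join l h t') [i, s] σ fun τ => Base d B t τ ∧ Cur d B t (X ∪ Y) τ ∧
      τ.nat 19 = σ.nat 19 ∧ τ.nat 20 = σ.nat 20 ∧ τ.nat 17 = σ.nat 17 ∧ τ.nat 18 = σ.nat 18 := by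
  have hc1 := hcur.le
  have hc2 := hcur.le_top
  refine (R_join hfit hw hbase.holds (lA := σ.nat 21 0) (nA := σ.nat 22 0 - σ.nat 21 0) rfl
    (by omega) (by omega) hlB hcur.card hnB hst (hbase.tree.ncard_bag_le hw le_rfl htn)
    (fun f hf j hj => (hcur.table.isOn f hf j hj).1) (fun f hf j hj => (hYo f hf j hj).1)).mono ?_
  rintro τ ⟨hf, hold, htop, hcard, h21, h22, hJ⟩
  have h17 := hf 17 (by simp) (by simp) (by simp) (by simp) (by simp)
  have h18 := hf 18 (by simp) (by simp) (by simp) (by simp) (by simp)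
  have h19 := hf 19 (by simp) (by simp) (by simp) (by simp) (by simp)
  have h20 := hf 20 (by simp) (by simp) (by simp) (by simp) (by simp)
  have hb : bagOf d.n τ = bagOf d.n σ := by unfold bagOf; rw [h19]
  refine ⟨hbase.congr hf hold htop, ⟨by omega, by omega, by omega, ?_⟩, h19, h20, h17, h18⟩
  rw [hb, h21, h22]
  exact hcur.table.join hw hJ hYo hXY hX hY hBc

end RAM.Algo

/-! ### The tables along the tree -/

namespace RAM.Algo

open X Polymatrix Data

variable {d : Data} {D B : ℕ} {σ τ : State}

theorem Data.Desc.congr {par par' : ℕ → ℕ} {t u : ℕ}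
    (hp : ∀ s, t < s → s ≤ d.n → par' s = par s) (h : d.Desc par t u) : d.Desc par' t u := by
  induction h with
  | refl => exact .refl
  | @tail b c h1 h2 ih =>
    have := Desc.le h1
    exact ih.tail ⟨h2.1, h2.2.1, by rw [hp c (by omega) h2.2.1]; exact h2.2.2⟩

theorem Data.span_congr {bag bag' : ℕ → ℕ → Prop} {par par' : ℕ → ℕ} {t : ℕ}
    (hp : ∀ s, t < s → s ≤ d.n → par' s = par s) (hb : ∀ j < d.n, bag' t j ↔ bag t j) :
    d.span bag' par' t = d.span bag par t := by
  ext j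
  refine and_congr_right fun hj => or_congr (hb j hj) ⟨?_, ?_⟩
  · exact Data.Desc.congr fun s h1 h2 => (hp s h1 h2).symm
  · exact Data.Desc.congr hp

theorem Data.BagTree.extend {bag bag' : ℕ → ℕ → Prop} {par par' : ℕ → ℕ} {t : ℕ}
    (h : d.BagTree (t + 1) bag par) (hb : ∀ s, t < s → ∀ j < d.n, bag' s j ↔ bag s j)
    (hp : ∀ s, t < s → par' s = par s)
    (h1 : ∀ j < d.n, bag' t j ↔ d.pos j = t ∨ d.pos j < t ∧
      (d.adj (d.ord t) j ∨ ∃ t', t' ≤ d.n ∧ t < t' ∧ par' t' = t ∧ bag' t' j))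
    (h2 : ∀ j < d.n, bag' t j → d.pos j < t → d.pos j ≤ par' t)
    (h3 : par' t = 0 ∨ ∃ j < d.n, bag' t j ∧ d.pos j < t ∧ d.pos j = par' t) :
    d.BagTree t bag' par' where
  bag_iff s hs hsn j hj := by
    rcases Nat.eq_or_lt_of_le hs with rfl | hs
    · exact h1 j hj
    · rw [hb s hs j hj, h.bag_iff s hs hsn j hj]
      refine or_congr Iff.rfl (and_congr Iff.rfl (or_congr Iff.rfl (exists_congr fun t' =>
        and_congr_right fun _ => and_congr_right fun h4 => ?_)))
      rw [hp t' (hs.trans h4), hb t' (hs.trans h4) j hj]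
  le_par s hs hsn j hj hbj hlt := by
    rcases Nat.eq_or_lt_of_le hs with rfl | hs
    · exact h2 j hj hbj hlt
    · rw [hp s hs]
      exact h.le_par s hs hsn j hj ((hb s hs j hj).1 hbj) hlt
  par_eq s hs hsn := by
    rcases Nat.eq_or_lt_of_le hs with rfl | hs
    · exact h3
    · rw [hp s hs]
      refine (h.par_eq s hs hsn).imp_right ?_
      rintro ⟨j, hj, h4, h5⟩
      exact ⟨j, hj, (hb s hs j hj).2 h4, h5⟩

theorem Data.IsTable.congr_bag {bag bag' : ℕ → Prop} {t : ℕ} {𝓐 : Set (ℕ → ℕ)} {X : Set ℕ}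
    (h : d.IsTable bag t 𝓐 X) (hb : ∀ j < d.n, bag' j → bag j) : d.IsTable bag' t 𝓐 X :=
  ⟨h.isOn, h.sat, fun z hz => by
    obtain ⟨f, hf, h1⟩ := h.complete z hz
    exact ⟨f, hf, fun s hs hbs => h1 s hs (hb s hs hbs)⟩⟩

/-- The memory holds the data, the bags, the tree and the tables from `t` on, and the single
strategies. -/
structure Done (d : Data) (B t : ℕ) (σ : State) : Prop where
  holds : d.Holds σ
  tree : d.BagTree t (bagOf d.n σ) (σ.nat 20)
  top : d.n * d.K ≤ σ.nat 16 0
  single : ∀ s < d.n, ∀ x < d.K, ∀ j < d.n,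
    row d.n σ (s * d.K + x) j = if j = s then x + 1 else 0
  table : ∀ t', t ≤ t' → t' ≤ d.n → σ.nat 17 t' ≤ σ.nat 18 t' ∧ σ.nat 18 t' ≤ σ.nat 16 0 ∧
    σ.nat 18 t' - σ.nat 17 t' ≤ B ∧
    d.IsTable (bagOf d.n σ t') t' (rows d.n σ (σ.nat 17 t') (σ.nat 18 t' - σ.nat 17 t'))
      (d.span (bagOf d.n σ) (σ.nat 20) t')

/-- The number of the elements of `{0, …, n - 1}` below the maximum of a function. -/
theorem sum_ind_eq_max {n : ℕ} {p : ℕ → Prop} {f : ℕ → ℕ} (hf : ∀ j < n, p j → f j ≤ n) :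
    (∀ j < n, p j → f j ≤ ∑ x ∈ Finset.range n, ind (∃ j < n, p j ∧ x < f j)) ∧
    (∑ x ∈ Finset.range n, ind (∃ j < n, p j ∧ x < f j) = 0 ∨
      ∃ j < n, p j ∧ f j = ∑ x ∈ Finset.range n, ind (∃ j < n, p j ∧ x < f j)) := by
  by_cases h : ∃ j < n, p j
  · obtain ⟨j, hj, hmax⟩ : ∃ j ∈ {j | j < n ∧ p j}, ∀ i ∈ {j | j < n ∧ p j}, f i ≤ f j :=
      Set.exists_max_image _ f ((Set.finite_lt_nat n).subset fun j hj => hj.1) h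
    have hs : ∑ x ∈ Finset.range n, ind (∃ j < n, p j ∧ x < f j) = f j := by
      rw [sum_ind, show {y | y < n ∧ ∃ j < n, p j ∧ y < f j} =
        ((Finset.range (f j) : Finset ℕ) : Set ℕ) from ?_, Set.ncard_coe_finset, Finset.card_range]
      ext y
      simp only [Set.mem_ofPred_eq, Finset.coe_range, Set.mem_Iio]
      constructor
      · rintro ⟨-, i, hi, hpi, hy⟩
        exact hy.trans_le (hmax i ⟨hi, hpi⟩)
      · intro hy
        exact ⟨hy.trans_le (hf j hj.1 hj.2), j, hj.1, hj.2, hy⟩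
    rw [hs]
    exact ⟨fun i hi hpi => hmax i ⟨hi, hpi⟩, Or.inr ⟨j, hj.1, hj.2, rfl⟩⟩
  · refine ⟨fun j hj hp => absurd ⟨j, hj, hp⟩ h, Or.inl (Finset.sum_eq_zero fun x _ => ?_)⟩
    rw [ind_of_not]
    rintro ⟨j, hj, hp, -⟩
    exact h ⟨j, hj, hp⟩

theorem R_bagPart (hfit : d.Fits D B) (hw : d.Wf D) (hd : d.Holds σ) {i t : ℕ} {t' : RAM.X}
    (htn : t ≤ d.n) (ht : ∀ τ : State, (∀ b < 15, τ.nat b = σ.nat b) → Stable B τ [i] t' t) :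
    R B (bagPart t') [i] σ fun τ => (∀ b, b ≠ 19 → τ.nat b = σ.nat b) ∧
      (∀ s, t < s → ∀ j < d.n, bagOf d.n τ s j ↔ bagOf d.n σ s j) ∧
      ∀ j < d.n, bagOf d.n τ t j ↔ d.pos j = t ∨ d.pos j < t ∧
        (d.adj (d.ord t) j ∨ ∃ t', t' ≤ d.n ∧ t < t' ∧ σ.nat 20 t' = t ∧ bagOf d.n σ t' j) := by
  have hB1 := hfit.one_le
  have hnB := hfit.n_lt
  let p : ℕ → Prop := fun j => d.pos j = t ∨ d.pos j < t ∧
        (d.adj (d.ord t) j ∨ ∃ t', t' ≤ d.n ∧ t < t' ∧ σ.nat 20 t' = t ∧ bagOf d.n σ t' j)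
  refine (Fills.for (a := 19) hB1 d.n (by simp [Algo.n]) (by simp [Algo.n, hd.n]) (by omega)
    (fun j => {t * d.n + j}) (fun c => ind (p (c % d.n))) fun j hj => ?_).mono ?_
  · set P := patch (⋃ i < j, {t * d.n + i}) (fun c => ind (p (c % d.n))) (σ.nat 19) with hP
    have h1 : ∀ b < 15, (σ.put 19 P).nat b = σ.nat b := fun b hb => by
      rw [State.put_nat, if_neg (by omega)]
    have hd' : d.Holds (σ.put 19 P) := hd.congr h1
    have hS := ht _ h1
    have hS0 := hS [j]
    have hS1 : ∀ x, _ := fun x => hS [j, x]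
    simp only [List.cons_append, List.nil_append] at hS0 hS1
    have hold : ∀ s, t < s → P (s * d.n + j) = σ.nat 19 (s * d.n + j) := fun s hs => by
      rw [hP, patch_of_notMem]
      simp only [Set.mem_iUnion, Set.mem_singleton_iff, not_exists]
      intro i hi he
      have := cell_lt (n := d.n) (j := i) (by omega) hs
      omega
    refine Fills.setN hB1 ?_ ?_ ?_ ?_
    · simp [Algo.n, hS0.1]
    · simp [Algo.n, hS0.1, (hS1 _).1, Algo.pos, Algo.adj, Algo.ord, par, Algo.bag, hd'.n, hnB]
    · simp [Algo.n, hS0.2, hd'.n]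
    · simp only [Algo.n, Algo.pos, Algo.adj, Algo.ord, par, Algo.bag, eval_lt, eval_ofNat, eval_add,
        eval_eq, eval_get, eval_mul, eval_ex, eval_var, List.cons_append, List.nil_append, hS0.2,
        (hS1 _).2, hd'.n, hd'.pos, hd'.ord, add_mul_mod_of_lt hj, List.getD_cons_zero,
        List.getD_cons_succ, State.put_nat_same, State.put_nat, Nat.reduceEqDiff, if_false]
      refine ind_congr ?_
      simp only [p, Nat.pos_iff_ne_zero, ne_eq, Nat.add_eq_zero_iff, Nat.mul_eq_zero, ind_eq_zero,
        not_and_or, not_or, not_not]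
      refine or_congr Iff.rfl (and_congr_right fun hlt => or_congr ?_ ?_)
      · have ho : d.ord t < d.n := hw.placed.ord_lt (by omega) htn
        have h2 := hd.adj _ ho j hj
        rw [ne_eq] at h2
        simpa [State.put_nat] using h2
      · refine exists_congr fun s => ?_
        constructor
        · rintro ⟨h1, ⟨h2, h3⟩, h4⟩
          rw [hold s h2] at h4
          exact ⟨by omega, h2, h3, h4⟩
        · rintro ⟨h1, h2, h3, h4⟩
          refine ⟨by omega, ⟨h2, h3⟩, ?_⟩
          rw [hold s h2]
          exact h4
  · rintro τ rfl
    refine ⟨fun b hb => by simp [State.put_nat, hb], fun s hs j hj => ?_, fun j hj => ?_⟩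
    · unfold bagOf
      rw [State.put_nat_same, patch_of_notMem]
      simp only [Set.mem_iUnion, Set.mem_singleton_iff, not_exists]
      intro i hi he
      have := cell_lt (n := d.n) (j := i) (by omega) hs
      omega
    · unfold bagOf
      rw [State.put_nat_same, patch_of_mem (by
        simp only [Set.mem_iUnion]
        exact ⟨j, hj, rfl⟩), add_mul_mod_of_lt hj, ne_eq, ind_eq_zero, not_not]
      rfl

theorem R_parPart (hfit : d.Fits D B) (hw : d.Wf D) (hd : d.Holds σ) {i t : ℕ} {t' : RAM.X}
    (ht : Stable B σ [i] t' t) :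
    R B (parPart t') [i] σ fun τ => (∀ b, b ≠ 20 → τ.nat b = σ.nat b) ∧
      (∀ s, t < s → τ.nat 20 s = σ.nat 20 s) ∧
      (∀ j < d.n, bagOf d.n σ t j → d.pos j < t → d.pos j ≤ τ.nat 20 t) ∧
      (τ.nat 20 t = 0 ∨ ∃ j < d.n, bagOf d.n σ t j ∧ d.pos j < t ∧ d.pos j = τ.nat 20 t) := by
  have hB1 := hfit.one_le
  have hnB := hfit.n_lt
  have hS1 : ∀ x, _ := fun x => ht [x]
  have hS2 : ∀ x y, _ := fun x y => ht [x, y]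
  simp only [List.cons_append, List.nil_append] at hS1 hS2
  refine R.setN hB1 ht.here.1 ?_ ?_
  · simp [Algo.n, Algo.pos, Algo.bag, hd.n, (hS2 _ _).1, (show d.n ≤ B by omega)]
  rw [ht.here.2]
  have he : (sum Algo.n (ex Algo.n (Algo.bag t' (var 2) * lt (Algo.pos (var 2)) t' *
      lt (var 1) (Algo.pos (var 2))))).eval σ [i] =
      ∑ x ∈ Finset.range d.n, ind (∃ j < d.n, (bagOf d.n σ t j ∧ d.pos j < t) ∧ x < d.pos j) := by
    simp [Algo.n, Algo.pos, Algo.bag, hd.n, hd.pos, (hS2 _ _).2, bagOf]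
  rw [he]
  obtain ⟨h1, h2⟩ := sum_ind_eq_max (n := d.n) (p := fun j => bagOf d.n σ t j ∧ d.pos j < t)
    (f := d.pos) fun j _ _ => hw.placed.le j
  refine ⟨fun b hb => setNat_nat_of_ne _ _ _ hb, fun s hs => ?_, fun j hj hb hlt => ?_, ?_⟩
  · rw [setNat_nat, if_neg (by omega)]
  · rw [setNat_nat_same]
    exact h1 j hj ⟨hb, hlt⟩
  · rw [setNat_nat_same]
    refine h2.imp_right ?_
    rintro ⟨j, hj, h3, h4⟩
    exact ⟨j, hj, h3.1, h3.2, h4⟩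

end RAM.Algo

namespace RAM.Algo

open X Polymatrix Data

variable {d : Data} {D B : ℕ} {σ τ : State}

theorem R.assoc {B : ℕ} (hB : 1 ≤ B) {s s' : S} {ρ : List ℕ} {σ : State} {Q Q' : State → Prop}
    (h : R B s ρ σ Q) (h' : ∀ τ, Q τ → R B s' ρ τ Q') : R B (.seq s s') ρ σ Q' :=
  R.seq hB (h.mono h')

theorem Done.base {t : ℕ} (h : Done d B (t + 1) σ) (hf : ∀ b, b ≠ 19 → b ≠ 20 → τ.nat b = σ.nat b)
    (hb : ∀ s, t < s → ∀ j < d.n, bagOf d.n τ s j ↔ bagOf d.n σ s j)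
    (hp : ∀ s, t < s → τ.nat 20 s = σ.nat 20 s)
    (h1 : ∀ j < d.n, bagOf d.n τ t j ↔ d.pos j = t ∨ d.pos j < t ∧
      (d.adj (d.ord t) j ∨ ∃ t', t' ≤ d.n ∧ t < t' ∧ τ.nat 20 t' = t ∧ bagOf d.n τ t' j))
    (h2 : ∀ j < d.n, bagOf d.n τ t j → d.pos j < t → d.pos j ≤ τ.nat 20 t)
    (h3 : τ.nat 20 t = 0 ∨ ∃ j < d.n, bagOf d.n τ t j ∧ d.pos j < t ∧ d.pos j = τ.nat 20 t) :
    Base d B t τ := by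
  have h15 := hf 15 (by simp) (by simp)
  have hr : ∀ r, row d.n τ r = row d.n σ r := fun r => by
    funext j; unfold row; rw [h15]
  refine ⟨h.holds.congr fun b hb => hf b (by omega) (by omega), h.tree.extend hb hp h1 h2 h3, ?_,
    ?_, fun t' ht' htn => ?_⟩
  · rw [hf 16 (by simp) (by simp)]; exact h.top
  · simp only [hr]; exact h.single
  · rw [hf 16 (by simp) (by simp), hf 17 (by simp) (by simp), hf 18 (by simp) (by simp)]
    obtain ⟨g1, g2, g3, g4⟩ := h.table t' ht' htn
    refine ⟨g1, g2, g3, ?_⟩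
    rw [Data.span_congr (fun s hs _ => hp s (by omega)) (hb t' ht')]
    unfold rows at g4 ⊢
    simp only [hr]
    exact g4.congr_bag fun j hj => (hb t' ht' j hj).1

/-- The empty profile equals the restriction of every solution to the empty set and has nobody to
satisfy, so alone it forms a table from which the joins can start. -/
theorem R_initPart (hfit : d.Fits D B) {i t : ℕ} (h : Base d B t σ) :
    R B initPart [i] σ fun τ => Base d B t τ ∧ Cur d B t ∅ τ ∧
      τ.nat 19 = σ.nat 19 ∧ τ.nat 20 = σ.nat 20 ∧ τ.nat 17 = σ.nat 17 ∧ τ.nat 18 = σ.nat 18 := by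
  have hB1 := hfit.one_le
  obtain ⟨T, hT⟩ : ∃ T, σ.nat 16 0 = T := ⟨_, rfl⟩
  refine R.seq hB1 (R.setN hB1 (by simp) (by simp [top]) ?_)
  generalize hσ' : (State.setNat _ _ _ _ : State) = σ'
  have hs : ∀ b, b ≠ 21 → σ'.nat b = σ.nat b := fun b hb => by
    rw [← hσ', setNat_nat_of_ne _ _ _ hb]
  have s21 : σ'.nat 21 0 = T := by rw [← hσ']; simp [top, hT]
  have s0 : σ'.nat 0 0 = d.n := by rw [hs 0 (by simp), h.holds.n]
  have s16 : σ'.nat 16 0 = T := by rw [hs 16 (by simp), hT]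
  refine R.assoc hB1 (Fills.for (a := 15) hB1 d.n (by simp [Algo.n]) (by simp [Algo.n, s0])
    (by have := hfit.n_lt; omega) (fun j => {T * d.n + j}) (fun _ => 0) fun j hj =>
      Fills.setN hB1 (by simp [Algo.n, top]) (by simp)
      (by simp [Algo.n, top, State.put_nat, s0, s16]) (by simp)) ?_
  rintro υ rfl
  refine R.seq hB1 (R.setN hB1 (by simp) (by simp [top]) ?_)
  refine R.setN hB1 (by simp) (by simp [top]) ?_
  generalize hτ : (State.setNat _ _ _ _ : State) = τ
  set P := patch (⋃ j < d.n, {T * d.n + j}) (fun _ => 0) (σ'.nat 15) with hP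
  have hf : ∀ b, b ≠ 15 → b ≠ 16 → b ≠ 21 → b ≠ 22 → τ.nat b = σ.nat b :=
    fun b h1 h2 h3 h4 => by
      rw [← hτ, setNat_nat_of_ne _ _ _ h4, setNat_nat_of_ne _ _ _ h2, State.put_nat, if_neg h1,
        hs b h3]
  have t16 : τ.nat 16 0 = T + 1 := by
    rw [← hτ]; simp [setNat_nat, top, State.put_nat, s16]
  have t21 : τ.nat 21 0 = T := by
    rw [← hτ]; simp [setNat_nat, State.put_nat, s21]
  have t22 : τ.nat 22 0 = T + 1 := by
    rw [← hτ]; simp [top, State.put_nat, s16]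
  have t15 : τ.nat 15 = P := by
    rw [← hτ, setNat_nat_of_ne _ _ _ (by simp), setNat_nat_of_ne _ _ _ (by simp),
      State.put_nat_same]
  have hold : ∀ c < σ.nat 16 0 * d.n, τ.nat 15 c = σ.nat 15 c := fun c hc => by
    rw [t15, hP, patch_of_notMem, hs 15 (by simp)]
    simp only [Set.mem_iUnion, Set.mem_singleton_iff, not_exists]
    intro i' _ he
    rw [hT] at hc
    omega
  have hrow : row d.n τ T = 0 := by
    funext j
    unfold row
    split_ifs with hj
    · rw [t15, hP, patch_of_mem]
      · rfl
      · simp only [Set.mem_iUnion]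
        exact ⟨j, hj, rfl⟩
    · rfl
  have hrows : ∀ f, f ∈ rows d.n τ (τ.nat 21 0) (τ.nat 22 0 - τ.nat 21 0) ↔ f = 0 := by
    intro f
    rw [t21, t22]
    constructor
    · rintro ⟨r, hr, rfl⟩
      rw [show T + r = T by omega, hrow]
    · rintro rfl
      exact ⟨0, by omega, hrow.symm⟩
  refine ⟨h.congr (fun b h1 h2 h3 h4 _ => hf b h1 h2 h3 h4) hold (by omega),
    ⟨by omega, by omega, by omega, ⟨fun f hf j hj => ?_, fun f _ c _ hc => ?_, fun z hz => ?_⟩⟩,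
    hf 19 (by simp) (by simp) (by simp) (by simp), hf 20 (by simp) (by simp) (by simp) (by simp),
    hf 17 (by simp) (by simp) (by simp) (by simp), hf 18 (by simp) (by simp) (by simp) (by simp)⟩
  · rw [(hrows f).1 hf]
    simp
  · exact absurd hc (Set.notMem_empty c)
  · have : restr z ∅ = 0 := by
      funext j
      exact restr_of_notMem (Set.notMem_empty j)
    exact ⟨0, (hrows 0).2 rfl, fun s _ _ => by rw [this]; exact ⟨rfl, fun _ _ => rfl⟩⟩

/-- What does not change while the table of `t` is computed. -/
def SameTree (σ τ : State) : Prop :=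
  τ.nat 19 = σ.nat 19 ∧ τ.nat 20 = σ.nat 20 ∧ τ.nat 17 = σ.nat 17 ∧ τ.nat 18 = σ.nat 18

/-- The players of the bag are added one by one by joins with all their strategies. Their positions
are at most t, so nobody has to be satisfied yet. -/
theorem R_singlePart (hfit : d.Fits D B) (hw : d.Wf D) {i t : ℕ} {t' : RAM.X} (htn : t ≤ d.n)
    (ht : ∀ τ : State, (∀ b < 15, τ.nat b = σ.nat b) → Stable B τ [i] t' t)
    (h : Base d B t σ) (hc : Cur d B t ∅ σ) :
    R B (singlePart t') [i] σ fun τ => Base d B t τ ∧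
      Cur d B t {j | j < d.n ∧ bagOf d.n σ t j} τ ∧ SameTree σ τ ∧
      ∀ b < 15, τ.nat b = σ.nat b := by
  have hB1 := hfit.one_le
  refine (R.frame (R.for hB1 d.n (by simp [Algo.n]) (by simp [Algo.n, h.holds.n])
    (by have := hfit.n_lt; omega) (fun s τ => Base d B t τ ∧
      Cur d B t {j | j < s ∧ bagOf d.n σ t j} τ ∧ SameTree σ τ ∧ ∀ b < 15, τ.nat b = σ.nat b)
      (Q := fun τ => Base d B t τ ∧
      Cur d B t {j | j < d.n ∧ bagOf d.n σ t j} τ ∧ SameTree σ τ ∧ ∀ b < 15, τ.nat b = σ.nat b)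
      ?_ (fun s hs τ hτ => ?_) fun τ hτ => hτ)).mono fun τ hτ => hτ.1
  · refine ⟨h, ?_, ⟨rfl, rfl, rfl, rfl⟩, fun _ _ => rfl⟩
    rw [show {j | j < 0 ∧ bagOf d.n σ t j} = ∅ by ext; simp]
    exact hc
  · obtain ⟨hb, hcu, hst, hlow⟩ := hτ
    have hbag : bagOf d.n τ = bagOf d.n σ := by unfold bagOf; rw [hst.1]
    have hS := ht τ hlow [s]
    have hN : numStrat.eval τ [i, s] = d.K := by simp [numStrat, hb.holds.K]
    have hsucc : {j | j < s + 1 ∧ bagOf d.n σ t j} =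
        {j | j < s ∧ bagOf d.n σ t j} ∪ {j | j = s ∧ bagOf d.n σ t j} := by
      ext j
      simp only [Set.mem_ofPred_eq, Set.mem_union, Nat.lt_succ_iff_lt_or_eq]
      tauto
    refine R.ite hB1 (by simpa [Algo.bag, Algo.n] using hS.1) (fun hbr => ?_) (fun hbr => ?_) <;>
      simp only [List.cons_append, List.nil_append] at hS <;>
      simp [Algo.bag, Algo.n, hS.2, hb.holds.n] at hbr
    · have hbs : bagOf d.n σ t s := by unfold bagOf; rw [← hst.1]; exact hbr
      have hpos : d.pos s ≤ t := hb.tree.pos_le le_rfl htn hs (by rw [hbag]; exact hbs)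
      have hYs : {j | j = s ∧ bagOf d.n σ t j} = {s} := by
        ext j
        simp only [Set.mem_ofPred_eq, Set.mem_singleton_iff]
        exact ⟨fun h => h.1, fun h => ⟨h, h ▸ hbs⟩⟩
      have htop : s * d.K + d.K ≤ τ.nat 16 0 := by
        have := Nat.mul_le_mul_right d.K (show s + 1 ≤ d.n from hs)
        rw [add_mul, one_mul] at this
        exact this.trans hb.top
      have hposX : ∀ c ∈ {j | j < s ∧ bagOf d.n σ t j}, ¬ t < d.pos c := fun c hc => by
        have := hb.tree.pos_le le_rfl htn (hc.1.trans hs) (by rw [hbag]; exact hc.2)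
        omega
      have hjoin := (R_join_table (i := i) (s := s) (l := var 1 * numStrat)
        (h := var 1 * numStrat + numStrat) (t' := t') (lB := s * d.K) (nB := d.K) (Y := {s})
        hfit hw hb hcu htn htop hfit.K_le (fun υ hυ => ?_) ?_ ?_ ?_ ?_ ?_).frame
      · refine hjoin.mono ?_
        rintro υ ⟨⟨h1, h2, h3, h4, h5, h6⟩, h7, -⟩
        refine ⟨h1, ?_, ⟨h3.trans hst.1, h4.trans hst.2.1, h5.trans hst.2.2.1,
          h6.trans hst.2.2.2⟩, fun b hb => ?_⟩
        · rw [hsucc, hYs]; exact h2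
        · rw [h7 b ?_, hlow b hb]
          simp [join, S.nats]
          omega
      · have h5 := hυ 5 (by simp) (by simp) (by simp) (by simp) (by simp)
        have hK : υ.nat 5 0 = d.K := by rw [h5, hb.holds.K]
        have hlow' : ∀ b < 15, υ.nat b = σ.nat b := fun b hb => by
          rw [hυ b (by omega) (by omega) (by omega) (by omega) (by omega), hlow b hb]
        exact ⟨fun l => by simp [numStrat, hK], fun l => by simp [numStrat, hK],
          (ht υ hlow').append [s]⟩
      · rintro _ ⟨x, hx, rfl⟩ j hj
        rw [hb.single s hs x hx j hj]
        split_ifs with hjs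
        · exact ⟨hx, by simp [hjs]⟩
        · exact ⟨Nat.zero_le _, by simp [hjs]⟩
      · rintro j - hj
        rw [Set.mem_singleton_iff] at hj
        rw [hj, hbag]
        exact hbs
      · exact fun c hc hlt => absurd hlt (hposX c hc)
      · rintro c hc hlt
        rw [Set.mem_singleton_iff] at hc
        rw [hc] at hlt
        omega
      · intro z hz
        obtain ⟨hz1, hz2, -⟩ := hz s hs
        have he : ∀ j < d.n, row d.n τ (s * d.K + (z s - 1)) j = restr z {s} j := fun j hj => by
          rw [hb.single s hs _ (by omega) j hj]
          split_ifs with hjs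
          · rw [hjs, restr_of_mem (Set.mem_singleton s)]
            omega
          · rw [restr_of_notMem (by simpa using hjs)]
        refine ⟨_, ⟨z s - 1, by omega, rfl⟩, fun j hj _ => ⟨he j hj, fun a _ =>
          Pay_congr fun l hl => by rw [he l hl]⟩, fun c _ hc hlt => ?_⟩
        rw [Set.mem_singleton_iff] at hc
        rw [hc] at hlt
        omega
    · refine R.skip ⟨hb, ?_, hst, hlow⟩
      rw [hsucc, show {j | j = s ∧ bagOf d.n σ t j} = ∅ from ?_, Set.union_empty]
      · exact hcu
      · ext j
        simp only [Set.mem_ofPred_eq, Set.mem_empty_iff_false, iff_false, not_and]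
        rintro rfl hbj
        unfold bagOf at hbj
        rw [← hst.1] at hbj
        exact hbj hbr

end RAM.Algo

/-! ### Children, the root, and the output of the dynamic program -/

namespace RAM.Algo

open X Polymatrix Data

variable {d : Data} {D B : ℕ} {σ τ : State}

theorem SameTree.trans {υ : State} (h : SameTree σ τ) (h' : SameTree τ υ) : SameTree σ υ :=
  ⟨h'.1.trans h.1, h'.2.1.trans h.2.1, h'.2.2.1.trans h.2.2.1, h'.2.2.2.trans h.2.2.2⟩

/-- The set of defined players grows from the bag by the spans of the children treated so far. Each
overlap lies in the bag by `bag_of_span_span`, and players after t have all neighbours in their own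
child's span by `span_of_adj`, as a join requires. After the last child the set is the span of t. -/
theorem R_childPart (hfit : d.Fits D B) (hw : d.Wf D) {i t : ℕ} {t' : RAM.X} (htn : t ≤ d.n)
    (ht : ∀ τ : State, (∀ b < 15, τ.nat b = σ.nat b) → Stable B τ [i] t' t)
    (h : Base d B t σ) (hc : Cur d B t {j | j < d.n ∧ bagOf d.n σ t j} σ) :
    R B (childPart t') [i] σ fun τ => Base d B t τ ∧
      Cur d B t (d.span (bagOf d.n σ) (σ.nat 20) t) τ ∧ SameTree σ τ ∧
      ∀ b < 15, τ.nat b = σ.nat b := by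
  have hB1 := hfit.one_le
  let X : ℕ → Set ℕ := fun c => {j | j < d.n ∧ bagOf d.n σ t j} ∪
    ⋃ t' ∈ {t' | t' < c ∧ t < t' ∧ σ.nat 20 t' = t}, d.span (bagOf d.n σ) (σ.nat 20) t'
  refine R.for hB1 (d.n + 1) (by simp [Algo.n]) (by simp [Algo.n, h.holds.n])
    hfit.n_lt (fun c τ => Base d B t τ ∧ Cur d B t (X c) τ ∧ SameTree σ τ ∧
      ∀ b < 15, τ.nat b = σ.nat b) ?_ (fun c hcn τ hτ => ?_) ?_
  · refine ⟨h, ?_, ⟨rfl, rfl, rfl, rfl⟩, fun _ _ => rfl⟩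
    rw [show X 0 = {j | j < d.n ∧ bagOf d.n σ t j} by simp [X]]
    exact hc
  · obtain ⟨hb, hcu, hst, hlow⟩ := hτ
    have hbag : bagOf d.n τ = bagOf d.n σ := by unfold bagOf; rw [hst.1]
    have hS := ht τ hlow [c]
    have htree := h.tree
    refine R.ite hB1 (by simpa [par] using hS.1) (fun hbr => ?_) (fun hbr => ?_) <;>
      simp only [List.cons_append, List.nil_append] at hS <;>
      simp [par, hS.2, hst.2.1] at hbr
    · have hsucc : X (c + 1) = X c ∪ d.span (bagOf d.n σ) (σ.nat 20) c := by
        ext j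
        simp only [X, Set.mem_union, Set.mem_iUnion, Set.mem_ofPred_eq, exists_prop,
          Nat.lt_succ_iff_lt_or_eq, or_assoc]
        refine or_congr Iff.rfl ?_
        constructor
        · rintro ⟨s, ⟨h1 | rfl, h2⟩, h3⟩
          · exact Or.inl ⟨s, ⟨h1, h2⟩, h3⟩
          · exact Or.inr h3
        · rintro (⟨s, ⟨h1, h2⟩, h3⟩ | h3)
          · exact ⟨s, ⟨Or.inl h1, h2⟩, h3⟩
          · exact ⟨c, ⟨Or.inr rfl, hbr⟩, h3⟩
      obtain ⟨g1, g2, g3, g4⟩ := hb.table c hbr.1 (by omega)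
      rw [hbag, hst.2.1] at g4
      have hcl : ∀ s, t < s → s ≤ d.n → σ.nat 20 s = t →
          ∀ c ∈ d.span (bagOf d.n σ) (σ.nat 20) s, t < d.pos c → ∀ j, d.adj c j →
            j ∈ d.span (bagOf d.n σ) (σ.nat 20) s := fun s h1 h2 h3 c hc hlt j hj =>
        htree.span_of_adj hw h1.le hc.1 (htree.desc_of_span le_rfl h1 h2 h3 hc hlt) hj
      have hjoin := (R_join_table (i := i) (s := c) (l := lo (var 1)) (h := hi (var 1)) (t' := t')
        (lB := τ.nat 17 c) (nB := τ.nat 18 c - τ.nat 17 c)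
        (Y := d.span (bagOf d.n σ) (σ.nat 20) c) hfit hw hb hcu htn (by omega) g3
        (fun υ hυ => ?_) (fun g hg => g4.isOn g hg) ?_ ?_ ?_ ?_).frame
      · refine hjoin.mono ?_
        rintro υ ⟨⟨h1, h2, h3, h4, h5, h6⟩, h7, -⟩
        refine ⟨h1, ?_, hst.trans ⟨h3, h4, h5, h6⟩, fun b hb => ?_⟩
        · rw [hsucc]; exact h2
        · rw [h7 b ?_, hlow b hb]
          simp [join, S.nats]
          omega
      · have h17 := hυ 17 (by simp) (by simp) (by simp) (by simp) (by simp)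
        have h18 := hυ 18 (by simp) (by simp) (by simp) (by simp) (by simp)
        have hlow' : ∀ b < 15, υ.nat b = σ.nat b := fun b hb => by
          rw [hυ b (by omega) (by omega) (by omega) (by omega) (by omega), hlow b hb]
        refine ⟨fun l => by simp [lo, h17], fun l => ?_, (ht υ hlow').append [c]⟩
        simp [hi, h18]
        omega
      · intro j hjX hjc
        rw [hbag]
        rcases hjX with hjX | hjX
        · exact hjX.2
        · simp only [Set.mem_iUnion] at hjX
          obtain ⟨s, ⟨h1, h2, h3⟩, h4⟩ := hjX
          exact htree.bag_of_span_span le_rfl h2 (by omega) h3 hbr.1 (by omega) hbr.2 (by omega)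
            h4 hjc
      · intro j hjX hlt l hl
        rcases hjX with hjX | hjX
        · have := htree.pos_le le_rfl htn hjX.1 hjX.2
          omega
        · refine Or.inr ?_
          simp only [Set.mem_iUnion] at hjX ⊢
          obtain ⟨s, ⟨h1, h2, h3⟩, h4⟩ := hjX
          exact ⟨s, ⟨h1, h2, h3⟩, hcl s h2 (by omega) h3 j h4 hlt l hl⟩
      · exact hcl c hbr.1 (by omega) hbr.2
      · intro z hz
        rw [hbag]
        exact g4.child hw htree le_rfl hbr.1 (by omega) hbr.2 z hz
    · refine R.skip ⟨hb, ?_, hst, hlow⟩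
      have hsucc : X (c + 1) = X c := by
        ext j
        simp only [X, Set.mem_union, Set.mem_iUnion, Set.mem_ofPred_eq, exists_prop,
          Nat.lt_succ_iff_lt_or_eq]
        refine or_congr Iff.rfl ?_
        constructor
        · rintro ⟨s, ⟨h1 | rfl, h2⟩, h3⟩
          · exact ⟨s, ⟨h1, h2⟩, h3⟩
          · exact absurd h2.2 (hbr h2.1)
        · rintro ⟨s, ⟨h1, h2⟩, h3⟩
          exact ⟨s, ⟨Or.inl h1, h2⟩, h3⟩
      rw [hsucc]
      exact hcu
  · rintro τ ⟨h1, h2, h3, h4⟩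
    refine ⟨h1, ?_, h3, h4⟩
    rw [h.tree.span_eq le_rfl htn]
    simpa only [X, Nat.lt_succ_iff] using h2

theorem R_table (hfit : d.Fits D B) (hw : d.Wf D) {i t : ℕ} {t' : RAM.X} (htn : t ≤ d.n)
    (ht : ∀ τ : State, (∀ b < 15, τ.nat b = σ.nat b) → Stable B τ [i] t' t)
    (h : Done d B (t + 1) σ) :
    R B (table t') [i] σ fun τ => Done d B t τ ∧ ∀ b < 15, τ.nat b = σ.nat b := by
  have hB1 := hfit.one_le
  refine R.assoc hB1 (R_bagPart hfit hw h.holds htn ht) ?_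
  rintro σ₁ ⟨a1, a2, a3⟩
  have low1 : ∀ b < 15, σ₁.nat b = σ.nat b := fun b hb => a1 b (by omega)
  refine R.assoc hB1 (R_parPart hfit hw (h.holds.congr low1) (ht _ low1)) ?_
  rintro σ₂ ⟨b1, b2, b3, b4⟩
  have low2 : ∀ b < 15, σ₂.nat b = σ.nat b := fun b hb => by rw [b1 b (by omega), low1 b hb]
  have hbag : bagOf d.n σ₂ = bagOf d.n σ₁ := by unfold bagOf; rw [b1 19 (by simp)]
  have a20 := a1 20 (by simp)
  have hbase : Base d B t σ₂ := by
    refine h.base (fun b h1 h2 => by rw [b1 b h2, a1 b h1]) (fun s hs j hj => ?_) (fun s hs => ?_)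
      (fun j hj => ?_) (fun j hj => ?_) ?_
    · rw [hbag]; exact a2 s hs j hj
    · rw [b2 s hs, a20]
    · rw [hbag, a3 j hj]
      refine or_congr Iff.rfl (and_congr Iff.rfl (or_congr Iff.rfl (exists_congr fun s =>
        and_congr_right fun _ => and_congr_right fun h4 => ?_)))
      rw [b2 s h4, a20, a2 s h4 j hj]
    · rw [hbag]; exact b3 j hj
    · rw [hbag]; exact b4
  refine R.assoc hB1 (R_initPart hfit (i := i) hbase).frame ?_
  rintro σ₃ ⟨⟨c1, c2, c3⟩, c4, -⟩
  have low3 : ∀ b < 15, σ₃.nat b = σ.nat b := fun b hb => by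
    rw [c4 b ?_, low2 b hb]
    simp [initPart, S.nats]
    omega
  have ht3 : ∀ τ : State, (∀ b < 15, τ.nat b = σ₃.nat b) → Stable B τ [i] t' t := fun τ hτ =>
    ht τ fun b hb => by rw [hτ b hb, low3 b hb]
  refine R.assoc hB1 (R_singlePart hfit hw htn ht3 c1 c2) ?_
  rintro σ₄ ⟨d1, d2, d3, d4⟩
  have ht4 : ∀ τ : State, (∀ b < 15, τ.nat b = σ₄.nat b) → Stable B τ [i] t' t := fun τ hτ =>
    ht3 τ fun b hb => by rw [hτ b hb, d4 b hb]
  have hbag4 : bagOf d.n σ₄ = bagOf d.n σ₃ := by unfold bagOf; rw [d3.1]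
  rw [← hbag4] at d2
  refine R.assoc hB1 (R_childPart hfit hw htn ht4 d1 d2) ?_
  rintro σ₅ ⟨e1, e2, e3, e4⟩
  have ht5 := ht4 σ₅ e4
  have hbag5 : bagOf d.n σ₅ = bagOf d.n σ₄ := by unfold bagOf; rw [e3.1]
  rw [← hbag5, ← e3.2.1] at e2
  refine R.seq hB1 (R.setN hB1 ht5.here.1 (by simp [curLo]) ?_)
  rw [ht5.here.2]
  have l1 : curLo.eval σ₅ [i] = σ₅.nat 21 0 := rfl
  rw [l1]
  have ht6 := ht4 (σ₅.setNat 17 t (σ₅.nat 21 0)) fun b hb => by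
    rw [setNat_nat_of_ne _ _ _ (by omega), e4 b hb]
  refine R.setN hB1 ht6.here.1 (by simp [curHi]) ?_
  rw [ht6.here.2]
  have l2 : curHi.eval (σ₅.setNat 17 t (σ₅.nat 21 0)) [i] = σ₅.nat 22 0 := by
    simp [curHi, setNat_nat]
  rw [l2]
  generalize hφ : State.setNat _ 18 _ _ = φ
  have hf : ∀ b, b ≠ 17 → b ≠ 18 → φ.nat b = σ₅.nat b := fun b h1 h2 => by
    rw [← hφ, setNat_nat_of_ne _ _ _ h2, setNat_nat_of_ne _ _ _ h1]
  have f17 : ∀ s, φ.nat 17 s = if s = t then σ₅.nat 21 0 else σ₅.nat 17 s := fun s => by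
    rw [← hφ]; simp [setNat_nat]
  have f18 : ∀ s, φ.nat 18 s = if s = t then σ₅.nat 22 0 else σ₅.nat 18 s := fun s => by
    rw [← hφ]; simp [setNat_nat]
  have h15 := hf 15 (by simp) (by simp)
  have hr : ∀ r, row d.n φ r = row d.n σ₅ r := fun r => by
    funext j; unfold row; rw [h15]
  have hrs : ∀ l r, rows d.n φ l r = rows d.n σ₅ l r := fun l r => by
    unfold rows; simp only [hr]
  have hbagφ : bagOf d.n φ = bagOf d.n σ₅ := by unfold bagOf; rw [hf 19 (by simp) (by simp)]
  refine ⟨⟨e1.holds.congr fun b hb => hf b (by omega) (by omega), ?_, ?_, ?_,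
    fun s hs hsn => ?_⟩, fun b hb => ?_⟩
  · rw [hbagφ, hf 20 (by simp) (by simp)]; exact e1.tree
  · rw [hf 16 (by simp) (by simp)]; exact e1.top
  · simp only [hr]; exact e1.single
  · rw [hf 16 (by simp) (by simp), hbagφ, hf 20 (by simp) (by simp), f17, f18, hrs]
    split_ifs with hst
    · rw [hst]
      exact ⟨e2.le, e2.le_top, e2.card, e2.table⟩
    · exact e1.table s (by omega) hsn
  · rw [hf b (by omega) (by omega), e4 b hb, d4 b hb, low3 b hb]

theorem R_tables (hfit : d.Fits D B) (hw : d.Wf D) (h : Done d B (d.n + 1) σ) :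
    R B (.for (Algo.n + 1) (table (Algo.n - var 0))) [] σ fun τ => Done d B 0 τ := by
  have hB1 := hfit.one_le
  refine R.for hB1 (d.n + 1) (by simp [Algo.n]) (by simp [Algo.n, h.holds.n]) hfit.n_lt
    (fun i τ => Done d B (d.n + 1 - i) τ) (by simpa using h) (fun i hi τ hτ => ?_) (by simp)
  have := R_table (t := d.n - i) (t' := Algo.n - var 0) (i := i) hfit hw (by omega)
    (fun υ hυ l => by
      have := (hτ.holds.congr hυ).n
      simp [Algo.n, this]) (by rwa [show d.n - i + 1 = d.n + 1 - i by omega])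
  refine this.mono fun υ hυ => ?_
  rw [show d.n + 1 - (i + 1) = d.n - i by omega]
  exact hυ.1

/-- Parents have smaller positions, so every node descends from 0 and the span of 0 contains all
players. All of them come after position 0, so every row of this table is a solution. Some solution
exists by assumption, hence the table has a row, and the first one may be taken. -/
theorem Done.solution (hw : d.Wf D) (h : Done d B 0 σ) (hz : ∃ z, d.Solution z) :
    d.Solution (row d.n σ (σ.nat 17 0)) := by
  obtain ⟨z, hz⟩ := hz
  obtain ⟨h1, h2, h3, h4⟩ := h.table 0 le_rfl (Nat.zero_le _)
  obtain ⟨f, ⟨r, hr, -⟩, -⟩ := h4.complete z hz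
  have hmem : row d.n σ (σ.nat 17 0) ∈ rows d.n σ (σ.nat 17 0) (σ.nat 18 0 - σ.nat 17 0) :=
    ⟨0, by omega, rfl⟩
  have hdesc : ∀ u, u ≤ d.n → d.Desc (σ.nat 20) 0 u := by
    intro u
    induction u using Nat.strong_induction_on with
    | _ u ih =>
      intro hu
      rcases Nat.eq_zero_or_pos u with rfl | hu0
      · exact .refl
      · have hlt : σ.nat 20 u < u := by
          rcases h.tree.par_eq u (Nat.zero_le _) hu with h6 | ⟨i, _, _, h6, h7⟩ <;> omega
        exact (ih _ hlt (by omega)).tail ⟨hlt, hu, rfl⟩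
  intro j hj
  have hjs : j ∈ d.span (bagOf d.n σ) (σ.nat 20) 0 := ⟨hj, Or.inr (hdesc _ (hw.placed.le j))⟩
  exact ⟨Nat.one_le_iff_ne_zero.2 ((h4.isOn _ hmem).ne_zero hj hjs), (h4.isOn _ hmem j hj).1,
    h4.sat _ hmem j hj hjs (hw.pos_pos hj)⟩

theorem R_singles (hfit : d.Fits D B) (hd : d.Holds σ) (h15 : σ.nat 15 = 0) :
    R B singles [] σ fun τ => Done d B (d.n + 1) τ := by
  have hB1 := hfit.one_le
  have hnB := hfit.n_lt
  refine R.assoc hB1 (Fills.for (a := 15) hB1 d.n (by simp [Algo.n]) (by simp [Algo.n, hd.n])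
    (by omega) _ (fun c => c / d.n % d.K + 1) fun s hs => Fills.for hB1 d.K (by simp [numStrat])
      (by simp [numStrat, State.put_nat, hd.K]) hfit.K_le
      (fun x => {(s * d.K + x) * d.n + s}) _ fun x hx => Fills.setN hB1 ?_ ?_ ?_ ?_) ?_
  · simp [numStrat, Algo.n]
  · simp
  · simp [numStrat, Algo.n, State.put_nat, hd.K, hd.n]
  · simp only [add_mul_div_of_lt hs, add_mul_mod_of_lt hx]
    simp
  rintro τ rfl
  set P := patch (⋃ i < d.n, ⋃ j < d.K, {(i * d.K + j) * d.n + i}) (fun c => c / d.n % d.K + 1)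
    (σ.nat 15) with hP
  refine R.setN hB1 (by simp) (by simp [Algo.n, numStrat]) ?_
  have e : (Algo.n * numStrat).eval (σ.put 15 P) [] = d.n * d.K := by
    simp [Algo.n, numStrat, State.put_nat, hd.n, hd.K]
  rw [e]
  generalize hφ : State.setNat _ _ _ _ = φ
  have hf : ∀ b, b ≠ 15 → b ≠ 16 → φ.nat b = σ.nat b := fun b h1 h2 => by
    rw [← hφ, setNat_nat_of_ne _ _ _ h2, State.put_nat, if_neg h1]
  have f15 : φ.nat 15 = P := by rw [← hφ, setNat_nat_of_ne _ _ _ (by simp), State.put_nat_same]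
  have f16 : φ.nat 16 0 = d.n * d.K := by rw [← hφ]; simp
  refine ⟨hd.congr fun b hb => hf b (by omega) (by omega), ⟨fun t h1 h2 => by omega,
    fun t h1 h2 => by omega, fun t h1 h2 => by omega⟩, f16.ge, fun s hs x hx j hj => ?_,
    fun t h1 h2 => by omega⟩
  rw [row_of_lt hj, f15, hP]
  split_ifs with hjs
  · subst hjs
    rw [patch_of_mem, add_mul_div_of_lt hj, add_mul_mod_of_lt hx]
    simp only [Set.mem_iUnion]
    exact ⟨j, hs, x, hx, rfl⟩
  · rw [patch_of_notMem, h15]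
    · rfl
    · simp only [Set.mem_iUnion, Set.mem_singleton_iff, not_exists]
      intro s' hs' x' hx' he
      have e1 := congrArg (· % d.n) he
      have e2 := congrArg (· / d.n / d.K) he
      simp only [add_mul_mod_of_lt hj, add_mul_mod_of_lt hs'] at e1
      simp only [add_mul_div_of_lt hj, add_mul_div_of_lt hs', add_mul_div_of_lt hx,
        add_mul_div_of_lt hx'] at e2
      omega

theorem R_output (hfit : d.Fits D B) (hd : d.Holds σ) :
    R B output [] σ fun τ => ∀ i < d.n, ∀ a < d.m, τ.rat 2 (i * d.m + a) =
      (d.C (row d.n σ (σ.nat 17 0) i * d.m + a) : ℚ) / d.k := by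
  have hB1 := hfit.one_le
  have hnB := hfit.n_lt
  refine R.mono (FillsR.for (a := 2) hB1 d.n (by simp [Algo.n]) (by simp [Algo.n, hd.n])
    (by omega) _ (fun c => (d.C (row d.n σ (σ.nat 17 0) (c / d.m) * d.m + c % d.m) : ℚ) / d.k)
    fun i hi => FillsR.for hB1 d.m (by simp [Algo.m])
      (by simp [Algo.m, hd.m]) hfit.m_le
      (fun a => {i * d.m + a}) _ fun a ha => FillsR.setR hB1 ?_ ?_ ?_ ?_) ?_
  · simp [Algo.m]
  · simp [cnt, wit, lo, Algo.m, Algo.n, Algo.k]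
  · simp [Algo.m, hd.m]
  · simp [cnt, wit, lo, Algo.m, Algo.n, Algo.k, hd.m, hd.n, hd.k, hd.C, add_mul_div_of_lt ha,
      add_mul_mod_of_lt ha, row_of_lt hi]
  · rintro τ rfl i hi a ha
    simp only [State.putR, Function.update_self]
    rw [patch_of_mem, add_mul_div_of_lt ha, add_mul_mod_of_lt ha]
    simp only [Set.mem_iUnion]
    exact ⟨i, hi, a, ha, rfl⟩

end RAM.Algo

/-! ### The whole program -/

namespace RAM.Algo

open X Polymatrix Data

variable {B : ℕ} {σ τ : State}

theorem shiftedVal_congr {n m k i j a b : ℕ} (h1 : τ.nat 1 = σ.nat 1) (h2 : τ.rat = σ.rat) :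
    shiftedVal τ n m k i j a b = shiftedVal σ n m k i j a b := by
  unfold shiftedVal
  rw [h1, h2]

/-- The algorithm finds a solution of the rounded game. -/
theorem R_main {n m w k₀ : ℕ} {e : ℚ} {adj : ℕ → ℕ → Prop} (hn : σ.nat 0 0 = n)
    (hm : σ.nat 0 1 = m) (h0 : ∀ b, 2 ≤ b → σ.nat b = 0) (he : σ.rat 0 0 = e) (he0 : 0 < e)
    (hn1 : 1 ≤ n) (hadj : ∀ i < n, ∀ j < n, σ.nat 1 (i * n + j) ≠ 0 ↔ adj i j)
    (hsymm : ∀ i j, adj i j → adj j i) (hlt : ∀ i j, adj i j → i < n ∧ j < n)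
    (hext : ∀ (R : Set ℕ) (u : ℕ), u < n → u ∉ R →
      (∀ v < n, v ∉ R → (nbrs adj R v).ncard ≤ 2 * (w + 1) + 1) →
      ∃ f : ℕ → ℕ, (∀ i < w + 1, f i < n) ∧ (∃ i < w + 1, f i ∉ R) ∧
        ∀ v < n, v ∉ R ∪ {x | ∃ i < w + 1, f i = x} →
          (nbrs adj (R ∪ {x | ∃ i < w + 1, f i = x}) v).ncard ≤ 2 * (w + 1) + 1)
    (hv : ∀ k : ℕ, ∀ i < n, ∀ j < n, ∀ a < m, ∀ b < m, shiftedVal σ n m k i j a b ≤ 2 * k)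
    (hk₀ : 11 * (n * n : ℚ) ≤ k₀ * e) (hnB : n + 1 ≤ B) (hmB : m ≤ B) (hkB : 2 * k₀ ≤ B)
    (hBn : n * ((w + 2) * n ^ (w + 1)) ≤ B)
    (hBt : (((k₀ + 1) ^ m + 1) * (n * (2 * k₀ * k₀) + 1) ^ m) ^ (3 * (w + 1) + 1 + 1) ≤ B) :
    R B main [] σ fun τ => ∃ d : Data, d.n = n ∧ d.m = m ∧ 11 * (n * n : ℚ) ≤ d.k * e ∧
      IsStratTable m d.k d.K d.C ∧
      (∀ i < n, ∀ j < n, ∀ a < m, ∀ b < m,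
        d.J (((i * n + j) * m + a) * m + b) = ⌊shiftedVal σ n m d.k i j a b⌋₊) ∧
      ((∃ z, d.Solution z) → ∃ z, d.Solution z ∧ ∀ i < n, ∀ a < m,
        τ.rat 2 (i * m + a) = (d.C (z i * m + a) : ℚ) / d.k) := by
  have hB1 : 1 ≤ B := by omega
  refine R.assoc hB1 (R_findRes hB1 hn (by rw [h0 2 le_rfl]; rfl) he hn1 he0 hk₀
    (by omega)) ?_
  rintro σ₁ ⟨a1, a2, a3, a4⟩
  obtain ⟨k, hk⟩ : ∃ k, σ₁.nat 2 0 = k := ⟨_, rfl⟩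
  rw [hk] at a3 a4
  -- The loop bounds are assumed for k₀; the minimality of the computed resolution k transfers them
  -- to k.
  have hkk : k ≤ k₀ := by
    have h1 : ((k : ℚ) - 1) * e < k₀ * e := a4.trans_le hk₀
    have h2 : (k : ℚ) - 1 < k₀ := lt_of_mul_lt_mul_right h1 he0.le
    have h3 : (k : ℚ) < k₀ + 1 := by linarith
    have h4 : k < k₀ + 1 := by exact_mod_cast h3
    omega
  have hpow : (k + 1) ^ m ≤ (k₀ + 1) ^ m := Nat.pow_le_pow_left (by omega) _
  have htab : ((k + 1) ^ m + 1) * (n * (2 * k * k) + 1) ^ m ≤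
      ((k₀ + 1) ^ m + 1) * (n * (2 * k₀ * k₀) + 1) ^ m :=
    Nat.mul_le_mul (by omega) (Nat.pow_le_pow_left (by gcongr) _)
  have hpB : (k + 1) ^ m ≤ B := by
    have h1 : 1 ≤ (n * (2 * k₀ * k₀) + 1) ^ m := Nat.one_le_pow _ _ (by omega)
    have h2 : ((k₀ + 1) ^ m + 1) * 1 ≤ ((k₀ + 1) ^ m + 1) * (n * (2 * k₀ * k₀) + 1) ^ m :=
      Nat.mul_le_mul_left _ h1
    have h3 := Nat.le_self_pow (show 3 * (w + 1) + 1 + 1 ≠ 0 by omega)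
      (((k₀ + 1) ^ m + 1) * (n * (2 * k₀ * k₀) + 1) ^ m)
    omega
  have hv' : ∀ i < n, ∀ j < n, ∀ a < m, ∀ b < m, shiftedVal σ₁ n m k i j a b ≤ 2 * k :=
    fun i hi j hj a ha b hb => by
      rw [shiftedVal_congr (a1 1 (by simp) (by simp)) a2]
      exact hv k i hi j hj a ha b hb
  refine R.assoc hB1 (R_roundPay hB1 (by rw [a1 0 (by simp) (by simp), hn])
    (by rw [a1 0 (by simp) (by simp), hm]) hk (by omega) hmB (by omega) hv') ?_
  rintro σ₂ ⟨b1, b2, b3⟩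
  have low2 : ∀ b, b ≠ 2 → b ≠ 24 → b ≠ 3 → σ₂.nat b = σ.nat b := fun b h2 h24 h3 => by
    rw [b1 b h3, a1 b h2 h24]
  refine R.assoc hB1 (R_strategies hB1 (k := k) (by rw [low2 0 (by simp) (by simp) (by simp), hm])
    (by rw [b1 2 (by simp), hk]) hmB hpB
    (by rw [low2 4 (by simp) (by simp) (by simp), h0 4 (by simp)])
    (by rw [low2 5 (by simp) (by simp) (by simp), h0 5 (by simp)]; rfl)
    (by rw [low2 6 (by simp) (by simp) (by simp), h0 6 (by simp)])
    (by rw [low2 7 (by simp) (by simp) (by simp), h0 7 (by simp)]; rfl)) ?_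
  rintro σ₃ ⟨c1, c2, c3, c4, c5⟩
  have low3 : ∀ b, b ∉ [2, 3, 4, 5, 6, 7, 24] → σ₃.nat b = σ.nat b := fun b hb => by
    simp only [List.mem_cons, List.not_mem_nil, not_or, or_false] at hb
    rw [c1 b (by tauto) (by tauto) (by tauto) (by tauto), low2 b (by tauto) (by tauto) (by tauto)]
  have hn3 : σ₃.nat 0 0 = n := by rw [low3 0 (by simp), hn]
  refine R.assoc hB1 (R_elimOrder hB1 (w := w) hn3 hn1 hBn
    (by rw [low3 1 (by simp)]; exact hadj) hlt hext c3 (by rw [low3 8 (by simp), h0 8 (by simp)])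
    (by rw [low3 9 (by simp), h0 9 (by simp)]; rfl)).frame ?_
  rintro σ₄ ⟨d1, d2, -⟩
  have low4 : ∀ b, b ∉ [6, 7, 8, 9, 10, 11, 12, 14] → σ₄.nat b = σ₃.nat b := fun b hb => by
    refine d2 b fun h => hb ?_
    simp [elimOrder, markRemoved, reach, place, inc, S.nats] at h ⊢
    tauto
  let d : Data := ⟨n, m, k, σ₃.nat 5 0, σ₂.nat 3, σ₃.nat 4, σ₄.nat 8, σ₄.nat 10, adj⟩
  have hd : d.Holds σ₄ := by
    refine ⟨?_, ?_, ?_, ?_, ?_, ?_, rfl, rfl, ?_⟩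
    · rw [low4 0 (by simp), hn3]
    · rw [low4 0 (by simp), low3 0 (by simp), hm]
    · rw [low4 2 (by simp), c1 2 (by simp) (by simp) (by simp) (by simp), b1 2 (by simp), hk]
    · rw [low4 5 (by simp)]
    · rw [low4 3 (by simp), c1 3 (by simp) (by simp) (by simp) (by simp)]
    · rw [low4 4 (by simp)]
    · rw [low4 1 (by simp), low3 1 (by simp)]
      exact hadj
  have hJ : ∀ i < n, ∀ j < n, ∀ a < m, ∀ b < m,
      d.J (((i * n + j) * m + a) * m + b) = ⌊shiftedVal σ n m d.k i j a b⌋₊ := by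
    intro i hi j hj a ha b hb
    rw [← shiftedVal_congr (a1 1 (by simp) (by simp)) a2]
    exact b3 i hi j hj a ha b hb
  have hw : d.Wf (3 * (w + 1) + 1) := by
    refine ⟨d1, hsymm, hlt, fun i hi j hj a ha b hb hne hna => ?_, fun i hi j hj a ha b hb => ?_, c5⟩
    · have h1 : σ.nat 1 (i * n + j) = 0 := by
        by_contra h
        exact hna ((hadj i hi j hj).1 h)
      rw [hJ i hi j hj a ha b hb]
      simp [shiftedVal, h1, ind_of_not hne]
    · rw [hJ i hi j hj a ha b hb]
      have h1 := Nat.floor_le_floor (hv k i hi j hj a ha b hb)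
      rwa [show (2 * (k : ℚ)) = ((2 * k : ℕ) : ℚ) by push_cast; rfl, Nat.floor_natCast] at h1
  have hfit : d.Fits (3 * (w + 1) + 1) B := by
    refine ⟨hB1, hnB, hmB, c4.trans hpB, le_trans ?_ hBt⟩
    exact Nat.pow_le_pow_left (le_trans (Nat.mul_le_mul_right _ (Nat.add_le_add_right c4 1)) htab) _
  refine R.assoc hB1 (R_singles hfit hd ?_) fun σ₅ h5 => ?_
  · rw [low4 15 (by simp), low3 15 (by simp), h0 15 (by simp)]
  refine R.assoc hB1 (R_tables hfit hw h5) fun σ₆ h6 => ?_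
  refine (R_output hfit h6.holds).mono fun τ hτ => ?_
  exact ⟨d, rfl, rfl, a3, c5, hJ, fun hz => ⟨_, h6.solution hw hz, hτ⟩⟩

end RAM.Algo

/-! ### A fixed point theorem for bounded C¹ maps -/

namespace FixedPoint

open MeasureTheory Set Metric Polynomial

/-- `det (1 + t A)` is a polynomial in `t` of degree at most the dimension. -/
theorem exists_poly_det {ι : Type*} [Fintype ι] [DecidableEq ι]
    (A : EuclideanSpace ℝ ι →L[ℝ] EuclideanSpace ℝ ι) :
    ∃ p : ℝ[X], p.natDegree ≤ Fintype.card ι ∧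
      ∀ t : ℝ, p.eval t = (ContinuousLinearMap.id ℝ _ + t • A).det := by
  set b := (EuclideanSpace.basisFun ι ℝ).toBasis
  set M := LinearMap.toMatrix b b (A : EuclideanSpace ℝ ι →ₗ[ℝ] EuclideanSpace ℝ ι)
  refine ⟨Matrix.det ((X : ℝ[X]) • M.map C + (1 : Matrix ι ι ℝ).map C),
    natDegree_det_X_add_C_le M 1, fun t => ?_⟩
  rw [← coe_evalRingHom, RingHom.map_det]
  have h : (ContinuousLinearMap.id ℝ _ + t • A).det = (1 + t • M).det := by
    rw [ContinuousLinearMap.det, ← LinearMap.det_toMatrix b]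
    congr 1
    ext i j
    simp [M, LinearMap.toMatrix_apply, Matrix.one_apply, b]
  rw [h]
  congr 1
  ext i j
  simp only [RingHom.mapMatrix_apply, Matrix.map_apply, Matrix.add_apply, Matrix.smul_apply, coe_evalRingHom, eval_add, smul_eq_mul,
    eval_mul, eval_X, eval_C]
  ring

/-- For 0 ≤ t ≤ 1 the map 1 + tA is invertible by the Neumann series, so its determinant cannot
change sign on the way from the value 1 at t = 0. -/
theorem det_pos_of_norm_lt {E : Type*} [NormedAddCommGroup E] [NormedSpace ℝ E]
    [FiniteDimensional ℝ E] [CompleteSpace E] {A : E →L[ℝ] E} (hA : ‖A‖ < 1) :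
    0 < (ContinuousLinearMap.id ℝ E + A).det := by
  have hne : ∀ t ∈ Icc (0:ℝ) 1, (ContinuousLinearMap.id ℝ E + t • A).det ≠ 0 := by
    intro t ht
    have h1 : ‖(-t) • A‖ < 1 := by
      rw [norm_smul, norm_neg, Real.norm_of_nonneg ht.1]
      nlinarith [ht.2, norm_nonneg A]
    obtain ⟨u, hu⟩ := isUnit_one_sub_of_norm_lt_one h1
    have h2 : (ContinuousLinearMap.id ℝ E + t • A) = (u : E →L[ℝ] E) := by
      rw [hu, neg_smul, sub_neg_eq_add]; rfl
    have h3 : IsUnit ((u : E →L[ℝ] E) : E →ₗ[ℝ] E) :=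
      u.isUnit.map (ContinuousLinearMap.toLinearMapRingHom (R₁ := ℝ) (M₁ := E))
    rw [h2, ContinuousLinearMap.det]
    exact (LinearMap.isUnit_iff_isUnit_det _).1 h3 |>.ne_zero
  have hc : ContinuousOn (fun t : ℝ => (ContinuousLinearMap.id ℝ E + t • A).det) (Icc 0 1) := by
    apply Continuous.continuousOn
    exact ContinuousLinearMap.continuous_det.comp (by fun_prop)
  by_contra h
  push Not at h
  have h0 : (ContinuousLinearMap.id ℝ E + (0:ℝ) • A).det = 1 := by
    simp [ContinuousLinearMap.det]
  have := intermediate_value_Icc' (zero_le_one) hc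
  obtain ⟨t, ht, he⟩ := this (show (0:ℝ) ∈ Icc _ _ from ⟨by simpa using h, by
    simp only [h0]; exact zero_le_one⟩)
  exact hne t ht he

variable {ι : Type*} [Fintype ι]

local notation "𝔼" => EuclideanSpace ℝ ι

/-- If `h` is Lipschitz, vanishes outside a ball and is differentiable inside, then the integral
of `det (1 + Dh)` over the ball is its volume. -/
theorem integral_det_eq {h : 𝔼 → 𝔼} {K : NNReal} {R : ℝ} (hL : LipschitzWith K h)
    (h0 : ∀ x, R ≤ ‖x‖ → h x = 0) (hd : ∀ x ∈ ball (0 : 𝔼) R, DifferentiableAt ℝ h x) :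
    ∫ x in ball (0 : 𝔼) R, (ContinuousLinearMap.id ℝ 𝔼 + fderiv ℝ h x).det
      = volume.real (ball (0 : 𝔼) R) := by
  classical
  set s := ball (0 : 𝔼) R
  -- For t ≤ c the map x ↦ t • h x is Lipschitz with constant 1/2, which makes x ↦ x + t • h x a
  -- bijection with positive Jacobian determinant.
  set c : ℝ := 1 / (2 * (K + 1))
  have hc : 0 < c := by positivity
  have key : ∀ t ∈ Ioc (0:ℝ) c,
      IntegrableOn (fun x => (ContinuousLinearMap.id ℝ 𝔼 + t • fderiv ℝ h x).det) s ∧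
      ∫ x in s, (ContinuousLinearMap.id ℝ 𝔼 + t • fderiv ℝ h x).det = volume.real s := by
    intro t ht
    have htK : t * K ≤ 1 / 2 := by
      have h1 : t * (K + 1) ≤ 1 / 2 := by
        have := mul_le_mul_of_nonneg_right ht.2 (by positivity : (0:ℝ) ≤ K + 1)
        refine this.trans (le_of_eq ?_)
        simp only [c]
        field_simp
      nlinarith [ht.1]
    set f : 𝔼 → 𝔼 := fun x => x + t • h x
    have hlip : ∀ x y, ‖t • h x - t • h y‖ ≤ 1 / 2 * ‖x - y‖ := by
      intro x y
      rw [← smul_sub, norm_smul, Real.norm_of_nonneg ht.1.le]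
      have := hL.dist_le_mul x y
      rw [dist_eq_norm, dist_eq_norm] at this
      nlinarith [norm_nonneg (x - y), ht.1]
    have hal : ApproximatesLinearOn f (ContinuousLinearEquiv.refl ℝ 𝔼 : 𝔼 →L[ℝ] 𝔼) univ
        ((1:NNReal) / 2) := by
      intro x _ y _
      have : f x - f y - (ContinuousLinearEquiv.refl ℝ 𝔼 : 𝔼 →L[ℝ] 𝔼) (x - y) =
          t • h x - t • h y := by
        simp [f]; abel
      rw [this]
      exact_mod_cast hlip x y
    have hinj : Function.Injective f := by
      intro x y hxy
      have h1 : t • h x - t • h y = y - x := by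
        simp only [f] at hxy
        rw [sub_eq_sub_iff_add_eq_add, add_comm, hxy, add_comm]
      have h2 := hlip x y
      rw [h1, norm_sub_rev] at h2
      have : ‖x - y‖ = 0 := by linarith [norm_nonneg (x - y)]
      exact sub_eq_zero.1 (norm_eq_zero.1 this)
    have hsurj : Function.Surjective f := by
      apply hal.surjective
      rcases subsingleton_or_nontrivial 𝔼 with h' | h'
      · exact .inl h'
      · right
        have : ‖((ContinuousLinearEquiv.refl ℝ 𝔼).symm : 𝔼 →L[ℝ] 𝔼)‖₊ = 1 := by
          have : ((ContinuousLinearEquiv.refl ℝ 𝔼).symm : 𝔼 →L[ℝ] 𝔼) = ContinuousLinearMap.id ℝ 𝔼 := rfl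
          rw [this]
          exact ContinuousLinearMap.nnnorm_id
        rw [this, inv_one]
        exact NNReal.half_lt_self one_ne_zero
    have hout : ∀ x, x ∉ s → f x = x := by
      intro x hx
      have : R ≤ ‖x‖ := by simpa [s] using hx
      simp [f, h0 x this]
    -- The bijection f fixes every point outside the ball and therefore permutes the ball; the
    -- change of variables formula then gives the integral for this t.
    have himg : f '' s = s := by
      ext y
      constructor
      · rintro ⟨x, hx, rfl⟩
        by_contra hy
        have := hinj (hout _ hy)
        rw [this] at hy
        exact hy hx
      · intro hy
        obtain ⟨x, rfl⟩ := hsurj y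
        refine ⟨x, ?_, rfl⟩
        by_contra hx
        rw [hout x hx] at hy
        exact hx hy
    have hder : ∀ x ∈ s, HasFDerivWithinAt f (ContinuousLinearMap.id ℝ 𝔼 + t • fderiv ℝ h x) s x :=
      fun x hx => (((hasFDerivAt_id x).add ((hd x hx).hasFDerivAt.const_smul t))).hasFDerivWithinAt
    have hpos : ∀ x ∈ s, 0 < (ContinuousLinearMap.id ℝ 𝔼 + t • fderiv ℝ h x).det := by
      intro x _
      apply det_pos_of_norm_lt
      rw [norm_smul, Real.norm_of_nonneg ht.1.le]
      have : ‖fderiv ℝ h x‖ ≤ K := norm_fderiv_le_of_lipschitz ℝ hL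
      nlinarith [ht.1]
    have e1 := (integrableOn_image_iff_integrableOn_abs_det_fderiv_smul volume measurableSet_ball
      hder hinj.injOn (fun _ => (1:ℝ)))
    have e2 := (integral_image_eq_integral_abs_det_fderiv_smul volume measurableSet_ball
      hder hinj.injOn (fun _ => (1:ℝ)))
    have e3 : ∀ x ∈ s, |(ContinuousLinearMap.id ℝ 𝔼 + t • fderiv ℝ h x).det| • (1:ℝ) =
        (ContinuousLinearMap.id ℝ 𝔼 + t • fderiv ℝ h x).det := fun x hx => by
      rw [abs_of_pos (hpos x hx), smul_eq_mul, mul_one]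
    constructor
    · refine (integrableOn_congr_fun e3 measurableSet_ball).1 (e1.1 ?_)
      change IntegrableOn _ (f '' s) _
      rw [himg]
      exact integrableOn_const (measure_ball_lt_top.ne)
    · rw [← setIntegral_congr_fun measurableSet_ball e3, ← e2]
      change ∫ x in f '' s, _ = _
      rw [himg]
      simp
  -- At each point the determinant is a polynomial in t of degree less than N. Lagrange
  -- interpolation at N nodes in (0, c] expresses its value at t = 1 with coefficients independent
  -- of x and of sum 1, so the integral at t = 1 is the volume as well.
  set N := Fintype.card ι + 1
  set v : ℕ → ℝ := fun j => c / (j + 1)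
  have hv : InjOn v (Finset.range N) := by
    intro i _ j _ hij
    simp only [v] at hij
    rw [div_eq_div_iff (by positivity) (by positivity)] at hij
    have := mul_left_cancel₀ hc.ne' hij
    exact_mod_cast (add_right_cancel this).symm
  have hvt : ∀ j, v j ∈ Ioc (0:ℝ) c := fun j =>
    ⟨by positivity, div_le_self hc.le (by linarith [(Nat.cast_nonneg j : (0:ℝ) ≤ j)])⟩
  have hpt : ∀ x, (ContinuousLinearMap.id ℝ 𝔼 + fderiv ℝ h x).det =
      ∑ j ∈ Finset.range N, (ContinuousLinearMap.id ℝ 𝔼 + v j • fderiv ℝ h x).det *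
        (Lagrange.basis (Finset.range N) v j).eval 1 := by
    intro x
    obtain ⟨p, hp, he⟩ := exists_poly_det (fderiv ℝ h x)
    have := Lagrange.eq_interpolate (f := p) hv (by
      rw [Finset.card_range]
      refine lt_of_le_of_lt degree_le_natDegree ?_
      exact_mod_cast Nat.lt_succ_of_le hp)
    have h1 := congrArg (eval 1) this
    rw [he, one_smul, Lagrange.interpolate_apply, eval_finsetSum] at h1
    rw [h1]
    simp only [eval_mul, eval_C, he]
  have hone : ∑ j ∈ Finset.range N, (Lagrange.basis (Finset.range N) v j).eval 1 = 1 := by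
    have := congrArg (eval 1) (Lagrange.sum_basis hv ⟨0, by simp [N]⟩)
    rwa [eval_finsetSum, eval_one] at this
  simp_rw [hpt]
  rw [integral_finsetSum _ fun j _ => ((key _ (hvt j)).1.mul_const _)]
  simp_rw [integral_mul_const, (key _ (hvt _)).2]
  rw [← Finset.mul_sum, hone, mul_one]

theorem norm_normalize_sub_le {c : ℝ} (hc : 0 < c) {x y : 𝔼} (hx : c ≤ ‖x‖) (hy : c ≤ ‖y‖) :
    ‖‖x‖⁻¹ • x - ‖y‖⁻¹ • y‖ ≤ 2 / c * ‖x - y‖ := by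
  have hx0 := hc.trans_le hx
  have hy0 := hc.trans_le hy
  have h : ‖x‖⁻¹ • x - ‖y‖⁻¹ • y = ‖x‖⁻¹ • ((x - y) + ((‖y‖ - ‖x‖) * ‖y‖⁻¹) • y) := by
    rw [smul_add, smul_sub, smul_smul]
    have : ‖x‖⁻¹ * ((‖y‖ - ‖x‖) * ‖y‖⁻¹) = ‖x‖⁻¹ - ‖y‖⁻¹ := by field_simp
    rw [this, sub_smul]; abel
  have h2 : ‖((‖y‖ - ‖x‖) * ‖y‖⁻¹) • y‖ ≤ ‖x - y‖ := by
    rw [norm_smul, norm_mul, norm_inv, norm_norm, mul_assoc, inv_mul_cancel₀ hy0.ne', mul_one,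
      norm_sub_rev]
    exact abs_norm_sub_norm_le x y
  rw [h, norm_smul, norm_inv, norm_norm]
  have h3 : ‖(x - y) + ((‖y‖ - ‖x‖) * ‖y‖⁻¹) • y‖ ≤ 2 * ‖x - y‖ :=
    (norm_add_le _ _).trans (by linarith)
  rw [div_eq_inv_mul, mul_assoc]
  exact mul_le_mul (inv_anti₀ hc hx) h3 (norm_nonneg _) (by positivity)

/-- A bounded `C¹` map of a Euclidean space into itself has a fixed point. -/
theorem exists_fixedPoint {F : 𝔼 → 𝔼} (hF : ContDiff ℝ 1 F) {M : ℝ} (hM : ∀ x, ‖F x‖ ≤ M) :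
    ∃ x, F x = x := by
  by_contra! hne
  have hM0 : 0 ≤ M := (norm_nonneg _).trans (hM 0)
  -- The cutoff equals 1 on the ball of radius M + 1, which contains every possible fixed point of
  -- q, so q has none either. Compact support makes q Lipschitz.
  let χ : ContDiffBump (0 : 𝔼) := ⟨M + 1, M + 2, by linarith, by linarith⟩
  set q : 𝔼 → 𝔼 := fun x => χ x • F x with hq
  have hqd : ContDiff ℝ 1 q := χ.contDiff.smul hF
  have hqs : HasCompactSupport q := χ.hasCompactSupport.smul_right
  have hq0 : ∀ x, M + 2 ≤ ‖x‖ → q x = 0 := fun x hx => by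
    simp only [q]
    rw [χ.zero_of_le_dist (by simpa [χ] using hx), zero_smul]
  have hqM : ∀ x, ‖q x‖ ≤ M := fun x => by
    simp only [q]
    rw [norm_smul, Real.norm_of_nonneg χ.nonneg]
    exact (mul_le_of_le_one_left (norm_nonneg _) χ.le_one).trans (hM x)
  obtain ⟨K, hK⟩ := hqd.lipschitzWith_of_hasCompactSupport hqs one_ne_zero
  set g : 𝔼 → 𝔼 := fun x => x - q x with hg
  have hgd : ContDiff ℝ 1 g := contDiff_id.sub hqd
  have hg0 : ∀ x, g x ≠ 0 := by
    intro x hx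
    have hx' : x = q x := sub_eq_zero.1 hx
    have h1 : ‖x‖ ≤ M := hx' ▸ hqM x
    apply hne x
    have : q x = F x := by
      simp only [q]
      rw [χ.one_of_mem_closedBall (by simp [χ]; linarith), one_smul]
    rw [← this, ← hx']
  -- Where q does not vanish, ‖x‖ < M + 2 and ‖q x‖ ≤ M, so ‖g x‖ < R; elsewhere g is the identity.
  -- Thus g maps the open ball of radius R into itself.
  set R := 2 * M + 3
  have hR : 0 < R := by positivity
  have hgR : ∀ x, R ≤ ‖x‖ → g x = x := fun x hx => by
    simp only [g]; rw [hq0 x (by simp only [R] at hx; linarith), sub_zero]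
  have hgR' : ∀ x, ‖x‖ < R → ‖g x‖ < R := by
    intro x hx
    by_cases h : M + 2 ≤ ‖x‖
    · simp only [g]; rwa [hq0 x h, sub_zero]
    · have := norm_sub_le x (q x)
      have h1 := hqM x
      simp only [g, R]
      linarith
  obtain ⟨c, hc, hcg⟩ : ∃ c > 0, ∀ x, c ≤ ‖g x‖ := by
    obtain ⟨x₀, -, hx₀⟩ := (isCompact_closedBall (0 : 𝔼) R).exists_isMinOn
      ⟨0, mem_closedBall_self hR.le⟩ hgd.continuous.norm.continuousOn
    refine ⟨min ‖g x₀‖ R, lt_min (norm_pos_iff.2 (hg0 _)) hR, fun x => ?_⟩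
    by_cases h : ‖x‖ ≤ R
    · exact (min_le_left _ _).trans (hx₀ (by simpa using h))
    · rw [hgR x (by linarith)]
      exact (min_le_right _ _).trans (by linarith)
  -- Inside the ball, x + h x = R • g x / ‖g x‖, the projection of g x to the sphere. Outside, h
  -- vanishes. Writing the radial push as ψ • g/‖g‖ makes h globally Lipschitz, since ‖g‖ is bounded
  -- below.
  set ψ : 𝔼 → ℝ := fun x => max (R - ‖g x‖) 0 with hψ
  set h : 𝔼 → 𝔼 := fun x => ψ x • ‖g x‖⁻¹ • g x - q x with hh
  have hgL : LipschitzWith (1 + K) g := LipschitzWith.id.sub hK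
  have hψL : ∀ x y, |ψ x - ψ y| ≤ ‖g x - g y‖ := by
    intro x y
    refine (abs_max_sub_max_le_abs _ _ _).trans ?_
    rw [show R - ‖g x‖ - (R - ‖g y‖) = ‖g y‖ - ‖g x‖ by ring, abs_sub_comm]
    exact abs_norm_sub_norm_le _ _
  have hψR : ∀ x, |ψ x| ≤ R := fun x => by
    rw [abs_of_nonneg (le_max_right _ _)]
    exact max_le (by linarith [norm_nonneg (g x)]) hR.le
  have hunit : ∀ x, ‖‖g x‖⁻¹ • g x‖ = 1 := fun x => by
    rw [norm_smul, norm_inv, norm_norm, inv_mul_cancel₀ (norm_ne_zero_iff.2 (hg0 x))]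
  have hbL : ∀ x y, ‖ψ x • ‖g x‖⁻¹ • g x - ψ y • ‖g y‖⁻¹ • g y‖ ≤ (1 + R * (2 / c)) * ‖g x - g y‖ := by
    intro x y
    have e : ∀ (a b : ℝ) (u v : 𝔼), a • u - b • v = (a - b) • u + b • (u - v) := fun a b u v => by
      rw [sub_smul, smul_sub]; abel
    rw [e]
    refine (norm_add_le _ _).trans ?_
    rw [norm_smul (ψ x - ψ y), norm_smul (ψ y), hunit, mul_one, Real.norm_eq_abs, Real.norm_eq_abs, add_mul, one_mul, mul_assoc]
    exact add_le_add (hψL x y) (mul_le_mul (hψR y) (norm_normalize_sub_le hc (hcg x) (hcg y))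
      (norm_nonneg _) hR.le)
  have hhL : LipschitzWith ((1 + R * (2 / c)) * (1 + K) + K).toNNReal h := by
    refine LipschitzWith.of_dist_le_mul fun x y => ?_
    rw [Real.coe_toNNReal _ (by positivity)]
    have h1 := hbL x y
    have h2 := hgL.dist_le_mul x y
    have h3 := hK.dist_le_mul x y
    rw [dist_eq_norm] at h2 h3 ⊢
    have e : h x - h y = (ψ x • ‖g x‖⁻¹ • g x - ψ y • ‖g y‖⁻¹ • g y) - (q x - q y) := by
      simp only [h]; abel
    rw [e]
    have h4 : (1 + R * (2 / c)) * ‖g x - g y‖ ≤ (1 + R * (2 / c)) * ((1 + K) * dist x y) :=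
      mul_le_mul_of_nonneg_left (by simpa using h2) (by positivity)
    refine (norm_sub_le _ _).trans ?_
    linarith
  have hh0 : ∀ x, R ≤ ‖x‖ → h x = 0 := fun x hx => by
    have : ψ x = 0 := by
      simp only [ψ]; rw [hgR x hx]; exact max_eq_right (by linarith)
    simp only [h]
    rw [this, zero_smul, hq0 x (by simp only [R] at hx; linarith), sub_zero]
  have hr : ∀ x ∈ ball (0 : 𝔼) R, (fun x => x + h x) =ᶠ[nhds x] fun x => (R * ‖g x‖⁻¹) • g x := by
    intro x hx
    filter_upwards [isOpen_ball.mem_nhds hx] with y hy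
    have hy' := hgR' y (by simpa using hy)
    have : ψ y = R - ‖g y‖ := max_eq_left (by linarith)
    simp only [h]
    rw [this, sub_smul, smul_smul, smul_smul ‖g y‖,
      mul_inv_cancel₀ (norm_ne_zero_iff.2 (hg0 y)), one_smul]
    simp only [g]; abel
  have hrd : ∀ x, DifferentiableAt ℝ (fun x => (R * ‖g x‖⁻¹) • g x) x := by
    intro x
    have h1 : DifferentiableAt ℝ g x := hgd.differentiable one_ne_zero x
    exact (((h1.norm ℝ (hg0 x)).inv (norm_ne_zero_iff.2 (hg0 x))).const_mul R).smul h1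
  have hhd : ∀ x ∈ ball (0 : 𝔼) R, HasFDerivAt h
      (fderiv ℝ (fun x => (R * ‖g x‖⁻¹) • g x) x - ContinuousLinearMap.id ℝ 𝔼) x := by
    intro x hx
    have := (((hrd x).hasFDerivAt).congr_of_eventuallyEq (hr x hx)).sub (hasFDerivAt_id x)
    refine this.congr_of_eventuallyEq (.of_forall fun y => ?_)
    simp
  have hint := integral_det_eq hhL hh0 fun x hx => (hhd x hx).differentiableAt
  have hz : ∀ x ∈ ball (0 : 𝔼) R, (ContinuousLinearMap.id ℝ 𝔼 + fderiv ℝ h x).det = 0 := by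
    intro x hx
    rw [(hhd x hx).fderiv, add_sub_cancel]
    set r : 𝔼 → 𝔼 := fun x => (R * ‖g x‖⁻¹) • g x
    have hrn : ∀ x, ‖r x‖ = R := fun x => by
      simp only [r]
      rw [mul_smul, norm_smul, hunit, mul_one, Real.norm_of_nonneg hR.le]
    -- As ‖r‖ is constant, the image of the derivative is orthogonal to r x ≠ 0. The derivative is
    -- not surjective, and its determinant is zero.
    have horth : ∀ v, inner ℝ (r x) (fderiv ℝ r x v) = (0:ℝ) := by
      intro v
      have h1 := ((hrd x).hasFDerivAt).norm_sq
      have h2 : HasFDerivAt (fun x => ‖r x‖ ^ 2) (0 : 𝔼 →L[ℝ] ℝ) x := by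
        simp_rw [hrn]; exact hasFDerivAt_const _ _
      have h3 := DFunLike.congr_fun (h1.unique h2) v
      have h4 : (2:ℝ) * inner ℝ (r x) (fderiv ℝ r x v) = 0 := by simpa using h3
      linarith
    by_contra hdet
    rw [ContinuousLinearMap.det] at hdet
    obtain ⟨v, hv⟩ := (LinearMap.equivOfDetNeZero _ hdet).surjective (r x)
    have h1 := horth v
    have h2 : fderiv ℝ r x v = r x := hv
    rw [h2, real_inner_self_eq_norm_sq, hrn] at h1
    nlinarith
  rw [setIntegral_congr_fun measurableSet_ball hz] at hint
  simp only [integral_zero] at hint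
  exact (ENNReal.toReal_pos (measure_ball_pos volume 0 hR).ne' measure_ball_lt_top.ne).ne hint

end FixedPoint

/-! ### Existence of approximate equilibria -/

namespace PolymatrixGame

variable {n m : ℕ}

/-- The quantal response equilibrium condition gives an approximate best response. -/
theorem approx_best_response_of_logit {l : ℝ} (hl : 0 < l) {x p : Fin m → ℝ}
    (hx : ∀ a, x a = Real.exp (l * p a) / ∑ b, Real.exp (l * p b)) (a : Fin m)
    (h1 : ∑ b, x b = 1) : p a - m / l ≤ ∑ b, x b * p b := by
  have hS : ∀ b, Real.exp (l * p b) ≤ ∑ b, Real.exp (l * p b) := fun b =>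
    Finset.single_le_sum (f := fun b => Real.exp (l * p b)) (fun _ _ => (Real.exp_pos _).le)
      (Finset.mem_univ b)
  -- The logit weight of b is at most exp(-l(p a - p b)), and u·exp(-u) ≤ 1 for u = l(p a - p b).
  have hterm : ∀ b, x b * (p a - p b) ≤ 1 / l := by
    intro b
    have hxb : 0 ≤ x b := by
      rw [hx]; exact div_nonneg (Real.exp_pos _).le ((Real.exp_pos _).le.trans (hS b))
    rcases le_total (p a) (p b) with h | h
    · exact (mul_nonpos_of_nonneg_of_nonpos hxb (by linarith)).trans (by positivity)
    · have hxb' : x b ≤ Real.exp (-(l * (p a - p b))) := by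
        rw [hx, div_le_iff₀ ((Real.exp_pos _).trans_le (hS a))]
        refine le_trans (le_of_eq ?_) (mul_le_mul_of_nonneg_left (hS a) (Real.exp_pos _).le)
        rw [← Real.exp_add]; ring_nf
      have hu : l * (p a - p b) * Real.exp (-(l * (p a - p b))) ≤ 1 := by
        rw [Real.exp_neg, ← div_eq_mul_inv, div_le_one (Real.exp_pos _)]
        linarith [Real.add_one_le_exp (l * (p a - p b))]
      rw [le_div_iff₀ hl]
      have : x b * (p a - p b) ≤ Real.exp (-(l * (p a - p b))) * (p a - p b) :=
        mul_le_mul_of_nonneg_right hxb' (by linarith)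
      nlinarith
  have hsum := Finset.sum_le_sum fun b (_ : b ∈ Finset.univ) => hterm b
  simp only [mul_sub, Finset.sum_sub_distrib, ← Finset.sum_mul, h1, one_mul, Finset.sum_const,
    Finset.card_univ, Fintype.card_fin, nsmul_eq_mul] at hsum
  have : (m : ℝ) * (1 / l) = m / l := by ring
  linarith

/-- Every polymatrix game has approximate Nash equilibria, for every precision. -/
theorem exists_isApproxNash (G : PolymatrixGame n m) (hm : 1 ≤ m) {δ : ℝ} (hδ : 0 < δ) :
    ∃ s, G.IsApproxNash δ s := by
  classical
  have : Nonempty (Fin m) := ⟨⟨0, hm⟩⟩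
  have hm' : (0:ℝ) < m := by exact_mod_cast hm
  set l : ℝ := m / δ
  have hl : 0 < l := by positivity
  -- The payoffs are linear in x, so the logit response is defined and smooth for all vectors x, not
  -- only for profiles, and always yields a profile. A fixed point in the whole space is thus
  -- automatically a profile.
  set q : EuclideanSpace ℝ (Fin n × Fin m) → Fin n → Fin m → ℝ := fun x i a =>
    Real.exp (l * G.purePayoff (fun i a => x (i, a)) i a) /
      ∑ b, Real.exp (l * G.purePayoff (fun i a => x (i, a)) i b) with hq
  have hpos : ∀ (x : EuclideanSpace ℝ (Fin n × Fin m)) i, 0 < ∑ b, Real.exp (l * G.purePayoff (fun i a => x (i, a)) i b) :=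
    fun x i => Finset.sum_pos (fun _ _ => Real.exp_pos _) Finset.univ_nonempty
  set F : EuclideanSpace ℝ (Fin n × Fin m) → EuclideanSpace ℝ (Fin n × Fin m) := fun x =>
    WithLp.toLp 2 fun ia => q x ia.1 ia.2
  have hF : ContDiff ℝ 1 F := by
    rw [contDiff_euclidean]
    rintro ⟨i, a⟩
    have hp : ∀ a, ContDiff ℝ 1 fun x : EuclideanSpace ℝ (Fin n × Fin m) =>
        Real.exp (l * G.purePayoff (fun i a => x (i, a)) i a) := by
      intro a
      unfold purePayoff
      refine Real.contDiff_exp.comp (contDiff_const.mul (ContDiff.sum fun j _ => ContDiff.sum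
        fun b _ => contDiff_const.mul ?_))
      exact contDiff_euclidean.1 contDiff_id (j, b)
    exact (hp a).div (ContDiff.sum fun b _ => hp b) fun x => (hpos x i).ne'
  have hq0 : ∀ x i a, 0 ≤ q x i a := fun x i a => div_nonneg (Real.exp_pos _).le (hpos x i).le
  have hq1 : ∀ x i, ∑ a, q x i a = 1 := fun x i => by
    simp only [q]
    rw [← Finset.sum_div, div_self (hpos x i).ne']
  have hqle : ∀ x i a, q x i a ≤ 1 := fun x i a => by
    rw [← hq1 x i]
    exact Finset.single_le_sum (fun a _ => hq0 x i a) (Finset.mem_univ a)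
  have hM : ∀ x, ‖F x‖ ≤ Real.sqrt (n * m) := fun x => by
    rw [EuclideanSpace.norm_eq]
    refine Real.sqrt_le_sqrt ?_
    refine (Finset.sum_le_card_nsmul _ _ 1 fun ia _ => ?_).trans ?_
    · rw [Real.norm_of_nonneg (hq0 _ _ _)]
      exact pow_le_one₀ (hq0 _ _ _) (hqle _ _ _)
    · simp
  obtain ⟨x, hx⟩ : ∃ x, F x = x := FixedPoint.exists_fixedPoint hF hM
  have hxe : ∀ i a, x (i, a) = q x i a := fun i a => by
    conv_lhs => rw [← hx]
  refine ⟨fun i a => x (i, a), fun i => ⟨fun a => ?_, ?_⟩, fun i a => ?_⟩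
  · simp only [hxe]; exact hq0 _ _ _
  · simp only [hxe]; exact hq1 _ _
  · have := approx_best_response_of_logit hl (x := fun a => x (i, a))
      (p := G.purePayoff (fun i a => x (i, a)) i) (fun a => hxe i a) a
      (by simp only [hxe]; exact hq1 _ _)
    have hml : (m : ℝ) / l = δ := by
      simp only [l]; field_simp
    rwa [hml] at this

end PolymatrixGame

namespace PolymatrixGame

open Polymatrix RAM RAM.Algo

variable {n m : ℕ}

/-! ### Normalised games -/

theorem purePayoff_update (G : PolymatrixGame n m) (s : Fin n → Fin m → ℝ) (i : Fin n)
    (x : Fin m → ℝ) (a : Fin m) :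
    G.purePayoff (Function.update s i x) i a = G.purePayoff s i a := by
  classical
  unfold purePayoff
  refine Finset.sum_congr rfl fun j hj => ?_
  have : j ≠ i := fun h => by
    subst h
    exact G.graph.irrefl (Finset.mem_filter.1 hj).2
  rw [Function.update_of_ne this]

theorem IsProfile.update {s : Fin n → Fin m → ℝ} (hs : IsProfile s) (i : Fin n) (a : Fin m) :
    IsProfile (Function.update s i (Pi.single a 1)) := by
  intro j
  by_cases h : j = i
  · subst h
    rw [Function.update_self]
    exact single_mem_stdSimplex ℝ a
  · rw [Function.update_of_ne h]; exact hs j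

/-- The payoff of an action is the expected payoff after a switch to that action, because a player's
own strategy does not influence his payoff vector. -/
theorem IsNormalised.purePayoff_mem {G : PolymatrixGame n m} (hG : G.IsNormalised)
    {s : Fin n → Fin m → ℝ} (hs : IsProfile s) (i : Fin n) (a : Fin m) :
    0 ≤ G.purePayoff s i a ∧ G.purePayoff s i a ≤ 1 := by
  have h := hG _ (hs.update i a) i
  have e : G.expPayoff (Function.update s i (Pi.single a 1)) i = G.purePayoff s i a := by
    unfold expPayoff
    simp only [purePayoff_update, Function.update_self]
    rw [Finset.sum_eq_single a (fun b _ hb => by rw [Pi.single_eq_of_ne hb, zero_mul])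
      (fun h => absurd (Finset.mem_univ a) h), Pi.single_eq_same, one_mul]
  rwa [e] at h

section

variable [NeZero m]

open Classical in
/-- The payoffs of the edges, shifted so that they become nonnegative; the sum of the amounts by
which they are shifted is independent of the action. -/
noncomputable def shiftedPay (G : PolymatrixGame n m) (i j : Fin n) (a b : Fin m) : ℝ :=
  (if G.graph.Adj i j then 1 + (G.payoff i j a b : ℝ) - G.payoff i j a 0 else 0) +
    if i = j then ∑ l with G.graph.Adj i l, (G.payoff i l a 0 : ℝ) else 0

theorem isProfile_zero : IsProfile (fun _ : Fin n => (Pi.single 0 1 : Fin m → ℝ)) :=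
  fun _ => single_mem_stdSimplex ℝ 0

open Classical in
theorem purePayoff_zero (G : PolymatrixGame n m) (i : Fin n) (a : Fin m) :
    G.purePayoff (fun _ => Pi.single 0 1) i a =
      ∑ l with G.graph.Adj i l, (G.payoff i l a 0 : ℝ) := by
  unfold purePayoff
  refine Finset.sum_congr rfl fun j _ => ?_
  simp [Pi.single_apply]

/-- Two profiles that differ only in the action of j give payoffs in [0,1] to action a of i, and
these differ by exactly this difference of matrix entries. -/
theorem IsNormalised.abs_sub_le {G : PolymatrixGame n m} (hG : G.IsNormalised) {i j : Fin n}
    (h : G.graph.Adj i j) (a b : Fin m) :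
    |(G.payoff i j a b : ℝ) - G.payoff i j a 0| ≤ 1 := by
  classical
  have h1 := hG.purePayoff_mem isProfile_zero i a
  have h2 := hG.purePayoff_mem (isProfile_zero.update j b) i a
  have e : G.purePayoff (Function.update (fun _ => Pi.single 0 1) j (Pi.single b 1)) i a =
      G.purePayoff (fun _ => Pi.single 0 1) i a + ((G.payoff i j a b : ℝ) - G.payoff i j a 0) := by
    rw [← sub_eq_iff_eq_add']
    unfold purePayoff
    rw [← Finset.sum_sub_distrib, Finset.sum_eq_single j]
    · simp [Pi.single_apply]
    · intro l _ hl
      rw [Function.update_of_ne hl, sub_self]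
    · intro hj
      exact absurd (Finset.mem_filter.2 ⟨Finset.mem_univ _, h⟩) hj
  rw [e] at h2
  rw [abs_le]
  constructor <;> linarith

theorem IsNormalised.shiftedPay_mem {G : PolymatrixGame n m} (hG : G.IsNormalised) (i j : Fin n)
    (a b : Fin m) : 0 ≤ G.shiftedPay i j a b ∧ G.shiftedPay i j a b ≤ 2 := by
  classical
  unfold shiftedPay
  have h0 := hG.purePayoff_mem isProfile_zero i a
  rw [purePayoff_zero] at h0
  by_cases h : G.graph.Adj i j
  · have h1 := abs_le.1 (hG.abs_sub_le h a b)
    rw [if_pos h, if_neg h.ne]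
    constructor <;> linarith
  · rw [if_neg h]
    split_ifs
    · constructor <;> linarith
    · constructor <;> linarith

-- Every strategy sums to 1, so the subtracted entries for action 0 and the diagonal term cancel.
-- What remains is the degree of i, the same for all actions.
open Classical in
theorem sum_shiftedPay (G : PolymatrixGame n m) {s : Fin n → Fin m → ℝ}
    (hs : ∀ i, ∑ a, s i a = 1) (i : Fin n) (a : Fin m) :
    ∑ j, ∑ b, G.shiftedPay i j a b * s j b =
      (Finset.univ.filter (G.graph.Adj i)).card + G.purePayoff s i a := by
  have h : ∀ j, ∑ b, G.shiftedPay i j a b * s j b =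
      (if G.graph.Adj i j then 1 + ∑ b, (G.payoff i j a b : ℝ) * s j b - G.payoff i j a 0 else 0) +
      if i = j then ∑ l with G.graph.Adj i l, (G.payoff i l a 0 : ℝ) else 0 := by
    intro j
    unfold shiftedPay
    simp only [add_mul, Finset.sum_add_distrib, ← Finset.mul_sum, hs, mul_one]
    congr 1
    split_ifs
    · simp only [add_mul, sub_mul, one_mul, Finset.sum_add_distrib, Finset.sum_sub_distrib,
        ← Finset.mul_sum, hs, mul_one]
    · simp
  simp only [h]
  rw [Finset.sum_add_distrib, Finset.sum_ite_eq, if_pos (Finset.mem_univ _), ← Finset.sum_filter,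
    Finset.sum_sub_distrib, Finset.sum_add_distrib]
  simp only [Finset.sum_const, nsmul_eq_mul, mul_one, purePayoff]
  ring

end

/-! ### The input -/

theorem index_inj {q a b i j : ℕ} (ha : a < q) (hb : b < q) (h : i * q + a = j * q + b) :
    i = j ∧ a = b := by
  have h1 : (i * q + a) / q = i := by
    rw [mul_comm, Nat.mul_add_div (by omega), Nat.div_eq_of_lt ha, add_zero]
  have h2 : (j * q + b) / q = j := by
    rw [mul_comm, Nat.mul_add_div (by omega), Nat.div_eq_of_lt hb, add_zero]
  have : i = j := by rw [← h1, h, h2]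
  subst this
  exact ⟨rfl, by omega⟩

open Classical in
theorem input_nat_one (G : PolymatrixGame n m) (e : ℚ) (i j : Fin n) :
    (G.input e).nat 1 (i * n + j) = if G.graph.Adj i j then 1 else 0 := by
  change (if _ then _ else _) = _
  refine if_congr ⟨?_, fun h => ⟨i, j, h, rfl⟩⟩ rfl rfl
  rintro ⟨i', j', h, he⟩
  obtain ⟨h1, h2⟩ := index_inj j.2 j'.2 he
  rw [Fin.ext h1, Fin.ext h2]; exact h

open Classical in
theorem input_rat_one (G : PolymatrixGame n m) (e : ℚ) (i j : Fin n) (a b : Fin m) :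
    (G.input e).rat 1 (((i * n + j) * m + a) * m + b) =
      if G.graph.Adj i j then G.payoff i j a b else 0 := by
  have h : ∀ i' j' a' b', ((i * n + j) * m + a) * m + b =
      (((i' : Fin n) * n + (j' : Fin n)) * m + (a' : Fin m)) * m + (b' : Fin m) ↔ i = i' ∧ j = j' ∧ a = a' ∧ b = b' := by
    intro i' j' a' b'
    constructor
    · intro h
      obtain ⟨h1, h2⟩ := index_inj b.2 b'.2 h
      obtain ⟨h3, h4⟩ := index_inj a.2 a'.2 h1
      obtain ⟨h5, h6⟩ := index_inj j.2 j'.2 h3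
      exact ⟨Fin.ext h5, Fin.ext h6, Fin.ext h4, Fin.ext h2⟩
    · rintro ⟨rfl, rfl, rfl, rfl⟩; rfl
  have hd : ∀ c, (G.input e).rat 1 c = ∑ i' : Fin n, ∑ j' : Fin n, ∑ a' : Fin m, ∑ b' : Fin m,
      if G.graph.Adj i' j' ∧ c = ((i' * n + j') * m + a') * m + b' then G.payoff i' j' a' b'
      else 0 := fun c => rfl
  rw [hd]
  simp only [h]
  rw [Finset.sum_eq_single i, Finset.sum_eq_single j, Finset.sum_eq_single a,
    Finset.sum_eq_single b]
  · simp
  all_goals first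
    | (intro h; exact absurd (Finset.mem_univ _) h)
    | (intro x _ hx; simp [hx.symm])

theorem shiftedVal_input [NeZero m] (G : PolymatrixGame n m) (e : ℚ) (k : ℕ) (i j : Fin n) (a b : Fin m) :
    (shiftedVal (G.input e) n m k i j a b : ℝ) = k * G.shiftedPay i j a b := by
  classical
  have h0 : ∀ i j : Fin n, ∀ a : Fin m, (G.input e).rat 1 (((i * n + j) * m + a) * m + 0) =
      if G.graph.Adj i j then G.payoff i j a 0 else 0 := fun i j a => by
    have := input_rat_one G e i j a 0
    rwa [Fin.val_zero] at this
  unfold shiftedVal shiftedPay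
  rw [Finset.sum_range]
  simp only [input_nat_one, input_rat_one, h0, ind, Fin.val_inj]
  have hs : ∑ l : Fin n, ((if G.graph.Adj i l then 1 else 0 : ℕ) : ℚ) *
      (if G.graph.Adj i l then G.payoff i l a 0 else 0) =
      ∑ l with G.graph.Adj i l, G.payoff i l a 0 := by
    rw [Finset.sum_filter]
    exact Finset.sum_congr rfl fun l _ => by split_ifs <;> simp
  rw [hs]
  push_cast
  split_ifs <;> simp [mul_add, mul_sub]

end PolymatrixGame

/-! ### Solutions of the rounded game and approximate equilibria -/

namespace PolymatrixGame

open Polymatrix RAM RAM.Algo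

variable {d : Data}

/-- The strategy profile with the numbers `z`. -/
noncomputable def gridProfile (d : Data) (z : ℕ → ℕ) (i : Fin d.n) (a : Fin d.m) : ℝ :=
  (d.C (z i * d.m + a) : ℝ) / d.k

/-- The integers `J` are the rounded payoffs of the game. -/
def IsRounding (d : Data) [NeZero d.m] (G : PolymatrixGame d.n d.m) : Prop :=
  ∀ (i j : Fin d.n) (a b : Fin d.m),
    d.J (((i * d.n + j) * d.m + a) * d.m + b) = ⌊(d.k : ℝ) * G.shiftedPay i j a b⌋₊

theorem sum_C {z : ℕ → ℕ} (hS : IsStratTable d.m d.k d.K d.C) (hz : ∀ j < d.n, 1 ≤ z j ∧ z j ≤ d.K)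
    (j : Fin d.n) : ∑ b : Fin d.m, (d.C (z j * d.m + b) : ℝ) = d.k := by
  have := hS.sum_eq (z j) (hz j j.2).1 (hz j j.2).2
  rw [Finset.sum_range] at this
  exact_mod_cast this

theorem sum_gridProfile {z : ℕ → ℕ} (hS : IsStratTable d.m d.k d.K d.C) (hk : 0 < d.k)
    (hz : ∀ j < d.n, 1 ≤ z j ∧ z j ≤ d.K) (j : Fin d.n) : ∑ b, gridProfile d z j b = 1 := by
  unfold gridProfile
  rw [← Finset.sum_div, sum_C hS hz j, div_self (by exact_mod_cast hk.ne')]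

theorem isProfile_gridProfile {z : ℕ → ℕ} (hS : IsStratTable d.m d.k d.K d.C) (hk : 0 < d.k)
    (hz : ∀ j < d.n, 1 ≤ z j ∧ z j ≤ d.K) : IsProfile (gridProfile d z) :=
  fun i => ⟨fun _ => div_nonneg (Nat.cast_nonneg _) (Nat.cast_nonneg _),
    sum_gridProfile hS hk hz i⟩

variable {G : PolymatrixGame d.n d.m}

theorem sum_C_mul {z : ℕ → ℕ} (hS : IsStratTable d.m d.k d.K d.C) (hk : 0 < d.k)
    (hz : ∀ j < d.n, 1 ≤ z j ∧ z j ≤ d.K) (i : Fin d.n) (D : ℝ) :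
    d.k ^ 3 * (D + G.expPayoff (gridProfile d z) i) = ∑ a : Fin d.m,
      (d.C (z i * d.m + a) : ℝ) * (d.k ^ 2 * (D + G.purePayoff (gridProfile d z) i a)) := by
  have e1 : ∀ a : Fin d.m, (d.C (z i * d.m + a) : ℝ) = d.k * gridProfile d z i a := fun a => by
    unfold gridProfile; field_simp
  unfold expPayoff
  have : D = ∑ a, gridProfile d z i a * D := by
    rw [← Finset.sum_mul, sum_gridProfile hS hk hz, one_mul]
  conv_lhs => rw [this]
  rw [← Finset.sum_add_distrib, Finset.mul_sum]
  refine Finset.sum_congr rfl fun a _ => ?_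
  rw [e1]; ring

variable [NeZero d.m]

-- On the scale k², every floor loses less than 1, and the strategy numbers of each of the n players
-- sum to k, so the total loss is between 0 and n·k.
open Classical in
theorem pay_bounds (hG : G.IsNormalised) (hJ : IsRounding d G) {z : ℕ → ℕ}
    (hS : IsStratTable d.m d.k d.K d.C) (hk : 0 < d.k) (hz : ∀ j < d.n, 1 ≤ z j ∧ z j ≤ d.K)
    (i : Fin d.n) (a : Fin d.m) :
    (d.Pay z i a : ℝ) ≤ d.k ^ 2 * ((Finset.univ.filter (G.graph.Adj i)).card +
      G.purePayoff (gridProfile d z) i a) ∧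
    d.k ^ 2 * ((Finset.univ.filter (G.graph.Adj i)).card +
      G.purePayoff (gridProfile d z) i a) ≤ d.Pay z i a + d.n * d.k := by
  have hk' : (0:ℝ) < d.k := by exact_mod_cast hk
  have e1 : (d.Pay z i a : ℝ) = ∑ j : Fin d.n, ∑ b : Fin d.m,
      (d.J (((i * d.n + j) * d.m + a) * d.m + b) : ℝ) * d.C (z j * d.m + b) := by
    unfold Data.Pay Data.edgePay
    simp only [Finset.sum_range]
    push_cast
    rfl
  have e2 : d.k ^ 2 * ((Finset.univ.filter (G.graph.Adj i)).card +
      G.purePayoff (gridProfile d z) i a) = ∑ j : Fin d.n, ∑ b : Fin d.m,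
      (d.k * G.shiftedPay i j a b) * d.C (z j * d.m + b) := by
    rw [← sum_shiftedPay G (sum_gridProfile hS hk hz), Finset.mul_sum]
    refine Finset.sum_congr rfl fun j _ => ?_
    rw [Finset.mul_sum]
    refine Finset.sum_congr rfl fun b _ => ?_
    unfold gridProfile
    field_simp
  have e3 : (d.n * d.k : ℝ) = ∑ j : Fin d.n, ∑ b : Fin d.m, (d.C (z j * d.m + b) : ℝ) := by
    simp only [sum_C hS hz]
    simp
  rw [e2, e1]
  constructor
  · refine Finset.sum_le_sum fun j _ => Finset.sum_le_sum fun b _ =>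
      mul_le_mul_of_nonneg_right ?_ (Nat.cast_nonneg _)
    rw [hJ]
    exact Nat.floor_le (mul_nonneg hk'.le (hG.shiftedPay_mem i j a b).1)
  · rw [e3, ← Finset.sum_add_distrib]
    refine Finset.sum_le_sum fun j _ => ?_
    rw [← Finset.sum_add_distrib]
    refine Finset.sum_le_sum fun b _ => ?_
    rw [← add_one_mul]
    refine mul_le_mul_of_nonneg_right ?_ (Nat.cast_nonneg _)
    rw [hJ]
    exact (Nat.lt_floor_add_one _).le

/-- Divided by k³, the tolerance 10n²k² and the rounding loss n·k² of the payoffs add up to at most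
11n²/k ≤ e. Rounding down helps on the other side of the inequality. -/
theorem isApproxNash_gridProfile (hG : G.IsNormalised) (hJ : IsRounding d G) {z : ℕ → ℕ}
    (hS : IsStratTable d.m d.k d.K d.C) (hk : 0 < d.k) (hn : 1 ≤ d.n) (hz : d.Solution z) {e : ℝ}
    (he : 11 * (d.n * d.n : ℝ) ≤ d.k * e) : G.IsApproxNash e (gridProfile d z) := by
  classical
  have hz' : ∀ j < d.n, 1 ≤ z j ∧ z j ≤ d.K := fun j hj => ⟨(hz j hj).1, (hz j hj).2.1⟩
  have hk' : (0:ℝ) < d.k := by exact_mod_cast hk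
  have hn' : (1:ℝ) ≤ d.n := by exact_mod_cast hn
  refine ⟨isProfile_gridProfile hS hk hz', fun i a => ?_⟩
  set D : ℝ := (((Finset.univ.filter (G.graph.Adj i)).card : ℕ) : ℝ)
  have hsat := (hz i i.2).2.2 a a.2
  rw [Finset.sum_range] at hsat
  have hsat' : (d.k : ℝ) * d.Pay z i a ≤ (∑ a' : Fin d.m, (d.C (z i * d.m + a') : ℝ) * d.Pay z i a') +
    10 * (d.n * d.n) * (d.k * d.k) := by exact_mod_cast hsat
  have h1 := (pay_bounds hG hJ hS hk hz' i a).2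
  have h2 : ∑ a' : Fin d.m, (d.C (z i * d.m + a') : ℝ) * d.Pay z i a' ≤
      d.k ^ 3 * (D + G.expPayoff (gridProfile d z) i) := by
    rw [sum_C_mul hS hk hz']
    exact Finset.sum_le_sum fun a' _ =>
      mul_le_mul_of_nonneg_left (pay_bounds hG hJ hS hk hz' i a').1 (Nat.cast_nonneg _)
  have h3 : (d.k : ℝ) ^ 2 * (d.k * G.purePayoff (gridProfile d z) i a) ≤
      d.k ^ 2 * (d.k * G.expPayoff (gridProfile d z) i + d.n + 10 * (d.n * d.n)) := by
    have := mul_le_mul_of_nonneg_left h1 hk'.le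
    nlinarith
  have h4 := le_of_mul_le_mul_left h3 (by positivity)
  have h5 : d.k * (G.purePayoff (gridProfile d z) i a - e) ≤
      d.k * G.expPayoff (gridProfile d z) i := by nlinarith
  exact le_of_mul_le_mul_left h5 hk'

/-- Rounding a probability distribution to multiples of `1 / k`. -/
theorem exists_rounding {m : ℕ} [NeZero m] {k : ℕ} {x : Fin m → ℝ}
    (hx : x ∈ stdSimplex ℝ (Fin m)) : ∃ f : Fin m → ℕ, ∑ a, f a = k ∧
      ∀ (v : Fin m → ℝ) (V : ℝ), (∀ a, 0 ≤ v a ∧ v a ≤ V) → |∑ a, ((f a : ℝ) - k * x a) * v a| ≤ m * V := by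
  set s := (Finset.univ : Finset (Fin m)).erase 0
  have hsplit : ∀ g : Fin m → ℝ, ∑ a, g a = g 0 + ∑ a ∈ s, g a := fun g =>
    (Finset.add_sum_erase _ _ (Finset.mem_univ 0)).symm
  have hfl : ∀ a, (⌊k * x a⌋₊ : ℝ) ≤ k * x a := fun a =>
    Nat.floor_le (mul_nonneg (Nat.cast_nonneg _) (hx.1 a))
  have hx1 : k * x 0 + ∑ a ∈ s, k * x a = k := by
    rw [← Finset.mul_sum, ← mul_add, ← hsplit x, hx.2, mul_one]
  have hle : ∑ a ∈ s, ⌊k * x a⌋₊ ≤ k := by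
    have : ((∑ a ∈ s, ⌊k * x a⌋₊ : ℕ) : ℝ) ≤ k := by
      push_cast
      refine (Finset.sum_le_sum fun a _ => hfl a).trans ?_
      have := mul_nonneg (Nat.cast_nonneg (α := ℝ) k) (hx.1 0)
      linarith
    exact_mod_cast this
  -- All actions but 0 are rounded down, and action 0 receives the remainder. The mass moved is at
  -- most m - 1 units, and moving one unit changes a weighted sum by at most V.
  refine ⟨Function.update (fun a => ⌊k * x a⌋₊) 0 (k - ∑ a ∈ s, ⌊k * x a⌋₊), ?_, ?_⟩
  · rw [← Finset.add_sum_erase _ _ (Finset.mem_univ 0), Function.update_self,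
      Finset.sum_congr rfl fun a ha => Function.update_of_ne (Finset.ne_of_mem_erase ha) _ _]
    exact Nat.sub_add_cancel hle
  · intro v V hv
    have hV : 0 ≤ V := (hv 0).1.trans (hv 0).2
    have hcard : (s.card : ℝ) + 1 = m := by
      have : s.card = m - 1 := by simp [s]
      rw [this, Nat.cast_sub (NeZero.one_le), Nat.cast_one, sub_add_cancel]
    have hu : ∀ c : ℕ, ∑ a ∈ s, ((Function.update (fun a => ⌊k * x a⌋₊) 0 c a : ℝ) - k * x a) * v a =
        ∑ a ∈ s, ((⌊k * x a⌋₊ : ℝ) - k * x a) * v a := fun c =>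
      Finset.sum_congr rfl fun a ha => by rw [Function.update_of_ne (Finset.ne_of_mem_erase ha)]
    rw [hsplit, Function.update_self, hu, Nat.cast_sub hle]
    push_cast
    set r : Fin m → ℝ := fun a => k * x a - ⌊k * x a⌋₊ with hr
    have hr0 : ∀ a, 0 ≤ r a := fun a => sub_nonneg.2 (hfl a)
    have hr1 : ∀ a, r a ≤ 1 := fun a => by
      have := (Nat.lt_floor_add_one (k * x a)).le
      simp only [r]; linarith
    have h0 : (k : ℝ) - ∑ a ∈ s, (⌊k * x a⌋₊ : ℝ) - k * x 0 = ∑ a ∈ s, r a := by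
      simp only [r, Finset.sum_sub_distrib]; linarith
    have h1 : ∑ a ∈ s, ((⌊k * x a⌋₊ : ℝ) - k * x a) * v a = - ∑ a ∈ s, r a * v a := by
      rw [← Finset.sum_neg_distrib]
      exact Finset.sum_congr rfl fun a _ => by simp only [r]; ring
    rw [h0, h1]
    have h2 : 0 ≤ ∑ a ∈ s, r a := Finset.sum_nonneg fun a _ => hr0 a
    have h3 : ∑ a ∈ s, r a ≤ s.card := by
      simpa using Finset.sum_le_card_nsmul s r 1 fun a _ => hr1 a
    have h4 : 0 ≤ ∑ a ∈ s, r a * v a := Finset.sum_nonneg fun a _ => mul_nonneg (hr0 a) (hv a).1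
    have h5 : ∑ a ∈ s, r a * v a ≤ (∑ a ∈ s, r a) * V := by
      rw [Finset.sum_mul]
      exact Finset.sum_le_sum fun a _ => mul_le_mul_of_nonneg_left (hv a).2 (hr0 a)
    have h6 := mul_nonneg h2 (hv 0).1
    have h7 := mul_le_mul_of_nonneg_left (hv 0).2 h2
    have h8 := mul_le_mul_of_nonneg_right h3 hV
    rw [abs_le]
    constructor <;> nlinarith

/-- A (1/k)-NE is rounded to the grid. Each pure payoff changes by at most 2nm/k, since the shifted
entries lie in [0,2], and rounding the own strategy costs another m/k. The regret becomes at most (1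
+ 4nm + m)/k; together with the payoff rounding n/k this is within 10n²/k because m ≤ n and n ≥ 2.
-/
theorem exists_solution (hG : G.IsNormalised) (hJ : IsRounding d G)
    (hS : IsStratTable d.m d.k d.K d.C) (hk : 0 < d.k) (hmn : d.m ≤ d.n) (hn : 2 ≤ d.n) :
    ∃ z, d.Solution z := by
  classical
  have hk' : (0:ℝ) < d.k := by exact_mod_cast hk
  have hn' : (2:ℝ) ≤ d.n := by exact_mod_cast hn
  have hmn' : (d.m:ℝ) ≤ d.n := by exact_mod_cast hmn
  obtain ⟨s, hs, hNE⟩ := G.exists_isApproxNash NeZero.one_le (δ := 1 / d.k) (by positivity)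
  choose f hf hfv using fun i => exists_rounding (k := d.k) (hs i)
  have hx : ∀ i : Fin d.n, ∃ x, 1 ≤ x ∧ x ≤ d.K ∧ ∀ a : Fin d.m, d.C (x * d.m + a) = f i a := by
    intro i
    obtain ⟨x, h1, h2, h3⟩ := hS.exists_eq (fun a => if h : a < d.m then f i ⟨a, h⟩ else 0) (by
      rw [Finset.sum_range]
      simpa using hf i)
    exact ⟨x, h1, h2, fun a => by simpa using h3 a a.2⟩
  choose x hx1 hx2 hx3 using hx
  set z : ℕ → ℕ := fun j => if h : j < d.n then x ⟨j, h⟩ else 0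
  have hzx : ∀ i : Fin d.n, z i = x i := fun i => by simp [z]
  have hz : ∀ j < d.n, 1 ≤ z j ∧ z j ≤ d.K := fun j hj => by
    rw [hzx ⟨j, hj⟩]; exact ⟨hx1 _, hx2 _⟩
  have hg : ∀ i a, gridProfile d z i a = (f i a : ℝ) / d.k := fun i a => by
    unfold gridProfile
    rw [hzx, hx3]
  set t := gridProfile d z with ht
  have hround : ∀ i (v : Fin d.m → ℝ) (V : ℝ), (∀ a, 0 ≤ v a ∧ v a ≤ V) →
      |∑ a, v a * t i a - ∑ a, v a * s i a| ≤ d.m * V / d.k := by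
    intro i v V hv
    have := hfv i v V hv
    rw [le_div_iff₀ hk']
    refine le_trans (le_of_eq ?_) this
    have habs : ∀ r : ℝ, |r| * d.k = |r * d.k| := fun r => by rw [abs_mul, abs_of_pos hk']
    rw [habs]
    congr 1
    rw [← Finset.sum_sub_distrib, Finset.sum_mul]
    refine Finset.sum_congr rfl fun a _ => ?_
    rw [hg]; field_simp
  have htp := isProfile_gridProfile hS hk hz
  rw [← ht] at htp
  have hpay : ∀ i a, |G.purePayoff t i a - G.purePayoff s i a| ≤ 2 * d.n * d.m / d.k := by
    intro i a
    have e1 := sum_shiftedPay G (fun i => (htp i).2) i a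
    have e2 := sum_shiftedPay G (fun i => (hs i).2) i a
    have e : G.purePayoff t i a - G.purePayoff s i a = ∑ j, (∑ b, G.shiftedPay i j a b * t j b -
        ∑ b, G.shiftedPay i j a b * s j b) := by
      rw [Finset.sum_sub_distrib, e1, e2]; ring
    rw [e]
    refine (Finset.abs_sum_le_sum_abs _ _).trans ((Finset.sum_le_card_nsmul _ _ _ fun j _ =>
      hround j _ 2 fun b => hG.shiftedPay_mem i j a b).trans (le_of_eq ?_))
    rw [Finset.card_univ, Fintype.card_fin, nsmul_eq_mul]; ring
  refine ⟨z, fun j hj => ⟨(hz j hj).1, (hz j hj).2, fun a ha => ?_⟩⟩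
  obtain ⟨i, rfl⟩ : ∃ i : Fin d.n, (i : ℕ) = j := ⟨⟨j, hj⟩, rfl⟩
  obtain ⟨a, rfl⟩ : ∃ b : Fin d.m, (b : ℕ) = a := ⟨⟨a, ha⟩, rfl⟩
  set D : ℝ := (((Finset.univ.filter (G.graph.Adj i)).card : ℕ) : ℝ)
  set δ : ℝ := 2 * d.n * d.m / d.k with hδ
  have h1 : G.expPayoff s i ≤ G.expPayoff t i + δ + d.m / d.k := by
    have e1 : G.expPayoff s i ≤ ∑ a, s i a * G.purePayoff t i a + δ := by
      have : δ = ∑ a, s i a * δ := by rw [← Finset.sum_mul, (hs i).2, one_mul]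
      rw [this, ← Finset.sum_add_distrib]
      unfold expPayoff
      refine Finset.sum_le_sum fun a _ => ?_
      rw [← mul_add]
      refine mul_le_mul_of_nonneg_left ?_ ((hs i).1 a)
      linarith [(abs_le.1 (hpay i a)).1]
    have e2 := hround i (G.purePayoff t i) 1 fun a => hG.purePayoff_mem htp i a
    have e3 : ∑ a, s i a * G.purePayoff t i a = ∑ a, G.purePayoff t i a * s i a :=
      Finset.sum_congr rfl fun a _ => mul_comm _ _
    have e4 : G.expPayoff t i = ∑ a, G.purePayoff t i a * t i a :=
      Finset.sum_congr rfl fun a _ => mul_comm _ _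
    have e5 := (abs_le.1 e2).1
    rw [mul_one] at e5
    linarith
  have h2 : G.purePayoff t i a ≤ G.expPayoff t i + (1 + 4 * d.n * d.m + d.m) / d.k := by
    have e1 := hNE i a
    have e2 := (abs_le.1 (hpay i a)).2
    have e3 : (1 + 4 * d.n * d.m + d.m : ℝ) / d.k = 1 / d.k + δ + δ + d.m / d.k := by
      simp only [δ]; ring
    rw [e3]; linarith
  have h3 : d.k * (G.purePayoff t i a - G.expPayoff t i) ≤ 1 + 4 * d.n * d.m + d.m := by
    have : G.purePayoff t i a - G.expPayoff t i ≤ (1 + 4 * d.n * d.m + d.m) / d.k := by linarith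
    rw [le_div_iff₀ hk'] at this
    linarith
  have h4 := (pay_bounds hG hJ hS hk hz i a).1
  have h5 : d.k ^ 3 * (D + G.expPayoff t i) ≤
      (∑ a' : Fin d.m, (d.C (z i * d.m + a') : ℝ) * d.Pay z i a') + d.n * d.k ^ 2 := by
    have e2 : (d.n * d.k ^ 2 : ℝ) = ∑ a' : Fin d.m, (d.C (z i * d.m + a') : ℝ) * (d.n * d.k) := by
      rw [← Finset.sum_mul, sum_C hS hz]; ring
    rw [ht, sum_C_mul hS hk hz, e2, ← Finset.sum_add_distrib]
    refine Finset.sum_le_sum fun a' _ => ?_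
    rw [← mul_add]
    exact mul_le_mul_of_nonneg_left (pay_bounds hG hJ hS hk hz i a').2 (Nat.cast_nonneg _)
  rw [Finset.sum_range]
  have h6 : (d.k : ℝ) * d.Pay z i a ≤ (∑ a' : Fin d.m, (d.C (z i * d.m + a') : ℝ) * d.Pay z i a') +
      10 * (d.n * d.n) * (d.k * d.k) := by
    have e1 := mul_le_mul_of_nonneg_left h4 hk'.le
    have e2 := mul_le_mul_of_nonneg_left h3 (sq_nonneg (d.k : ℝ))
    have e3 : (1 + 4 * d.n * d.m + d.m : ℝ) + d.n ≤ 10 * (d.n * d.n) := by nlinarith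
    have e4 := mul_le_mul_of_nonneg_left e3 (sq_nonneg (d.k : ℝ))
    linear_combination e1 + e2 + e4 + h5
  exact_mod_cast h6

end PolymatrixGame

/-! ### The running time -/

namespace PolymatrixGame

open Polymatrix RAM RAM.Algo

variable {n m : ℕ}

/-- The renumbering of arrays that frees the reserved ones fixes the arrays with input and moves
only arrays that are zero. -/
theorem rep_input (G : PolymatrixGame n m) (e : ℚ) : Rep (G.input e) (G.input e) := by
  refine ⟨fun a => ?_, fun a => ?_⟩
  · unfold natArr
    split_ifs with h
    · rfl
    · obtain ⟨b, rfl⟩ : ∃ b, a = b + 2 := ⟨a - 2, by omega⟩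
      rfl
  · unfold ratArr
    split_ifs with h
    · rfl
    · obtain ⟨b, rfl⟩ : ∃ b, a = b + 2 := ⟨a - 2, by omega⟩
      rfl

theorem isApproxNash_of_data {G : PolymatrixGame n m} [NeZero m] {e : ℚ} {d : Data} {τ : State} (hG : G.IsNormalised)
    (hn : d.n = n) (hm : d.m = m) (hk : 11 * (n * n : ℚ) ≤ d.k * e)
    (hS : IsStratTable m d.k d.K d.C) (hmn : m ≤ n) (hn2 : 2 ≤ n)
    (hJ : ∀ i < n, ∀ j < n, ∀ a < m, ∀ b < m,
      d.J (((i * n + j) * m + a) * m + b) = ⌊shiftedVal (G.input e) n m d.k i j a b⌋₊)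
    (hz : (∃ z, d.Solution z) → ∃ z, d.Solution z ∧ ∀ i < n, ∀ a < m,
        τ.rat 2 (i * m + a) = (d.C (z i * m + a) : ℚ) / d.k) :
    G.IsApproxNash e (output n m τ) := by
  subst hn hm
  have hkpos : 0 < d.k := by
    rcases Nat.eq_zero_or_pos d.k with h | h
    · rw [h] at hk
      have : (2:ℚ) ≤ d.n := by exact_mod_cast hn2
      simp only [Nat.cast_zero, zero_mul] at hk
      nlinarith
    · exact h
  have hR : IsRounding d G := fun i j a b => by
    rw [hJ i i.2 j j.2 a a.2 b b.2, ← shiftedVal_input G e]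
    rw [← Int.floor_toNat, ← Int.floor_toNat, Rat.floor_cast]
  obtain ⟨z, hz1, hz2⟩ := hz (exists_solution hG hR hS hkpos hmn hn2)
  have ho : output d.n d.m τ = gridProfile d z := by
    funext i a
    unfold output gridProfile
    rw [hz2 i i.2 a a.2]
    push_cast
    rfl
  rw [ho]
  exact isApproxNash_gridProfile hG hR hS hkpos (by omega) hz1 (by exact_mod_cast hk)

theorem two_mul_add_one_le_pow {y : ℝ} (hy : 3 ≤ y) (l : ℕ) : 2 * (l : ℝ) + 1 ≤ y ^ l := by
  have h1 := one_add_mul_le_pow (a := (2:ℝ)) (by norm_num) l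
  have h2 := pow_le_pow_left₀ (by norm_num) hy l
  norm_num at h1
  linarith

/-- For y ≥ 3 constants are absorbed into powers of y. The resolution satisfies k + 1 ≤ y^6, so
strategies and payoff vectors contribute at most y^(7m) and y^(13m). The exponent 3w + 5 is at most
8·max(w,1), whence 160 = 20·8. -/
theorem pow_bounds {n m w k : ℕ} {y : ℝ} (hy : 3 ≤ y) (hny : n ≤ y) (hm : 1 ≤ m)
    (hk : (k : ℝ) ≤ 11 * y ^ 2 + 1) :
    (n : ℝ) + 1 ≤ y ^ (160 * (m * max w 1)) ∧ 2 * (k : ℝ) ≤ y ^ (160 * (m * max w 1)) ∧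
    (n : ℝ) * ((w + 2) * n ^ (w + 1)) ≤ y ^ (160 * (m * max w 1)) ∧
    ((((k : ℝ) + 1) ^ m + 1) * (n * (2 * k * k) + 1) ^ m) ^ (3 * (w + 1) + 1 + 1) ≤
      y ^ (160 * (m * max w 1)) := by
  have hy1 : 1 ≤ y := by linarith
  have hy0 : 0 ≤ y := by linarith
  set w' := max w 1
  have hw1 : 1 ≤ w' := le_max_right _ _
  have hw : w ≤ w' := le_max_left _ _
  have hmw : w' ≤ m * w' := Nat.le_mul_of_pos_left _ hm
  have hE : ∀ {l : ℕ}, l ≤ 160 * (m * w') → y ^ l ≤ y ^ (160 * (m * w')) := fun h =>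
    pow_le_pow_right₀ hy1 h
  have h27 : 27 ≤ y ^ 3 := by
    have := pow_le_pow_left₀ (by norm_num) hy 3
    norm_num at this; exact this
  have h9 : 9 ≤ y ^ 2 := by nlinarith
  have hk5 : (k : ℝ) ≤ y ^ 5 := by
    have : y ^ 5 = y ^ 3 * y ^ 2 := by ring
    rw [this]; nlinarith
  have h5 : 1 ≤ y ^ 5 := one_le_pow₀ hy1
  have hk6 : (k : ℝ) + 1 ≤ y ^ 6 := by
    have : y ^ 6 = y * y ^ 5 := by ring
    rw [this]; nlinarith
  have h2k : 2 * (k : ℝ) ≤ y ^ 6 := by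
    have : y ^ 6 = y * y ^ 5 := by ring
    rw [this]; nlinarith
  refine ⟨?_, h2k.trans (hE (by omega)), ?_, ?_⟩
  · have : (n : ℝ) + 1 ≤ y ^ 2 := by nlinarith
    exact this.trans (hE (by omega))
  · have hw2 : (w : ℝ) + 2 ≤ y ^ (w + 1) := by
      have h1 := two_mul_add_one_le_pow hy (w + 1)
      have : (0:ℝ) ≤ w := Nat.cast_nonneg _
      push_cast at h1
      linarith
    have h3 : (n : ℝ) ^ (w + 1) ≤ y ^ (w + 1) := pow_le_pow_left₀ (Nat.cast_nonneg _) hny _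
    calc (n : ℝ) * ((w + 2) * n ^ (w + 1)) ≤ y * (y ^ (w + 1) * y ^ (w + 1)) := by gcongr
      _ = y ^ (2 * w + 3) := by ring
      _ ≤ _ := hE (by omega)
  · have h1 : ((k : ℝ) + 1) ^ m + 1 ≤ y ^ (7 * m) := by
      have h2 : ((k : ℝ) + 1) ^ m ≤ y ^ (6 * m) := by
        rw [pow_mul]; exact pow_le_pow_left₀ (by positivity) hk6 _
      have h3 : 3 ≤ y ^ m := hy.trans (le_self_pow₀ hy1 (by omega))
      have h4 : 1 ≤ y ^ (6 * m) := one_le_pow₀ hy1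
      have : y ^ (7 * m) = y ^ m * y ^ (6 * m) := by ring
      rw [this]; nlinarith
    have h2 : ((n : ℝ) * (2 * k * k) + 1) ^ m ≤ y ^ (13 * m) := by
      rw [pow_mul]
      refine pow_le_pow_left₀ (by positivity) ?_ _
      have h3 : (n : ℝ) * (2 * k * k) ≤ y * (y ^ 6 * y ^ 5) := by gcongr
      have h4 : y ^ 13 = y * (y * (y ^ 6 * y ^ 5)) := by ring
      have h5 : 1 ≤ y * (y ^ 6 * y ^ 5) := by
        have : y * (y ^ 6 * y ^ 5) = y ^ 12 := by ring
        rw [this]; exact one_le_pow₀ hy1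
      rw [h4]; nlinarith
    calc _ ≤ (y ^ (7 * m) * y ^ (13 * m)) ^ (3 * (w + 1) + 1 + 1) := by gcongr
      _ = y ^ (20 * (m * (3 * w + 5))) := by rw [← pow_add, ← pow_mul]; congr 1; ring
      _ ≤ _ := hE (by
        have : m * (3 * w + 5) ≤ m * (8 * w') := Nat.mul_le_mul_left _ (by omega)
        have e : m * (8 * w') = 8 * (m * w') := by ring
        omega)

theorem three_le_of_le_log (hm : 1 ≤ m) (hmn : (m : ℝ) ≤ Real.log n) : 3 ≤ n := by
  have hm' : (1:ℝ) ≤ m := by exact_mod_cast hm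
  by_contra h
  have h1 : (n : ℝ) ≤ 2 := by exact_mod_cast (by omega : n ≤ 2)
  have h2 : Real.log n ≤ 0.6931471808 := by
    rcases Nat.eq_zero_or_pos n with h0 | h0
    · rw [h0]; norm_num
    · exact (Real.log_le_log (by exact_mod_cast h0) h1).trans Real.log_two_lt_d9.le
  norm_num at h2
  linarith

/-- The algorithm computes an approximate Nash equilibrium. -/
theorem runs_main {G : PolymatrixGame n m} (hG : G.IsNormalised) {e : ℚ} (hm : 1 ≤ m)
    (hmn : (m : ℝ) ≤ Real.log n) (he : 0 < e) (he1 : e ≤ 1) :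
    Runs ⌊((n : ℝ) / e) ^ (160 * (m * max (treewidth G.graph) 1))⌋₊ (Algo.main.comp 0) (G.input e)
      fun τ => G.IsApproxNash e (output n m τ) := by
  have : NeZero m := ⟨by omega⟩
  have hn3 := three_le_of_le_log hm hmn
  have hn3' : (3:ℝ) ≤ n := by exact_mod_cast hn3
  have hmn' : m ≤ n := by
    have : (m : ℝ) ≤ n := hmn.trans (Real.log_le_self (by positivity))
    exact_mod_cast this
  have he' : (0:ℝ) < e := by exact_mod_cast he
  have he1' : (e:ℝ) ≤ 1 := by exact_mod_cast he1
  set y : ℝ := n / e with hy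
  set w := treewidth G.graph
  have hny : (n : ℝ) ≤ y := by
    rw [hy, le_div_iff₀ he']; nlinarith
  have hy3 : 3 ≤ y := hn3'.trans hny
  set k := ⌈11 * (n * n : ℚ) / e⌉₊
  have hk0 : 11 * (n * n : ℚ) ≤ k * e := by
    rw [← div_le_iff₀ he]; exact Nat.le_ceil _
  have hk : (k : ℝ) ≤ 11 * y ^ 2 + 1 := by
    have h1 : (k : ℚ) < 11 * (n * n : ℚ) / e + 1 := Nat.ceil_lt_add_one (by positivity)
    have h2 : (k : ℝ) < 11 * (n * n : ℝ) / e + 1 := by exact_mod_cast h1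
    have h3 : (11 * (n * n : ℝ)) / e ≤ 11 * y ^ 2 := by
      have : 11 * (n * n : ℝ) / e = 11 * (n * y) := by rw [hy]; ring
      rw [this]
      nlinarith
    linarith
  set E := 160 * (m * max w 1)
  obtain ⟨b1, b2, b3, b4⟩ := pow_bounds (w := w) hy3 hny hm hk
  have hB : ∀ x : ℕ, (x : ℝ) ≤ y ^ E → x ≤ ⌊y ^ E⌋₊ := fun x hx => Nat.le_floor hx
  have hv : ∀ k : ℕ, ∀ i < n, ∀ j < n, ∀ a < m, ∀ b < m,
      shiftedVal (G.input e) n m k i j a b ≤ 2 * k := by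
    intro k i hi j hj a ha b hb
    have h1 := shiftedVal_input G e k ⟨i, hi⟩ ⟨j, hj⟩ ⟨a, ha⟩ ⟨b, hb⟩
    have h2 := (hG.shiftedPay_mem ⟨i, hi⟩ ⟨j, hj⟩ ⟨a, ha⟩ ⟨b, hb⟩).2
    have h3 := mul_le_mul_of_nonneg_left h2 (Nat.cast_nonneg k)
    rw [← h1] at h3
    have h4 : (shiftedVal (G.input e) n m k i j a b : ℝ) ≤ 2 * k := by
      rw [mul_comm]; exact h3
    exact_mod_cast h4
  have hn1 : n + 1 ≤ ⌊y ^ E⌋₊ := hB _ (by push_cast; exact b1)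
  have hmain := R_main (σ := G.input e) (B := ⌊y ^ E⌋₊) (n := n) (m := m) (w := w) (k₀ := k) (e := e)
    (adj := adjNat G.graph) rfl rfl
    (fun b hb => by obtain ⟨c, rfl⟩ : ∃ c, b = c + 2 := ⟨b - 2, by omega⟩; rfl) rfl he (by omega)
    (fun i hi j hj => by
      classical
      rw [input_nat_one G e ⟨i, hi⟩ ⟨j, hj⟩]
      constructor
      · intro h
        by_contra h'
        exact h (if_neg fun h2 => h' ⟨hi, hj, h2⟩)
      · rintro ⟨_, _, h⟩
        rw [if_pos h]; exact one_ne_zero)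
    (fun i j => adjNat_symm _) (fun i j h => ⟨h.1, h.2.1⟩)
    (fun R u hu hR h => exists_extension_nat G.graph rfl hu hR h) hv hk0 hn1 (by omega)
    (hB _ (by push_cast; exact b2)) (hB _ (by push_cast; exact b3)) (hB _ (by push_cast; exact b4))
  obtain ⟨t, τ, hexec, ht, -, τ₀, hrep, d, d1, d2, d3, d4, d5, d6⟩ :=
    hmain _ (rep_input G e) (fun x hx => absurd hx (by simp))
  refine ⟨t, τ, hexec, ht, ?_⟩
  refine isApproxNash_of_data hG d1 d2 d3 d4 hmn' (by omega) d5 fun h => ?_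
  obtain ⟨z, hz1, hz2⟩ := d6 h
  refine ⟨z, hz1, fun i hi a ha => ?_⟩
  rw [← hz2 i hi a ha, ← hrep.2 2]
  rfl

/-- The algorithm is fast. -/
theorem exists_program : ∃ (P : Program) (T : ℕ), ∀ {n m : ℕ} {G : PolymatrixGame n m} {e : ℚ},
    G.IsNormalised → 1 ≤ m → (m : ℝ) ≤ Real.log n → 0 < e → e ≤ 1 →
    ∃ t τ, Exec P (G.input e) t τ ∧
      (t : ℝ) ≤ ((n : ℝ) / e) ^ (T * (m * max (treewidth G.graph) 1)) ∧
      G.IsApproxNash e (output n m τ) := by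
  obtain ⟨P, hP⟩ : ∃ P : Program, ∀ {n m : ℕ} {G : PolymatrixGame n m} {e : ℚ},
      G.IsNormalised → 1 ≤ m → (m : ℝ) ≤ Real.log n → 0 < e → e ≤ 1 →
      Runs ⌊((n : ℝ) / e) ^ (160 * (m * max (treewidth G.graph) 1))⌋₊ P (G.input e)
        fun τ => G.IsApproxNash e (output n m τ) :=
    ⟨_, fun hG hm hmn he he1 => runs_main hG hm hmn he he1⟩
  -- The base y is at least 3, so the constant factor `P.weight` is at most y^`P.weight`; the depth
  -- multiplies the exponent of the loop bound.
  refine ⟨P, P.weight + 160 * P.depth, fun {n m G e} hG hm hmn he he1 => ?_⟩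
  obtain ⟨t, τ, hexec, ht, hτ⟩ := hP hG hm hmn he he1
  refine ⟨t, τ, hexec, ?_, hτ⟩
  have hn3' : (3:ℝ) ≤ n := by exact_mod_cast three_le_of_le_log hm hmn
  have he' : (0:ℝ) < e := by exact_mod_cast he
  have he1' : (e:ℝ) ≤ 1 := by exact_mod_cast he1
  set y : ℝ := n / e with hy
  have hy3 : 3 ≤ y := by
    rw [hy, le_div_iff₀ he']; nlinarith
  set w := treewidth G.graph
  set E := 160 * (m * max w 1)
  have hBy : (⌊y ^ E⌋₊ : ℝ) ≤ y ^ E := Nat.floor_le (by positivity)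
  have ht' : (t : ℝ) ≤ P.weight * (⌊y ^ E⌋₊ : ℝ) ^ P.depth := by
    exact_mod_cast ht
  have hW : (P.weight : ℝ) ≤ y ^ P.weight := by
    have h1 := two_mul_add_one_le_pow hy3 P.weight
    have : (0:ℝ) ≤ P.weight := Nat.cast_nonneg _
    linarith
  have hq : 1 ≤ m * max w 1 := Nat.mul_pos hm (lt_of_lt_of_le one_pos (le_max_right _ _))
  calc (t : ℝ) ≤ y ^ P.weight * (y ^ E) ^ P.depth := by
        refine ht'.trans ?_
        gcongr
    _ = y ^ (P.weight + E * P.depth) := by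
        rw [← pow_mul, ← pow_add]
    _ ≤ _ := by
        refine pow_le_pow_right₀ (by linarith) ?_
        rw [add_mul]
        refine Nat.add_le_add (Nat.le_mul_of_pos_right _ hq) (le_of_eq ?_)
        simp only [E]; ring

/-- Round a precision greater than one down to one. -/
def capPrecision : Program :=
  .cond (.ratLe (.get 0 (.lit 0)) (.ofNat (.lit 1))) .skip (.setRat 0 (.lit 0) (.ofNat (.lit 1)))

theorem exec_capPrecision (G : PolymatrixGame n m) (e : ℚ) :
    ∃ t ≤ 10, Exec capPrecision (G.input e) t (G.input (min e 1)) := by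
  have hr : (G.input e).rat 0 0 = e := by simp [input]
  by_cases h : e ≤ 1
  · refine ⟨_, ?_, Exec.condTrue (t := 1) ?_ ?_⟩
    · simp [Test.cost, RatExpr.cost, NatExpr.cost]
    · simpa [Test.Holds, RatExpr.eval, NatExpr.eval, hr] using h
    · rw [min_eq_left h]; exact Exec.skip _
  · have e1 : G.input (min e 1) = (G.input e).setRat 0 (NatExpr.eval (G.input e) (.lit 0))
        (RatExpr.eval (G.input e) (.ofNat (.lit 1))) := by
      rw [min_eq_right (le_of_not_ge h)]
      simp only [State.setRat, NatExpr.eval, RatExpr.eval, Nat.cast_one]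
      unfold input
      congr 1
      funext a c
      match a with
      | 0 => by_cases hc : c = 0 <;> simp [hc]
      | 1 => simp
      | (b + 2) => simp
    rw [e1]
    refine ⟨_, ?_, Exec.condFalse ?_ (Exec.setRat _ _ _ _)⟩
    · simp [Test.cost, RatExpr.cost, NatExpr.cost]
    · simpa [Test.Holds, RatExpr.eval, NatExpr.eval, hr] using h

end PolymatrixGame

theorem mainTheorem7 :
    (∃ (P : RAM.Program) (C : ℝ), ∀ (n m : ℕ) (G : PolymatrixGame n m) (ε : ℚ) (w : ℕ),
      1 ≤ m → (m : ℝ) ≤ Real.log n → G.IsNormalised → Polymatrix.treewidth G.graph = w →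
      0 < ε → ε ≤ 1 →
        PolymatrixGame.FindsNash P G ε (3 / 2 * ε)
          (((n : ℝ) / ε) ^ (C * (max w 1 : ℕ) * Real.log n / (ε : ℝ) ^ 2)))
    ∧
    (∃ Q : RAM.Program, ∀ w : ℕ, PolymatrixGame.IsQPTAS Q fun n m G =>
      1 ≤ m ∧ (m : ℝ) ≤ Real.log n ∧ G.IsNormalised ∧ Polymatrix.treewidth G.graph ≤ w) := by
  have mono : ∀ {n m : ℕ} {G : PolymatrixGame n m} {δ δ' : ℝ} {s : Fin n → Fin m → ℝ}, δ ≤ δ' →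
      G.IsApproxNash δ s → G.IsApproxNash δ' s := fun hδ h =>
    ⟨h.1, fun i a => by linarith [h.2 i a]⟩
  have base : ∀ {n m : ℕ} {e : ℚ}, 1 ≤ m → (m : ℝ) ≤ Real.log n → 0 < e → e ≤ 1 →
      (0:ℝ) < n ∧ 1 ≤ (n : ℝ) / e := by
    intro n m e hm hmn he he1
    have hm' : (1:ℝ) ≤ m := by exact_mod_cast hm
    have he' : (0:ℝ) < e := by exact_mod_cast he
    have he1' : (e:ℝ) ≤ 1 := by exact_mod_cast he1
    have hn : n ≠ 0 := fun h => by
      rw [h] at hmn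
      norm_num at hmn
      linarith
    have hn1 : (1:ℝ) ≤ n := by exact_mod_cast Nat.one_le_iff_ne_zero.2 hn
    exact ⟨by linarith, by rw [le_div_iff₀ he']; linarith⟩
  obtain ⟨P, T, hP⟩ := PolymatrixGame.exists_program
  constructor
  · refine ⟨P, T, ?_⟩
    intro n m G e w hm hmn hG hw he he1
    subst hw
    obtain ⟨t, τ, h1, h2, h3⟩ := hP hG hm hmn he he1
    have he' : (0:ℝ) < e := by exact_mod_cast he
    have he1' : (e:ℝ) ≤ 1 := by exact_mod_cast he1
    refine ⟨t, τ, h1, h2.trans ?_, mono (by linarith) h3⟩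
    rw [← Real.rpow_natCast]
    refine Real.rpow_le_rpow_of_exponent_le (base hm hmn he he1).2 ?_
    have hl : (0:ℝ) ≤ Real.log n := (Nat.cast_nonneg m).trans hmn
    rw [le_div_iff₀ (by positivity)]
    push_cast
    have hA : (0:ℝ) ≤ T * max (Polymatrix.treewidth G.graph : ℝ) 1 := by
      positivity
    -- The program achieves the exponent m·max(w,1); by m ≤ ln n and ε ≤ 1 it is below the one
    -- claimed.
    have h4 : (m : ℝ) * (e : ℝ) ^ 2 ≤ Real.log n := by
      have : (e : ℝ) ^ 2 ≤ 1 := pow_le_one₀ he'.le he1'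
      nlinarith [(Nat.cast_nonneg m : (0:ℝ) ≤ m)]
    calc _ = T * max (Polymatrix.treewidth G.graph : ℝ) 1 * (m * (e : ℝ) ^ 2) := by
          ring
      _ ≤ _ := mul_le_mul_of_nonneg_left h4 hA
  · refine ⟨.seq PolymatrixGame.capPrecision P, fun w e he => ?_⟩
    have hmin : 0 < min e 1 := lt_min he one_pos
    have hmin' : (0:ℝ) < (min e 1 : ℚ) := by exact_mod_cast hmin
    set L : ℝ := - Real.log (min e 1 : ℚ)
    have hL : 0 ≤ L := by
      have : Real.log (min e 1 : ℚ) ≤ 0 :=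
        Real.log_nonpos hmin'.le (by exact_mod_cast min_le_right e 1)
      simp only [L]; linarith
    -- With ln(n/min(ε,1)) = ln n + L ≤ (1 + L)·ln n, valid as ln n ≥ m ≥ 1, and m ≤ ln n, the time
    -- is at most exp(A·(ln n)²). The summand 12 in c pays for the steps that cap the precision.
    set A : ℝ := T * (max w 1 : ℕ) * (1 + L)
    have hA : 0 ≤ A := by positivity
    refine ⟨⌈A⌉₊ + 12, fun n m G ⟨hm, hmn, hG, hw⟩ => ?_⟩
    obtain ⟨t₁, ht₁, h₁⟩ := PolymatrixGame.exec_capPrecision G e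
    obtain ⟨t, τ, h1, h2, h3⟩ := hP hG hm hmn hmin (min_le_right e 1)
    refine ⟨t₁ + t, τ, .seq h₁ h1, ?_, mono (by exact_mod_cast min_le_left e 1) h3⟩
    obtain ⟨hn0, hy1⟩ := base hm hmn hmin (min_le_right e 1)
    have hm' : (1:ℝ) ≤ m := by exact_mod_cast hm
    have hl1 : 1 ≤ Real.log n := hm'.trans hmn
    have ht : (t : ℝ) ≤ Real.exp (A * Real.log n ^ 2) := by
      refine h2.trans ?_
      rw [← Real.exp_log (show (0:ℝ) < n / (min e 1 : ℚ) by positivity), ← Real.exp_nat_mul,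
        Real.log_div hn0.ne' hmin'.ne', Real.exp_le_exp]
      have e1 : Real.log n - Real.log (min e 1 : ℚ) ≤ Real.log n * (1 + L) := by
        have : Real.log n - Real.log (min e 1 : ℚ) = Real.log n + L := by simp only [L]; ring
        rw [this]; nlinarith
      have e2 : ((T * (m * max (Polymatrix.treewidth G.graph) 1) : ℕ) : ℝ) ≤
          T * (Real.log n * (max w 1 : ℕ)) := by
        rw [Nat.cast_mul, Nat.cast_mul]
        have : ((max (Polymatrix.treewidth G.graph) 1 : ℕ) : ℝ) ≤ (max w 1 : ℕ) := by
          exact_mod_cast max_le_max_right 1 hw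
        gcongr
      calc _ ≤ T * (Real.log n * (max w 1 : ℕ)) * (Real.log n * (1 + L)) :=
            mul_le_mul e2 e1 (by simp only [L] at hL; linarith) (by positivity)
        _ = _ := by simp only [A]; ring
    set c := ⌈A⌉₊ + 12
    have hc : A ≤ c := by
      simp only [c]; push_cast
      linarith [Nat.le_ceil A]
    have hc10 : (12:ℝ) ≤ c := by
      simp only [c]; push_cast
      linarith [(Nat.cast_nonneg ⌈A⌉₊ : (0:ℝ) ≤ _)]
    have hpow : Real.log n ^ 2 ≤ Real.log n ^ c := pow_le_pow_right₀ hl1 (by omega)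
    have h4 : A * Real.log n ^ 2 ≤ c * Real.log n ^ c := by gcongr
    have h5 : (t₁ : ℝ) ≤ 10 := by exact_mod_cast ht₁
    have h6 : 1 ≤ Real.exp (c * Real.log n ^ c) := Real.one_le_exp (by positivity)
    have h7 : (11:ℝ) ≤ Real.exp c := by linarith [Real.add_one_le_exp (c : ℝ)]
    rw [Real.exp_add]
    push_cast
    nlinarith [Real.exp_le_exp.2 h4]
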